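/- **Setting.** Fix two disjoint countably infinite sets, of *names* $x,y,\dots$ and of *rigid names* $\mathbf a,\mathbf c,\dots$. Messages are $M,N::=x\mid\mathbf a\mid\langle M,N\rangle\mid\{M\}_N$. Processes, up to $\alpha$-equivalence, are $$P,Q,R::=0\mid\bar M\langle N\rangle.P\mid M(x).P\mid P|Q\mid(\nu x)P\mid\,!P\mid[M=N]P\mid\mathsf{let}\ \langle x,y\rangle=M\ \mathsf{in}\ P\mid\mathsf{case}\ L\ \mathsf{of}\ \{x\}_N\ \mathsf{in}\ P .$$ A message or process is *pure* if no rigid name occurs in it; a process is *finite* if it contains no replication. Substitutions map names to messages, are capture-avoiding and have finite domain. Write $\mathrm{fn}$, $\mathrm{rn}$ for the sets of free names and of rigid names. *Transitions* $P\xrightarrow{\alpha}A$ are those of the spi calculus with arbitrary messages as channels: $\alpha$ is $\tau$ (then $A$ is a process), an input $M$ (then $A$ is an abstraction $(x)P'$) or an output $\bar M$ (then $A$ is a concretion $(\nu\vec x)\langle N\rangle P'$). They are generated by $M(x).P\xrightarrow{M}(x)P$; $\bar M\langle N\rangle.P\xrightarrow{\bar M}\langle N\rangle P$; communication: $P|Q\xrightarrow{\tau}(\nu\vec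 y)(P'[N/x]\,|\,Q')$ if $P\xrightarrow{M}(x)P'$ and $Q\xrightarrow{\bar M}(\nu\vec y)\langle N\rangle Q'$, and symmetrically; closure under parallel composition, and under $(\nu m)$ if $m\notin\mathrm{fn}(\alpha)$; and $P\xrightarrow{\alpha}A$ if $P>Q$ and $Q\xrightarrow{\alpha}A$, where $!P>P|!P$, $[M=M]P>P$, $\mathsf{let}\ \langle x,y\rangle=\langle M,N\rangle\ \mathsf{in}\ P>P[M/x][N/y]$, $\mathsf{case}\ \{M\}_N\ \mathsf{of}\ \{x\}_N\ \mathsf{in}\ P>P[M/x]$. Here parallel composition and restriction act on the process part of an agent, except that $(\nu m)(\nu\vec x)\langle N\rangle P'=(\nu m,\vec x)\langle N\rangle P'$ if $m\in\mathrm{fn}(N)$. *Theories.* A theory $\Gamma$ is a set of pairs of messages. $\Gamma\vdash M\leftrightarrow N$ is generated by: $\Gamma\vdash x\leftrightarrow x$ for names $x$; $\Gamma\vdash M\leftrightarrow N$ if $(M,N)\in\Gamma$; closure under pairing and encryption; if $(\langle M_1,N_1\rangle,\langle M_2,N_2\rangle)\in\Gamma$ and $\Gamma,(M_1,M_2),(N_1,N_2)\vdash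 M\leftrightarrow N$ then $\Gamma\vdash M\leftrightarrow N$; and if $(\{M_1\}_{N_1},\{M_2\}_{N_2})\in\Gamma$, $\Gamma\vdash N_1\leftrightarrow N_2$ and $\Gamma,(M_1,M_2),(N_1,N_2)\vdash M\leftrightarrow N$ then $\Gamma\vdash M\leftrightarrow N$. The one-sided relation $\Sigma\vdash M$, for a set $\Sigma$ of messages, is generated by the projections of these rules. $\Gamma$ is *consistent* if $\Gamma\vdash M\leftrightarrow N$ implies: (1) $M,N$ are both names, both rigid names, both pairs or both encryptions; (2) if $M=\{M_1\}_{M_2}$ and $N=\{N_1\}_{N_2}$, then $\pi_1(\Gamma)\vdash M_2$ implies $\Gamma\vdash M_2\leftrightarrow N_2$, and $\pi_2(\Gamma)\vdash N_2$ implies $\Gamma\vdash M_2\leftrightarrow N_2$; (3) for every $R$, $\Gamma\vdash M\leftrightarrow R$ implies $R=N$, and $\Gamma\vdash R\leftrightarrow N$ implies $R=M$. *Bi-traces.* A bi-trace $h$ is a finite list of pairs $(M,N)^i$ (input) or $(M,N)^o$ (output) such that $h=h_1.(M,N)^o.h_2$ implies $\mathrm{fn}(M,N)\subseteq\mathrm{fn}(h_1)$.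 It is read as a theory by forgetting order and marks; $h^{-1}$ swaps the components of each pair; a substitution pair $\vec\theta=(\theta_1,\theta_2)$ acts on $h$ componentwise. $\vec\theta$ *respects* $h$ if $h=h_1.(M,N)^i.h_2$ and $x\in\mathrm{fn}(M,N)$ imply $h_1\vec\theta\vdash x\theta_1\leftrightarrow x\theta_2$. The empty bi-trace is *consistent*; $h.(M,N)^i$ is consistent if $h$ is and $h\vdash M\leftrightarrow N$; a bi-trace $h.(M,N)^o$ is consistent if $h$ is and, for every $\vec\theta$ respecting $h$ with $h\vec\theta$ a consistent bi-trace, the theory of $(h.(M,N)^o)\vec\theta$ is consistent. $h$ is *universal* if all its entries have the form $(x,x)^i$ with $x$ a name. *Open bisimilarity.* A set $\mathcal R$ of triples $(h,P,Q)$, with $h$ a bi-trace and $\mathrm{fn}(P,Q)\subseteq\mathrm{fn}(h)$, is a *strong open bisimulation* if every such $h$ is consistent, $(h,P,Q)\in\mathcal R$ implies $(h^{-1},Q,P)\in\mathcal R$, and for all $(h,P,Q)\in\mathcal R$ and all $\vec\theta$ respecting $h$: 1. if $P\theta_1\xrightarrow{\tau}P'$, then $Q\theta_2\xrightarrow{\tau}Q'$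 for some $Q'$ with $(h\vec\theta,P',Q')\in\mathcal R$; 2. if $P\theta_1\xrightarrow{M}(x)P'$ with $x\notin\mathrm{fn}(h\vec\theta)$ and $\pi_1(h\vec\theta)\vdash M$, then $Q\theta_2\xrightarrow{N}(x)Q'$ for some $N,Q'$ with $(h\vec\theta.(M,N)^i.(x,x)^i,P',Q')\in\mathcal R$; 3. if $P\theta_1\xrightarrow{\bar M}(\nu\vec x)\langle M'\rangle P'$ and $\pi_1(h\vec\theta)\vdash M$, then $Q\theta_2\xrightarrow{\bar N}(\nu\vec y)\langle N'\rangle Q'$ for some $N,\vec y,N',Q'$ such that $(h\vec\theta.(M,N)^i.(M'[\vec{\mathbf c}/\vec x],N'[\vec{\mathbf d}/\vec y])^o,P'[\vec{\mathbf c}/\vec x],Q'[\vec{\mathbf d}/\vec y])\in\mathcal R$ for some list $\vec{\mathbf c}$ of distinct rigid names and some list $\vec{\mathbf d}$ of distinct rigid names, all of them outside $\mathrm{rn}(h\vec\theta,P\theta_1,Q\theta_2)$. For processes $P,Q$ write $P\sim_o Q$ if $P$ and $Q$ are pure and $(h,P,Q)$ belongs to some strong open bisimulation for some universal bi-trace $h$.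 **Theorem.** The relation $\sim_o$ is a congruence on finite pure processes. That is, it is an equivalence relation on finite pure processes, and if $P,Q$ are finite pure processes with $P\sim_o Q$, then for all pure messages $L,M,N$, all names $x,y$ and every finite pure process $R$: - $M(x).P\sim_o M(x).Q$; - $\bar M\langle N\rangle.P\sim_o\bar M\langle N\rangle.Q$; - $P|R\sim_o Q|R$ and $R|P\sim_o R|Q$; - $(\nu x)P\sim_o(\nu x)Q$; - $[M=N]P\sim_o[M=N]Q$; - $\mathsf{let}\ \langle x,y\rangle=M\ \mathsf{in}\ P\sim_o\mathsf{let}\ \langle x,y\rangle=M\ \mathsf{in}\ Q$; - $\mathsf{case}\ L\ \mathsf{of}\ \{x\}_N\ \mathsf{in}\ P\sim_o\mathsf{case}\ L\ \mathsf{of}\ \{x\}_N\ \mathsf{in}\ Q$. -/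

import Mathlib

namespace Spi

/-! Syntax. Names and rigid names are two disjoint copies of `ℕ`. Processes are taken up to
alpha-equivalence by means of de Bruijn indices: in the body of a binder the index `0` is the bound
name and `n + 1` stands for the name `n` of the surrounding scope. Hence each term of type `Proc`
is exactly one alpha-equivalence class of processes with free names in `ℕ`. The binders of the
usual named syntax (`M(x).P`, `(ν x)P`, ...) are recovered below by `Proc.inpN`, `Proc.resN`,
`Proc.letN`, `Proc.decN`. -/

/-- Messages: names, rigid names, pairs `⟨M,N⟩`, and `enc M K`, the message `M` encrypted with
the key `K`. -/
inductive Msg : Type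
  | nm (x : ℕ)
  | rg (a : ℕ)
  | pair (M N : Msg)
  | enc (M K : Msg)

/-- Processes up to alpha-equivalence. -/
inductive Proc : Type
  /-- the inert process `0` -/
  | nil
  /-- output of `N` on channel `M`, continuing as `P` -/
  | out (M N : Msg) (P : Proc)
  /-- input on channel `M`; binds one name (index `0`) in `P` -/
  | inp (M : Msg) (P : Proc)
  | par (P Q : Proc)
  /-- restriction; binds one name (index `0`) in `P` -/
  | res (P : Proc)
  /-- replication `!P` -/
  | bang (P : Proc)
  /-- matching `[M = N]P` -/
  | mat (M N : Msg) (P : Proc)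
  /-- `let ⟨x,y⟩ = M in P`; binds `x` (index `0`) and `y` (index `1`) in `P` -/
  | letp (M : Msg) (P : Proc)
  /-- `case L of {x}_K in P`; binds `x` (index `0`) in `P` -/
  | dec (L K : Msg) (P : Proc)

/-! Free names, free rigid names, substitution. -/

/-- Free names of a message. -/
def Msg.fn : Msg → Set ℕ
  | nm x => {x}
  | rg _ => ∅
  | pair M N => M.fn ∪ N.fn
  | enc M K => M.fn ∪ K.fn

/-- Rigid names of a message. -/
def Msg.rn : Msg → Set ℕ
  | nm _ => ∅
  | rg a => {a}
  | pair M N => M.rn ∪ N.rn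
  | enc M K => M.rn ∪ K.rn

/-- Application of a map from names to messages. -/
def Msg.subst (θ : ℕ → Msg) : Msg → Msg
  | nm x => θ x
  | rg a => rg a
  | pair M N => pair (M.subst θ) (N.subst θ)
  | enc M K => enc (M.subst θ) (K.subst θ)

def Msg.rename (f : ℕ → ℕ) (M : Msg) : Msg := M.subst fun x => nm (f x)

/-- The map `θ` carried under one binder. -/
def lift (θ : ℕ → Msg) : ℕ → Msg
  | 0 => Msg.nm 0
  | n + 1 => (θ n).rename Nat.succ

/-- Free names of a process. -/
def Proc.fn : Proc → Set ℕ
  | nil => ∅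
  | out M N P => M.fn ∪ N.fn ∪ P.fn
  | inp M P => M.fn ∪ {x | x + 1 ∈ P.fn}
  | par P Q => P.fn ∪ Q.fn
  | res P => {x | x + 1 ∈ P.fn}
  | bang P => P.fn
  | mat M N P => M.fn ∪ N.fn ∪ P.fn
  | letp M P => M.fn ∪ {x | x + 2 ∈ P.fn}
  | dec L K P => L.fn ∪ K.fn ∪ {x | x + 1 ∈ P.fn}

/-- Rigid names of a process. -/
def Proc.rn : Proc → Set ℕ
  | nil => ∅
  | out M N P => M.rn ∪ N.rn ∪ P.rn
  | inp M P => M.rn ∪ P.rn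
  | par P Q => P.rn ∪ Q.rn
  | res P => P.rn
  | bang P => P.rn
  | mat M N P => M.rn ∪ N.rn ∪ P.rn
  | letp M P => M.rn ∪ P.rn
  | dec L K P => L.rn ∪ K.rn ∪ P.rn

/-- Capture-avoiding application of a map from names to messages. -/
def Proc.subst (θ : ℕ → Msg) : Proc → Proc
  | nil => nil
  | out M N P => out (M.subst θ) (N.subst θ) (P.subst θ)
  | inp M P => inp (M.subst θ) (P.subst (lift θ))
  | par P Q => par (P.subst θ) (Q.subst θ)
  | res P => res (P.subst (lift θ))
  | bang P => bang (P.subst θ)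
  | mat M N P => mat (M.subst θ) (N.subst θ) (P.subst θ)
  | letp M P => letp (M.subst θ) (P.subst (lift (lift θ)))
  | dec L K P => dec (L.subst θ) (K.subst θ) (P.subst (lift θ))

def Proc.rename (f : ℕ → ℕ) (P : Proc) : Proc := P.subst fun x => Msg.nm (f x)

/-- A substitution is a map from names to messages with finite domain. -/
def IsSubst (θ : ℕ → Msg) : Prop := {x | θ x ≠ Msg.nm x}.Finite

/-- Pure messages: no rigid names. -/
def Msg.IsPure (M : Msg) : Prop := M.rn = ∅

/-- Pure processes: no rigid names. -/
def Proc.IsPure (P : Proc) : Prop := P.rn = ∅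

/-- Finite processes: no replication. -/
def Proc.IsFinite : Proc → Prop
  | nil => True
  | out _ _ P => P.IsFinite
  | inp _ P => P.IsFinite
  | par P Q => P.IsFinite ∧ Q.IsFinite
  | res P => P.IsFinite
  | bang _ => False
  | mat _ _ P => P.IsFinite
  | letp _ P => P.IsFinite
  | dec _ _ P => P.IsFinite

/-! Binders of the named syntax. -/

/-- The body obtained from `P` by binding the name `x`. -/
def Proc.close (x : ℕ) (P : Proc) : Proc :=
  P.rename fun y => if y = x then 0 else y + 1

/-- `M(x).P` -/
def Proc.inpN (M : Msg) (x : ℕ) (P : Proc) : Proc := inp M (P.close x)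

/-- `(ν x)P` -/
def Proc.resN (x : ℕ) (P : Proc) : Proc := res (P.close x)

/-- `let ⟨x,y⟩ = M in P` -/
def Proc.letN (x y : ℕ) (M : Msg) (P : Proc) : Proc :=
  letp M (P.rename fun z => if z = x then 0 else if z = y then 1 else z + 2)

/-- `case L of {x}_K in P` -/
def Proc.decN (L : Msg) (x : ℕ) (K : Msg) (P : Proc) : Proc := dec L K (P.close x)

/-! Operational semantics. -/

/-- The map instantiating index `0` by `M`. -/
def inst (M : Msg) : ℕ → Msg
  | 0 => M
  | n + 1 => Msg.nm n

/-- The map instantiating index `0` by `M` and index `1` by `N`. -/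
def inst₂ (M N : Msg) : ℕ → Msg
  | 0 => M
  | 1 => N
  | n + 2 => Msg.nm n

/-- `k` nested restrictions. -/
def Proc.resIter : ℕ → Proc → Proc
  | 0, P => P
  | k + 1, P => resIter k (res P)

/-- Agents: processes, abstractions `(x)P` (index `0` is bound in `P`), and concretions
`(ν x₁ … x_k)⟨M⟩P` (the indices below `k` are bound in `M` and `P`). -/
inductive Agent : Type
  | proc (P : Proc)
  | abs (P : Proc)
  | conc (k : ℕ) (M : Msg) (P : Proc)

open Classical in
/-- Restriction of an agent, `(ν m)A`, where `m` is the index `0` of `A`. It commutes with an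
abstraction. On a concretion with `k` extruded names, where `m` is the index `k`, it joins the
extruded names if `m` occurs in the message, and is moved to the process part otherwise. -/
noncomputable def Agent.res : Agent → Agent
  | proc P => proc P.res
  | abs P => abs (Proc.res (P.rename fun i => if i = 0 then 1 else if i = 1 then 0 else i))
  | conc k M P =>
      if k ∈ M.fn then conc (k + 1) M P
      else conc k (M.rename fun i => if k < i then i - 1 else i)
        (Proc.res (P.rename fun i => if i < k then i + 1 else if i = k then 0 else i))

/-- `A | R` -/
def Agent.parL (A : Agent) (R : Proc) : Agent :=
  match A with
  | proc P => proc (P.par R)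
  | abs P => abs (P.par (R.rename Nat.succ))
  | conc k M P => conc k M (P.par (R.rename (· + k)))

/-- `R | A` -/
def Agent.parR (R : Proc) (A : Agent) : Agent :=
  match A with
  | proc P => proc (R.par P)
  | abs P => abs ((R.rename Nat.succ).par P)
  | conc k M P => conc k M ((R.rename (· + k)).par P)

/-- The body of an abstraction, moved into the scope of the `k` extruded names of a concretion
and applied to its message `M`. -/
def Proc.receive (k : ℕ) (M : Msg) (P : Proc) : Proc :=
  P.subst fun i => match i with
    | 0 => M
    | n + 1 => Msg.nm (n + k)

/-- The reduction relation `P > Q`. -/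
inductive Red : Proc → Proc → Prop
  | bang (P : Proc) : Red P.bang (P.par P.bang)
  | mat (M : Msg) (P : Proc) : Red (Proc.mat M M P) P
  | letp (M N : Msg) (P : Proc) : Red (Proc.letp (Msg.pair M N) P) (P.subst (inst₂ M N))
  | dec (M K : Msg) (P : Proc) : Red (Proc.dec (Msg.enc M K) K P) (P.subst (inst M))

/-- Actions: `τ`, a message `M` (input on `M`), a co-message (output on `M`). -/
inductive Act : Type
  | tau
  | inp (M : Msg)
  | out (M : Msg)

/-- The action seen from under a binder; the bound name does not occur in it. -/
def Act.shift : Act → Act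
  | tau => tau
  | inp M => inp (M.rename Nat.succ)
  | out M => out (M.rename Nat.succ)

/-- One-step transitions. -/
inductive Step : Proc → Act → Agent → Prop
  | inp (M : Msg) (P : Proc) : Step (Proc.inp M P) (Act.inp M) (Agent.abs P)
  | out (M N : Msg) (P : Proc) : Step (Proc.out M N P) (Act.out M) (Agent.conc 0 N P)
  | comL {P Q : Proc} {M : Msg} {P' : Proc} {k : ℕ} {N : Msg} {Q' : Proc} :
      Step P (Act.inp M) (Agent.abs P') → Step Q (Act.out M) (Agent.conc k N Q') →
      Step (P.par Q) Act.tau (Agent.proc (Proc.resIter k ((P'.receive k N).par Q')))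
  | comR {P Q : Proc} {M : Msg} {k : ℕ} {N : Msg} {P' Q' : Proc} :
      Step P (Act.out M) (Agent.conc k N P') → Step Q (Act.inp M) (Agent.abs Q') →
      Step (P.par Q) Act.tau (Agent.proc (Proc.resIter k (P'.par (Q'.receive k N))))
  | red {P Q : Proc} {α : Act} {A : Agent} : Red P Q → Step Q α A → Step P α A
  | parL {P : Proc} {α : Act} {A : Agent} (Q : Proc) : Step P α A → Step (P.par Q) α (A.parL Q)
  | parR {Q : Proc} {α : Act} {A : Agent} (P : Proc) : Step Q α A → Step (P.par Q) α (A.parR P)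
  | res {P : Proc} {α : Act} {A : Agent} : Step P α.shift A → Step P.res α A.res

/-! Observer theories. -/

/-- `Γ ⊢ M ↔ N` -/
inductive Eqv : Set (Msg × Msg) → Msg → Msg → Prop
  | var {Γ : Set (Msg × Msg)} (x : ℕ) : Eqv Γ (Msg.nm x) (Msg.nm x)
  | id {Γ : Set (Msg × Msg)} {M N : Msg} : (M, N) ∈ Γ → Eqv Γ M N
  | pr {Γ : Set (Msg × Msg)} {M N M' N' : Msg} :
      Eqv Γ M M' → Eqv Γ N N' → Eqv Γ (Msg.pair M N) (Msg.pair M' N')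
  | er {Γ : Set (Msg × Msg)} {M N M' N' : Msg} :
      Eqv Γ M M' → Eqv Γ N N' → Eqv Γ (Msg.enc M N) (Msg.enc M' N')
  | pl {Γ : Set (Msg × Msg)} {M₁ N₁ M₂ N₂ M N : Msg} :
      (Msg.pair M₁ N₁, Msg.pair M₂ N₂) ∈ Γ →
      Eqv (insert (M₁, M₂) (insert (N₁, N₂) Γ)) M N → Eqv Γ M N
  | el {Γ : Set (Msg × Msg)} {M₁ N₁ M₂ N₂ M N : Msg} :
      (Msg.enc M₁ N₁, Msg.enc M₂ N₂) ∈ Γ → Eqv Γ N₁ N₂ →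
      Eqv (insert (M₁, M₂) (insert (N₁, N₂) Γ)) M N → Eqv Γ M N

/-- Message synthesis `S ⊢ M`. -/
inductive Syn : Set Msg → Msg → Prop
  | var {S : Set Msg} (x : ℕ) : Syn S (Msg.nm x)
  | id {S : Set Msg} {M : Msg} : M ∈ S → Syn S M
  | pr {S : Set Msg} {M N : Msg} : Syn S M → Syn S N → Syn S (Msg.pair M N)
  | er {S : Set Msg} {M N : Msg} : Syn S M → Syn S N → Syn S (Msg.enc M N)
  | pl {S : Set Msg} {M N R : Msg} :
      Msg.pair M N ∈ S → Syn (insert M (insert N S)) R → Syn S R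
  | el {S : Set Msg} {M N R : Msg} :
      Msg.enc M N ∈ S → Syn S N → Syn (insert M (insert N S)) R → Syn S R

/-- Both messages are names, or both rigid names, or both pairs, or both encryptions. -/
def Msg.SameType : Msg → Msg → Prop
  | nm _, nm _ => True
  | rg _, rg _ => True
  | pair _ _, pair _ _ => True
  | enc _ _, enc _ _ => True
  | _, _ => False

/-- Consistent observer theories. -/
structure ConsistentTheory (Γ : Set (Msg × Msg)) : Prop where
  sameType : ∀ M N, Eqv Γ M N → M.SameType N
  key_left : ∀ M₁ M₂ N₁ N₂, Eqv Γ (Msg.enc M₁ M₂) (Msg.enc N₁ N₂) →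
    Syn (Prod.fst '' Γ) M₂ → Eqv Γ M₂ N₂
  key_right : ∀ M₁ M₂ N₁ N₂, Eqv Γ (Msg.enc M₁ M₂) (Msg.enc N₁ N₂) →
    Syn (Prod.snd '' Γ) N₂ → Eqv Γ M₂ N₂
  unique_right : ∀ M N R, Eqv Γ M N → Eqv Γ M R → R = N
  unique_left : ∀ M N R, Eqv Γ M N → Eqv Γ R N → R = M

/-! Bi-traces. -/

/-- The marks of an I/O pair: `i` for input, `o` for output. -/
inductive Mark : Type
  | i
  | o

/-- Lists of I/O pairs, in reverse chronological order: the head of the list is the most recent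
pair, so that `(m, M, N) :: h` is `h` extended with `(M,N)` at the end. -/
abbrev Trace : Type := List (Mark × Msg × Msg)

namespace Trace

def fn (h : Trace) : Set ℕ := {x | ∃ e ∈ h, x ∈ e.2.1.fn ∪ e.2.2.fn}

def rn (h : Trace) : Set ℕ := {a | ∃ e ∈ h, a ∈ e.2.1.rn ∪ e.2.2.rn}

/-- The observer theory underlying `h`. -/
def theory (h : Trace) : Set (Msg × Msg) := {p | ∃ e ∈ h, e.2 = p}

/-- The set of first components. -/
def fst (h : Trace) : Set Msg := Prod.fst '' h.theory

def inverse (h : Trace) : Trace := h.map fun e => (e.1, e.2.2, e.2.1)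

/-- Application of a substitution pair. -/
def subst (θ₁ θ₂ : ℕ → Msg) (h : Trace) : Trace :=
  h.map fun e => (e.1, e.2.1.subst θ₁, e.2.2.subst θ₂)

/-- Bi-traces: the names of an output pair occur before it. -/
def IsBiTrace : Trace → Prop
  | [] => True
  | (Mark.i, _, _) :: h => IsBiTrace h
  | (Mark.o, M, N) :: h => M.fn ∪ N.fn ⊆ fn h ∧ IsBiTrace h

/-- The pair `(θ₁, θ₂)` respects `h`: the values of the names of each input pair are equivalent
in the theory of the (instantiated) preceding part of the trace. -/
def Respects (θ₁ θ₂ : ℕ → Msg) : Trace → Prop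
  | [] => True
  | (Mark.i, M, N) :: h =>
      (∀ x ∈ M.fn ∪ N.fn, Eqv (theory (subst θ₁ θ₂ h)) (θ₁ x) (θ₂ x)) ∧ Respects θ₁ θ₂ h
  | (Mark.o, _, _) :: h => Respects θ₁ θ₂ h

/-- Consistent bi-traces, by recursion on the length. -/
def Consistent : Trace → Prop
  | [] => True
  | (Mark.i, M, N) :: h => Consistent h ∧ Eqv (theory h) M N
  | (Mark.o, M, N) :: h =>
      IsBiTrace ((Mark.o, M, N) :: h) ∧ Consistent h ∧
        ∀ θ₁ θ₂ : ℕ → Msg, IsSubst θ₁ → IsSubst θ₂ → Respects θ₁ θ₂ h →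
          Consistent (subst θ₁ θ₂ h) →
          ConsistentTheory (theory (subst θ₁ θ₂ ((Mark.o, M, N) :: h)))
termination_by h => h.length
decreasing_by all_goals simp [subst]

/-- Universal bi-traces: only input pairs `(x,x)` with `x` a name. -/
def IsUniversal (h : Trace) : Prop := ∀ e ∈ h, ∃ x : ℕ, e = (Mark.i, Msg.nm x, Msg.nm x)

end Trace

/-! Open bisimulation. -/

/-- The map instantiating the `k` extruded names of a concretion by the rigid names `c`. -/
def instRigid {k : ℕ} (c : Fin k → ℕ) : ℕ → Msg :=
  fun i => if hi : i < k then Msg.rg (c ⟨i, hi⟩) else Msg.nm (i - k)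

/-- Traced process pairs. -/
def IsTraced (h : Trace) (P Q : Proc) : Prop :=
  h.IsBiTrace ∧ P.fn ∪ Q.fn ⊆ h.fn

/-- Strong open bisimulations; `R h P Q` says that the triple `(h, P, Q)` is in the set `R`. -/
structure IsOpenBisimulation (R : Trace → Proc → Proc → Prop) : Prop where
  traced : ∀ h P Q, R h P Q → IsTraced h P Q
  consistent : ∀ h P Q, R h P Q → h.Consistent
  symm : ∀ h P Q, R h P Q → R h.inverse Q P
  tau : ∀ h P Q, R h P Q → ∀ θ₁ θ₂ : ℕ → Msg, IsSubst θ₁ → IsSubst θ₂ → h.Respects θ₁ θ₂ →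
    ∀ P', Step (P.subst θ₁) Act.tau (Agent.proc P') →
      ∃ Q', Step (Q.subst θ₂) Act.tau (Agent.proc Q') ∧ R (h.subst θ₁ θ₂) P' Q'
  inp : ∀ h P Q, R h P Q → ∀ θ₁ θ₂ : ℕ → Msg, IsSubst θ₁ → IsSubst θ₂ → h.Respects θ₁ θ₂ →
    ∀ M P', Step (P.subst θ₁) (Act.inp M) (Agent.abs P') → Syn (h.subst θ₁ θ₂).fst M →
      ∀ x ∉ (h.subst θ₁ θ₂).fn,
        ∃ N Q', Step (Q.subst θ₂) (Act.inp N) (Agent.abs Q') ∧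
          R ((Mark.i, Msg.nm x, Msg.nm x) :: (Mark.i, M, N) :: h.subst θ₁ θ₂)
            (P'.subst (inst (Msg.nm x))) (Q'.subst (inst (Msg.nm x)))
  /-- The extruded names of each side are replaced by pairwise distinct fresh rigid names. -/
  out : ∀ h P Q, R h P Q → ∀ θ₁ θ₂ : ℕ → Msg, IsSubst θ₁ → IsSubst θ₂ → h.Respects θ₁ θ₂ →
    ∀ M k M' P', Step (P.subst θ₁) (Act.out M) (Agent.conc k M' P') →
      Syn (h.subst θ₁ θ₂).fst M →
        ∃ N l N' Q', Step (Q.subst θ₂) (Act.out N) (Agent.conc l N' Q') ∧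
          ∃ (c : Fin k → ℕ) (d : Fin l → ℕ), Function.Injective c ∧ Function.Injective d ∧
            Disjoint (Set.range c ∪ Set.range d)
              ((h.subst θ₁ θ₂).rn ∪ (P.subst θ₁).rn ∪ (Q.subst θ₂).rn) ∧
            R ((Mark.o, M'.subst (instRigid c), N'.subst (instRigid d)) ::
                (Mark.i, M, N) :: h.subst θ₁ θ₂)
              (P'.subst (instRigid c)) (Q'.subst (instRigid d))

/-- The union of all strong open bisimulations: `P` and `Q` are strong open `h`-bisimilar. -/
def OpenBisimilarAt (h : Trace) (P Q : Proc) : Prop :=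
  ∃ R : Trace → Proc → Proc → Prop, IsOpenBisimulation R ∧ R h P Q

/-- Strong open bisimilarity `P ∼ₒ Q`. -/
def OpenBisimilar (P Q : Proc) : Prop :=
  P.IsPure ∧ Q.IsPure ∧ ∃ h : Trace, h.IsUniversal ∧ OpenBisimilarAt h P Q

/-- Finite pure processes. -/
abbrev FinPureProc : Type := {P : Proc // P.IsFinite ∧ P.IsPure}

end Spi

/-! Two facts carry the proof. First, `Eqv Γ` is the least relation that contains `Γ` and is closed
under building and taking apart messages (`Eqv.least`), and a consistent theory gives each
synthesizable message exactly one partner. Hence consistency passes to theories derivable from a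
consistent one (`ConsistentTheory.of_eqv`), along invertible replacements
(`ConsistentTheory.transport`) and to composites (`ConsistentTheory.comp`). Secondly, respectful
substitutions compose and preserve consistent bi-traces, because each name of a consistent bi-trace
occurs on both sides. Bisimilarity is therefore closed under respectful substitutions and under
independent permutations of the rigid names of the two sides, so that its output clause holds for
every choice of fresh rigid names (`openBisimilarAt_bisim`). From then on each property is proved by
exhibiting a relation that satisfies `Bisim`.

Equivalence: processes of the same form whose messages correspond in a consistent theory imitate
each other step by step (`PRel.step`), which gives reflexivity. Universal bi-traces are their own
inverses, which gives symmetry. For transitivity, bi-traces that agree in the middle are composed;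
the middle substitution is found entry by entry (`Trace₃.exists_respects`).

Parallel composition and restriction cannot be separated: a communication with the context leaves
restrictions behind and passes messages that the observer never sees. `Clo` closes bisimilarity at
once under forgetting knowledge (`Cov`), under parallel composition with related processes (`PRel`)
and under restriction, restricted names being represented by fresh rigid ones. If the context sends
its private names, bisimilarity must survive the addition of fresh rigid pairs to the bi-trace
(`OpenBisimilarAt.weaken`). This is a case of `OpenBisimilarAt.flex`, by which a name may be
replaced by a fresh pair of rigid names. The same lemma makes a free name restrictable: it is
replaced by a rigid name, which the observer then forgets.

Prefixes: over a universal bi-trace the observer only knows pure messages, each paired with itself,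
so a respectful pair of substitutions amounts to a single pure substitution. Bisimilar pure
processes have bisimilar pure instances (`PureEquiv`), and this is what the continuation of a prefix
requires. -/

namespace Spi

/-! Simultaneous replacement of names and rigid names by messages. -/

/-- Replace each name by `θ` and each rigid name by `ρ`. -/
def Msg.bs (θ ρ : ℕ → Msg) : Msg → Msg
  | nm x => θ x
  | rg a => ρ a
  | pair M N => pair (M.bs θ ρ) (N.bs θ ρ)
  | enc M K => enc (M.bs θ ρ) (K.bs θ ρ)

/-- The replacement of rigid names carried under one binder. -/
def liftR (ρ : ℕ → Msg) : ℕ → Msg := fun a => (ρ a).rename Nat.succ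

/-- Acting on rigid names too makes it possible to turn a rigid name back into a name, free or
bound, which `subst` cannot do. Substitution, renaming and permutation of rigid names are special
cases, so one calculus serves them all. -/
def Proc.bs (θ ρ : ℕ → Msg) : Proc → Proc
  | nil => nil
  | out M N P => out (M.bs θ ρ) (N.bs θ ρ) (P.bs θ ρ)
  | inp M P => inp (M.bs θ ρ) (P.bs (lift θ) (liftR ρ))
  | par P Q => par (P.bs θ ρ) (Q.bs θ ρ)
  | res P => res (P.bs (lift θ) (liftR ρ))
  | bang P => bang (P.bs θ ρ)
  | mat M N P => mat (M.bs θ ρ) (N.bs θ ρ) (P.bs θ ρ)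
  | letp M P => letp (M.bs θ ρ) (P.bs (lift (lift θ)) (liftR (liftR ρ)))
  | dec L K P => dec (L.bs θ ρ) (K.bs θ ρ) (P.bs (lift θ) (liftR ρ))

theorem Msg.subst_eq (θ : ℕ → Msg) (M : Msg) : M.subst θ = M.bs θ rg := by
  induction M <;> simp_all [subst, bs]

theorem Msg.rename_eq (f : ℕ → ℕ) (M : Msg) : M.rename f = M.bs (fun x => nm (f x)) rg :=
  M.subst_eq _

theorem liftR_rg : liftR Msg.rg = Msg.rg := rfl

theorem Proc.subst_eq (θ : ℕ → Msg) (P : Proc) : P.subst θ = P.bs θ Msg.rg := by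
  induction P generalizing θ <;> simp_all [subst, bs, Msg.subst_eq, liftR_rg]

theorem Proc.rename_eq (f : ℕ → ℕ) (P : Proc) :
    P.rename f = P.bs (fun x => Msg.nm (f x)) Msg.rg :=
  P.subst_eq _

theorem Msg.bs_congr {θ ρ θ' ρ' : ℕ → Msg} (M : Msg) (h₁ : ∀ x ∈ M.fn, θ x = θ' x)
    (h₂ : ∀ a ∈ M.rn, ρ a = ρ' a) : M.bs θ ρ = M.bs θ' ρ' := by
  induction M with
  | nm x => exact h₁ x rfl
  | rg a => exact h₂ a rfl
  | pair M N ihM ihN =>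
    simp only [bs]
    rw [ihM (fun x hx => h₁ x (Or.inl hx)) (fun x hx => h₂ x (Or.inl hx)),
      ihN (fun x hx => h₁ x (Or.inr hx)) (fun x hx => h₂ x (Or.inr hx))]
  | enc M N ihM ihN =>
    simp only [bs]
    rw [ihM (fun x hx => h₁ x (Or.inl hx)) (fun x hx => h₂ x (Or.inl hx)),
      ihN (fun x hx => h₁ x (Or.inr hx)) (fun x hx => h₂ x (Or.inr hx))]

theorem Msg.bs_id (M : Msg) : M.bs nm rg = M := by
  induction M <;> simp_all [bs]

theorem Msg.bs_bs (θ ρ θ' ρ' : ℕ → Msg) (M : Msg) :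
    (M.bs θ ρ).bs θ' ρ' = M.bs (fun x => (θ x).bs θ' ρ') (fun a => (ρ a).bs θ' ρ') := by
  induction M <;> simp_all [bs]

theorem Msg.mem_fn_bs {θ ρ : ℕ → Msg} {M : Msg} {x : ℕ} :
    x ∈ (M.bs θ ρ).fn ↔ (∃ y ∈ M.fn, x ∈ (θ y).fn) ∨ ∃ a ∈ M.rn, x ∈ (ρ a).fn := by
  induction M with
  | nm y => simp [bs, fn, rn]
  | rg a => simp [bs, fn, rn]
  | pair M N ihM ihN => simp only [bs, fn, rn, Set.mem_union, ihM, ihN, or_and_right, exists_or]; exact iff_of_eq (by ac_rfl)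
  | enc M N ihM ihN => simp only [bs, fn, rn, Set.mem_union, ihM, ihN, or_and_right, exists_or]; exact iff_of_eq (by ac_rfl)

theorem Msg.mem_rn_bs {θ ρ : ℕ → Msg} {M : Msg} {b : ℕ} :
    b ∈ (M.bs θ ρ).rn ↔ (∃ y ∈ M.fn, b ∈ (θ y).rn) ∨ ∃ a ∈ M.rn, b ∈ (ρ a).rn := by
  induction M with
  | nm y => simp [bs, fn, rn]
  | rg a => simp [bs, fn, rn]
  | pair M N ihM ihN => simp only [bs, fn, rn, Set.mem_union, ihM, ihN, or_and_right, exists_or]; exact iff_of_eq (by ac_rfl)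
  | enc M N ihM ihN => simp only [bs, fn, rn, Set.mem_union, ihM, ihN, or_and_right, exists_or]; exact iff_of_eq (by ac_rfl)

theorem Msg.mem_fn_rename {f : ℕ → ℕ} {M : Msg} {x : ℕ} :
    x ∈ (M.rename f).fn ↔ ∃ y ∈ M.fn, x = f y := by
  simp [rename_eq, mem_fn_bs, fn]

theorem Msg.rn_rename (f : ℕ → ℕ) (M : Msg) : (M.rename f).rn = M.rn := by
  ext x; simp [rename_eq, mem_rn_bs, rn]

theorem Msg.rename_bs (f : ℕ → ℕ) (θ ρ : ℕ → Msg) (M : Msg) :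
    (M.rename f).bs θ ρ = M.bs (fun x => θ (f x)) ρ := by
  rw [rename_eq, bs_bs]; rfl

theorem lift_comp (θ θ' ρ' : ℕ → Msg) :
    (fun x => (lift θ x).bs (lift θ') (liftR ρ')) = lift (fun x => (θ x).bs θ' ρ') := by
  funext x
  cases x with
  | zero => rfl
  | succ n =>
    simp only [lift, Msg.rename_bs]
    simp only [Msg.rename_eq, Msg.bs_bs]
    exact Msg.bs_congr _ (fun _ _ => rfl) fun _ _ => by rw [liftR, Msg.rename_eq]

theorem liftR_comp (ρ θ' ρ' : ℕ → Msg) :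
    (fun x => (liftR ρ x).bs (lift θ') (liftR ρ')) = liftR (fun x => (ρ x).bs θ' ρ') := by
  funext x
  simp only [liftR, lift, Msg.rename_bs]
  simp only [Msg.rename_eq, Msg.bs_bs]
  exact Msg.bs_congr _ (fun _ _ => rfl) fun _ _ => by rw [liftR, Msg.rename_eq]

theorem lift_nm : lift Msg.nm = Msg.nm := by
  funext x; cases x <;> rfl

theorem Proc.bs_id (P : Proc) : P.bs Msg.nm Msg.rg = P := by
  induction P <;> simp_all [bs, Msg.bs_id, lift_nm, liftR_rg]

theorem Proc.bs_bs (θ ρ θ' ρ' : ℕ → Msg) (P : Proc) :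
    (P.bs θ ρ).bs θ' ρ' = P.bs (fun x => (θ x).bs θ' ρ') (fun a => (ρ a).bs θ' ρ') := by
  induction P generalizing θ ρ θ' ρ' <;>
    simp_all [bs, Msg.bs_bs, lift_comp, liftR_comp]

theorem lift_congr {θ θ' : ℕ → Msg} {S : Set ℕ} (h : ∀ x, x + 1 ∈ S → θ x = θ' x) :
    ∀ x ∈ S, lift θ x = lift θ' x := by
  intro x hx
  cases x with
  | zero => rfl
  | succ n => simp only [lift, h n hx]

theorem liftR_congr {ρ ρ' : ℕ → Msg} {S : Set ℕ} (h : ∀ a ∈ S, ρ a = ρ' a) :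
    ∀ a ∈ S, liftR ρ a = liftR ρ' a :=
  fun a ha => congrArg (Msg.rename Nat.succ) (h a ha)

theorem Proc.bs_congr {θ ρ θ' ρ' : ℕ → Msg} (P : Proc) (h₁ : ∀ x ∈ P.fn, θ x = θ' x)
    (h₂ : ∀ a ∈ P.rn, ρ a = ρ' a) : P.bs θ ρ = P.bs θ' ρ' := by
  induction P generalizing θ ρ θ' ρ' with
  | nil => rfl
  | out M N P ih =>
    rw [bs, bs, M.bs_congr (fun x hx => h₁ x (.inl (.inl hx))) (fun x hx => h₂ x (.inl (.inl hx))),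
      N.bs_congr (fun x hx => h₁ x (.inl (.inr hx))) (fun x hx => h₂ x (.inl (.inr hx))),
      ih (fun x hx => h₁ x (.inr hx)) (fun x hx => h₂ x (.inr hx))]
  | inp M P ih =>
    rw [bs, bs, M.bs_congr (fun x hx => h₁ x (.inl hx)) (fun x hx => h₂ x (.inl hx)),
      ih (lift_congr fun x hx => h₁ x (.inr hx)) (liftR_congr fun x hx => h₂ x (.inr hx))]
  | par P Q ihP ihQ =>
    rw [bs, bs, ihP (fun x hx => h₁ x (.inl hx)) (fun x hx => h₂ x (.inl hx)),
      ihQ (fun x hx => h₁ x (.inr hx)) (fun x hx => h₂ x (.inr hx))]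
  | res P ih => rw [bs, bs, ih (lift_congr h₁) (liftR_congr h₂)]
  | bang P ih => rw [bs, bs, ih h₁ h₂]
  | mat M N P ih =>
    rw [bs, bs, M.bs_congr (fun x hx => h₁ x (.inl (.inl hx))) (fun x hx => h₂ x (.inl (.inl hx))),
      N.bs_congr (fun x hx => h₁ x (.inl (.inr hx))) (fun x hx => h₂ x (.inl (.inr hx))),
      ih (fun x hx => h₁ x (.inr hx)) (fun x hx => h₂ x (.inr hx))]
  | letp M P ih =>
    rw [bs, bs, M.bs_congr (fun x hx => h₁ x (.inl hx)) (fun x hx => h₂ x (.inl hx)),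
      ih (lift_congr (S := P.fn) (lift_congr (S := {x | x + 1 ∈ P.fn}) fun x hx => h₁ x (.inr hx)))
        (liftR_congr (liftR_congr fun x hx => h₂ x (.inr hx)))]
  | dec L K P ih =>
    rw [bs, bs, L.bs_congr (fun x hx => h₁ x (.inl (.inl hx))) (fun x hx => h₂ x (.inl (.inl hx))),
      K.bs_congr (fun x hx => h₁ x (.inl (.inr hx))) (fun x hx => h₂ x (.inl (.inr hx))),
      ih (lift_congr fun x hx => h₁ x (.inr hx)) (liftR_congr fun x hx => h₂ x (.inr hx))]

theorem mem_fn_lift {θ : ℕ → Msg} {S : Set ℕ} {x : ℕ} :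
    (∃ y ∈ S, x + 1 ∈ (lift θ y).fn) ↔ ∃ y, y + 1 ∈ S ∧ x ∈ (θ y).fn := by
  constructor
  · rintro ⟨y, hy, h⟩
    cases y with
    | zero => simp [lift, Msg.fn] at h
    | succ n =>
      obtain ⟨z, hz, e⟩ := Msg.mem_fn_rename.1 h
      cases e
      exact ⟨n, hy, hz⟩
  · rintro ⟨y, hy, h⟩
    exact ⟨y + 1, hy, Msg.mem_fn_rename.2 ⟨x, h, rfl⟩⟩

theorem mem_fn_liftR {ρ : ℕ → Msg} {x a : ℕ} : x + 1 ∈ (liftR ρ a).fn ↔ x ∈ (ρ a).fn := by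
  simp [liftR, Msg.mem_fn_rename]

theorem mem_rn_lift {θ : ℕ → Msg} {S : Set ℕ} {x : ℕ} :
    (∃ y ∈ S, x ∈ (lift θ y).rn) ↔ ∃ y, y + 1 ∈ S ∧ x ∈ (θ y).rn := by
  constructor
  · rintro ⟨y, hy, h⟩
    cases y with
    | zero => simp [lift, Msg.rn] at h
    | succ n => exact ⟨n, hy, by simpa [lift, Msg.rn_rename] using h⟩
  · rintro ⟨y, hy, h⟩
    exact ⟨y + 1, hy, by simpa [lift, Msg.rn_rename] using h⟩

theorem mem_rn_liftR {ρ : ℕ → Msg} {x a : ℕ} : x ∈ (liftR ρ a).rn ↔ x ∈ (ρ a).rn := by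
  simp [liftR, Msg.rn_rename]

theorem Proc.mem_fn_bs {θ ρ : ℕ → Msg} {P : Proc} {x : ℕ} :
    x ∈ (P.bs θ ρ).fn ↔ (∃ y ∈ P.fn, x ∈ (θ y).fn) ∨ ∃ a ∈ P.rn, x ∈ (ρ a).fn := by
  induction P generalizing θ ρ x with
  | nil => simp [bs, fn, rn]
  | out M N P ih =>
    simp only [bs, fn, rn, Set.mem_union, ih, Msg.mem_fn_bs, or_and_right, exists_or]; exact iff_of_eq (by ac_rfl)
  | inp M P ih =>
    simp only [bs, fn, rn, Set.mem_union, Set.mem_ofPred_eq, ih, Msg.mem_fn_bs, or_and_right,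
      exists_or, mem_fn_lift, mem_fn_liftR]
    exact iff_of_eq (by ac_rfl)
  | par P Q ihP ihQ =>
    simp only [bs, fn, rn, Set.mem_union, ihP, ihQ, or_and_right, exists_or]; exact iff_of_eq (by ac_rfl)
  | res P ih => simp only [bs, fn, rn, Set.mem_ofPred_eq, ih, mem_fn_lift, mem_fn_liftR]
  | bang P ih => simp only [bs, fn, rn, ih]
  | mat M N P ih =>
    simp only [bs, fn, rn, Set.mem_union, ih, Msg.mem_fn_bs, or_and_right, exists_or]; exact iff_of_eq (by ac_rfl)
  | letp M P ih =>
    have := @mem_fn_lift θ {x | x + 1 ∈ P.fn} x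
    simp only [Set.mem_ofPred_eq, show ∀ y, y + 1 + 1 = y + 2 from fun _ => rfl] at this
    simp only [bs, fn, rn, Set.mem_union, Set.mem_ofPred_eq, ih, Msg.mem_fn_bs, or_and_right,
      exists_or, mem_fn_lift, mem_fn_liftR, this]
    exact iff_of_eq (by ac_rfl)
  | dec L K P ih =>
    simp only [bs, fn, rn, Set.mem_union, Set.mem_ofPred_eq, ih, Msg.mem_fn_bs, or_and_right,
      exists_or, mem_fn_lift, mem_fn_liftR]
    exact iff_of_eq (by ac_rfl)

theorem Proc.mem_rn_bs {θ ρ : ℕ → Msg} {P : Proc} {x : ℕ} :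
    x ∈ (P.bs θ ρ).rn ↔ (∃ y ∈ P.fn, x ∈ (θ y).rn) ∨ ∃ a ∈ P.rn, x ∈ (ρ a).rn := by
  induction P generalizing θ ρ x with
  | nil => simp [bs, fn, rn]
  | out M N P ih =>
    simp only [bs, fn, rn, Set.mem_union, ih, Msg.mem_rn_bs, or_and_right, exists_or]; exact iff_of_eq (by ac_rfl)
  | inp M P ih =>
    simp only [bs, fn, rn, Set.mem_union, Set.mem_ofPred_eq, ih, Msg.mem_rn_bs, or_and_right,
      exists_or, mem_rn_lift, mem_rn_liftR]
    exact iff_of_eq (by ac_rfl)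
  | par P Q ihP ihQ =>
    simp only [bs, fn, rn, Set.mem_union, ihP, ihQ, or_and_right, exists_or]; exact iff_of_eq (by ac_rfl)
  | res P ih => simp only [bs, fn, rn, Set.mem_ofPred_eq, ih, mem_rn_lift, mem_rn_liftR]
  | bang P ih => simp only [bs, fn, rn, ih]
  | mat M N P ih =>
    simp only [bs, fn, rn, Set.mem_union, ih, Msg.mem_rn_bs, or_and_right, exists_or]; exact iff_of_eq (by ac_rfl)
  | letp M P ih =>
    have := @mem_rn_lift θ {x | x + 1 ∈ P.fn} x
    simp only [Set.mem_ofPred_eq, show ∀ y, y + 1 + 1 = y + 2 from fun _ => rfl] at this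
    simp only [bs, fn, rn, Set.mem_union, Set.mem_ofPred_eq, ih, Msg.mem_rn_bs, or_and_right,
      exists_or, mem_rn_lift, mem_rn_liftR]
    rw [this]
    exact iff_of_eq (by ac_rfl)
  | dec L K P ih =>
    simp only [bs, fn, rn, Set.mem_union, Set.mem_ofPred_eq, ih, Msg.mem_rn_bs, or_and_right,
      exists_or, mem_rn_lift, mem_rn_liftR]
    exact iff_of_eq (by ac_rfl)

/-- Under the `k` extruded names of a concretion, this closed form reduces identities between maps
to arithmetic on indices. -/
theorem lift_iterate (θ : ℕ → Msg) (k i : ℕ) :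
    lift^[k] θ i = if i < k then Msg.nm i else (θ (i - k)).rename (· + k) := by
  induction k generalizing i with
  | zero => simp [Msg.rename_eq, Msg.bs_id]
  | succ k ih =>
    rw [Function.iterate_succ_apply']
    cases i with
    | zero => simp [lift]
    | succ i =>
      simp only [lift, ih, Nat.add_lt_add_iff_right, Nat.add_sub_add_right]
      split_ifs
      · rfl
      · simp [Msg.rename_eq, Msg.bs_bs, Msg.bs]; rfl

theorem liftR_iterate (ρ : ℕ → Msg) (k a : ℕ) :
    liftR^[k] ρ a = (ρ a).rename (· + k) := by
  induction k generalizing a with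
  | zero => simp [Msg.rename_eq, Msg.bs_id]
  | succ k ih =>
    rw [Function.iterate_succ_apply']
    simp only [liftR, ih]
    simp [Msg.rename_eq, Msg.bs_bs, Msg.bs]; rfl

theorem Msg.fn_finite (M : Msg) : M.fn.Finite := by
  induction M <;> simp_all [fn]

theorem Msg.rn_finite (M : Msg) : M.rn.Finite := by
  induction M <;> simp_all [rn]

theorem Proc.rn_finite (P : Proc) : P.rn.Finite := by
  induction P <;> simp_all [rn, Msg.rn_finite]

theorem Proc.fn_finite (P : Proc) : P.fn.Finite := by
  induction P with
  | nil => simp [fn]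
  | out M N P ih => simp [fn, Msg.fn_finite, ih]
  | inp M P ih =>
    exact M.fn_finite.union (ih.preimage ((add_left_injective 1).injOn))
  | par P Q ihP ihQ => exact ihP.union ihQ
  | res P ih => exact ih.preimage ((add_left_injective 1).injOn)
  | bang P ih => exact ih
  | mat M N P ih => simp [fn, Msg.fn_finite, ih]
  | letp M P ih => exact M.fn_finite.union (ih.preimage ((add_left_injective 2).injOn))
  | dec L K P ih =>
    exact (L.fn_finite.union K.fn_finite).union (ih.preimage ((add_left_injective 1).injOn))

/-! ### Transitions under replacement of names and rigid names -/

def Act.bs (θ ρ : ℕ → Msg) : Act → Act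
  | tau => tau
  | inp M => inp (M.bs θ ρ)
  | out M => out (M.bs θ ρ)

def Agent.bs (θ ρ : ℕ → Msg) : Agent → Agent
  | proc P => proc (P.bs θ ρ)
  | abs P => abs (P.bs (lift θ) (liftR ρ))
  | conc k M P =>
      conc k (M.bs (lift^[k] θ) (liftR^[k] ρ)) (P.bs (lift^[k] θ) (liftR^[k] ρ))

/-- A replacement carried under `k + 1` binders fixes the index `k` and produces it from nothing
else, so the test by which `Agent.res` decides on extrusion is stable. -/
theorem Msg.mem_fn_liftN {k : ℕ} {θ ρ : ℕ → Msg} {M : Msg} :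
    k ∈ (M.bs (lift^[k + 1] θ) (liftR^[k + 1] ρ)).fn ↔ k ∈ M.fn := by
  rw [Msg.mem_fn_bs]
  simp only [lift_iterate, liftR_iterate]
  constructor
  · rintro (⟨y, hy, h⟩ | ⟨a, -, h⟩)
    · split_ifs at h with hk
      · cases h; exact hy
      · obtain ⟨z, -, e⟩ := Msg.mem_fn_rename.1 h; omega
    · obtain ⟨z, -, e⟩ := Msg.mem_fn_rename.1 h; omega
  · intro h
    exact .inl ⟨k, h, by simp [Msg.fn]⟩

theorem Agent.bs_res (θ ρ : ℕ → Msg) (A : Agent) :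
    A.res.bs θ ρ = (A.bs (lift θ) (liftR ρ)).res := by
  cases A with
  | proc P => rfl
  | abs P =>
    simp only [res, bs, Proc.bs, Proc.rename_eq, Proc.bs_bs, Agent.abs.injEq, Proc.res.injEq]
    refine Proc.bs_congr _ (fun x _ => ?_) fun a _ => ?_
    · rcases x with _ | _ | x
      · rfl
      · rfl
      · simp [lift, Msg.bs, Msg.rename_eq, Msg.bs_bs]
    · simp [liftR, Msg.bs, Msg.rename_eq, Msg.bs_bs]
  | conc k M P =>
    have hk := @Msg.mem_fn_liftN k θ ρ M
    simp only [Function.iterate_succ_apply] at hk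
    by_cases h : k ∈ M.fn
    · simp only [res, if_pos h, bs, if_pos (hk.2 h), Function.iterate_succ_apply]
    · simp only [res, if_neg h, bs]
      rw [if_neg (mt hk.1 h)]
      simp only [Agent.conc.injEq, true_and, Proc.bs, Proc.res.injEq, Proc.rename_eq, Proc.bs_bs, Msg.rename_eq, Msg.bs_bs,
        ← Function.iterate_succ_apply, ← Function.iterate_succ_apply' lift,
        ← Function.iterate_succ_apply' liftR, lift_iterate, liftR_iterate]
      refine ⟨Msg.bs_congr _ (fun x hx => ?_) fun a _ => ?_,
        Proc.bs_congr _ (fun x _ => ?_) fun a _ => ?_⟩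
      · have hxk : x ≠ k := fun e => h (e ▸ hx)
        rcases lt_or_gt_of_ne hxk with h' | h'
        · simp [Msg.bs, lift_iterate, h', not_lt_of_gt h', show x < k + 1 by omega]
        · simp [Msg.bs, lift_iterate, h', show ¬ x - 1 < k by omega, show ¬ x < k + 1 by omega,
            Msg.rename_eq, Msg.bs_bs, show x - 1 - k = x - (k + 1) by omega,
            show ∀ z, k < z + (k+1) by omega]
      · simp [Msg.bs, liftR_iterate, Msg.rename_eq,
          show ∀ z, k < z + (k+1) by omega]
      · rcases lt_trichotomy x k with h' | h' | h'
        · simp [Msg.bs, lift_iterate, h', show x < k + 1 by omega]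
        · simp [Msg.bs, lift_iterate, h']
        · simp [Msg.bs, lift_iterate, not_lt_of_gt h', h'.ne', show ¬ x < k + 1 by omega,
            Msg.rename_eq, Msg.bs_bs,
            show ∀ z, ¬ z + (k+1) < k by omega, show ∀ z, z + (k+1) ≠ k by omega]
      · simp [Msg.bs, liftR_iterate, Msg.rename_eq,
          show ∀ z, ¬ z + (k+1) < k by omega, show ∀ z, z + (k+1) ≠ k by omega]

theorem Proc.bs_resIter (θ ρ : ℕ → Msg) (k : ℕ) (P : Proc) :
    (P.resIter k).bs θ ρ = (P.bs (lift^[k] θ) (liftR^[k] ρ)).resIter k := by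
  induction k generalizing P with
  | zero => rfl
  | succ k ih => simp only [resIter, ih, bs, Function.iterate_succ_apply']

theorem Proc.bs_receive (θ ρ : ℕ → Msg) (k : ℕ) (N : Msg) (P : Proc) :
    (P.receive k N).bs (lift^[k] θ) (liftR^[k] ρ) =
      (P.bs (lift θ) (liftR ρ)).receive k (N.bs (lift^[k] θ) (liftR^[k] ρ)) := by
  simp only [receive, subst_eq, bs_bs]
  refine Proc.bs_congr _ (fun x _ => ?_) fun a _ => ?_
  · cases x with
    | zero => rfl
    | succ n => simp [lift, Msg.bs, lift_iterate, Msg.rename_eq, Msg.bs_bs]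
  · simp [liftR, Msg.bs, liftR_iterate, Msg.rename_eq, Msg.bs_bs]

theorem Proc.rename_liftN (θ ρ : ℕ → Msg) (k : ℕ) (P : Proc) :
    (P.rename (· + k)).bs (lift^[k] θ) (liftR^[k] ρ) = (P.bs θ ρ).rename (· + k) := by
  simp only [rename_eq, bs_bs]
  refine Proc.bs_congr _ (fun x _ => ?_) fun a _ => ?_
  · simp [Msg.bs, lift_iterate, Msg.rename_eq]
  · simp [Msg.bs, liftR_iterate, Msg.rename_eq]

theorem Agent.bs_parL (θ ρ : ℕ → Msg) (A : Agent) (R : Proc) :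
    (A.parL R).bs θ ρ = (A.bs θ ρ).parL (R.bs θ ρ) := by
  cases A with
  | proc P => rfl
  | abs P =>
    simp only [parL, bs, Proc.bs, Agent.abs.injEq, Proc.par.injEq, true_and]
    exact R.rename_liftN θ ρ 1
  | conc k M P => simp only [parL, bs, Proc.bs, R.rename_liftN θ ρ k]

theorem Agent.bs_parR (θ ρ : ℕ → Msg) (A : Agent) (R : Proc) :
    (A.parR R).bs θ ρ = (A.bs θ ρ).parR (R.bs θ ρ) := by
  cases A with
  | proc P => rfl
  | abs P =>
    simp only [parR, bs, Proc.bs, Agent.abs.injEq, Proc.par.injEq, and_true]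
    exact R.rename_liftN θ ρ 1
  | conc k M P => simp only [parR, bs, Proc.bs, R.rename_liftN θ ρ k]

theorem Act.bs_shift (θ ρ : ℕ → Msg) (α : Act) :
    α.shift.bs (lift θ) (liftR ρ) = (α.bs θ ρ).shift := by
  have (M : Msg) : (M.rename Nat.succ).bs (lift θ) (liftR ρ) = (M.bs θ ρ).rename Nat.succ := by
    rw [Msg.rename_bs, Msg.rename_eq, Msg.bs_bs]
    exact Msg.bs_congr _ (fun x _ => by simp [lift, Msg.rename_eq])
      fun a _ => by simp [liftR, Msg.rename_eq]
  cases α <;> simp [shift, bs, this]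

theorem Red.bs {P Q : Proc} (h : Red P Q) (θ ρ : ℕ → Msg) : Red (P.bs θ ρ) (Q.bs θ ρ) := by
  cases h with
  | bang P => exact Red.bang _
  | mat M P => exact Red.mat _ _
  | letp M N P =>
    have : (P.subst (inst₂ M N)).bs θ ρ = (P.bs (lift (lift θ)) (liftR (liftR ρ))).subst
        (inst₂ (M.bs θ ρ) (N.bs θ ρ)) := by
      simp only [Proc.subst_eq, Proc.bs_bs]
      refine Proc.bs_congr _ (fun x _ => ?_) fun a _ => ?_
      · rcases x with _ | _ | x
        · rfl
        · rfl
        · simp [lift, inst₂, Msg.bs, Msg.rename_eq, Msg.bs_bs, Msg.bs_id]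
      · simp [liftR, inst₂, Msg.bs, Msg.rename_eq, Msg.bs_bs, Msg.bs_id]
    rw [this]; exact Red.letp _ _ _
  | dec M K P =>
    have : (P.subst (inst M)).bs θ ρ = (P.bs (lift θ) (liftR ρ)).subst
        (inst (M.bs θ ρ)) := by
      simp only [Proc.subst_eq, Proc.bs_bs]
      refine Proc.bs_congr _ (fun x _ => ?_) fun a _ => ?_
      · rcases x with _ | x
        · rfl
        · simp [lift, inst, Msg.bs, Msg.rename_eq, Msg.bs_bs, Msg.bs_id]
      · simp [liftR, inst, Msg.bs, Msg.rename_eq, Msg.bs_bs, Msg.bs_id]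
    rw [this]; exact Red.dec _ _ _

/-- Transitions are stable under replacement of names and rigid names. -/
theorem Step.bs {P : Proc} {α : Act} {A : Agent} (h : Step P α A) (θ ρ : ℕ → Msg) :
    Step (P.bs θ ρ) (α.bs θ ρ) (A.bs θ ρ) := by
  induction h generalizing θ ρ with
  | inp M P => exact Step.inp _ _
  | out M N P => exact Step.out _ _ _
  | comL _ _ ih₁ ih₂ =>
    have := Step.comL (ih₁ θ ρ) (ih₂ θ ρ)
    rw [← Proc.bs_receive] at this
    simpa only [Agent.bs, Proc.bs_resIter, Proc.bs, Act.bs] using this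
  | comR _ _ ih₁ ih₂ =>
    have := Step.comR (ih₁ θ ρ) (ih₂ θ ρ)
    rw [← Proc.bs_receive] at this
    simpa only [Agent.bs, Proc.bs_resIter, Proc.bs, Act.bs] using this
  | red hr _ ih => exact Step.red (hr.bs θ ρ) (ih θ ρ)
  | parL Q _ ih => rw [Agent.bs_parL]; exact Step.parL _ (ih θ ρ)
  | parR P _ ih => rw [Agent.bs_parR]; exact Step.parR _ (ih θ ρ)
  | res _ ih =>
    rw [Agent.bs_res]
    have := ih (lift θ) (liftR ρ)
    rw [Act.bs_shift] at this
    exact Step.res this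

/-! ### Names and rigid names along transitions -/

def Act.fn : Act → Set ℕ
  | tau => ∅
  | inp M => M.fn
  | out M => M.fn

def Act.rn : Act → Set ℕ
  | tau => ∅
  | inp M => M.rn
  | out M => M.rn

def Agent.fn : Agent → Set ℕ
  | proc P => P.fn
  | abs P => {x | x + 1 ∈ P.fn}
  | conc k M P => {x | x + k ∈ M.fn ∪ P.fn}

def Agent.rn : Agent → Set ℕ
  | proc P => P.rn
  | abs P => P.rn
  | conc _ M P => M.rn ∪ P.rn

theorem Proc.mem_fn_rename {f : ℕ → ℕ} {P : Proc} {x : ℕ} :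
    x ∈ (P.rename f).fn ↔ ∃ y ∈ P.fn, x = f y := by
  simp [rename_eq, mem_fn_bs, Msg.fn]

theorem Proc.rn_rename (f : ℕ → ℕ) (P : Proc) : (P.rename f).rn = P.rn := by
  ext x; simp [rename_eq, mem_rn_bs, Msg.rn]

theorem Proc.fn_resIter (k : ℕ) (P : Proc) : (P.resIter k).fn = {x | x + k ∈ P.fn} := by
  induction k generalizing P with
  | zero => rfl
  | succ k ih => rw [resIter, ih]; ext x; simp [fn, add_assoc]

theorem Proc.rn_resIter (k : ℕ) (P : Proc) : (P.resIter k).rn = P.rn := by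
  induction k generalizing P with
  | zero => rfl
  | succ k ih => rw [resIter, ih]; rfl

theorem Proc.fn_receive {k : ℕ} {N : Msg} {P : Proc} {x : ℕ} (h : x + k ∈ (P.receive k N).fn) :
    x + k ∈ N.fn ∨ x + 1 ∈ P.fn := by
  rw [receive, subst_eq, mem_fn_bs] at h
  rcases h with ⟨_ | y, hy, h⟩ | ⟨a, -, h⟩
  · exact .inl h
  · simp only [Msg.fn, Set.mem_singleton_iff] at h
    obtain rfl : x = y := by omega
    exact .inr hy
  · simp [Msg.fn] at h

theorem Proc.rn_receive {k : ℕ} {N : Msg} {P : Proc} : (P.receive k N).rn ⊆ N.rn ∪ P.rn := by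
  intro a h
  rw [receive, subst_eq, mem_rn_bs] at h
  rcases h with ⟨_ | y, hy, h⟩ | ⟨b, hb, h⟩
  · exact .inl h
  · simp [Msg.rn] at h
  · simp only [Msg.rn, Set.mem_singleton_iff] at h; exact .inr (h ▸ hb)

theorem Agent.fn_res (A : Agent) : A.res.fn ⊆ {x | x + 1 ∈ A.fn} := by
  intro x hx
  cases A with
  | proc P => exact hx
  | abs P =>
    simp only [res, fn, Proc.fn, Set.mem_ofPred_eq, Proc.mem_fn_rename] at hx ⊢
    obtain ⟨y, hy, e⟩ := hx
    split_ifs at e with h1 h2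
    · omega
    · rwa [e]
  | conc k M P =>
    by_cases h : k ∈ M.fn
    · simp only [res, if_pos h, fn] at hx
      simpa only [fn, Set.mem_ofPred_eq, add_assoc, add_comm k 1] using hx
    · simp only [res, if_neg h, fn, Proc.fn, Set.mem_union, Set.mem_ofPred_eq, Proc.mem_fn_rename,
        Msg.mem_fn_rename] at hx
      rcases hx with ⟨y, hy, e⟩ | ⟨y, hy, e⟩
      · have : y ≠ k := fun h' => h (h' ▸ hy)
        split_ifs at e with h1
        · left; rwa [show x + 1 + k = y by omega]
        · omega
      · split_ifs at e with h1 h2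
        · omega
        · right; rwa [show x + 1 + k = y by omega]

theorem Agent.rn_res (A : Agent) : A.res.rn = A.rn := by
  cases A with
  | proc P => rfl
  | abs P => simp only [res, rn, Proc.rn, Proc.rn_rename]
  | conc k M P =>
    by_cases h : k ∈ M.fn
    · simp only [res, if_pos h, rn]
    · simp only [res, if_neg h, rn, Proc.rn, Proc.rn_rename, Msg.rn_rename]

theorem Red.fn {P Q : Proc} (h : Red P Q) : Q.fn ⊆ P.fn := by
  intro x hx
  cases h with
  | bang P => simpa [Proc.fn] using hx
  | mat M P => exact .inr hx
  | letp M N P =>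
    rw [Proc.subst_eq, Proc.mem_fn_bs] at hx
    rcases hx with ⟨_ | _ | y, hy, h⟩ | ⟨a, -, h⟩
    · exact .inl (.inl h)
    · exact .inl (.inr h)
    · cases h; exact .inr hy
    · simp [Msg.fn] at h
  | dec M K P =>
    rw [Proc.subst_eq, Proc.mem_fn_bs] at hx
    rcases hx with ⟨_ | y, hy, h⟩ | ⟨a, -, h⟩
    · exact .inl (.inl (.inl h))
    · cases h; exact .inr hy
    · simp [Msg.fn] at h

theorem Red.rn {P Q : Proc} (h : Red P Q) : Q.rn ⊆ P.rn := by
  intro x hx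
  cases h with
  | bang P => simpa [Proc.rn] using hx
  | mat M P => exact .inr hx
  | letp M N P =>
    rw [Proc.subst_eq, Proc.mem_rn_bs] at hx
    rcases hx with ⟨_ | _ | y, hy, h⟩ | ⟨a, ha, h⟩
    · exact .inl (.inl h)
    · exact .inl (.inr h)
    · simp [inst₂, Msg.rn] at h
    · cases h; exact .inr ha
  | dec M K P =>
    rw [Proc.subst_eq, Proc.mem_rn_bs] at hx
    rcases hx with ⟨_ | y, hy, h⟩ | ⟨a, ha, h⟩
    · exact .inl (.inl (.inl h))
    · simp [inst, Msg.rn] at h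
    · cases h; exact .inr ha

theorem Agent.fn_parL (A : Agent) (R : Proc) : (A.parL R).fn = A.fn ∪ R.fn := by
  ext x; cases A <;> simp [parL, fn, Proc.fn, Proc.mem_fn_rename, or_assoc]

theorem Agent.fn_parR (A : Agent) (R : Proc) : (A.parR R).fn = R.fn ∪ A.fn := by
  ext x; cases A <;> simp [parR, fn, Proc.fn, Proc.mem_fn_rename, or_left_comm]

theorem Agent.rn_parL (A : Agent) (R : Proc) : (A.parL R).rn = A.rn ∪ R.rn := by
  ext x; cases A <;> simp [parL, rn, Proc.rn, Proc.rn_rename, or_assoc]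

theorem Agent.rn_parR (A : Agent) (R : Proc) : (A.parR R).rn = R.rn ∪ A.rn := by
  ext x; cases A <;> simp [parR, rn, Proc.rn, Proc.rn_rename, or_left_comm]

theorem Act.fn_shift {α : Act} {x : ℕ} : x + 1 ∈ α.shift.fn ↔ x ∈ α.fn := by
  cases α <;> simp [shift, fn, Msg.mem_fn_rename]

theorem Act.rn_shift (α : Act) : α.shift.rn = α.rn := by
  cases α <;> simp [shift, rn, Msg.rn_rename]

theorem Step.fn {P : Proc} {α : Act} {A : Agent} (h : Step P α A) :
    α.fn ⊆ P.fn ∧ A.fn ⊆ P.fn := by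
  induction h with
  | inp M P => exact ⟨fun x hx => .inl hx, fun x hx => .inr hx⟩
  | out M N P =>
    refine ⟨fun x hx => .inl (.inl hx), fun x hx => ?_⟩
    rcases hx with hx | hx
    · exact .inl (.inr hx)
    · exact .inr hx
  | comL _ _ ih₁ ih₂ =>
    refine ⟨by simp [Act.fn], fun x hx => ?_⟩
    simp only [Agent.fn, Proc.fn_resIter, Proc.fn, Set.mem_ofPred_eq] at hx
    rcases hx with hx | hx
    · rcases Proc.fn_receive hx with h | h
      · exact .inr (ih₂.2 (.inl h))
      · exact .inl (ih₁.2 h)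
    · exact .inr (ih₂.2 (.inr hx))
  | comR _ _ ih₁ ih₂ =>
    refine ⟨by simp [Act.fn], fun x hx => ?_⟩
    simp only [Agent.fn, Proc.fn_resIter, Proc.fn, Set.mem_ofPred_eq] at hx
    rcases hx with hx | hx
    · exact .inl (ih₁.2 (.inr hx))
    · rcases Proc.fn_receive hx with h | h
      · exact .inl (ih₁.2 (.inl h))
      · exact .inr (ih₂.2 h)
  | red hr _ ih => exact ⟨ih.1.trans hr.fn, ih.2.trans hr.fn⟩
  | parL Q _ ih =>
    rw [Agent.fn_parL]
    exact ⟨fun x hx => .inl (ih.1 hx), Set.union_subset_union_left _ ih.2⟩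
  | parR P _ ih =>
    rw [Agent.fn_parR]
    exact ⟨fun x hx => .inr (ih.1 hx), Set.union_subset_union_right _ ih.2⟩
  | res _ ih =>
    exact ⟨fun x hx => ih.1 (Act.fn_shift.2 hx), fun x hx => ih.2 (Agent.fn_res _ hx)⟩

theorem Step.rn {P : Proc} {α : Act} {A : Agent} (h : Step P α A) :
    α.rn ⊆ P.rn ∧ A.rn ⊆ P.rn := by
  induction h with
  | inp M P => exact ⟨fun x hx => .inl hx, fun x hx => .inr hx⟩
  | out M N P =>
    refine ⟨fun x hx => .inl (.inl hx), fun x hx => ?_⟩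
    rcases hx with hx | hx
    · exact .inl (.inr hx)
    · exact .inr hx
  | comL _ _ ih₁ ih₂ =>
    refine ⟨by simp [Act.rn], fun x hx => ?_⟩
    simp only [Agent.rn, Proc.rn_resIter, Proc.rn] at hx
    rcases hx with hx | hx
    · rcases Proc.rn_receive hx with h | h
      · exact .inr (ih₂.2 (.inl h))
      · exact .inl (ih₁.2 h)
    · exact .inr (ih₂.2 (.inr hx))
  | comR _ _ ih₁ ih₂ =>
    refine ⟨by simp [Act.rn], fun x hx => ?_⟩
    simp only [Agent.rn, Proc.rn_resIter, Proc.rn] at hx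
    rcases hx with hx | hx
    · exact .inl (ih₁.2 (.inr hx))
    · rcases Proc.rn_receive hx with h | h
      · exact .inl (ih₁.2 (.inl h))
      · exact .inr (ih₂.2 h)
  | red hr _ ih => exact ⟨ih.1.trans hr.rn, ih.2.trans hr.rn⟩
  | parL Q _ ih =>
    rw [Agent.rn_parL]
    exact ⟨fun x hx => .inl (ih.1 hx), Set.union_subset_union_left _ ih.2⟩
  | parR P _ ih =>
    rw [Agent.rn_parR]
    exact ⟨fun x hx => .inr (ih.1 hx), Set.union_subset_union_right _ ih.2⟩
  | res _ ih =>
    rw [Agent.rn_res]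
    exact ⟨fun x hx => ih.1 (by rwa [Act.rn_shift]), ih.2⟩

/-! ### Derivability in a theory -/

/-- The elimination rules enlarge the theory and keep the conclusion, which is awkward in
inductions. As closure conditions on a relation they say that `Rel` passes to components of pairs
and to contents of encryptions with related keys. Most later properties of derivability are
instances of this principle. -/
theorem Eqv.least {Rel : Msg → Msg → Prop} (hvar : ∀ x, Rel (Msg.nm x) (Msg.nm x))
    (hpr : ∀ M N M' N', Rel M M' → Rel N N' → Rel (Msg.pair M N) (Msg.pair M' N'))
    (her : ∀ M N M' N', Rel M M' → Rel N N' → Rel (Msg.enc M N) (Msg.enc M' N'))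
    (hpl : ∀ M N M' N', Rel (Msg.pair M N) (Msg.pair M' N') → Rel M M' ∧ Rel N N')
    (hel : ∀ M N M' N', Rel (Msg.enc M N) (Msg.enc M' N') → Rel N N' → Rel M M')
    {Γ : Set (Msg × Msg)} {M N : Msg} (h : Eqv Γ M N) (hΓ : ∀ p ∈ Γ, Rel p.1 p.2) : Rel M N := by
  induction h with
  | var x => exact hvar x
  | id hm => exact hΓ _ hm
  | pr _ _ ih₁ ih₂ => exact hpr _ _ _ _ (ih₁ hΓ) (ih₂ hΓ)
  | er _ _ ih₁ ih₂ => exact her _ _ _ _ (ih₁ hΓ) (ih₂ hΓ)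
  | pl hm _ ih =>
    refine ih fun p hp => ?_
    have := hpl _ _ _ _ (hΓ _ hm)
    rcases hp with rfl | rfl | hp
    exacts [this.1, this.2, hΓ _ hp]
  | el hm _ _ ih₁ ih =>
    refine ih fun p hp => ?_
    have h₂ := ih₁ hΓ
    have h₁ := hel _ _ _ _ (hΓ _ hm) h₂
    rcases hp with rfl | rfl | hp
    exacts [h₁, h₂, hΓ _ hp]

theorem Eqv.mono {Γ Γ' : Set (Msg × Msg)} {M N : Msg} (h : Eqv Γ M N) (hΓ : Γ ⊆ Γ') :
    Eqv Γ' M N := by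
  induction h generalizing Γ' with
  | var x => exact .var x
  | id hm => exact .id (hΓ hm)
  | pr _ _ ih₁ ih₂ => exact .pr (ih₁ hΓ) (ih₂ hΓ)
  | er _ _ ih₁ ih₂ => exact .er (ih₁ hΓ) (ih₂ hΓ)
  | pl hm _ ih => exact .pl (hΓ hm) (ih (Set.insert_subset_insert (Set.insert_subset_insert hΓ)))
  | el hm _ _ ih₁ ih =>
    exact .el (hΓ hm) (ih₁ hΓ) (ih (Set.insert_subset_insert (Set.insert_subset_insert hΓ)))

/-- Together with `Eqv.inv_enc`, this shows that `Eqv Γ` meets the closure conditions of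
`Eqv.least`: a final elimination rule commutes with taking components. -/
theorem Eqv.inv_pair {Γ : Set (Msg × Msg)} {M N M' N' : Msg}
    (h : Eqv Γ (Msg.pair M N) (Msg.pair M' N')) : Eqv Γ M M' ∧ Eqv Γ N N' := by
  generalize hA : Msg.pair M N = A, hB : Msg.pair M' N' = B at h
  induction h with
  | var x => cases hA
  | id hm =>
    subst hA hB
    exact ⟨.pl hm (.id (.inl rfl)), .pl hm (.id (.inr (.inl rfl)))⟩
  | pr h₁ h₂ => cases hA; cases hB; exact ⟨h₁, h₂⟩
  | er => cases hA
  | pl hm _ ih => exact ⟨.pl hm (ih hA hB).1, .pl hm (ih hA hB).2⟩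
  | el hm hk _ _ ih => exact ⟨.el hm hk (ih hA hB).1, .el hm hk (ih hA hB).2⟩

theorem Eqv.inv_enc {Γ : Set (Msg × Msg)} {M N M' N' : Msg}
    (h : Eqv Γ (Msg.enc M N) (Msg.enc M' N')) (hk : Eqv Γ N N') : Eqv Γ M M' := by
  generalize hA : Msg.enc M N = A, hB : Msg.enc M' N' = B at h
  induction h with
  | var x => cases hA
  | id hm =>
    subst hA hB
    exact .el hm hk (.id (.inl rfl))
  | pr => cases hA
  | er h₁ h₂ => cases hA; cases hB; exact h₁
  | pl hm _ ih =>
    exact .pl hm (ih (hk.mono ((Set.subset_insert _ _).trans (Set.subset_insert _ _))) hA hB)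
  | el hm hk' _ _ ih =>
    exact .el hm hk' (ih (hk.mono ((Set.subset_insert _ _).trans (Set.subset_insert _ _))) hA hB)

/-- The maps `ρ₁`, `ρ₂` are constrained only through `Γ`, because derivations take their rigid names
from there. -/
theorem Eqv.bs {Γ Γ' : Set (Msg × Msg)} {θ₁ ρ₁ θ₂ ρ₂ : ℕ → Msg}
    (hx : ∀ x, Eqv Γ' (θ₁ x) (θ₂ x)) (hΓ : ∀ p ∈ Γ, Eqv Γ' (p.1.bs θ₁ ρ₁) (p.2.bs θ₂ ρ₂))
    {M N : Msg} (h : Eqv Γ M N) : Eqv Γ' (M.bs θ₁ ρ₁) (N.bs θ₂ ρ₂) :=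
  h.least (Rel := fun M N => Eqv Γ' (M.bs θ₁ ρ₁) (N.bs θ₂ ρ₂)) hx
    (fun _ _ _ _ h₁ h₂ => .pr h₁ h₂) (fun _ _ _ _ h₁ h₂ => .er h₁ h₂)
    (fun _ _ _ _ h => h.inv_pair) (fun _ _ _ _ h hk => h.inv_enc hk) hΓ

theorem Eqv.cut {Γ Γ' : Set (Msg × Msg)} {M N : Msg} (h : Eqv Γ M N)
    (hΓ : ∀ p ∈ Γ, Eqv Γ' p.1 p.2) : Eqv Γ' M N :=
  h.least Eqv.var (fun _ _ _ _ h₁ h₂ => .pr h₁ h₂) (fun _ _ _ _ h₁ h₂ => .er h₁ h₂)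
    (fun _ _ _ _ h => h.inv_pair) (fun _ _ _ _ h hk => h.inv_enc hk) hΓ

/-- The theory with the two sides exchanged. -/
def sw (Γ : Set (Msg × Msg)) : Set (Msg × Msg) := Prod.swap '' Γ

theorem sw_sw (Γ : Set (Msg × Msg)) : sw (sw Γ) = Γ := by
  simp [sw, Set.image_image]

theorem fst_sw (Γ : Set (Msg × Msg)) : Prod.fst '' sw Γ = Prod.snd '' Γ := by
  simp [sw, Set.image_image]

theorem Eqv.sw {Γ : Set (Msg × Msg)} {M N : Msg} (h : Eqv Γ M N) : Eqv (sw Γ) N M :=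
  h.least (Rel := fun M N => Eqv (Spi.sw Γ) N M) Eqv.var (fun _ _ _ _ h₁ h₂ => .pr h₁ h₂)
    (fun _ _ _ _ h₁ h₂ => .er h₁ h₂)
    (fun _ _ _ _ h => h.inv_pair) (fun _ _ _ _ h hk => h.inv_enc hk)
    fun p hp => .id ⟨p, hp, rfl⟩

theorem Eqv.of_sw {Γ : Set (Msg × Msg)} {M N : Msg} (h : Eqv (Spi.sw Γ) N M) : Eqv Γ M N := by
  have := h.sw
  rwa [sw_sw] at this

/-- A derivation by itself introduces names on both sides at once; a name on one side only comes
from `Γ`. -/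
theorem Eqv.fn_left {Γ : Set (Msg × Msg)} {M N : Msg} (h : Eqv Γ M N) :
    M.fn ⊆ N.fn ∪ {x | ∃ p ∈ Γ, x ∈ p.1.fn} := by
  induction h with
  | var x => exact Set.subset_union_left
  | id hm => exact fun x hx => .inr ⟨_, hm, hx⟩
  | pr _ _ ih₁ ih₂ =>
    rintro x (hx | hx)
    · exact (ih₁ hx).imp (fun h => .inl h) _root_.id
    · exact (ih₂ hx).imp (fun h => .inr h) _root_.id
  | er _ _ ih₁ ih₂ =>
    rintro x (hx | hx)
    · exact (ih₁ hx).imp (fun h => .inl h) _root_.id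
    · exact (ih₂ hx).imp (fun h => .inr h) _root_.id
  | pl hm _ ih =>
    intro x hx
    refine (ih hx).imp _root_.id ?_
    rintro ⟨p, rfl | rfl | hp, h⟩
    exacts [⟨_, hm, .inl h⟩, ⟨_, hm, .inr h⟩, ⟨_, hp, h⟩]
  | el hm _ _ _ ih =>
    intro x hx
    refine (ih hx).imp _root_.id ?_
    rintro ⟨p, rfl | rfl | hp, h⟩
    exacts [⟨_, hm, .inl h⟩, ⟨_, hm, .inr h⟩, ⟨_, hp, h⟩]

/-- Rigid names have no introduction rule. This is what keeps fresh rigid names out of respectful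
substitutions. -/
theorem Eqv.rn_left {Γ : Set (Msg × Msg)} {M N : Msg} (h : Eqv Γ M N) :
    M.rn ⊆ {x | ∃ p ∈ Γ, x ∈ p.1.rn} := by
  induction h with
  | var x => simp [Msg.rn]
  | id hm => exact fun x hx => ⟨_, hm, hx⟩
  | pr _ _ ih₁ ih₂ => exact Set.union_subset ih₁ ih₂
  | er _ _ ih₁ ih₂ => exact Set.union_subset ih₁ ih₂
  | pl hm _ ih =>
    intro x hx
    obtain ⟨p, rfl | rfl | hp, h⟩ := ih hx
    exacts [⟨_, hm, .inl h⟩, ⟨_, hm, .inr h⟩, ⟨_, hp, h⟩]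
  | el hm _ _ _ ih =>
    intro x hx
    obtain ⟨p, rfl | rfl | hp, h⟩ := ih hx
    exacts [⟨_, hm, .inl h⟩, ⟨_, hm, .inr h⟩, ⟨_, hp, h⟩]

theorem Eqv.fn_right {Γ : Set (Msg × Msg)} {M N : Msg} (h : Eqv Γ M N) :
    N.fn ⊆ M.fn ∪ {x | ∃ p ∈ Γ, x ∈ p.2.fn} := by
  intro x hx
  refine (h.sw.fn_left hx).imp _root_.id ?_
  rintro ⟨_, ⟨p, hp, rfl⟩, h⟩
  exact ⟨p, hp, h⟩

theorem Eqv.rn_right {Γ : Set (Msg × Msg)} {M N : Msg} (h : Eqv Γ M N) :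
    N.rn ⊆ {x | ∃ p ∈ Γ, x ∈ p.2.rn} := by
  intro x hx
  obtain ⟨_, ⟨p, hp, rfl⟩, h⟩ := h.sw.rn_left hx
  exact ⟨p, hp, h⟩

/-! ### Synthesis of messages -/

theorem Syn.least {Rel : Msg → Prop} (hvar : ∀ x, Rel (Msg.nm x))
    (hpr : ∀ M N, Rel M → Rel N → Rel (Msg.pair M N))
    (her : ∀ M N, Rel M → Rel N → Rel (Msg.enc M N))
    (hpl : ∀ M N, Rel (Msg.pair M N) → Rel M ∧ Rel N)
    (hel : ∀ M N, Rel (Msg.enc M N) → Rel N → Rel M)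
    {S : Set Msg} {M : Msg} (h : Syn S M) (hS : ∀ m ∈ S, Rel m) : Rel M := by
  induction h with
  | var x => exact hvar x
  | id hm => exact hS _ hm
  | pr _ _ ih₁ ih₂ => exact hpr _ _ (ih₁ hS) (ih₂ hS)
  | er _ _ ih₁ ih₂ => exact her _ _ (ih₁ hS) (ih₂ hS)
  | pl hm _ ih =>
    refine ih fun p hp => ?_
    have := hpl _ _ (hS _ hm)
    rcases hp with rfl | rfl | hp
    exacts [this.1, this.2, hS _ hp]
  | el hm _ _ ih₁ ih =>
    refine ih fun p hp => ?_
    have h₂ := ih₁ hS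
    have h₁ := hel _ _ (hS _ hm) h₂
    rcases hp with rfl | rfl | hp
    exacts [h₁, h₂, hS _ hp]

theorem Syn.mono {S S' : Set Msg} {M : Msg} (h : Syn S M) (hS : S ⊆ S') : Syn S' M := by
  induction h generalizing S' with
  | var x => exact .var x
  | id hm => exact .id (hS hm)
  | pr _ _ ih₁ ih₂ => exact .pr (ih₁ hS) (ih₂ hS)
  | er _ _ ih₁ ih₂ => exact .er (ih₁ hS) (ih₂ hS)
  | pl hm _ ih => exact .pl (hS hm) (ih (Set.insert_subset_insert (Set.insert_subset_insert hS)))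
  | el hm _ _ ih₁ ih =>
    exact .el (hS hm) (ih₁ hS) (ih (Set.insert_subset_insert (Set.insert_subset_insert hS)))

theorem Syn.inv_pair {S : Set Msg} {M N : Msg} (h : Syn S (Msg.pair M N)) : Syn S M ∧ Syn S N := by
  generalize hA : Msg.pair M N = A at h
  induction h with
  | var x => cases hA
  | id hm =>
    subst hA
    exact ⟨.pl hm (.id (.inl rfl)), .pl hm (.id (.inr (.inl rfl)))⟩
  | pr h₁ h₂ => cases hA; exact ⟨h₁, h₂⟩
  | er => cases hA
  | pl hm _ ih => exact ⟨.pl hm (ih hA).1, .pl hm (ih hA).2⟩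
  | el hm hk _ _ ih => exact ⟨.el hm hk (ih hA).1, .el hm hk (ih hA).2⟩

theorem Syn.inv_enc {S : Set Msg} {M N : Msg} (h : Syn S (Msg.enc M N)) (hk : Syn S N) :
    Syn S M := by
  generalize hA : Msg.enc M N = A at h
  induction h with
  | var x => cases hA
  | id hm => subst hA; exact .el hm hk (.id (.inl rfl))
  | pr => cases hA
  | er h₁ h₂ => cases hA; exact h₁
  | pl hm _ ih =>
    exact .pl hm (ih (hk.mono ((Set.subset_insert _ _).trans (Set.subset_insert _ _))) hA)
  | el hm hk' _ _ ih =>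
    exact .el hm hk' (ih (hk.mono ((Set.subset_insert _ _).trans (Set.subset_insert _ _))) hA)

theorem Syn.bs {S S' : Set Msg} {θ ρ : ℕ → Msg} (hx : ∀ x, Syn S' (θ x))
    (hS : ∀ m ∈ S, Syn S' (m.bs θ ρ)) {M : Msg} (h : Syn S M) : Syn S' (M.bs θ ρ) :=
  h.least (Rel := fun M => Syn S' (M.bs θ ρ)) hx (fun _ _ h₁ h₂ => .pr h₁ h₂)
    (fun _ _ h₁ h₂ => .er h₁ h₂) (fun _ _ h => h.inv_pair) (fun _ _ h hk => h.inv_enc hk) hS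

theorem Syn.cut {S S' : Set Msg} {M : Msg} (h : Syn S M) (hS : ∀ m ∈ S, Syn S' m) : Syn S' M :=
  h.least Syn.var (fun _ _ h₁ h₂ => .pr h₁ h₂)
    (fun _ _ h₁ h₂ => .er h₁ h₂) (fun _ _ h => h.inv_pair) (fun _ _ h hk => h.inv_enc hk) hS

theorem Eqv.syn_left {Γ : Set (Msg × Msg)} {M N : Msg} (h : Eqv Γ M N) :
    Syn (Prod.fst '' Γ) M :=
  h.least (Rel := fun M _ => Syn (Prod.fst '' Γ) M) Syn.var (fun _ _ _ _ h₁ h₂ => .pr h₁ h₂)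
    (fun _ _ _ _ h₁ h₂ => .er h₁ h₂) (fun _ _ _ _ h => h.inv_pair)
    (fun _ _ _ _ h hk => h.inv_enc hk) fun p hp => .id ⟨p, hp, rfl⟩

theorem Eqv.syn_right {Γ : Set (Msg × Msg)} {M N : Msg} (h : Eqv Γ M N) :
    Syn (Prod.snd '' Γ) N := by
  have := h.sw.syn_left
  rwa [fst_sw] at this

/-- A theory in which equivalent messages have the same shape and decryption keys are unique
assigns an equivalent message to each synthesizable one. -/
theorem Syn.exists_eqv {Γ : Set (Msg × Msg)} (hs : ∀ M N, Eqv Γ M N → M.SameType N)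
    (hk : ∀ A K A' K' X, Eqv Γ (Msg.enc A K) (Msg.enc A' K') → Eqv Γ K X → X = K')
    {S : Set Msg} {M : Msg} (h : Syn S M) (hS : ∀ m ∈ S, ∃ N, Eqv Γ m N) : ∃ N, Eqv Γ M N := by
  refine h.least (Rel := fun M => ∃ N, Eqv Γ M N) (fun x => ⟨_, .var x⟩)
    (fun _ _ ⟨_, h₁⟩ ⟨_, h₂⟩ => ⟨_, .pr h₁ h₂⟩) (fun _ _ ⟨_, h₁⟩ ⟨_, h₂⟩ => ⟨_, .er h₁ h₂⟩) ?_ ?_ hS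
  · rintro M N ⟨X, h⟩
    have := hs _ _ h
    cases X <;> simp only [Msg.SameType] at this
    exact ⟨⟨_, h.inv_pair.1⟩, ⟨_, h.inv_pair.2⟩⟩
  · rintro M N ⟨X, h⟩ ⟨Y, h'⟩
    have := hs _ _ h
    cases X <;> simp only [Msg.SameType] at this
    -- The partner `Y` of the left key must be the right key, so the decryption is possible on both
    -- sides at once.
    obtain rfl := hk _ _ _ _ _ h h'
    exact ⟨_, h.inv_enc h'⟩

/-! ### Consistent theories -/

/-- A key with a partner is synthesizable, so the key condition of consistency makes it equivalent
to the right key, and uniqueness leaves no other partner. -/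
theorem ConsistentTheory.key_unique {Γ : Set (Msg × Msg)} (hΓ : ConsistentTheory Γ)
    {A K A' K' X : Msg} (h : Eqv Γ (Msg.enc A K) (Msg.enc A' K')) (h' : Eqv Γ K X) : X = K' :=
  hΓ.unique_right _ _ _ (hΓ.key_left _ _ _ _ h h'.syn_left) h'

theorem ConsistentTheory.exists_eqv {Γ : Set (Msg × Msg)} (hΓ : ConsistentTheory Γ)
    {M : Msg} (h : Syn (Prod.fst '' Γ) M) : ∃ N, Eqv Γ M N :=
  h.exists_eqv hΓ.sameType (fun _ _ _ _ _ h h' => hΓ.key_unique h h')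
    (by rintro _ ⟨p, hp, rfl⟩; exact ⟨_, .id hp⟩)

/-- The half of consistency that concerns the left components. -/
structure ConsistentLeft (Γ : Set (Msg × Msg)) : Prop where
  sameType : ∀ M N, Eqv Γ M N → M.SameType N
  key_left : ∀ M₁ M₂ N₁ N₂, Eqv Γ (Msg.enc M₁ M₂) (Msg.enc N₁ N₂) →
    Syn (Prod.fst '' Γ) M₂ → Eqv Γ M₂ N₂
  unique_right : ∀ M N R, Eqv Γ M N → Eqv Γ M R → R = N

theorem ConsistentTheory.of_left {Γ : Set (Msg × Msg)} (h₁ : ConsistentLeft Γ)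
    (h₂ : ConsistentLeft (sw Γ)) : ConsistentTheory Γ where
  sameType := h₁.sameType
  key_left := h₁.key_left
  key_right M₁ M₂ N₁ N₂ h hs := (h₂.key_left _ _ _ _ h.sw (by rwa [fst_sw])).of_sw
  unique_right := h₁.unique_right
  unique_left M N R h h' := h₂.unique_right _ _ _ h.sw h'.sw

theorem Msg.SameType.symm {M N : Msg} (h : M.SameType N) : N.SameType M := by
  cases M <;> cases N <;> simp_all [SameType]

theorem Msg.SameType.trans {M N R : Msg} (h : M.SameType N) (h' : N.SameType R) :
    M.SameType R := by
  cases M <;> cases N <;> cases R <;> simp_all [SameType]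

theorem ConsistentTheory.sw {Γ : Set (Msg × Msg)} (h : ConsistentTheory Γ) :
    ConsistentTheory (sw Γ) where
  sameType M N hm := (h.sameType _ _ hm.of_sw).symm
  key_left M₁ M₂ N₁ N₂ hm hs := (h.key_right _ _ _ _ hm.of_sw (by rwa [fst_sw] at hs)).sw
  key_right M₁ M₂ N₁ N₂ hm hs :=
    (h.key_left _ _ _ _ hm.of_sw (by rwa [← fst_sw, sw_sw] at hs)).sw
  unique_right M N R hm hr := h.unique_left _ _ _ hm.of_sw hr.of_sw
  unique_left M N R hm hr := h.unique_right _ _ _ hm.of_sw hr.of_sw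

/-- A theory derivable from a consistent one is consistent. -/
theorem ConsistentTheory.of_eqv {Γ Γ' : Set (Msg × Msg)} (hΓ' : ConsistentTheory Γ')
    (h : ∀ p ∈ Γ, Eqv Γ' p.1 p.2) : ConsistentTheory Γ := by
  have main : ∀ {Γ Γ' : Set (Msg × Msg)}, ConsistentTheory Γ' → (∀ p ∈ Γ, Eqv Γ' p.1 p.2) →
      ConsistentLeft Γ := by
    intro Γ Γ' hΓ' h
    have hs : ∀ M N, Eqv Γ M N → M.SameType N := fun M N hm => hΓ'.sameType _ _ (hm.cut h)
    have hk : ∀ A K A' K' X, Eqv Γ (Msg.enc A K) (Msg.enc A' K') → Eqv Γ K X → X = K' :=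
      fun A K A' K' X h₁ h₂ => hΓ'.key_unique (h₁.cut h) (h₂.cut h)
    refine ⟨hs, fun M₁ M₂ N₁ N₂ hm hsyn => ?_, fun M N R h₁ h₂ =>
      hΓ'.unique_right _ _ _ (h₁.cut h) (h₂.cut h)⟩
    -- Consistency of `Γ'` alone would relate the keys in `Γ'`. A partner found inside `Γ` has to be
    -- the right key, which relates them in `Γ`.
    obtain ⟨X, hX⟩ := hsyn.exists_eqv hs hk (by rintro _ ⟨p, hp, rfl⟩; exact ⟨_, .id hp⟩)
    obtain rfl := hk _ _ _ _ _ hm hX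
    exact hX
  refine .of_left (main hΓ' h) (main hΓ'.sw ?_)
  rintro _ ⟨p, hp, rfl⟩
  exact (h p hp).sw

/-- Consistency is reflected along invertible replacements of names and rigid names. -/
theorem ConsistentTheory.transport {Γ Δ : Set (Msg × Msg)} (hΓ : ConsistentTheory Γ)
    {φ₁ r₁ φ₂ r₂ γ₁ s₁ γ₂ s₂ : ℕ → Msg}
    (hf : ∀ p ∈ Δ, Eqv Γ (p.1.bs φ₁ r₁) (p.2.bs φ₂ r₂)) (hfx : ∀ x, Eqv Γ (φ₁ x) (φ₂ x))
    (hg : ∀ p ∈ Γ, Eqv Δ (p.1.bs γ₁ s₁) (p.2.bs γ₂ s₂)) (hgx : ∀ x, Eqv Δ (γ₁ x) (γ₂ x))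
    (h₁ : ∀ x, (φ₁ x).bs γ₁ s₁ = Msg.nm x) (h₁' : ∀ a, (r₁ a).bs γ₁ s₁ = Msg.rg a)
    (h₂ : ∀ x, (φ₂ x).bs γ₂ s₂ = Msg.nm x) (h₂' : ∀ a, (r₂ a).bs γ₂ s₂ = Msg.rg a)
    (hx : ∀ x, (γ₁ x).SameType (γ₂ x)) (ha : ∀ a b, (s₁ a).SameType (s₂ b)) :
    ConsistentTheory Δ := by
  have main : ∀ {Γ Δ : Set (Msg × Msg)}, ConsistentTheory Γ →
    ∀ {φ₁ r₁ φ₂ r₂ γ₁ s₁ γ₂ s₂ : ℕ → Msg},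
    (∀ p ∈ Δ, Eqv Γ (p.1.bs φ₁ r₁) (p.2.bs φ₂ r₂)) → (∀ x, Eqv Γ (φ₁ x) (φ₂ x)) →
    (∀ p ∈ Γ, Eqv Δ (p.1.bs γ₁ s₁) (p.2.bs γ₂ s₂)) → (∀ x, Eqv Δ (γ₁ x) (γ₂ x)) →
    (∀ x, (φ₁ x).bs γ₁ s₁ = Msg.nm x) → (∀ a, (r₁ a).bs γ₁ s₁ = Msg.rg a) →
    (∀ x, (φ₂ x).bs γ₂ s₂ = Msg.nm x) → (∀ a, (r₂ a).bs γ₂ s₂ = Msg.rg a) →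
    (∀ x, (γ₁ x).SameType (γ₂ x)) → (∀ a b, (s₁ a).SameType (s₂ b)) → ConsistentLeft Δ := by
    intro Γ Δ hΓ φ₁ r₁ φ₂ r₂ γ₁ s₁ γ₂ s₂ hf hfx hg hgx h₁ h₁' h₂ h₂' hx ha
    have inv₁ (M : Msg) : (M.bs φ₁ r₁).bs γ₁ s₁ = M := by
      simp only [Msg.bs_bs, h₁, h₁']; exact M.bs_id
    have inv₂ (M : Msg) : (M.bs φ₂ r₂).bs γ₂ s₂ = M := by
      simp only [Msg.bs_bs, h₂, h₂']; exact M.bs_id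
    have fwd {M N : Msg} (h : Eqv Δ M N) : Eqv Γ (M.bs φ₁ r₁) (N.bs φ₂ r₂) := h.bs hfx hf
    refine ⟨fun M N h => ?_, fun M₁ M₂ N₁ N₂ h hs => ?_, fun M N R h h' => ?_⟩
    · have key : ∀ m n, Eqv Γ m n → (m.bs γ₁ s₁).SameType (n.bs γ₂ s₂) := by
        intro m n hm
        have ht := hΓ.sameType _ _ hm
        cases m <;> cases n <;> simp only [Msg.SameType] at ht
        · have := hΓ.unique_right _ _ _ hm (.var _)
          cases this
          exact hx _
        · exact ha _ _
        · trivial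
        · trivial
      have := key _ _ (fwd h)
      rwa [inv₁, inv₂] at this
    · have h' := hΓ.key_left _ _ _ _ (fwd h) (hs.bs (fun x => (hfx x).syn_left) (by
        rintro _ ⟨p, hp, rfl⟩; exact (hf p hp).syn_left))
      have := h'.bs hgx hg
      rwa [inv₁, inv₂] at this
    · have := hΓ.unique_right _ _ _ (fwd h) (fwd h')
      rw [← inv₂ R, this, inv₂]
  refine .of_left (main hΓ hf hfx hg hgx h₁ h₁' h₂ h₂' hx ha)
    (main hΓ.sw (φ₁ := φ₂) (r₁ := r₂) (φ₂ := φ₁) (r₂ := r₁) (γ₁ := γ₂) (s₁ := s₂) (γ₂ := γ₁)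
      (s₂ := s₁) ?_ (fun x => (hfx x).sw) ?_ (fun x => (hgx x).sw) h₂ h₂' h₁ h₁'
      (fun x => (hx x).symm) fun a b => (ha b a).symm)
  · rintro _ ⟨p, hp, rfl⟩; exact (hf p hp).sw
  · rintro _ ⟨p, hp, rfl⟩; exact (hg p hp).sw

theorem Eqv.of_empty {M N : Msg} (h : Eqv ∅ M N) : M = N ∧ M.IsPure := by
  refine h.least (Rel := fun M N => M = N ∧ M.IsPure) ?_ ?_ ?_ ?_ ?_ (by simp)
  · exact fun x => ⟨rfl, rfl⟩
  · rintro M N _ _ ⟨rfl, h⟩ ⟨rfl, h'⟩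
    exact ⟨rfl, by simp_all [Msg.IsPure, Msg.rn]⟩
  · rintro M N _ _ ⟨rfl, h⟩ ⟨rfl, h'⟩
    exact ⟨rfl, by simp_all [Msg.IsPure, Msg.rn]⟩
  · rintro M N M' N' ⟨h, h'⟩
    cases h
    simp_all [Msg.IsPure, Msg.rn]
  · rintro M N M' N' ⟨h, h'⟩ -
    cases h
    simp_all [Msg.IsPure, Msg.rn]

theorem Eqv.of_pure {Γ : Set (Msg × Msg)} {M : Msg} (h : M.IsPure) : Eqv Γ M M := by
  induction M with
  | nm x => exact .var x
  | rg a => simp [Msg.IsPure, Msg.rn] at h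
  | pair M N ihM ihN =>
    simp only [Msg.IsPure, Msg.rn, Set.union_empty_iff] at h
    exact .pr (ihM h.1) (ihN h.2)
  | enc M N ihM ihN =>
    simp only [Msg.IsPure, Msg.rn, Set.union_empty_iff] at h
    exact .er (ihM h.1) (ihN h.2)

theorem ConsistentTheory.empty : ConsistentTheory ∅ where
  sameType M N h := by
    obtain ⟨rfl, -⟩ := h.of_empty
    cases M <;> trivial
  key_left M₁ M₂ N₁ N₂ h _ := by
    obtain ⟨e, h'⟩ := h.of_empty
    cases e
    simp only [Msg.IsPure, Msg.rn, Set.union_empty_iff] at h'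
    exact .of_pure h'.2
  key_right M₁ M₂ N₁ N₂ h _ := by
    obtain ⟨e, h'⟩ := h.of_empty
    cases e
    simp only [Msg.IsPure, Msg.rn, Set.union_empty_iff] at h'
    exact .of_pure h'.2
  unique_right M N R h h' := by rw [← h.of_empty.1, ← h'.of_empty.1]
  unique_left M N R h h' := by rw [h.of_empty.1, h'.of_empty.1]

/-! Composition of theories, presented by sets of triples. -/

section Composition

variable {T : Set (Msg × Msg × Msg)}

/-- First and second components of a set of triples. -/
def th₁₂ (T : Set (Msg × Msg × Msg)) : Set (Msg × Msg) := (fun t => (t.1, t.2.1)) '' T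

def th₂₃ (T : Set (Msg × Msg × Msg)) : Set (Msg × Msg) := (fun t => (t.2.1, t.2.2)) '' T

def th₁₃ (T : Set (Msg × Msg × Msg)) : Set (Msg × Msg) := (fun t => (t.1, t.2.2)) '' T

/-- The relational composite of the two derivabilities is closed under decomposition: by consistency
of the first theory, the middle message has the shape of the left one and the two middle keys
coincide. So `Eqv.least` applies. -/
theorem Eqv.exists_middle (h₁ : ConsistentTheory (th₁₂ T))
    {M R : Msg} (h : Eqv (th₁₃ T) M R) : ∃ N, Eqv (th₁₂ T) M N ∧ Eqv (th₂₃ T) N R := by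
  refine h.least (Rel := fun M R => ∃ N, Eqv (th₁₂ T) M N ∧ Eqv (th₂₃ T) N R)
    (fun x => ⟨_, .var x, .var x⟩)
    (fun _ _ _ _ ⟨_, a, b⟩ ⟨_, c, d⟩ => ⟨_, .pr a c, .pr b d⟩)
    (fun _ _ _ _ ⟨_, a, b⟩ ⟨_, c, d⟩ => ⟨_, .er a c, .er b d⟩) ?_ ?_ ?_
  · rintro M N M' N' ⟨X, hX, hX'⟩
    have := h₁.sameType _ _ hX
    cases X <;> simp only [Msg.SameType] at this
    exact ⟨⟨_, hX.inv_pair.1, hX'.inv_pair.1⟩, ⟨_, hX.inv_pair.2, hX'.inv_pair.2⟩⟩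
  · rintro M N M' N' ⟨X, hX, hX'⟩ ⟨Y, hY, hY'⟩
    have := h₁.sameType _ _ hX
    cases X <;> simp only [Msg.SameType] at this
    obtain rfl := h₁.key_unique hX hY
    exact ⟨_, hX.inv_enc hY, hX'.inv_enc hY'⟩
  · rintro _ ⟨t, ht, rfl⟩
    exact ⟨_, .id ⟨t, ht, rfl⟩, .id ⟨t, ht, rfl⟩⟩

theorem Eqv.comp_key_unique (h₁ : ConsistentTheory (th₁₂ T)) (h₂ : ConsistentTheory (th₂₃ T))
    (A K A' K' X : Msg) (h : Eqv (th₁₃ T) (Msg.enc A K) (Msg.enc A' K'))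
    (hX : Eqv (th₁₃ T) K X) : X = K' := by
  obtain ⟨Y, hY, hY'⟩ := h.exists_middle h₁
  obtain ⟨Z, hZ, hZ'⟩ := hX.exists_middle h₁
  have := h₁.sameType _ _ hY
  cases Y <;> simp only [Msg.SameType] at this
  obtain rfl := h₁.key_unique hY hZ
  exact h₂.key_unique hY' hZ'

/-- Being synthesizable on the left, `M` has some partner in the composite theory. Passing through
the middle and using uniqueness twice identifies that partner with `R`. -/
theorem Eqv.comp (h₁ : ConsistentTheory (th₁₂ T)) (h₂ : ConsistentTheory (th₂₃ T))
    {M N R : Msg} (hM : Eqv (th₁₂ T) M N) (hR : Eqv (th₂₃ T) N R) : Eqv (th₁₃ T) M R := by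
  obtain ⟨R', hR'⟩ := hM.syn_left.exists_eqv (Γ := th₁₃ T) (by
      intro A B h
      obtain ⟨C, hC, hC'⟩ := h.exists_middle h₁
      exact (h₁.sameType _ _ hC).trans (h₂.sameType _ _ hC')) (Eqv.comp_key_unique h₁ h₂) (by
      rintro _ ⟨_, ⟨t, ht, rfl⟩, rfl⟩
      exact ⟨_, .id ⟨t, ht, rfl⟩⟩)
  obtain ⟨N', hN, hN'⟩ := hR'.exists_middle h₁
  obtain rfl := h₁.unique_right _ _ _ hM hN
  obtain rfl := h₂.unique_right _ _ _ hR hN'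
  exact hR'

theorem ConsistentTheory.comp (h₁ : ConsistentTheory (th₁₂ T)) (h₂ : ConsistentTheory (th₂₃ T)) :
    ConsistentTheory (th₁₃ T) := by
  have main : ∀ {T : Set (Msg × Msg × Msg)}, ConsistentTheory (th₁₂ T) →
      ConsistentTheory (th₂₃ T) → ConsistentLeft (th₁₃ T) := by
    intro T h₁ h₂
    refine ⟨fun M R h => ?_, fun M₁ M₂ R₁ R₂ h hs => ?_, fun M R R' h h' => ?_⟩
    · obtain ⟨N, hN, hN'⟩ := h.exists_middle h₁
      exact (h₁.sameType _ _ hN).trans (h₂.sameType _ _ hN')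
    · obtain ⟨Y, hY, hY'⟩ := h.exists_middle h₁
      have := h₁.sameType _ _ hY
      cases Y <;> simp only [Msg.SameType] at this
      have h₁₂ := h₁.key_left _ _ _ _ hY (by
        simpa only [th₁₂, th₁₃, Set.image_image] using hs)
      refine Eqv.comp h₁ h₂ h₁₂ (h₂.key_left _ _ _ _ hY' ?_)
      simpa only [th₁₂, th₂₃, Set.image_image] using h₁₂.syn_right
    · obtain ⟨N, hN, hN'⟩ := h.exists_middle h₁
      obtain ⟨N', hM, hM'⟩ := h'.exists_middle h₁
      obtain rfl := h₁.unique_right _ _ _ hN hM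
      exact h₂.unique_right _ _ _ hN' hM'
  refine .of_left (main h₁ h₂) ?_
  -- Reversing the triples exchanges the two theories, so the left half of consistency yields the
  -- right half.
  let r : Msg × Msg × Msg → Msg × Msg × Msg := fun t => (t.2.2, t.2.1, t.1)
  have e₁ : th₁₂ (r '' T) = Spi.sw (th₂₃ T) := by
    simp only [th₁₂, th₂₃, Spi.sw, Set.image_image, r]; rfl
  have e₂ : th₂₃ (r '' T) = Spi.sw (th₁₂ T) := by
    simp only [th₁₂, th₂₃, Spi.sw, Set.image_image, r]; rfl
  have e₃ : th₁₃ (r '' T) = Spi.sw (th₁₃ T) := by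
    simp only [th₁₃, Spi.sw, Set.image_image, r]; rfl
  rw [← e₃]
  exact main (e₁ ▸ h₂.sw) (e₂ ▸ h₁.sw)

end Composition

/-! ### Bi-traces, respectful substitutions and consistency -/

namespace Trace

@[elab_as_elim]
theorem ind {motive : Trace → Prop} (nil : motive [])
    (cons : ∀ m M N (h : Trace), motive h → motive ((m, M, N) :: h)) (h : Trace) : motive h :=
  List.rec nil (fun e h ih => cons e.1 e.2.1 e.2.2 h ih) h

def bs (θ₁ ρ₁ θ₂ ρ₂ : ℕ → Msg) (h : Trace) : Trace :=
  h.map fun e => (e.1, e.2.1.bs θ₁ ρ₁, e.2.2.bs θ₂ ρ₂)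

theorem subst_eq (θ₁ θ₂ : ℕ → Msg) (h : Trace) : h.subst θ₁ θ₂ = h.bs θ₁ Msg.rg θ₂ Msg.rg := by
  simp [subst, bs, Msg.subst_eq]

theorem bs_bs (θ₁ ρ₁ θ₂ ρ₂ θ₁' ρ₁' θ₂' ρ₂' : ℕ → Msg) (h : Trace) :
    (h.bs θ₁ ρ₁ θ₂ ρ₂).bs θ₁' ρ₁' θ₂' ρ₂' =
      h.bs (fun x => (θ₁ x).bs θ₁' ρ₁') (fun a => (ρ₁ a).bs θ₁' ρ₁')
        (fun x => (θ₂ x).bs θ₂' ρ₂') (fun a => (ρ₂ a).bs θ₂' ρ₂') := by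
  simp [bs, Msg.bs_bs]

theorem bs_id (h : Trace) : h.bs Msg.nm Msg.rg Msg.nm Msg.rg = h := by
  simp [bs, Msg.bs_id]

theorem subst_subst (θ₁ θ₂ θ₁' θ₂' : ℕ → Msg) (h : Trace) :
    (h.subst θ₁ θ₂).subst θ₁' θ₂' =
      h.subst (fun x => (θ₁ x).subst θ₁') (fun x => (θ₂ x).subst θ₂') := by
  simp only [subst_eq, bs_bs, Msg.subst_eq]; rfl

theorem subst_nm (h : Trace) : h.subst Msg.nm Msg.nm = h := by rw [subst_eq, bs_id]

@[simp] theorem subst_nil (θ₁ θ₂ : ℕ → Msg) : subst θ₁ θ₂ [] = [] := rfl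

@[simp] theorem subst_cons (θ₁ θ₂ : ℕ → Msg) (m : Mark) (M N : Msg) (h : Trace) :
    subst θ₁ θ₂ ((m, M, N) :: h) = (m, M.subst θ₁, N.subst θ₂) :: subst θ₁ θ₂ h := rfl

@[simp] theorem inverse_cons (m : Mark) (M N : Msg) (h : Trace) :
    inverse ((m, M, N) :: h) = (m, N, M) :: inverse h := rfl

theorem inverse_inverse (h : Trace) : h.inverse.inverse = h := by
  simp only [inverse, List.map_map]
  exact List.map_id h

theorem inverse_subst (θ₁ θ₂ : ℕ → Msg) (h : Trace) :
    (h.subst θ₁ θ₂).inverse = h.inverse.subst θ₂ θ₁ := by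
  simp [inverse, subst]

@[simp] theorem theory_nil : theory [] = ∅ := by simp [theory]

@[simp] theorem theory_cons (m : Mark) (M N : Msg) (h : Trace) :
    theory ((m, M, N) :: h) = insert (M, N) (theory h) := by
  ext p; simp [theory, eq_comm]

theorem mem_theory_of_mem {h : Trace} {m : Mark} {M N : Msg} (he : (m, M, N) ∈ h) :
    (M, N) ∈ h.theory := ⟨_, he, rfl⟩

theorem theory_inverse (h : Trace) : h.inverse.theory = sw h.theory := by
  ext ⟨a, b⟩; simp [theory, sw, inverse]

theorem theory_bs (θ₁ ρ₁ θ₂ ρ₂ : ℕ → Msg) (h : Trace) :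
    (h.bs θ₁ ρ₁ θ₂ ρ₂).theory =
      (fun p : Msg × Msg => (p.1.bs θ₁ ρ₁, p.2.bs θ₂ ρ₂)) '' h.theory := by
  ext ⟨a, b⟩
  constructor
  · rintro ⟨_, he, e⟩
    obtain ⟨⟨m, M, N⟩, he', rfl⟩ := List.mem_map.1 he
    exact ⟨(M, N), mem_theory_of_mem he', e⟩
  · rintro ⟨_, ⟨e, he, rfl⟩, e'⟩
    exact ⟨_, List.mem_map.2 ⟨e, he, rfl⟩, e'⟩

theorem mem_theory_bs {θ₁ ρ₁ θ₂ ρ₂ : ℕ → Msg} {h : Trace} {p : Msg × Msg} (hp : p ∈ h.theory) :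
    (p.1.bs θ₁ ρ₁, p.2.bs θ₂ ρ₂) ∈ (h.bs θ₁ ρ₁ θ₂ ρ₂).theory := by
  rw [theory_bs]; exact ⟨p, hp, rfl⟩

/-- Names and rigid names of the two sides of a trace. -/
def fnL (h : Trace) : Set ℕ := {x | ∃ e ∈ h, x ∈ e.2.1.fn}
def fnR (h : Trace) : Set ℕ := {x | ∃ e ∈ h, x ∈ e.2.2.fn}
def rnL (h : Trace) : Set ℕ := {x | ∃ e ∈ h, x ∈ e.2.1.rn}
def rnR (h : Trace) : Set ℕ := {x | ∃ e ∈ h, x ∈ e.2.2.rn}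

@[simp] theorem fnL_nil : fnL [] = ∅ := by simp [fnL]
@[simp] theorem fnR_nil : fnR [] = ∅ := by simp [fnR]
@[simp] theorem rnL_nil : rnL [] = ∅ := by simp [rnL]
@[simp] theorem fn_nil : fn [] = ∅ := by simp [fn]
@[simp] theorem fnL_cons (m : Mark) (M N : Msg) (h : Trace) :
    fnL ((m, M, N) :: h) = M.fn ∪ fnL h := by ext; simp [fnL]
@[simp] theorem fnR_cons (m : Mark) (M N : Msg) (h : Trace) :
    fnR ((m, M, N) :: h) = N.fn ∪ fnR h := by ext; simp [fnR]
@[simp] theorem rnL_cons (m : Mark) (M N : Msg) (h : Trace) :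
    rnL ((m, M, N) :: h) = M.rn ∪ rnL h := by ext; simp [rnL]
@[simp] theorem rnR_cons (m : Mark) (M N : Msg) (h : Trace) :
    rnR ((m, M, N) :: h) = N.rn ∪ rnR h := by ext; simp [rnR]
@[simp] theorem fn_cons (m : Mark) (M N : Msg) (h : Trace) :
    fn ((m, M, N) :: h) = M.fn ∪ N.fn ∪ fn h := by ext; simp [fn]

theorem fn_eq (h : Trace) : h.fn = h.fnL ∪ h.fnR := by
  ext x; simp only [fn, fnL, fnR, Set.mem_union, Set.mem_ofPred_eq, and_or_left, exists_or]

theorem rn_eq (h : Trace) : h.rn = h.rnL ∪ h.rnR := by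
  ext x; simp only [rn, rnL, rnR, Set.mem_union, Set.mem_ofPred_eq, and_or_left, exists_or]

theorem fnL_inverse (h : Trace) : h.inverse.fnL = h.fnR := by
  ext; simp only [fnL, fnR, inverse, List.mem_map, Set.mem_ofPred_eq, exists_exists_and_eq_and]
theorem fnR_inverse (h : Trace) : h.inverse.fnR = h.fnL := by
  ext; simp only [fnL, fnR, inverse, List.mem_map, Set.mem_ofPred_eq, exists_exists_and_eq_and]
theorem rnL_inverse (h : Trace) : h.inverse.rnL = h.rnR := by
  ext; simp only [rnL, rnR, inverse, List.mem_map, Set.mem_ofPred_eq, exists_exists_and_eq_and]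
theorem rnR_inverse (h : Trace) : h.inverse.rnR = h.rnL := by
  ext; simp only [rnL, rnR, inverse, List.mem_map, Set.mem_ofPred_eq, exists_exists_and_eq_and]
theorem fn_inverse (h : Trace) : h.inverse.fn = h.fn := by
  rw [fn_eq, fn_eq, fnL_inverse, fnR_inverse, Set.union_comm]

theorem fn_finite (h : Trace) : h.fn.Finite := by
  induction h using Trace.ind with
  | nil => simp
  | cons m M N h ih =>
    rw [fn_cons]; exact (M.fn_finite.union N.fn_finite).union ih

theorem rnL_finite (h : Trace) : h.rnL.Finite := by
  induction h using Trace.ind with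
  | nil => simp
  | cons m M N h ih =>
    rw [rnL_cons]; exact M.rn_finite.union ih

theorem rnR_finite (h : Trace) : h.rnR.Finite := rnL_inverse h ▸ h.inverse.rnL_finite

theorem fn_of_mem_theory {h : Trace} {p : Msg × Msg} (hp : p ∈ h.theory) :
    p.1.fn ∪ p.2.fn ⊆ h.fn := by
  obtain ⟨e, he, rfl⟩ := hp
  exact fun x hx => ⟨e, he, hx⟩

theorem bs_congr {θ₁ ρ₁ θ₂ ρ₂ θ₁' ρ₁' θ₂' ρ₂' : ℕ → Msg} (h : Trace)
    (h₁ : ∀ x ∈ h.fnL, θ₁ x = θ₁' x) (h₁' : ∀ x ∈ h.rnL, ρ₁ x = ρ₁' x)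
    (h₂ : ∀ x ∈ h.fnR, θ₂ x = θ₂' x) (h₂' : ∀ x ∈ h.rnR, ρ₂ x = ρ₂' x) :
    h.bs θ₁ ρ₁ θ₂ ρ₂ = h.bs θ₁' ρ₁' θ₂' ρ₂' := by
  refine List.map_congr_left fun e he => ?_
  rw [Msg.bs_congr _ (fun x hx => h₁ x ⟨e, he, hx⟩) (fun x hx => h₁' x ⟨e, he, hx⟩),
    Msg.bs_congr _ (fun x hx => h₂ x ⟨e, he, hx⟩) (fun x hx => h₂' x ⟨e, he, hx⟩)]

theorem subst_congr {θ₁ θ₂ θ₁' θ₂' : ℕ → Msg} {h : Trace}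
    (h₁ : ∀ x ∈ h.fn, θ₁ x = θ₁' x) (h₂ : ∀ x ∈ h.fn, θ₂ x = θ₂' x) :
    h.subst θ₁ θ₂ = h.subst θ₁' θ₂' := by
  rw [subst_eq, subst_eq]
  rw [fn_eq] at h₁ h₂
  exact h.bs_congr (fun x hx => h₁ x (.inl hx)) (fun _ _ => rfl) (fun x hx => h₂ x (.inr hx))
    (fun _ _ => rfl)

theorem Respects.congr {θ₁ θ₂ θ₁' θ₂' : ℕ → Msg} {h : Trace} (hr : h.Respects θ₁ θ₂)
    (h₁ : ∀ x ∈ h.fn, θ₁ x = θ₁' x) (h₂ : ∀ x ∈ h.fn, θ₂ x = θ₂' x) : h.Respects θ₁' θ₂' := by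
  induction h using Trace.ind with
  | nil => trivial
  | cons m M N h ih =>
    rcases m with _ | _
    · simp only [fn_cons] at h₁ h₂
      refine ⟨fun x hx => ?_, ih hr.2 (fun x hx => h₁ x (.inr hx)) (fun x hx => h₂ x (.inr hx))⟩
      rw [← h₁ x (.inl hx), ← h₂ x (.inl hx),
        ← subst_congr (fun x hx => h₁ x (.inr hx)) (fun x hx => h₂ x (.inr hx))]
      exact hr.1 x hx
    · simp only [fn_cons] at h₁ h₂
      exact ih hr (fun x hx => h₁ x (.inr hx)) (fun x hx => h₂ x (.inr hx))

open Classical in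
/-- The substitution `θ` cut down to the set `X`. -/
noncomputable def cutTo (X : Set ℕ) (θ : ℕ → Msg) : ℕ → Msg :=
  fun x => if x ∈ X then θ x else Msg.nm x

theorem cutTo_of_mem {X : Set ℕ} {θ : ℕ → Msg} {x : ℕ} (hx : x ∈ X) : cutTo X θ x = θ x :=
  if_pos hx

theorem cutTo_of_notMem {X : Set ℕ} {θ : ℕ → Msg} {x : ℕ} (hx : x ∉ X) :
    cutTo X θ x = Msg.nm x :=
  if_neg hx

theorem isSubst_cutTo {X : Set ℕ} (hX : X.Finite) (θ : ℕ → Msg) : IsSubst (cutTo X θ) :=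
  hX.subset fun x hx => by
    by_contra h
    exact hx (cutTo_of_notMem h)

/-- Both `Respects` and the action on a bi-trace see only the names of `h`. So arbitrary maps may be
replaced by maps of finite domain, and the finiteness condition can be dropped from later
statements. -/
theorem Respects.cutTo {θ₁ θ₂ : ℕ → Msg} {h : Trace} (hr : h.Respects θ₁ θ₂) :
    h.Respects (cutTo h.fn θ₁) (cutTo h.fn θ₂) :=
  hr.congr (fun _ hx => (cutTo_of_mem hx).symm) (fun _ hx => (cutTo_of_mem hx).symm)

theorem subst_cutTo (θ₁ θ₂ : ℕ → Msg) (h : Trace) :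
    h.subst (Trace.cutTo h.fn θ₁) (Trace.cutTo h.fn θ₂) = h.subst θ₁ θ₂ :=
  subst_congr (fun _ hx => cutTo_of_mem hx) (fun _ hx => cutTo_of_mem hx)

/-- Every name of a bi-trace occurs in some input pair, since output pairs contain only earlier
names; the equivalence that holds there persists as the trace grows. -/
theorem Respects.fn {θ₁ θ₂ : ℕ → Msg} {h : Trace} (hr : h.Respects θ₁ θ₂) (hb : h.IsBiTrace)
    {x : ℕ} (hx : x ∈ h.fn) : Eqv (h.subst θ₁ θ₂).theory (θ₁ x) (θ₂ x) := by
  induction h using Trace.ind with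
  | nil => simp at hx
  | cons m M N h ih =>
    rcases m with _ | _
    · rw [fn_cons] at hx
      rw [subst_cons, theory_cons]
      refine Eqv.mono ?_ (Set.subset_insert _ _)
      rcases hx with hx | hx
      · exact hr.1 x hx
      · exact ih hr.2 hb hx
    · rw [fn_cons] at hx
      rw [subst_cons, theory_cons]
      refine (ih hr hb.2 ?_).mono (Set.subset_insert _ _)
      rcases hx with hx | hx
      · exact hb.1 hx
      · exact hx

end Trace

theorem Eqv.subst_of {Γ Γ' : Set (Msg × Msg)} {X : Set ℕ} {θ₁ θ₂ : ℕ → Msg}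
    (hx : ∀ x ∈ X, Eqv Γ' (θ₁ x) (θ₂ x)) (hX : ∀ p ∈ Γ, p.1.fn ∪ p.2.fn ⊆ X)
    (hΓ : ∀ p ∈ Γ, Eqv Γ' (p.1.subst θ₁) (p.2.subst θ₂))
    {M N : Msg} (hM : M.fn ∪ N.fn ⊆ X) (h : Eqv Γ M N) : Eqv Γ' (M.subst θ₁) (N.subst θ₂) := by
  have e (θ : ℕ → Msg) {M : Msg} (hM : M.fn ⊆ X) :
      M.subst θ = M.bs (Trace.cutTo X θ) Msg.rg := by
    rw [Msg.subst_eq]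
    exact M.bs_congr (fun x hx => (Trace.cutTo_of_mem (hM hx)).symm) (fun _ _ => rfl)
  rw [Set.union_subset_iff] at hM
  rw [e θ₁ hM.1, e θ₂ hM.2]
  refine h.bs (fun x => ?_) fun p hp => ?_
  · by_cases h : x ∈ X
    · rw [Trace.cutTo_of_mem h, Trace.cutTo_of_mem h]; exact hx x h
    · rw [Trace.cutTo_of_notMem h, Trace.cutTo_of_notMem h]; exact .var x
  · have := hX p hp
    rw [Set.union_subset_iff] at this
    rw [← e θ₁ this.1, ← e θ₂ this.2]
    exact hΓ p hp

theorem Msg.subst_nm (M : Msg) : M.subst Msg.nm = M := by rw [Msg.subst_eq, Msg.bs_id]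

namespace Trace

/-- Respectful substitutions preserve derivability. -/
theorem Respects.eqv {θ₁ θ₂ : ℕ → Msg} {h : Trace} (hr : h.Respects θ₁ θ₂) (hb : h.IsBiTrace)
    {M N : Msg} (hM : ∀ x ∈ M.fn ∪ N.fn, x ∈ h.fn ∨ Eqv (h.subst θ₁ θ₂).theory (θ₁ x) (θ₂ x))
    (he : Eqv h.theory M N) : Eqv (h.subst θ₁ θ₂).theory (M.subst θ₁) (N.subst θ₂) := by
  refine he.subst_of (X := h.fn ∪ (M.fn ∪ N.fn)) ?_
    (fun p hp => (fn_of_mem_theory hp).trans Set.subset_union_left)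
    (fun p hp => ?_) Set.subset_union_right
  · rintro x (hx | hx)
    · exact hr.fn hb hx
    · exact (hM x hx).elim (hr.fn hb) id
  · refine .id ?_
    rw [subst_eq, Msg.subst_eq, Msg.subst_eq]
    exact mem_theory_bs hp

theorem consistent_nil : Consistent [] := by simp [Consistent]

theorem consistent_i {M N : Msg} {h : Trace} :
    Consistent ((Mark.i, M, N) :: h) ↔ Consistent h ∧ Eqv (theory h) M N := by
  rw [Consistent]

theorem consistent_o_aux {M N : Msg} {h : Trace} :
    Consistent ((Mark.o, M, N) :: h) ↔ IsBiTrace ((Mark.o, M, N) :: h) ∧ Consistent h ∧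
      ∀ θ₁ θ₂ : ℕ → Msg, Respects θ₁ θ₂ h → Consistent (subst θ₁ θ₂ h) →
        ConsistentTheory (theory (subst θ₁ θ₂ ((Mark.o, M, N) :: h))) := by
  rw [Consistent]
  refine and_congr_right fun hb => and_congr_right fun _ =>
    ⟨fun H θ₁ θ₂ hr hc => ?_, fun H θ₁ θ₂ _ _ hr hc => H θ₁ θ₂ hr hc⟩
  have e : fn ((Mark.o, M, N) :: h) = fn h := by rw [fn_cons]; exact Set.union_eq_right.2 hb.1
  have := H _ _ (isSubst_cutTo h.fn_finite θ₁) (isSubst_cutTo h.fn_finite θ₂) hr.cutTo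
    (by rwa [subst_cutTo])
  rwa [← e, subst_cutTo] at this

theorem Consistent.isBiTrace {h : Trace} (hc : h.Consistent) : h.IsBiTrace := by
  induction h using Trace.ind with
  | nil => trivial
  | cons m M N h ih =>
    rcases m with _ | _
    · exact ih (consistent_i.1 hc).1
    · exact (consistent_o_aux.1 hc).1

theorem Consistent.tail {e : Mark × Msg × Msg} {h : Trace} (hc : Consistent (e :: h)) :
    h.Consistent := by
  obtain ⟨_ | _, M, N⟩ := e
  · exact (consistent_i.1 hc).1
  · exact (consistent_o_aux.1 hc).2.1

/-- A name new in an input pair occurs in both components, by `Eqv.fn_left` and `Eqv.fn_right`;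
output pairs contain no new names. Hence, after any substitution, the names of `θ₁ x` and of `θ₂ x`
both occur in the instance, which therefore stays a bi-trace. -/
theorem Consistent.fn_subset {h : Trace} (hc : h.Consistent) : h.fn ⊆ h.fnL ∩ h.fnR := by
  induction h using Trace.ind with
  | nil => simp
  | cons m M N h ih =>
    rcases m with _ | _
    · obtain ⟨hc, he⟩ := consistent_i.1 hc
      have ih := ih hc
      intro x hx
      rw [fnL_cons, fnR_cons]
      rw [fn_cons] at hx
      have key : x ∈ h.fn → x ∈ (M.fn ∪ h.fnL) ∩ (N.fn ∪ h.fnR) :=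
        fun hx => ⟨.inr (ih hx).1, .inr (ih hx).2⟩
      rcases hx with (hx | hx) | hx
      · rcases he.fn_left hx with h' | ⟨p, hp, h'⟩
        · exact ⟨.inl hx, .inl h'⟩
        · exact key (fn_of_mem_theory hp (.inl h'))
      · rcases he.fn_right hx with h' | ⟨p, hp, h'⟩
        · exact ⟨.inl h', .inl hx⟩
        · exact key (fn_of_mem_theory hp (.inr h'))
      · exact key hx
    · intro x hx
      have hb := hc.isBiTrace
      rw [fn_cons] at hx
      have := ih hc.tail (hx.elim (@hb.1 x) id)
      rw [fnL_cons, fnR_cons]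
      exact ⟨.inr this.1, .inr this.2⟩

theorem fn_subst_left {θ₁ θ₂ : ℕ → Msg} {h : Trace} {x : ℕ} (hx : x ∈ h.fnL) :
    (θ₁ x).fn ⊆ (h.subst θ₁ θ₂).fn := by
  obtain ⟨e, he, hx⟩ := hx
  intro y hy
  refine ⟨_, List.mem_map.2 ⟨e, he, rfl⟩, .inl ?_⟩
  rw [Msg.subst_eq, Msg.mem_fn_bs]
  exact .inl ⟨x, hx, hy⟩

theorem fn_subst_right {θ₁ θ₂ : ℕ → Msg} {h : Trace} {x : ℕ} (hx : x ∈ h.fnR) :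
    (θ₂ x).fn ⊆ (h.subst θ₁ θ₂).fn := by
  obtain ⟨e, he, hx⟩ := hx
  intro y hy
  refine ⟨_, List.mem_map.2 ⟨e, he, rfl⟩, .inr ?_⟩
  change y ∈ (e.2.2.subst θ₂).fn
  rw [Msg.subst_eq, Msg.mem_fn_bs]
  exact .inl ⟨x, hx, hy⟩

theorem Consistent.fn_subst {h : Trace} (hc : h.Consistent) {θ₁ θ₂ : ℕ → Msg} {x : ℕ}
    (hx : x ∈ h.fn) : (θ₁ x).fn ∪ (θ₂ x).fn ⊆ (h.subst θ₁ θ₂).fn :=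
  Set.union_subset (fn_subst_left (hc.fn_subset hx).1) (fn_subst_right (hc.fn_subset hx).2)

theorem Consistent.msg_fn_subst {h : Trace} (hc : h.Consistent) {θ₁ θ₂ : ℕ → Msg} {M N : Msg}
    (hM : M.fn ∪ N.fn ⊆ h.fn) : (M.subst θ₁).fn ∪ (N.subst θ₂).fn ⊆ (h.subst θ₁ θ₂).fn := by
  rintro y (hy | hy) <;> rw [Msg.subst_eq, Msg.mem_fn_bs] at hy
  · rcases hy with ⟨x, hx, hy⟩ | ⟨a, -, hy⟩
    · exact hc.fn_subst (hM (.inl hx)) (.inl hy)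
    · simp [Msg.fn] at hy
  · rcases hy with ⟨x, hx, hy⟩ | ⟨a, -, hy⟩
    · exact hc.fn_subst (hM (.inr hx)) (.inr hy)
    · simp [Msg.fn] at hy

theorem Consistent.isBiTrace_subst {h : Trace} (hc : h.Consistent) (θ₁ θ₂ : ℕ → Msg) :
    (h.subst θ₁ θ₂).IsBiTrace := by
  induction h using Trace.ind with
  | nil => trivial
  | cons m M N h ih =>
    rcases m with _ | _
    · exact ih hc.tail
    · exact ⟨hc.tail.msg_fn_subst hc.isBiTrace.1, ih hc.tail⟩

/-- A name new at an input pair occurs in both of its messages, so all names of its two values occur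
in the instantiated pair, where the second pair of substitutions is controlled. The derivation given
by the first pair can then be instantiated by `Respects.eqv`. -/
theorem Respects.comp {θ₁ θ₂ θ₁' θ₂' : ℕ → Msg} {h : Trace} (hc : h.Consistent)
    (hr : h.Respects θ₁ θ₂) (hr' : (h.subst θ₁ θ₂).Respects θ₁' θ₂') :
    h.Respects (fun x => (θ₁ x).subst θ₁') (fun x => (θ₂ x).subst θ₂') := by
  induction h using Trace.ind with
  | nil => trivial
  | cons m M N h ih =>
    rcases m with _ | _
    · have hr₁ := ih hc.tail hr.2 hr'.2
      refine ⟨fun x hx => ?_, hr₁⟩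
      by_cases hxh : x ∈ h.fn
      · exact hr₁.fn hc.tail.isBiTrace hxh
      have hxMN : x ∈ M.fn ∧ x ∈ N.fn := by
        have he := (consistent_i.1 hc).2
        rcases hx with hx | hx
        · rcases he.fn_left hx with h' | ⟨p, hp, h'⟩
          · exact ⟨hx, h'⟩
          · exact absurd (fn_of_mem_theory hp (.inl h')) hxh
        · rcases he.fn_right hx with h' | ⟨p, hp, h'⟩
          · exact ⟨h', hx⟩
          · exact absurd (fn_of_mem_theory hp (.inr h')) hxh
      rw [← subst_subst]
      refine hr'.2.eqv (hc.tail.isBiTrace_subst θ₁ θ₂) (fun y hy => .inr (hr'.1 y ?_)) (hr.1 x hx)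
      rw [Msg.subst_eq, Msg.subst_eq]
      rcases hy with hy | hy
      · exact .inl (Msg.mem_fn_bs.2 (.inl ⟨x, hxMN.1, hy⟩))
      · exact .inr (Msg.mem_fn_bs.2 (.inl ⟨x, hxMN.2, hy⟩))
    · exact ih hc.tail hr hr'

/-- Respectful substitutions preserve consistency of bi-traces. -/
theorem Consistent.subst {h : Trace} (hc : h.Consistent) {θ₁ θ₂ : ℕ → Msg}
    (hr : h.Respects θ₁ θ₂) : (h.subst θ₁ θ₂).Consistent := by
  induction h using Trace.ind with
  | nil => exact hc
  | cons m M N h ih =>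
    rcases m with _ | _
    · obtain ⟨hc, he⟩ := consistent_i.1 hc
      exact consistent_i.2 ⟨ih hc hr.2, hr.2.eqv hc.isBiTrace (fun x hx => .inr (hr.1 x hx)) he⟩
    · have hb := hc.isBiTrace_subst θ₁ θ₂
      obtain ⟨-, hc, H⟩ := consistent_o_aux.1 hc
      refine consistent_o_aux.2 ⟨hb, ih hc hr, fun θ₁' θ₂' hr' hc' => ?_⟩
      have := H _ _ (Respects.comp hc hr hr') (by rwa [← subst_subst])
      rw [← subst_subst] at this
      exact this

/-- The instantiated prefix is consistent automatically, by `Consistent.subst`, so that premise of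
the definition disappears. -/
theorem consistent_o {M N : Msg} {h : Trace} :
    Consistent ((Mark.o, M, N) :: h) ↔ M.fn ∪ N.fn ⊆ h.fn ∧ Consistent h ∧
      ∀ θ₁ θ₂ : ℕ → Msg, Respects θ₁ θ₂ h →
        ConsistentTheory (insert (M.subst θ₁, N.subst θ₂) (theory (subst θ₁ θ₂ h))) := by
  rw [consistent_o_aux]
  constructor
  · rintro ⟨hb, hc, H⟩
    refine ⟨hb.1, hc, fun θ₁ θ₂ hr => ?_⟩
    rw [← theory_cons Mark.o]
    exact H θ₁ θ₂ hr (hc.subst hr)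
  · rintro ⟨hb, hc, H⟩
    refine ⟨⟨hb, hc.isBiTrace⟩, hc, fun θ₁ θ₂ hr _ => ?_⟩
    rw [subst_cons, theory_cons]
    exact H θ₁ θ₂ hr

theorem respects_nm (h : Trace) : h.Respects Msg.nm Msg.nm := by
  induction h using Trace.ind with
  | nil => trivial
  | cons m M N h ih =>
    rcases m with _ | _
    · exact ⟨fun x _ => .var x, ih⟩
    · exact ih

/-- An input pair is derivable from what precedes it and adds nothing; for an output pair the
identity is an admissible test. -/
theorem Consistent.theory {h : Trace} (hc : h.Consistent) : ConsistentTheory h.theory := by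
  induction h using Trace.ind with
  | nil => rw [theory_nil]; exact .empty
  | cons m M N h ih =>
    rcases m with _ | _
    · obtain ⟨hc, he⟩ := consistent_i.1 hc
      refine (ih hc).of_eqv ?_
      rw [theory_cons]
      rintro p (rfl | hp)
      · exact he
      · exact .id hp
    · have := (consistent_o.1 hc).2.2 _ _ h.respects_nm
      rwa [subst_nm, Msg.subst_nm, Msg.subst_nm, ← theory_cons Mark.o] at this

theorem isBiTrace_inverse {h : Trace} (hb : h.IsBiTrace) : h.inverse.IsBiTrace := by
  induction h using Trace.ind with
  | nil => trivial
  | cons m M N h ih =>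
    rcases m with _ | _
    · exact ih hb
    · rw [inverse_cons]
      refine ⟨?_, ih hb.2⟩
      rw [fn_inverse, Set.union_comm]; exact hb.1

theorem Respects.inverse {θ₁ θ₂ : ℕ → Msg} {h : Trace} (hr : h.Respects θ₁ θ₂) :
    h.inverse.Respects θ₂ θ₁ := by
  induction h using Trace.ind with
  | nil => trivial
  | cons m M N h ih =>
    rcases m with _ | _
    · rw [inverse_cons]
      refine ⟨fun x hx => ?_, ih hr.2⟩
      rw [← inverse_subst, theory_inverse]
      exact (hr.1 x hx.symm).sw
    · exact ih hr

theorem Consistent.inverse {h : Trace} (hc : h.Consistent) : h.inverse.Consistent := by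
  induction h using Trace.ind with
  | nil => exact hc
  | cons m M N h ih =>
    rcases m with _ | _
    · obtain ⟨hc, he⟩ := consistent_i.1 hc
      rw [inverse_cons]
      refine consistent_i.2 ⟨ih hc, ?_⟩
      rw [theory_inverse]
      exact he.sw
    · obtain ⟨hb, hc, H⟩ := consistent_o.1 hc
      rw [inverse_cons]
      refine consistent_o.2 ⟨?_, ih hc, fun θ₁ θ₂ hr => ?_⟩
      · rw [fn_inverse, Set.union_comm]; exact hb
      · have := hr.inverse
        rw [inverse_inverse] at this
        have := (H _ _ this).sw
        rw [← inverse_subst, theory_inverse]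
        rwa [sw, Set.image_insert_eq] at this

/-- The values of a respectful substitution are derivable from the trace, and derivations create no
rigid names. So a rigid name fresh for one side stays fresh for it. -/
theorem Respects.rnL {θ₁ θ₂ : ℕ → Msg} {h : Trace} (hr : h.Respects θ₁ θ₂) (hb : h.IsBiTrace) :
    (h.subst θ₁ θ₂).rnL ⊆ h.rnL := by
  induction h using Trace.ind with
  | nil => simp
  | cons m M N h ih =>
    have key (M : Msg) (hM : ∀ x ∈ M.fn, (θ₁ x).rn ⊆ h.rnL) :
        (M.subst θ₁).rn ⊆ M.rn ∪ h.rnL := by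
      intro a ha
      rw [Msg.subst_eq, Msg.mem_rn_bs] at ha
      rcases ha with ⟨x, hx, h'⟩ | ⟨b, hb, h'⟩
      · exact .inr (hM x hx h')
      · cases h'; exact .inl hb
    have key' {x : ℕ} (hb : h.IsBiTrace) (hr : h.Respects θ₁ θ₂)
        (hx : Eqv (h.subst θ₁ θ₂).theory (θ₁ x) (θ₂ x)) : (θ₁ x).rn ⊆ h.rnL := by
      intro a ha
      obtain ⟨_, ⟨e, he, rfl⟩, h'⟩ := hx.rn_left ha
      exact ih hr hb ⟨e, he, h'⟩
    rcases m with _ | _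
    · rw [subst_cons, rnL_cons, rnL_cons]
      exact Set.union_subset (key M fun x hx => key' hb hr.2 (hr.1 x (.inl hx)))
        ((ih hr.2 hb).trans Set.subset_union_right)
    · rw [subst_cons, rnL_cons, rnL_cons]
      refine Set.union_subset (key M fun x hx => key' hb.2 hr ?_)
        ((ih hr hb.2).trans Set.subset_union_right)
      exact Respects.fn (h := h) hr hb.2 (hb.1 (.inl hx))

theorem Respects.rnR {θ₁ θ₂ : ℕ → Msg} {h : Trace} (hr : h.Respects θ₁ θ₂) (hb : h.IsBiTrace) :
    (h.subst θ₁ θ₂).rnR ⊆ h.rnR := by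
  rw [← rnL_inverse, ← rnL_inverse, inverse_subst]
  exact hr.inverse.rnL (isBiTrace_inverse hb)

theorem Consistent.exists_eqv {h : Trace} (hc : h.Consistent) {M : Msg} (hM : Syn h.fst M) :
    ∃ N, Eqv h.theory M N :=
  hc.theory.exists_eqv hM

end Trace

/-! Permutation of rigid names. -/

def Msg.ren (f : Equiv.Perm ℕ) (M : Msg) : Msg := M.bs Msg.nm fun a => Msg.rg (f a)

def Proc.ren (f : Equiv.Perm ℕ) (P : Proc) : Proc := P.bs Msg.nm fun a => Msg.rg (f a)

def Act.ren (f : Equiv.Perm ℕ) (α : Act) : Act := α.bs Msg.nm fun a => Msg.rg (f a)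

def Agent.ren (f : Equiv.Perm ℕ) (A : Agent) : Agent := A.bs Msg.nm fun a => Msg.rg (f a)

/-- The permutations of the two sides are independent: an occurrence of a rigid name on the left has
nothing to do with one of the same rigid name on the right. -/
def Trace.ren (f₁ f₂ : Equiv.Perm ℕ) (h : Trace) : Trace :=
  h.bs Msg.nm (fun a => Msg.rg (f₁ a)) Msg.nm fun a => Msg.rg (f₂ a)

theorem liftR_rg_comp (f : ℕ → ℕ) : (liftR fun a => Msg.rg (f a)) = fun a => Msg.rg (f a) := rfl

theorem lift_nm_iterate (k : ℕ) : lift^[k] Msg.nm = Msg.nm := by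
  induction k with
  | zero => rfl
  | succ k ih => rw [Function.iterate_succ_apply, lift_nm, ih]

theorem liftR_rg_iterate (f : ℕ → ℕ) (k : ℕ) :
    (liftR^[k] fun a => Msg.rg (f a)) = fun a => Msg.rg (f a) := by
  induction k with
  | zero => rfl
  | succ k ih => rw [Function.iterate_succ_apply, liftR_rg_comp, ih]

theorem Msg.ren_ren_symm (f : Equiv.Perm ℕ) (M : Msg) : (M.ren f).ren f.symm = M := by
  simp only [ren, bs_bs, bs, Equiv.symm_apply_apply]; exact M.bs_id

theorem Proc.ren_ren_symm (f : Equiv.Perm ℕ) (P : Proc) : (P.ren f).ren f.symm = P := by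
  simp only [ren, bs_bs, Msg.bs, Equiv.symm_apply_apply]; exact P.bs_id

theorem Msg.ren_symm_ren (f : Equiv.Perm ℕ) (M : Msg) : (M.ren f.symm).ren f = M :=
  M.ren_ren_symm f.symm

theorem Proc.ren_symm_ren (f : Equiv.Perm ℕ) (P : Proc) : (P.ren f.symm).ren f = P :=
  P.ren_ren_symm f.symm

theorem Trace.ren_ren_symm (f₁ f₂ : Equiv.Perm ℕ) (h : Trace) :
    (h.ren f₁ f₂).ren f₁.symm f₂.symm = h := by
  simp only [ren, bs_bs, Msg.bs, Equiv.symm_apply_apply]; exact h.bs_id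

/-- Moving a permutation across a substitution conjugates the values of the substitution. -/
theorem Msg.ren_subst (f : Equiv.Perm ℕ) (θ : ℕ → Msg) (M : Msg) :
    (M.ren f).subst θ = (M.subst fun x => (θ x).ren f.symm).ren f := by
  rw [subst_eq, subst_eq]
  change (M.bs _ _).bs _ _ = (M.bs _ _).bs _ _
  rw [bs_bs, bs_bs]
  refine M.bs_congr (fun x _ => ?_) fun _ _ => rfl
  exact ((θ x).ren_symm_ren f).symm

theorem Proc.ren_subst (f : Equiv.Perm ℕ) (θ : ℕ → Msg) (P : Proc) :
    (P.ren f).subst θ = (P.subst fun x => (θ x).ren f.symm).ren f := by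
  simp only [ren, subst_eq, bs_bs, Msg.bs]
  refine P.bs_congr (fun x _ => ?_) fun _ _ => rfl
  exact ((θ x).ren_symm_ren f).symm

theorem Trace.ren_subst (f₁ f₂ : Equiv.Perm ℕ) (θ₁ θ₂ : ℕ → Msg) (h : Trace) :
    (h.ren f₁ f₂).subst θ₁ θ₂ =
      (h.subst (fun x => (θ₁ x).ren f₁.symm) fun x => (θ₂ x).ren f₂.symm).ren f₁ f₂ := by
  simp only [ren, subst_eq, bs_bs, Msg.bs]
  refine h.bs_congr (fun x _ => ?_) (fun _ _ => rfl) (fun x _ => ?_) fun _ _ => rfl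
  · exact ((θ₁ x).ren_symm_ren f₁).symm
  · exact ((θ₂ x).ren_symm_ren f₂).symm

theorem Proc.inst_ren (f : Equiv.Perm ℕ) (x : ℕ) (P : Proc) :
    (P.subst (inst (Msg.nm x))).ren f = (P.ren f).subst (inst (Msg.nm x)) := by
  simp only [ren, subst_eq, bs_bs, Msg.bs]
  refine P.bs_congr (fun x _ => ?_) fun _ _ => rfl
  cases x <;> rfl

theorem instRigid_ren (f : Equiv.Perm ℕ) {k : ℕ} (c : Fin k → ℕ) (i : ℕ) :
    (instRigid c i).ren f = instRigid (fun j => f (c j)) i := by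
  simp only [instRigid]
  split_ifs <;> rfl

theorem Msg.instRigid_ren (f : Equiv.Perm ℕ) {k : ℕ} (c : Fin k → ℕ) (M : Msg) :
    (M.subst (instRigid c)).ren f = (M.ren f).subst (instRigid fun j => f (c j)) := by
  simp only [ren, subst_eq, bs_bs, Msg.bs]
  exact M.bs_congr (fun x _ => Spi.instRigid_ren f c x) fun _ _ => rfl

theorem Proc.instRigid_ren (f : Equiv.Perm ℕ) {k : ℕ} (c : Fin k → ℕ) (P : Proc) :
    (P.subst (instRigid c)).ren f = (P.ren f).subst (instRigid fun j => f (c j)) := by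
  simp only [ren, subst_eq, bs_bs, Msg.bs]
  exact P.bs_congr (fun x _ => Spi.instRigid_ren f c x) fun _ _ => rfl

theorem Msg.ren_eq_self {f : Equiv.Perm ℕ} {M : Msg} (h : ∀ a ∈ M.rn, f a = a) : M.ren f = M := by
  conv_rhs => rw [← M.bs_id]
  exact M.bs_congr (fun _ _ => rfl) fun a ha => by rw [h a ha]

theorem Proc.ren_eq_self {f : Equiv.Perm ℕ} {P : Proc} (h : ∀ a ∈ P.rn, f a = a) :
    P.ren f = P := by
  conv_rhs => rw [← P.bs_id]
  exact P.bs_congr (fun _ _ => rfl) fun a ha => by rw [h a ha]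

theorem Trace.ren_eq_self {f₁ f₂ : Equiv.Perm ℕ} {h : Trace} (h₁ : ∀ a ∈ h.rnL, f₁ a = a)
    (h₂ : ∀ a ∈ h.rnR, f₂ a = a) : h.ren f₁ f₂ = h := by
  conv_rhs => rw [← h.bs_id]
  exact h.bs_congr (fun _ _ => rfl) (fun a ha => by rw [h₁ a ha]) (fun _ _ => rfl)
    fun a ha => by rw [h₂ a ha]

theorem Msg.fn_ren (f : Equiv.Perm ℕ) (M : Msg) : (M.ren f).fn = M.fn := by
  ext x; simp [ren, mem_fn_bs, fn]

theorem Proc.fn_ren (f : Equiv.Perm ℕ) (P : Proc) : (P.ren f).fn = P.fn := by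
  ext x; simp [ren, mem_fn_bs, Msg.fn]

theorem Msg.rn_ren (f : Equiv.Perm ℕ) (M : Msg) : (M.ren f).rn = f '' M.rn := by
  ext x; simp only [ren, mem_rn_bs, rn, Set.mem_image]; simp [eq_comm]

theorem Proc.rn_ren (f : Equiv.Perm ℕ) (P : Proc) : (P.ren f).rn = f '' P.rn := by
  ext x; simp only [ren, mem_rn_bs, Msg.rn, Set.mem_image]; simp [eq_comm]

theorem Step.ren {P : Proc} {α : Act} {A : Agent} (h : Step P α A) (f : Equiv.Perm ℕ) :
    Step (P.ren f) (α.ren f) (A.ren f) := h.bs _ _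

theorem Step.of_ren {P : Proc} {α : Act} {A : Agent} {f : Equiv.Perm ℕ} (h : Step (P.ren f) α A) :
    Step P (α.ren f.symm) (A.ren f.symm) := by
  have := h.ren f.symm
  rwa [Proc.ren_ren_symm] at this

theorem Agent.ren_abs (f : Equiv.Perm ℕ) (P : Proc) : (Agent.abs P).ren f = .abs (P.ren f) := by
  simp only [ren, bs, lift_nm, liftR_rg_comp, Proc.ren]

theorem Agent.ren_conc (f : Equiv.Perm ℕ) (k : ℕ) (M : Msg) (P : Proc) :
    (Agent.conc k M P).ren f = .conc k (M.ren f) (P.ren f) := by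
  simp only [ren, bs, lift_nm_iterate, liftR_rg_iterate, Proc.ren, Msg.ren]

namespace Trace

@[simp] theorem ren_nil (f₁ f₂ : Equiv.Perm ℕ) : ren f₁ f₂ [] = [] := rfl

@[simp] theorem ren_cons (f₁ f₂ : Equiv.Perm ℕ) (m : Mark) (M N : Msg) (h : Trace) :
    ren f₁ f₂ ((m, M, N) :: h) = (m, M.ren f₁, N.ren f₂) :: ren f₁ f₂ h := rfl

theorem fn_ren (f₁ f₂ : Equiv.Perm ℕ) (h : Trace) : (h.ren f₁ f₂).fn = h.fn := by
  induction h using Trace.ind with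
  | nil => rfl
  | cons m M N h ih => simp only [ren_cons, fn_cons, Msg.fn_ren, ih]

theorem rnL_ren (f₁ f₂ : Equiv.Perm ℕ) (h : Trace) : (h.ren f₁ f₂).rnL = f₁ '' h.rnL := by
  induction h using Trace.ind with
  | nil => simp
  | cons m M N h ih => simp only [ren_cons, rnL_cons, Msg.rn_ren, ih, Set.image_union]

theorem inverse_ren (f₁ f₂ : Equiv.Perm ℕ) (h : Trace) :
    (h.ren f₁ f₂).inverse = h.inverse.ren f₂ f₁ := by
  simp [ren, bs, inverse]

theorem rnR_ren (f₁ f₂ : Equiv.Perm ℕ) (h : Trace) : (h.ren f₁ f₂).rnR = f₂ '' h.rnR := by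
  rw [← rnL_inverse, inverse_ren, rnL_ren, rnL_inverse]

end Trace

theorem Eqv.ren {h : Trace} {M N : Msg} (he : Eqv h.theory M N) (f₁ f₂ : Equiv.Perm ℕ) :
    Eqv (h.ren f₁ f₂).theory (M.ren f₁) (N.ren f₂) :=
  he.bs (fun x => .var x) fun _ hp => .id (Trace.mem_theory_bs hp)

theorem Eqv.of_ren {h : Trace} {M N : Msg} {f₁ f₂ : Equiv.Perm ℕ}
    (he : Eqv (h.ren f₁ f₂).theory M N) : Eqv h.theory (M.ren f₁.symm) (N.ren f₂.symm) := by
  have := he.ren f₁.symm f₂.symm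
  rwa [Trace.ren_ren_symm] at this

theorem Syn.ren {h : Trace} {M : Msg} (he : Syn h.fst M) (f₁ f₂ : Equiv.Perm ℕ) :
    Syn (h.ren f₁ f₂).fst (M.ren f₁) := by
  refine he.bs (fun x => .var x) ?_
  rintro _ ⟨p, hp, rfl⟩
  exact .id ⟨_, Trace.mem_theory_bs hp, rfl⟩

theorem Syn.of_ren {h : Trace} {M : Msg} {f₁ f₂ : Equiv.Perm ℕ} (he : Syn (h.ren f₁ f₂).fst M) :
    Syn h.fst (M.ren f₁.symm) := by
  have := he.ren f₁.symm f₂.symm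
  rwa [Trace.ren_ren_symm] at this

namespace Trace

theorem theory_ren_consistent {h : Trace} (hc : ConsistentTheory h.theory)
    (f₁ f₂ : Equiv.Perm ℕ) : ConsistentTheory (h.ren f₁ f₂).theory := by
  refine hc.transport (φ₁ := Msg.nm) (r₁ := fun a => Msg.rg (f₁.symm a)) (φ₂ := Msg.nm)
    (r₂ := fun a => Msg.rg (f₂.symm a)) (γ₁ := Msg.nm) (s₁ := fun a => Msg.rg (f₁ a))
    (γ₂ := Msg.nm) (s₂ := fun a => Msg.rg (f₂ a)) ?_ (fun x => .var x) ?_ (fun x => .var x)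
    (fun _ => rfl) (fun a => by simp [Msg.bs]) (fun _ => rfl) (fun a => by simp [Msg.bs])
    (fun _ => trivial) (fun _ _ => trivial)
  · exact fun p hp => (Eqv.id (M := p.1) (N := p.2) hp).of_ren
  · exact fun p hp => (Eqv.id (M := p.1) (N := p.2) hp).ren _ _

theorem Respects.of_ren {h : Trace} {f₁ f₂ : Equiv.Perm ℕ} {θ₁ θ₂ : ℕ → Msg}
    (hr : (h.ren f₁ f₂).Respects θ₁ θ₂) :
    h.Respects (fun x => (θ₁ x).ren f₁.symm) (fun x => (θ₂ x).ren f₂.symm) := by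
  induction h using Trace.ind with
  | nil => trivial
  | cons m M N h ih =>
    rcases m with _ | _
    · refine ⟨fun x hx => ?_, ih hr.2⟩
      rw [← Msg.fn_ren f₁, ← Msg.fn_ren f₂ N] at hx
      have : Eqv ((h.ren f₁ f₂).subst θ₁ θ₂).theory (θ₁ x) (θ₂ x) := hr.1 x hx
      rw [ren_subst] at this
      exact this.of_ren
    · exact ih hr

theorem Consistent.ren {h : Trace} (hc : h.Consistent) (f₁ f₂ : Equiv.Perm ℕ) :
    (h.ren f₁ f₂).Consistent := by
  induction h using Trace.ind with
  | nil => exact hc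
  | cons m M N h ih =>
    rcases m with _ | _
    · obtain ⟨hc, he⟩ := consistent_i.1 hc
      rw [ren_cons]
      exact consistent_i.2 ⟨ih hc, he.ren f₁ f₂⟩
    · obtain ⟨hb, hc, H⟩ := consistent_o.1 hc
      rw [ren_cons]
      refine consistent_o.2 ⟨by rwa [Msg.fn_ren, Msg.fn_ren, fn_ren], ih hc, fun θ₁ θ₂ hr => ?_⟩
      rw [ren_subst, Msg.ren_subst, Msg.ren_subst, ← theory_cons Mark.o, ← ren_cons]
      refine theory_ren_consistent ?_ f₁ f₂
      rw [theory_cons]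
      exact H _ _ hr.of_ren

end Trace

/-- This makes the particular choice of fresh rigid names immaterial. A permutation for the initial
segments is followed by a transposition that corrects the last entry. -/
theorem exists_perm {k : ℕ} (c d : Fin k → ℕ) (hc : Function.Injective c)
    (hd : Function.Injective d) :
    ∃ f : Equiv.Perm ℕ, (∀ i, f (c i) = d i) ∧
      ∀ a, a ∉ Set.range c → a ∉ Set.range d → f a = a := by
  induction k with
  | zero => exact ⟨1, fun i => i.elim0, fun _ _ _ => rfl⟩
  | succ k ih =>
    obtain ⟨f, hf, hf'⟩ := ih (c ∘ Fin.castSucc) (d ∘ Fin.castSucc)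
      (hc.comp (Fin.castSucc_injective k)) (hd.comp (Fin.castSucc_injective k))
    refine ⟨f.trans (Equiv.swap (f (c (Fin.last k))) (d (Fin.last k))), fun i => ?_,
      fun a ha ha' => ?_⟩
    · refine Fin.lastCases ?_ (fun i => ?_) i
      · simp
      · have h₁ := hf i
        simp only [Function.comp] at h₁
        rw [Equiv.trans_apply, h₁, Equiv.swap_apply_of_ne_of_ne]
        · rw [← h₁]
          intro h
          exact (Fin.castSucc_lt_last i).ne (hc (f.injective h))
        · intro h
          exact (Fin.castSucc_lt_last i).ne (hd h)
    · have h₁ : f a = a := hf' a (fun ⟨i, hi⟩ => ha ⟨_, hi⟩) (fun ⟨i, hi⟩ => ha' ⟨_, hi⟩)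
      rw [Equiv.trans_apply, h₁, Equiv.swap_apply_of_ne_of_ne]
      · intro h
        rw [← h₁] at h
        exact ha ⟨_, (f.injective h).symm⟩
      · intro h
        exact ha' ⟨_, h.symm⟩

theorem exists_fresh_rigid {S : Set ℕ} (hS : S.Finite) (k : ℕ) :
    ∃ c : Fin k → ℕ, Function.Injective c ∧ Disjoint (Set.range c) S := by
  obtain ⟨n, hn⟩ := hS.bddAbove
  refine ⟨fun i => n + 1 + i, fun i j h => Fin.ext (by simpa using h), ?_⟩
  rw [Set.disjoint_left]
  rintro _ ⟨i, rfl⟩ h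
  have : n + 1 + i ≤ n := hn h
  omega

theorem Proc.subst_congr {θ θ' : ℕ → Msg} {P : Proc} (h : ∀ x ∈ P.fn, θ x = θ' x) :
    P.subst θ = P.subst θ' := by
  rw [subst_eq, subst_eq]; exact P.bs_congr h fun _ _ => rfl

theorem Msg.subst_congr {θ θ' : ℕ → Msg} {M : Msg} (h : ∀ x ∈ M.fn, θ x = θ' x) :
    M.subst θ = M.subst θ' := by
  rw [subst_eq, subst_eq]; exact M.bs_congr h fun _ _ => rfl

theorem Proc.subst_subst (θ θ' : ℕ → Msg) (P : Proc) :
    (P.subst θ).subst θ' = P.subst fun x => (θ x).subst θ' := by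
  simp only [subst_eq, bs_bs, Msg.subst_eq]; rfl

theorem Msg.subst_subst (θ θ' : ℕ → Msg) (P : Msg) :
    (P.subst θ).subst θ' = P.subst fun x => (θ x).subst θ' := by
  simp only [subst_eq, bs_bs]; rfl

theorem Proc.subst_nm (P : Proc) : P.subst Msg.nm = P := by rw [subst_eq, bs_id]

theorem Trace.Consistent.proc_fn_subst {h : Trace} (hc : h.Consistent) {θ₁ θ₂ : ℕ → Msg}
    {P Q : Proc} (hP : P.fn ∪ Q.fn ⊆ h.fn) :
    (P.subst θ₁).fn ∪ (Q.subst θ₂).fn ⊆ (h.subst θ₁ θ₂).fn := by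
  rintro y (hy | hy) <;> rw [Proc.subst_eq, Proc.mem_fn_bs] at hy
  · rcases hy with ⟨x, hx, hy⟩ | ⟨a, -, hy⟩
    · exact hc.fn_subst (hP (.inl hx)) (.inl hy)
    · simp [Msg.fn] at hy
  · rcases hy with ⟨x, hx, hy⟩ | ⟨a, -, hy⟩
    · exact hc.fn_subst (hP (.inr hx)) (.inr hy)
    · simp [Msg.fn] at hy

/-! ### Bisimulations with arbitrary fresh rigid names -/

/-- Bisimulations closed under respectful substitutions, whose output clause allows all choices
of fresh rigid names. -/
structure Bisim (R : Trace → Proc → Proc → Prop) : Prop where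
  fn : ∀ {h P Q}, R h P Q → P.fn ∪ Q.fn ⊆ h.fn
  consistent : ∀ {h P Q}, R h P Q → h.Consistent
  symm : ∀ {h P Q}, R h P Q → R h.inverse Q P
  subst : ∀ {h P Q θ₁ θ₂}, R h P Q → h.Respects θ₁ θ₂ →
    R (h.subst θ₁ θ₂) (P.subst θ₁) (Q.subst θ₂)
  tau : ∀ {h P Q P'}, R h P Q → Step P Act.tau (Agent.proc P') →
    ∃ Q', Step Q Act.tau (Agent.proc Q') ∧ R h P' Q'
  inp : ∀ {h P Q M P' x}, R h P Q → Step P (Act.inp M) (Agent.abs P') → Syn h.fst M →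
    x ∉ h.fn → ∃ N Q', Step Q (Act.inp N) (Agent.abs Q') ∧
      R ((Mark.i, Msg.nm x, Msg.nm x) :: (Mark.i, M, N) :: h)
        (P'.subst (inst (Msg.nm x))) (Q'.subst (inst (Msg.nm x)))
  out : ∀ {h P Q M k M' P'}, R h P Q → Step P (Act.out M) (Agent.conc k M' P') → Syn h.fst M →
    ∃ N l N' Q', Step Q (Act.out N) (Agent.conc l N' Q') ∧
      ∀ (c : Fin k → ℕ) (d : Fin l → ℕ), Function.Injective c → Function.Injective d →
        Disjoint (Set.range c) (h.rnL ∪ P.rn) → Disjoint (Set.range d) (h.rnR ∪ Q.rn) →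
        R ((Mark.o, M'.subst (instRigid c), N'.subst (instRigid d)) :: (Mark.i, M, N) :: h)
          (P'.subst (instRigid c)) (Q'.subst (instRigid d))

theorem Bisim.isOpenBisimulation {R : Trace → Proc → Proc → Prop} (hR : Bisim R) :
    IsOpenBisimulation R where
  traced h P Q hh := ⟨(hR.consistent hh).isBiTrace, hR.fn hh⟩
  consistent h P Q hh := hR.consistent hh
  symm h P Q hh := hR.symm hh
  tau h P Q hh θ₁ θ₂ _ _ hr P' hs := hR.tau (hR.subst hh hr) hs
  inp h P Q hh θ₁ θ₂ _ _ hr M P' hs hM x hx := hR.inp (hR.subst hh hr) hs hM hx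
  out h P Q hh θ₁ θ₂ _ _ hr M k M' P' hs hM := by
    obtain ⟨N, l, N', Q', hs', H⟩ := hR.out (hR.subst hh hr) hs hM
    have hfin : ((h.subst θ₁ θ₂).rn ∪ (P.subst θ₁).rn ∪ (Q.subst θ₂).rn).Finite := by
      rw [Trace.rn_eq]
      exact (((Trace.rnL_finite _).union (Trace.rnR_finite _)).union (Proc.rn_finite _)).union
        (Proc.rn_finite _)
    obtain ⟨c, hc, hc'⟩ := exists_fresh_rigid hfin k
    obtain ⟨d, hd, hd'⟩ := exists_fresh_rigid hfin l
    refine ⟨N, l, N', Q', hs', c, d, hc, hd, Set.disjoint_union_left.2 ⟨hc', hd'⟩,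
      H c d hc hd (hc'.mono_right ?_) (hd'.mono_right ?_)⟩
    · rw [Trace.rn_eq]
      rintro x (hx | hx)
      exacts [.inl (.inl (.inl hx)), .inl (.inr hx)]
    · rw [Trace.rn_eq]
      rintro x (hx | hx)
      exacts [.inl (.inl (.inr hx)), .inr hx]

theorem Bisim.le {R : Trace → Proc → Proc → Prop} (hR : Bisim R) {h : Trace} {P Q : Proc}
    (hh : R h P Q) : OpenBisimilarAt h P Q :=
  ⟨R, hR.isOpenBisimulation, hh⟩

/-- The closure of a relation under respectful substitutions and permutations of rigid names. -/
def RenClosure (R : Trace → Proc → Proc → Prop) (h : Trace) (P Q : Proc) : Prop :=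
  ∃ h₀ P₀ Q₀ θ₁ θ₂ f₁ f₂, R h₀ P₀ Q₀ ∧ h₀.Respects θ₁ θ₂ ∧ h = (h₀.subst θ₁ θ₂).ren f₁ f₂ ∧
    P = (P₀.subst θ₁).ren f₁ ∧ Q = (Q₀.subst θ₂).ren f₂

theorem RenClosure.of {R : Trace → Proc → Proc → Prop} {h : Trace} {P Q : Proc} (H : R h P Q)
    (f₁ f₂ : Equiv.Perm ℕ) : RenClosure R (h.ren f₁ f₂) (P.ren f₁) (Q.ren f₂) :=
  ⟨h, P, Q, Msg.nm, Msg.nm, f₁, f₂, H, h.respects_nm, by rw [Trace.subst_nm],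
    by rw [Proc.subst_nm], by rw [Proc.subst_nm]⟩

theorem Act.ren_inp (f : Equiv.Perm ℕ) (M : Msg) : (Act.inp M).ren f = .inp (M.ren f) := rfl

theorem Act.ren_out (f : Equiv.Perm ℕ) (M : Msg) : (Act.out M).ren f = .out (M.ren f) := rfl

theorem Msg.ren_trans (f g : Equiv.Perm ℕ) (M : Msg) : M.ren (f.trans g) = (M.ren f).ren g := by
  simp only [ren, bs_bs, bs]; rfl

theorem Proc.ren_trans (f g : Equiv.Perm ℕ) (P : Proc) : P.ren (f.trans g) = (P.ren f).ren g := by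
  simp only [ren, bs_bs, Msg.bs]; rfl

theorem Trace.ren_trans (f₁ g₁ f₂ g₂ : Equiv.Perm ℕ) (h : Trace) :
    h.ren (f₁.trans g₁) (f₂.trans g₂) = (h.ren f₁ f₂).ren g₁ g₂ := by
  simp only [ren, bs_bs, Msg.bs]; rfl

/-- Open bisimulations answer only to substitutions of finite domain. Cutting down to the names of
the trace changes nothing, as the processes have no other names. -/
theorem RenClosure.isSubst {R : Trace → Proc → Proc → Prop} (hR : IsOpenBisimulation R)
    {h : Trace} {P Q : Proc} (H : RenClosure R h P Q) :
    ∃ h₀ P₀ Q₀ θ₁ θ₂ f₁ f₂, R h₀ P₀ Q₀ ∧ IsSubst θ₁ ∧ IsSubst θ₂ ∧ h₀.Respects θ₁ θ₂ ∧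
      h = (h₀.subst θ₁ θ₂).ren f₁ f₂ ∧ P = (P₀.subst θ₁).ren f₁ ∧ Q = (Q₀.subst θ₂).ren f₂ := by
  obtain ⟨h₀, P₀, Q₀, φ₁, φ₂, f₁, f₂, H, hφ, rfl, rfl, rfl⟩ := H
  have ht := (hR.traced _ _ _ H).2
  refine ⟨h₀, P₀, Q₀, _, _, f₁, f₂, H, Trace.isSubst_cutTo h₀.fn_finite _,
    Trace.isSubst_cutTo h₀.fn_finite _, hφ.cutTo, ?_, ?_, ?_⟩
  · rw [Trace.subst_cutTo]
  · rw [Proc.subst_congr fun x hx => Trace.cutTo_of_mem (ht (.inl hx))]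
  · rw [Proc.subst_congr fun x hx => Trace.cutTo_of_mem (ht (.inr hx))]

/-- The names `c` are fresh before the permutation `f`, the names `c'` after it. Pulled back along
`f`, both avoid `S`, so the correcting permutation `g` fixes everything already in use. -/
theorem instRigid_fresh {k : ℕ} {c c' : Fin k → ℕ} {f g : Equiv.Perm ℕ} {S : Set ℕ}
    (hg : ∀ a, a ∉ Set.range c → a ∉ Set.range (fun i => f.symm (c' i)) → g a = a)
    (hc : Disjoint (Set.range c) S) (hc' : Disjoint (Set.range c') (f '' S)) :
    ∀ a ∈ S, g a = a := by
  intro a ha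
  refine hg a (fun h => Set.disjoint_left.1 hc h ha) ?_
  rintro ⟨i, rfl⟩
  exact Set.disjoint_left.1 hc' ⟨i, rfl⟩ ⟨_, ha, by simp⟩

theorem Msg.instRigid_ren_trans {k : ℕ} {c c' : Fin k → ℕ} {f g : Equiv.Perm ℕ}
    (hg : ∀ i, g (c i) = f.symm (c' i)) {M : Msg} (hM : ∀ a ∈ M.rn, g a = a) :
    (M.subst (instRigid c)).ren (g.trans f) = (M.ren f).subst (instRigid c') := by
  rw [ren_trans, instRigid_ren, ren_eq_self hM, instRigid_ren]
  simp only [hg, Equiv.apply_symm_apply]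

theorem Proc.instRigid_ren_trans {k : ℕ} {c c' : Fin k → ℕ} {f g : Equiv.Perm ℕ}
    (hg : ∀ i, g (c i) = f.symm (c' i)) {P : Proc} (hP : ∀ a ∈ P.rn, g a = a) :
    (P.subst (instRigid c)).ren (g.trans f) = (P.ren f).subst (instRigid c') := by
  rw [ren_trans, instRigid_ren, ren_eq_self hP, instRigid_ren]
  simp only [hg, Equiv.apply_symm_apply]

/-- The point is the output clause. An open bisimulation answers with some fresh rigid names,
whereas `Bisim` prescribes them; a further permutation that fixes everything already present turns
the former into the latter. -/
theorem RenClosure.bisim {R : Trace → Proc → Proc → Prop}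
    (hR : IsOpenBisimulation R) : Bisim (RenClosure R) := by
  have hcons : ∀ h P Q, RenClosure R h P Q → h.Consistent := by
    rintro _ _ _ ⟨h, P, Q, θ₁, θ₂, f₁, f₂, H, hr, rfl, rfl, rfl⟩
    exact ((hR.consistent _ _ _ H).subst hr).ren f₁ f₂
  constructor
  · rintro _ _ _ ⟨h, P, Q, θ₁, θ₂, f₁, f₂, H, hr, rfl, rfl, rfl⟩
    rw [Proc.fn_ren, Proc.fn_ren, Trace.fn_ren]
    exact (hR.consistent _ _ _ H).proc_fn_subst (hR.traced _ _ _ H).2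
  · exact fun H => hcons _ _ _ H
  · rintro _ _ _ ⟨h, P, Q, θ₁, θ₂, f₁, f₂, H, hr, rfl, rfl, rfl⟩
    exact ⟨_, _, _, θ₂, θ₁, f₂, f₁, hR.symm _ _ _ H, hr.inverse,
      by rw [Trace.inverse_ren, Trace.inverse_subst], rfl, rfl⟩
  · rintro _ _ _ θ₁ θ₂ ⟨h₀, P₀, Q₀, φ₁, φ₂, f₁, f₂, H, hφ, rfl, rfl, rfl⟩ hr
    exact ⟨h₀, P₀, Q₀, _, _, f₁, f₂, H, hφ.comp (hR.consistent _ _ _ H) hr.of_ren,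
      by rw [Trace.ren_subst, Trace.subst_subst], by rw [Proc.ren_subst, Proc.subst_subst],
      by rw [Proc.ren_subst, Proc.subst_subst]⟩
  · intro h P Q P' H hs
    obtain ⟨h₀, P₀, Q₀, φ₁, φ₂, f₁, f₂, H₀, i₁, i₂, hφ, rfl, rfl, rfl⟩ := H.isSubst hR
    obtain ⟨Q', hs', H'⟩ := hR.tau _ _ _ H₀ _ _ i₁ i₂ hφ _ hs.of_ren
    refine ⟨Q'.ren f₂, hs'.ren f₂, ?_⟩
    have := RenClosure.of H' f₁ f₂
    rwa [← Proc.ren, Proc.ren_symm_ren] at this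
  · intro h P Q M P' x H hs hM hx
    obtain ⟨h₀, P₀, Q₀, φ₁, φ₂, f₁, f₂, H₀, i₁, i₂, hφ, rfl, rfl, rfl⟩ := H.isSubst hR
    rw [Trace.fn_ren] at hx
    have hs := hs.of_ren
    rw [Agent.ren_abs, Act.ren_inp] at hs
    obtain ⟨N, Q', hs', H'⟩ := hR.inp _ _ _ H₀ _ _ i₁ i₂ hφ _ _ hs hM.of_ren x hx
    refine ⟨N.ren f₂, Q'.ren f₂, by simpa only [Agent.ren_abs, Act.ren_inp] using hs'.ren f₂, ?_⟩
    have := RenClosure.of H' f₁ f₂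
    rw [Proc.inst_ren, Proc.inst_ren, Proc.ren_symm_ren, Trace.ren_cons, Trace.ren_cons,
      Msg.ren_symm_ren] at this
    exact this
  · intro h P Q M k M' P' H hs hM
    obtain ⟨h₀, P₀, Q₀, φ₁, φ₂, f₁, f₂, H₀, i₁, i₂, hφ, rfl, rfl, rfl⟩ := H.isSubst hR
    have hs := hs.of_ren
    rw [Agent.ren_conc, Act.ren_out] at hs
    obtain ⟨N, l, N', Q', hs', c, d, hc, hd, hdis, H'⟩ :=
      hR.out _ _ _ H₀ _ _ i₁ i₂ hφ _ _ _ _ hs hM.of_ren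
    refine ⟨N.ren f₂, l, N'.ren f₂, Q'.ren f₂,
      by simpa only [Agent.ren_conc, Act.ren_out] using hs'.ren f₂, ?_⟩
    intro c' d' hc' hd' hcd hdd
    -- The permutation `g₁` is applied before `f₁`, so it must send `c` to the preimage of `c'`
    -- under `f₁`.
    obtain ⟨g₁, hg₁, hg₁'⟩ := exists_perm c (fun i => f₁.symm (c' i)) hc
      (f₁.symm.injective.comp hc')
    obtain ⟨g₂, hg₂, hg₂'⟩ := exists_perm d (fun i => f₂.symm (d' i)) hd
      (f₂.symm.injective.comp hd')
    rw [Trace.rnL_ren, Proc.rn_ren, ← Set.image_union] at hcd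
    rw [Trace.rnR_ren, Proc.rn_ren, ← Set.image_union] at hdd
    rw [Set.disjoint_union_left, Trace.rn_eq] at hdis
    have k₁ := instRigid_fresh hg₁' (hdis.1.mono_right (by
      rintro x (hx | hx)
      exacts [.inl (.inl (.inl hx)), .inl (.inr hx)])) hcd
    have k₂ := instRigid_fresh hg₂' (hdis.2.mono_right (by
      rintro x (hx | hx)
      exacts [.inl (.inl (.inr hx)), .inr hx])) hdd
    have := RenClosure.of H' (g₁.trans f₁) (g₂.trans f₂)
    rw [Trace.ren_cons, Trace.ren_cons,
      Msg.instRigid_ren_trans hg₁ fun a ha => k₁ a (.inr (hs.rn.2 (.inl ha))),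
      Msg.instRigid_ren_trans hg₂ fun a ha => k₂ a (.inr (hs'.rn.2 (.inl ha))),
      Proc.instRigid_ren_trans hg₁ fun a ha => k₁ a (.inr (hs.rn.2 (.inr ha))),
      Proc.instRigid_ren_trans hg₂ fun a ha => k₂ a (.inr (hs'.rn.2 (.inr ha))),
      Trace.ren_trans, Trace.ren_eq_self (fun a ha => k₁ a (.inl ha)) fun a ha => k₂ a (.inl ha),
      Msg.ren_trans, Msg.ren_trans, Msg.ren_eq_self fun a ha => k₁ a (.inr (hs.rn.1 ha)),
      Msg.ren_eq_self fun a ha => k₂ a (.inr (hs'.rn.1 ha)), Msg.ren_symm_ren, Msg.ren_symm_ren,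
      Proc.ren_symm_ren] at this
    exact this

theorem openBisimilarAt_isOpenBisimulation : IsOpenBisimulation OpenBisimilarAt where
  traced := fun h P Q ⟨_, hR, H⟩ => hR.traced _ _ _ H
  consistent := fun h P Q ⟨_, hR, H⟩ => hR.consistent _ _ _ H
  symm := fun h P Q ⟨R, hR, H⟩ => ⟨R, hR, hR.symm _ _ _ H⟩
  tau := by
    rintro h P Q ⟨R, hR, H⟩ θ₁ θ₂ i₁ i₂ hr P' hs
    obtain ⟨Q', hs', H'⟩ := hR.tau _ _ _ H _ _ i₁ i₂ hr _ hs
    exact ⟨Q', hs', R, hR, H'⟩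
  inp := by
    rintro h P Q ⟨R, hR, H⟩ θ₁ θ₂ i₁ i₂ hr M P' hs hM x hx
    obtain ⟨N, Q', hs', H'⟩ := hR.inp _ _ _ H _ _ i₁ i₂ hr _ _ hs hM x hx
    exact ⟨N, Q', hs', R, hR, H'⟩
  out := by
    rintro h P Q ⟨R, hR, H⟩ θ₁ θ₂ i₁ i₂ hr M k M' P' hs hM
    obtain ⟨N, l, N', Q', hs', c, d, hc, hd, hdis, H'⟩ := hR.out _ _ _ H _ _ i₁ i₂ hr _ _ _ _ hs hM
    exact ⟨N, l, N', Q', hs', c, d, hc, hd, hdis, R, hR, H'⟩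

theorem OpenBisimilarAt.ren {h : Trace} {P Q : Proc} (H : OpenBisimilarAt h P Q)
    (f₁ f₂ : Equiv.Perm ℕ) : OpenBisimilarAt (h.ren f₁ f₂) (P.ren f₁) (Q.ren f₂) :=
  (RenClosure.bisim openBisimilarAt_isOpenBisimulation).le (.of H f₁ f₂)

/-- Bisimilarity is the largest open bisimulation, so it contains its own closure and inherits the
properties of that closure. -/
theorem openBisimilarAt_bisim : Bisim OpenBisimilarAt := by
  have hB := RenClosure.bisim openBisimilarAt_isOpenBisimulation
  have : RenClosure OpenBisimilarAt = OpenBisimilarAt := by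
    funext h P Q
    refine propext ⟨fun H => hB.le H, fun H => ?_⟩
    have := RenClosure.of H (Equiv.refl ℕ) (Equiv.refl ℕ)
    rwa [Trace.ren_eq_self (fun _ _ => rfl) fun _ _ => rfl, Proc.ren_eq_self fun _ _ => rfl,
      Proc.ren_eq_self fun _ _ => rfl] at this
  rwa [this] at hB

/-- In a relation closed under permutations of rigid names, one choice of fresh rigid names in an
output clause yields all choices. -/
theorem out_all_of_exists {R : Trace → Proc → Proc → Prop}
    (hren : ∀ {h P Q} (f₁ f₂ : Equiv.Perm ℕ), R h P Q → R (h.ren f₁ f₂) (P.ren f₁) (Q.ren f₂))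
    {h : Trace} {P Q P' Q' : Proc} {M N M' N' : Msg} {k l : ℕ}
    (hP : Step P (Act.out M) (Agent.conc k M' P')) (hQ : Step Q (Act.out N) (Agent.conc l N' Q'))
    {c : Fin k → ℕ} {d : Fin l → ℕ} (hc : Function.Injective c) (hd : Function.Injective d)
    (hcf : Disjoint (Set.range c) (h.rnL ∪ P.rn)) (hdf : Disjoint (Set.range d) (h.rnR ∪ Q.rn))
    (H : R ((Mark.o, M'.subst (instRigid c), N'.subst (instRigid d)) :: (Mark.i, M, N) :: h)
      (P'.subst (instRigid c)) (Q'.subst (instRigid d)))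
    (c' : Fin k → ℕ) (d' : Fin l → ℕ) (hc' : Function.Injective c') (hd' : Function.Injective d')
    (hcf' : Disjoint (Set.range c') (h.rnL ∪ P.rn))
    (hdf' : Disjoint (Set.range d') (h.rnR ∪ Q.rn)) :
    R ((Mark.o, M'.subst (instRigid c'), N'.subst (instRigid d')) :: (Mark.i, M, N) :: h)
      (P'.subst (instRigid c')) (Q'.subst (instRigid d')) := by
  obtain ⟨f, hf, hf'⟩ := exists_perm c c' hc hc'
  obtain ⟨g, hg, hg'⟩ := exists_perm d d' hd hd'
  have k₁ : ∀ a ∈ h.rnL ∪ P.rn, f a = a := fun a ha =>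
    hf' a (fun h' => Set.disjoint_left.1 hcf h' ha) (fun h' => Set.disjoint_left.1 hcf' h' ha)
  have k₂ : ∀ a ∈ h.rnR ∪ Q.rn, g a = a := fun a ha =>
    hg' a (fun h' => Set.disjoint_left.1 hdf h' ha) (fun h' => Set.disjoint_left.1 hdf' h' ha)
  have := hren f g H
  rw [Trace.ren_cons, Trace.ren_cons, Msg.instRigid_ren, Msg.instRigid_ren, Proc.instRigid_ren,
    Proc.instRigid_ren, Trace.ren_eq_self (fun a ha => k₁ a (.inl ha)) fun a ha => k₂ a (.inl ha),
    Msg.ren_eq_self fun a ha => k₁ a (.inr (hP.rn.2 (.inl ha))),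
    Msg.ren_eq_self fun a ha => k₂ a (.inr (hQ.rn.2 (.inl ha))),
    Msg.ren_eq_self fun a ha => k₁ a (.inr (hP.rn.1 ha)),
    Msg.ren_eq_self fun a ha => k₂ a (.inr (hQ.rn.1 ha)),
    Proc.ren_eq_self fun a ha => k₁ a (.inr (hP.rn.2 (.inr ha))),
    Proc.ren_eq_self fun a ha => k₂ a (.inr (hQ.rn.2 (.inr ha)))] at this
  simpa only [hf, hg] using this

/-! ### Reducing the knowledge of the observer -/

theorem Trace.fn_ren_subset {h : Trace} {M N : Msg} (hM : M.fn ∪ N.fn ⊆ h.fn)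
    (f₁ f₂ : Equiv.Perm ℕ) : (M.ren f₁).fn ∪ (N.ren f₂).fn ⊆ (h.ren f₁ f₂).fn := by
  rwa [fn_ren, Msg.fn_ren, Msg.fn_ren]

/-- `Cov h h'`: the bi-trace `h'` provides at least the knowledge of `h`, at the same times. -/
inductive Cov : Trace → Trace → Prop
  | nil : Cov [] []
  | inp {h h' : Trace} {M N : Msg} : Cov h h' → Eqv h.theory M N →
      Cov ((Mark.i, M, N) :: h) ((Mark.i, M, N) :: h')
  | out {h h' : Trace} {M N : Msg} : Cov h h' → M.fn ∪ N.fn ⊆ h.fn →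
      Cov ((Mark.o, M, N) :: h) ((Mark.o, M, N) :: h')
  -- Redundant entries of `h` need no counterpart in `h'`. An input pair must be derivable from `h`,
  -- as consistency of `h` demands; for an output pair derivability from `h'` is enough, since `h`
  -- may learn it only now.
  | dropI {h h' : Trace} {M N : Msg} : Cov h h' → Eqv h.theory M N → Cov ((Mark.i, M, N) :: h) h'
  | dropO {h h' : Trace} {M N : Msg} : Cov h h' → Eqv h'.theory M N → M.fn ∪ N.fn ⊆ h.fn →
      Cov ((Mark.o, M, N) :: h) h'
  -- Knowledge may be hidden from `h` as long as it brings no new name: substitutions act at names,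
  -- and all of these have to be governed by `h`.
  | hide {h h' : Trace} {m : Mark} {M N : Msg} : Cov h h' → M.fn ∪ N.fn ⊆ h.fn →
      Cov h ((m, M, N) :: h')

namespace Cov

variable {h h' : Trace}

theorem fn (H : Cov h h') : h'.fn ⊆ h.fn := by
  induction H with
  | nil => exact subset_rfl
  | inp _ _ ih => rw [Trace.fn_cons, Trace.fn_cons]; exact Set.union_subset_union_right _ ih
  | out _ _ ih => rw [Trace.fn_cons, Trace.fn_cons]; exact Set.union_subset_union_right _ ih
  | dropI _ _ ih => rw [Trace.fn_cons]; exact ih.trans Set.subset_union_right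
  | dropO _ _ _ ih => rw [Trace.fn_cons]; exact ih.trans Set.subset_union_right
  | hide _ hM ih => rw [Trace.fn_cons]; exact Set.union_subset hM ih

theorem mem (H : Cov h h') : ∀ p ∈ h.theory, Eqv h'.theory p.1 p.2 := by
  induction H with
  | nil => simp
  | inp _ _ ih =>
    rw [Trace.theory_cons, Trace.theory_cons]
    rintro p (rfl | hp)
    exacts [.id (.inl rfl), (ih p hp).mono (Set.subset_insert _ _)]
  | out _ _ ih =>
    rw [Trace.theory_cons, Trace.theory_cons]
    rintro p (rfl | hp)
    exacts [.id (.inl rfl), (ih p hp).mono (Set.subset_insert _ _)]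
  | dropI _ he ih =>
    rw [Trace.theory_cons]
    rintro p (rfl | hp)
    exacts [he.cut ih, ih p hp]
  | dropO _ he _ ih =>
    rw [Trace.theory_cons]
    rintro p (rfl | hp)
    exacts [he, ih p hp]
  | hide _ _ ih =>
    rw [Trace.theory_cons]
    exact fun p hp => (ih p hp).mono (Set.subset_insert _ _)

theorem eqv (H : Cov h h') {M N : Msg} (he : Eqv h.theory M N) : Eqv h'.theory M N := he.cut H.mem

theorem syn (H : Cov h h') {M : Msg} (he : Syn h.fst M) : Syn h'.fst M := by
  refine he.cut ?_
  rintro _ ⟨p, hp, rfl⟩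
  exact (H.mem p hp).syn_left

theorem isBiTrace (H : Cov h h') : h.IsBiTrace := by
  induction H with
  | nil => trivial
  | inp _ _ ih => exact ih
  | out _ hM ih => exact ⟨hM, ih⟩
  | dropI _ _ ih => exact ih
  | dropO _ _ hM ih => exact ⟨hM, ih⟩
  | hide _ _ ih => exact ih

/-- Respecting the smaller knowledge is the stronger demand: what its instance derives, the instance
of `h'` derives too, and the names of hidden entries are already governed by `h`. -/
theorem respects (H : Cov h h') (hb : h'.IsBiTrace) {θ₁ θ₂ : ℕ → Msg} (hr : h.Respects θ₁ θ₂) :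
    h'.Respects θ₁ θ₂ ∧
      ∀ p ∈ (h.subst θ₁ θ₂).theory, Eqv (h'.subst θ₁ θ₂).theory p.1 p.2 := by
  induction H with
  | nil => exact ⟨hr, by simp⟩
  | inp _ _ ih =>
    obtain ⟨ih₁, ih₂⟩ := ih hb hr.2
    refine ⟨⟨fun x hx => (hr.1 x hx).cut ih₂, ih₁⟩, ?_⟩
    rw [Trace.subst_cons, Trace.subst_cons, Trace.theory_cons, Trace.theory_cons]
    rintro p (rfl | hp)
    exacts [.id (.inl rfl), (ih₂ p hp).mono (Set.subset_insert _ _)]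
  | out _ _ ih =>
    obtain ⟨ih₁, ih₂⟩ := ih hb.2 hr
    refine ⟨ih₁, ?_⟩
    rw [Trace.subst_cons, Trace.subst_cons, Trace.theory_cons, Trace.theory_cons]
    rintro p (rfl | hp)
    exacts [.id (.inl rfl), (ih₂ p hp).mono (Set.subset_insert _ _)]
  | dropI H he ih =>
    obtain ⟨ih₁, ih₂⟩ := ih hb hr.2
    refine ⟨ih₁, ?_⟩
    rw [Trace.subst_cons, Trace.theory_cons]
    rintro p (rfl | hp)
    exacts [(hr.2.eqv H.isBiTrace (fun x hx => .inr (hr.1 x hx)) he).cut ih₂, ih₂ p hp]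
  | @dropO h _ _ _ H he hM ih =>
    obtain ⟨ih₁, ih₂⟩ := ih hb hr
    refine ⟨ih₁, ?_⟩
    rw [Trace.subst_cons, Trace.theory_cons]
    rintro p (rfl | hp)
    exacts [ih₁.eqv hb (fun x hx => .inr
      ((Trace.Respects.fn (h := h) hr H.isBiTrace (hM hx)).cut ih₂)) he, ih₂ p hp]
  | @hide _ h' m _ _ H hM ih =>
    rw [Trace.subst_cons, Trace.theory_cons]
    rcases m with _ | _
    · obtain ⟨ih₁, ih₂⟩ := ih hb hr
      exact ⟨⟨fun x hx => (Trace.Respects.fn hr H.isBiTrace (hM hx)).cut ih₂, ih₁⟩,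
        fun p hp => (ih₂ p hp).mono (Set.subset_insert _ _)⟩
    · obtain ⟨ih₁, ih₂⟩ := ih hb.2 hr
      exact ⟨ih₁, fun p hp => (ih₂ p hp).mono (Set.subset_insert _ _)⟩

/-- At an output pair, every respectful instance of the smaller theory is derivable from the same
instance of the larger one, so `ConsistentTheory.of_eqv` applies. -/
theorem consistent (H : Cov h h') (hc : h'.Consistent) : h.Consistent := by
  induction H with
  | nil => exact hc
  | inp _ he ih => exact Trace.consistent_i.2 ⟨ih hc.tail, he⟩
  | out H hM ih =>
    refine Trace.consistent_o.2 ⟨hM, ih hc.tail, fun θ₁ θ₂ hr => ?_⟩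
    obtain ⟨h₁, h₂⟩ := H.respects hc.tail.isBiTrace hr
    refine ((Trace.consistent_o.1 hc).2.2 _ _ h₁).of_eqv ?_
    rintro p (rfl | hp)
    exacts [.id (.inl rfl), (h₂ p hp).mono (Set.subset_insert _ _)]
  | dropI _ he ih => exact Trace.consistent_i.2 ⟨ih hc, he⟩
  | dropO H he hM ih =>
    refine Trace.consistent_o.2 ⟨hM, ih hc, fun θ₁ θ₂ hr => ?_⟩
    obtain ⟨h₁, h₂⟩ := (H.dropO he hM).respects hc.isBiTrace hr
    refine (hc.subst h₁).theory.of_eqv ?_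
    rw [← Trace.theory_cons Mark.o]
    exact h₂
  | hide _ _ ih => exact ih hc.tail

theorem subst (H : Cov h h') (hc : h'.Consistent) {θ₁ θ₂ : ℕ → Msg} (hr : h.Respects θ₁ θ₂) :
    Cov (h.subst θ₁ θ₂) (h'.subst θ₁ θ₂) := by
  induction H with
  | nil => exact .nil
  | inp H he ih =>
    exact (ih hc.tail hr.2).inp (hr.2.eqv H.isBiTrace (fun x hx => .inr (hr.1 x hx)) he)
  | out H hM ih => exact (ih hc.tail hr).out ((H.consistent hc.tail).msg_fn_subst hM)
  | dropI H he ih =>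
    exact (ih hc hr.2).dropI (hr.2.eqv H.isBiTrace (fun x hx => .inr (hr.1 x hx)) he)
  | @dropO h _ _ _ H he hM ih =>
    obtain ⟨h₁, h₂⟩ := H.respects hc.isBiTrace hr
    exact (ih hc hr).dropO (h₁.eqv hc.isBiTrace (fun x hx => .inr
      ((Trace.Respects.fn (h := h) hr H.isBiTrace (hM hx)).cut h₂)) he)
      ((H.consistent hc).msg_fn_subst hM)
  | hide H hM ih => exact (ih hc.tail hr).hide ((H.consistent hc.tail).msg_fn_subst hM)

theorem refl (hc : h.Consistent) : Cov h h := by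
  induction h using Trace.ind with
  | nil => exact .nil
  | cons m M N h ih =>
    rcases m with _ | _
    · exact (ih hc.tail).inp (Trace.consistent_i.1 hc).2
    · exact (ih hc.tail).out (Trace.consistent_o.1 hc).1

theorem inverse (H : Cov h h') : Cov h.inverse h'.inverse := by
  induction H with
  | nil => exact .nil
  | inp _ he ih => exact ih.inp (by rw [Trace.theory_inverse]; exact he.sw)
  | out _ hM ih => exact ih.out (by rwa [Trace.fn_inverse, Set.union_comm])
  | dropI _ he ih => exact ih.dropI (by rw [Trace.theory_inverse]; exact he.sw)
  | dropO _ he hM ih =>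
    exact ih.dropO (by rw [Trace.theory_inverse]; exact he.sw)
      (by rwa [Trace.fn_inverse, Set.union_comm])
  | hide _ hM ih => exact ih.hide (by rwa [Trace.fn_inverse, Set.union_comm])

theorem ren (H : Cov h h') (f₁ f₂ : Equiv.Perm ℕ) : Cov (h.ren f₁ f₂) (h'.ren f₁ f₂) := by
  induction H with
  | nil => exact .nil
  | inp _ he ih => exact ih.inp (he.ren _ _)
  | out _ hM ih => exact ih.out (Trace.fn_ren_subset hM _ _)
  | dropI _ he ih => exact ih.dropI (he.ren _ _)
  | dropO _ he hM ih =>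
    exact ih.dropO (he.ren _ _) (Trace.fn_ren_subset hM _ _)
  | hide _ hM ih => exact ih.hide (Trace.fn_ren_subset hM _ _)

/-- Being synthesizable from `h`, the message `M` has a partner there; this is also a partner in
`h'`, hence it is `N`. -/
theorem eqv_of_syn (H : Cov h h') (hc : h'.Consistent) {M N : Msg} (hM : Syn h.fst M)
    (he : Eqv h'.theory M N) : Eqv h.theory M N := by
  obtain ⟨N', hN⟩ := (H.consistent hc).exists_eqv hM
  rwa [hc.theory.unique_right _ _ _ (H.eqv hN) he]

end Cov

/-! ### Trading a name for a pair of fresh rigid names -/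

/-- The substitution of the rigid name `c` for the name `z`. -/
def rgFor (z c : ℕ) : ℕ → Msg := fun x => if x = z then .rg c else .nm x

/-- The replacement of the rigid name `c` by the name `z`. -/
def nmFor (c z : ℕ) : ℕ → Msg := fun a => if a = c then .nm z else .rg a

def Msg.unrg (c z : ℕ) (M : Msg) : Msg := M.bs Msg.nm (nmFor c z)

def Proc.unrg (c z : ℕ) (P : Proc) : Proc := P.bs Msg.nm (nmFor c z)

theorem rgFor_self (z c : ℕ) : rgFor z c z = .rg c := if_pos rfl

theorem rgFor_of_ne {z c x : ℕ} (h : x ≠ z) : rgFor z c x = .nm x := if_neg h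

theorem nmFor_self (c z : ℕ) : nmFor c z c = .nm z := if_pos rfl

theorem nmFor_of_ne {z c x : ℕ} (h : x ≠ c) : nmFor c z x = .rg x := if_neg h

theorem nmFor_bs_rgFor (c z a : ℕ) : (nmFor c z a).bs (rgFor z c) Msg.rg = .rg a := by
  unfold nmFor rgFor
  split_ifs with h <;> simp [Msg.bs, h]

theorem rgFor_bs_nmFor (c z x : ℕ) : (rgFor z c x).bs Msg.nm (nmFor c z) = .nm x := by
  unfold nmFor rgFor
  split_ifs with h <;> simp [Msg.bs, h]

theorem Msg.unrg_subst {c z : ℕ} {M : Msg} (h : z ∉ M.fn) :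
    (M.unrg c z).subst (rgFor z c) = M := by
  rw [unrg, subst_eq, bs_bs, M.bs_congr (θ' := nm) (ρ' := rg), bs_id]
  · exact fun x hx => rgFor_of_ne fun e => h (e ▸ hx)
  · exact fun a _ => nmFor_bs_rgFor c z a

theorem Proc.unrg_subst {c z : ℕ} {P : Proc} (h : z ∉ P.fn) :
    (P.unrg c z).subst (rgFor z c) = P := by
  rw [unrg, subst_eq, bs_bs, P.bs_congr (θ' := Msg.nm) (ρ' := Msg.rg), bs_id]
  · exact fun x hx => rgFor_of_ne fun e => h (e ▸ hx)
  · exact fun a _ => nmFor_bs_rgFor c z a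

theorem Msg.subst_unrg {c z : ℕ} {M : Msg} (h : c ∉ M.rn) :
    (M.subst (rgFor z c)).unrg c z = M := by
  rw [unrg, subst_eq, bs_bs, M.bs_congr (θ' := nm) (ρ' := rg), bs_id]
  · exact fun x _ => rgFor_bs_nmFor c z x
  · exact fun a ha => nmFor_of_ne fun e => h (e ▸ ha)

theorem Proc.subst_unrg {c z : ℕ} {P : Proc} (h : c ∉ P.rn) :
    (P.subst (rgFor z c)).unrg c z = P := by
  rw [unrg, subst_eq, bs_bs, P.bs_congr (θ' := Msg.nm) (ρ' := Msg.rg), bs_id]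
  · exact fun x _ => rgFor_bs_nmFor c z x
  · exact fun a ha => nmFor_of_ne fun e => h (e ▸ ha)

theorem Msg.mem_fn_unrg {c z x : ℕ} {M : Msg} :
    x ∈ (M.unrg c z).fn ↔ x ∈ M.fn ∨ c ∈ M.rn ∧ x = z := by
  rw [unrg, mem_fn_bs]
  constructor
  · rintro (⟨y, hy, h⟩ | ⟨a, ha, h⟩)
    · cases h; exact .inl hy
    · by_cases e : a = c
      · subst e; rw [nmFor_self] at h; exact .inr ⟨ha, h⟩
      · rw [nmFor_of_ne e] at h; exact h.elim
  · rintro (h | ⟨h, rfl⟩)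
    · exact .inl ⟨x, h, rfl⟩
    · exact .inr ⟨c, h, by rw [nmFor_self]; rfl⟩

theorem Proc.mem_fn_unrg {c z x : ℕ} {P : Proc} :
    x ∈ (P.unrg c z).fn ↔ x ∈ P.fn ∨ c ∈ P.rn ∧ x = z := by
  rw [unrg, mem_fn_bs]
  constructor
  · rintro (⟨y, hy, h⟩ | ⟨a, ha, h⟩)
    · cases h; exact .inl hy
    · by_cases e : a = c
      · subst e; rw [nmFor_self] at h; exact .inr ⟨ha, h⟩
      · rw [nmFor_of_ne e] at h; exact h.elim
  · rintro (h | ⟨h, rfl⟩)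
    · exact .inl ⟨x, h, rfl⟩
    · exact .inr ⟨c, h, by rw [nmFor_self]; rfl⟩

theorem mem_rn_nmFor {c z a b : ℕ} : b ∈ (nmFor c z a).rn ↔ b = a ∧ a ≠ c := by
  by_cases e : a = c
  · subst e; rw [nmFor_self]; simp [Msg.rn]
  · rw [nmFor_of_ne e]; simp [Msg.rn, e]

theorem Msg.mem_rn_unrg {c z a : ℕ} {M : Msg} : a ∈ (M.unrg c z).rn ↔ a ∈ M.rn ∧ a ≠ c := by
  rw [unrg, mem_rn_bs]
  constructor
  · rintro (⟨y, hy, h⟩ | ⟨b, hb, h⟩)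
    · exact h.elim
    · obtain ⟨rfl, h⟩ := mem_rn_nmFor.1 h; exact ⟨hb, h⟩
  · exact fun h => .inr ⟨a, h.1, mem_rn_nmFor.2 ⟨rfl, h.2⟩⟩

theorem Proc.mem_rn_unrg {c z a : ℕ} {P : Proc} : a ∈ (P.unrg c z).rn ↔ a ∈ P.rn ∧ a ≠ c := by
  rw [unrg, mem_rn_bs]
  constructor
  · rintro (⟨y, hy, h⟩ | ⟨b, hb, h⟩)
    · exact h.elim
    · obtain ⟨rfl, h⟩ := mem_rn_nmFor.1 h; exact ⟨hb, h⟩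
  · exact fun h => .inr ⟨a, h.1, mem_rn_nmFor.2 ⟨rfl, h.2⟩⟩

theorem Msg.unrg_eq_self {c z : ℕ} {M : Msg} (h : c ∉ M.rn) : M.unrg c z = M := by
  rw [unrg, M.bs_congr (θ' := nm) (ρ' := rg), bs_id]
  · exact fun _ _ => rfl
  · exact fun a ha => nmFor_of_ne fun e => h (e ▸ ha)

theorem Proc.unrg_eq_self {c z : ℕ} {P : Proc} (h : c ∉ P.rn) : P.unrg c z = P := by
  rw [unrg, P.bs_congr (θ' := Msg.nm) (ρ' := Msg.rg), bs_id]
  · exact fun _ _ => rfl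
  · exact fun a ha => nmFor_of_ne fun e => h (e ▸ ha)

/-- The substitution that corresponds to `θ` when `c` is represented by `z` before and by `z'`
after the substitution. -/
def unrgSubst (c z z' : ℕ) (θ : ℕ → Msg) : ℕ → Msg :=
  fun x => if x = z then .nm z' else (θ x).unrg c z'

theorem unrgSubst_of_ne {c z z' x : ℕ} {θ : ℕ → Msg} (h : x ≠ z) :
    unrgSubst c z z' θ x = (θ x).unrg c z' := if_neg h

theorem unrgSubst_self (c z z' : ℕ) (θ : ℕ → Msg) : unrgSubst c z z' θ z = .nm z' := if_pos rfl

theorem nmFor_bs_unrgSubst (c z z' : ℕ) (θ : ℕ → Msg) (a : ℕ) :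
    (nmFor c z a).bs (unrgSubst c z z' θ) Msg.rg = nmFor c z' a := by
  unfold nmFor unrgSubst
  split_ifs with h <;> simp [Msg.bs]

/-- The representative of `c` must be allowed to change from `z` to `z'`, because `z` may occur in
the values of `θ`. -/
theorem Msg.unrg_unrgSubst {c z z' : ℕ} (θ : ℕ → Msg) {M : Msg} (h : z ∉ M.fn) :
    (M.unrg c z).subst (unrgSubst c z z' θ) = (M.subst θ).unrg c z' := by
  rw [unrg, subst_eq, bs_bs, unrg, subst_eq, bs_bs]
  exact M.bs_congr (fun x hx => unrgSubst_of_ne fun e => h (e ▸ hx))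
    fun a _ => nmFor_bs_unrgSubst c z z' θ a

theorem Proc.unrg_unrgSubst {c z z' : ℕ} (θ : ℕ → Msg) {P : Proc} (h : z ∉ P.fn) :
    (P.unrg c z).subst (unrgSubst c z z' θ) = (P.subst θ).unrg c z' := by
  rw [unrg, subst_eq, bs_bs, unrg, subst_eq, bs_bs]
  exact P.bs_congr (fun x hx => unrgSubst_of_ne fun e => h (e ▸ hx))
    fun a _ => nmFor_bs_unrgSubst c z z' θ a

/-- `Flex z c d h₀ h`: the bi-trace `h` arises from `h₀` by the output of the fresh rigid names
`(c, d)` at some time, and by putting them for the name `z` afterwards. -/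
inductive Flex (z c d : ℕ) : Trace → Trace → Prop
  | start {h : Trace} : z ∉ h.fn → c ∉ h.rnL → d ∉ h.rnR →
      Flex z c d h ((Mark.o, Msg.rg c, Msg.rg d) :: h)
  | step {h₀ h : Trace} (m : Mark) {M N : Msg} : Flex z c d h₀ h → z ∉ M.fn → z ∉ N.fn →
      Flex z c d ((m, M.unrg c z, N.unrg d z) :: h₀) ((m, M, N) :: h)

namespace Flex

variable {z c d : ℕ} {h₀ h : Trace}

theorem notMem_fn (H : Flex z c d h₀ h) : z ∉ h.fn := by
  induction H with
  | start hz _ _ => simpa [Msg.fn] using hz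
  | step m _ hM hN ih => simp [hM, hN, ih]

theorem mem_fn (H : Flex z c d h₀ h) {x : ℕ} (hx : x ≠ z) : x ∈ h₀.fn ↔ x ∈ h.fn := by
  induction H with
  | start hz _ _ => simp [Msg.fn]
  | step m _ hM hN ih => simp [ih, Msg.mem_fn_unrg, hx]

theorem rnL_subset (H : Flex z c d h₀ h) : h₀.rnL ⊆ h.rnL := by
  induction H with
  | start hz _ _ => simp
  | step m _ hM hN ih =>
    rw [Trace.rnL_cons, Trace.rnL_cons]
    exact Set.union_subset_union (fun x hx => (Msg.mem_rn_unrg.1 hx).1) ih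

theorem rnR_subset (H : Flex z c d h₀ h) : h₀.rnR ⊆ h.rnR := by
  induction H with
  | start hz _ _ => simp
  | step m _ hM hN ih =>
    rw [Trace.rnR_cons, Trace.rnR_cons]
    exact Set.union_subset_union (fun x hx => (Msg.mem_rn_unrg.1 hx).1) ih

theorem mem_theory (H : Flex z c d h₀ h) : (Msg.rg c, Msg.rg d) ∈ h.theory := by
  induction H with
  | start => simp
  | step m _ hM hN ih => simp [ih]

theorem mem_rnL (H : Flex z c d h₀ h) : c ∈ h.rnL := by
  obtain ⟨e, he, he'⟩ := H.mem_theory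
  exact ⟨e, he, by rw [he']; rfl⟩

theorem mem_rnR (H : Flex z c d h₀ h) : d ∈ h.rnR := by
  obtain ⟨e, he, he'⟩ := H.mem_theory
  exact ⟨e, he, by rw [he']; rfl⟩

theorem inverse (H : Flex z c d h₀ h) : Flex z d c h₀.inverse h.inverse := by
  induction H with
  | start hz hc hd =>
    exact .start (by rwa [Trace.fn_inverse]) (by rwa [Trace.rnL_inverse])
      (by rwa [Trace.rnR_inverse])
  | step m _ hM hN ih => exact .step m ih hN hM

theorem of_mem_theory (H : Flex z c d h₀ h) : ∀ p ∈ h.theory,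
    Eqv h₀.theory (p.1.unrg c z) (p.2.unrg d z) := by
  induction H with
  | @start h hz hc hd =>
    rw [Trace.theory_cons]
    rintro p (rfl | hp)
    · simp only [Msg.unrg, Msg.bs, nmFor_self]; exact .var z
    · have hp' := hp
      obtain ⟨e, he, rfl⟩ := hp
      rw [Msg.unrg_eq_self fun h' => hc ⟨e, he, h'⟩, Msg.unrg_eq_self fun h' => hd ⟨e, he, h'⟩]
      exact .id hp'
  | step m _ hM hN ih =>
    rw [Trace.theory_cons, Trace.theory_cons]
    rintro p (rfl | hp)
    exacts [.id (.inl rfl), (ih p hp).mono (Set.subset_insert _ _)]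

theorem eqv_unrg (H : Flex z c d h₀ h) {M N : Msg} (he : Eqv h.theory M N) :
    Eqv h₀.theory (M.unrg c z) (N.unrg d z) :=
  he.bs (fun x => .var x) H.of_mem_theory

theorem syn_unrg (H : Flex z c d h₀ h) {M : Msg} (he : Syn h.fst M) :
    Syn h₀.fst (M.unrg c z) :=
  he.bs (fun x => .var x) (by
    rintro _ ⟨p, hp, rfl⟩
    exact (H.of_mem_theory p hp).syn_left)

theorem subst_mem_theory (H : Flex z c d h₀ h) : ∀ p ∈ h₀.theory,
    (p.1.subst (rgFor z c), p.2.subst (rgFor z d)) ∈ h.theory := by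
  induction H with
  | @start h hz hc hd =>
    intro p hp
    rw [Trace.theory_cons, Msg.subst_congr (θ' := Msg.nm), Msg.subst_nm,
      Msg.subst_congr (θ' := Msg.nm), Msg.subst_nm]
    · exact .inr hp
    · exact fun x hx => rgFor_of_ne fun e => hz (e ▸ Trace.fn_of_mem_theory hp (.inr hx))
    · exact fun x hx => rgFor_of_ne fun e => hz (e ▸ Trace.fn_of_mem_theory hp (.inl hx))
  | step m _ hM hN ih =>
    rw [Trace.theory_cons, Trace.theory_cons]
    rintro p (rfl | hp)
    · simp only [Msg.unrg_subst hM, Msg.unrg_subst hN]; exact .inl rfl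
    · exact .inr (ih p hp)

theorem eqv_rgFor (H : Flex z c d h₀ h) (x : ℕ) : Eqv h.theory (rgFor z c x) (rgFor z d x) := by
  by_cases e : x = z
  · subst e; rw [rgFor_self, rgFor_self]; exact .id H.mem_theory
  · rw [rgFor_of_ne e, rgFor_of_ne e]; exact .var x

theorem eqv_subst (H : Flex z c d h₀ h) {M N : Msg} (he : Eqv h₀.theory M N) :
    Eqv h.theory (M.subst (rgFor z c)) (N.subst (rgFor z d)) := by
  rw [Msg.subst_eq, Msg.subst_eq]
  refine he.bs H.eqv_rgFor fun p hp => .id ?_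
  have := H.subst_mem_theory p hp
  rwa [Msg.subst_eq, Msg.subst_eq] at this

theorem isBiTrace (H : Flex z c d h₀ h) (hb : h₀.IsBiTrace) : h.IsBiTrace := by
  induction H with
  | start => exact ⟨by simp [Msg.fn], hb⟩
  | @step h₀ h m M N H hM hN ih =>
    rcases m with _ | _
    · exact ih hb
    · refine ⟨?_, ih hb.2⟩
      rintro x hx
      have hxz : x ≠ z := by rintro rfl; exact hx.elim hM hN
      refine (H.mem_fn hxz).1 (hb.1 ?_)
      exact hx.imp (fun h => Msg.mem_fn_unrg.2 (.inl h)) fun h => Msg.mem_fn_unrg.2 (.inl h)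

/-- A substitution respecting `h` cannot use `c` and `d` at names introduced before their output,
but it may use them later. Written with `z'` for `c` and `d`, it respects `h₀`, where `z'` is
available at all times because a name is equivalent to itself. -/
theorem subst (H : Flex z c d h₀ h) (hb : h₀.IsBiTrace) {θ₁ θ₂ : ℕ → Msg} (hr : h.Respects θ₁ θ₂)
    {z' : ℕ} (hz' : z' ∉ (h.subst θ₁ θ₂).fn) :
    h₀.Respects (unrgSubst c z z' θ₁) (unrgSubst d z z' θ₂) ∧
      Flex z' c d (h₀.subst (unrgSubst c z z' θ₁) (unrgSubst d z z' θ₂)) (h.subst θ₁ θ₂) := by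
  induction H with
  | @start h hz hc hd =>
    have hr' : h.Respects θ₁ θ₂ := hr
    have hc' : c ∉ (h.subst θ₁ θ₂).rnL := fun h' => hc (hr'.rnL hb h')
    have hd' : d ∉ (h.subst θ₁ θ₂).rnR := fun h' => hd (hr'.rnR hb h')
    have k₁ : ∀ x ∈ h.fn, θ₁ x = unrgSubst c z z' θ₁ x := fun x hx => by
      rw [unrgSubst_of_ne (ne_of_mem_of_not_mem hx hz), Msg.unrg_eq_self fun h' => hc' ?_]
      obtain ⟨_, ⟨e, he, rfl⟩, h'⟩ := (hr'.fn hb hx).rn_left h'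
      exact ⟨e, he, h'⟩
    have k₂ : ∀ x ∈ h.fn, θ₂ x = unrgSubst d z z' θ₂ x := fun x hx => by
      rw [unrgSubst_of_ne (ne_of_mem_of_not_mem hx hz), Msg.unrg_eq_self fun h' => hd' ?_]
      obtain ⟨_, ⟨e, he, rfl⟩, h'⟩ := (hr'.fn hb hx).rn_right h'
      exact ⟨e, he, h'⟩
    refine ⟨hr'.congr k₁ k₂, ?_⟩
    rw [← Trace.subst_congr k₁ k₂]
    exact .start (fun h' => hz' (by rw [Trace.subst_cons, Trace.fn_cons]; exact .inr h')) hc' hd'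
  | @step h₀ h m M N H hM hN ih =>
    rw [Trace.subst_cons, Trace.fn_cons] at hz'
    have hzM : z' ∉ (M.subst θ₁).fn := fun h' => hz' (.inl (.inl h'))
    have hzN : z' ∉ (N.subst θ₂).fn := fun h' => hz' (.inl (.inr h'))
    have hzh : z' ∉ (h.subst θ₁ θ₂).fn := fun h' => hz' (.inr h')
    rw [Trace.subst_cons, Trace.subst_cons, Msg.unrg_unrgSubst θ₁ hM, Msg.unrg_unrgSubst θ₂ hN]
    rcases m with _ | _
    · obtain ⟨h₁, h₂⟩ := ih hb hr.2 hzh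
      refine ⟨⟨fun x hx => ?_, h₁⟩, .step _ h₂ hzM hzN⟩
      by_cases e : x = z
      · subst e; rw [unrgSubst_self, unrgSubst_self]; exact .var _
      · rw [unrgSubst_of_ne e, unrgSubst_of_ne e]
        refine h₂.eqv_unrg (hr.1 x ?_)
        rw [Set.mem_union, Msg.mem_fn_unrg, Msg.mem_fn_unrg] at hx
        simpa [e] using hx
    · obtain ⟨h₁, h₂⟩ := ih hb.2 hr hzh
      exact ⟨h₁, .step _ h₂ hzM hzN⟩

/-- An injection of the names into the names other than `z` that fixes the names below `m`. -/
theorem exists_avoid {X : Set ℕ} (hX : X.Finite) {z : ℕ} (hz : z ∉ X) : ∃ φ ψ : ℕ → ℕ,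
    (∀ x, ψ (φ x) = x) ∧ (∀ x, φ x ≠ z) ∧ (∀ x ∈ X, φ x = x) ∧ ∀ x ∈ X, ψ x = x := by
  -- With `m` a bound of `X` and `z`, the injection sends `z` to `m + 1`, shifts everything above
  -- `m`, and fixes the rest.
  obtain ⟨m, hm⟩ := (hX.insert z).bddAbove
  have hm' : ∀ x ∈ X, x ≤ m := fun x hx => hm (.inr hx)
  have hzm : z ≤ m := hm (.inl rfl)
  have key : ∀ x ∈ X, (if x ≤ m then (if x = z then m + 1 else x) else x + 1) = x := fun x hx => by
    rw [if_pos (hm' x hx), if_neg (ne_of_mem_of_not_mem hx hz)]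
  have inj : Function.Injective
      fun x => if x ≤ m then (if x = z then m + 1 else x) else x + 1 := by
    intro x y hxy
    simp only at hxy
    split_ifs at hxy <;> omega
  refine ⟨fun x => if x ≤ m then (if x = z then m + 1 else x) else x + 1, Function.invFun _,
    Function.leftInverse_invFun inj, fun x => ?_, key, fun x hx => ?_⟩
  · dsimp only
    split_ifs <;> omega
  · have := Function.leftInverse_invFun inj x
    simp only [key x hx] at this
    exact this

/-- The theories of `h₀` and `h` are exchanged by writing `z` for `c` and `d`, and back, so
`ConsistentTheory.transport` applies. The messages to be tested are arbitrary and may contain `z`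
itself; the injection `φ` moves this occurrence away and keeps the replacement invertible. -/
theorem theory_consistent (H : Flex z c d h₀ h) (hc : ConsistentTheory h₀.theory) :
    ConsistentTheory h.theory := by
  obtain ⟨φ, ψ, hψ, hφ, hφX, hψX⟩ := exists_avoid h.fn_finite H.notMem_fn
  have hψX' : ∀ x ∈ h₀.fn, ∀ a, (if x = z then Msg.rg a else Msg.nm (ψ x)) = rgFor z a x := by
    intro x hx a
    by_cases e : x = z
    · rw [if_pos e, e, rgFor_self]
    · rw [if_neg e, rgFor_of_ne e, hψX x ((H.mem_fn e).1 hx)]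
  refine hc.transport (φ₁ := fun x => .nm (φ x)) (φ₂ := fun x => .nm (φ x)) (r₁ := nmFor c z)
    (r₂ := nmFor d z) (γ₁ := fun x => if x = z then .rg c else .nm (ψ x))
    (γ₂ := fun x => if x = z then .rg d else .nm (ψ x)) (s₁ := Msg.rg) (s₂ := Msg.rg)
    (fun p hp => ?_) (fun x => .var _) (fun p hp => ?_) (fun x => ?_) (fun x => ?_) (fun a => ?_)
    (fun x => ?_) (fun a => ?_) (fun x => ?_) fun a b => trivial
  · have := H.of_mem_theory p hp
    rwa [Msg.unrg, Msg.unrg, p.1.bs_congr (θ' := fun x => .nm (φ x)) (ρ' := nmFor c z),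
      p.2.bs_congr (θ' := fun x => .nm (φ x)) (ρ' := nmFor d z)] at this
    · exact fun x hx => by rw [hφX x (Trace.fn_of_mem_theory hp (.inr hx))]
    · exact fun _ _ => rfl
    · exact fun x hx => by rw [hφX x (Trace.fn_of_mem_theory hp (.inl hx))]
    · exact fun _ _ => rfl
  · have := H.subst_mem_theory p hp
    rw [Msg.subst_eq, Msg.subst_eq] at this
    rw [p.1.bs_congr (θ' := rgFor z c) (ρ' := Msg.rg), p.2.bs_congr (θ' := rgFor z d) (ρ' := Msg.rg)]
    · exact .id this
    · exact fun x hx => hψX' x (Trace.fn_of_mem_theory hp (.inr hx)) _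
    · exact fun _ _ => rfl
    · exact fun x hx => hψX' x (Trace.fn_of_mem_theory hp (.inl hx)) _
    · exact fun _ _ => rfl
  · by_cases e : x = z
    · simp only [if_pos e]; exact .id H.mem_theory
    · simp only [if_neg e]; exact .var _
  · simp [Msg.bs, hφ, hψ]
  · by_cases e : a = c
    · rw [e, nmFor_self]; simp [Msg.bs]
    · rw [nmFor_of_ne e]; rfl
  · simp [Msg.bs, hφ, hψ]
  · by_cases e : a = d
    · rw [e, nmFor_self]; simp [Msg.bs]
    · rw [nmFor_of_ne e]; rfl
  · by_cases e : x = z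
    · simp only [if_pos e]; trivial
    · simp only [if_neg e]; trivial

theorem consistent (H : Flex z c d h₀ h) (hc : h₀.Consistent) : h.Consistent := by
  induction H with
  | @start h hz hc' hd' =>
    refine Trace.consistent_o.2 ⟨by simp [Msg.fn], hc, fun θ₁ θ₂ hr => ?_⟩
    obtain ⟨z', hz'⟩ := (Trace.fn_finite (Trace.subst θ₁ θ₂ ((Mark.o, .rg c, .rg d) :: h))).exists_notMem
    obtain ⟨h₁, h₂⟩ := (Flex.start hz hc' hd').subst (θ₁ := θ₁) (θ₂ := θ₂) hc.isBiTrace hr hz'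
    have := h₂.theory_consistent (hc.subst h₁).theory
    rwa [Trace.subst_cons, Trace.theory_cons] at this
  | @step h₀ h m M N H hM hN ih =>
    have hb := (H.step m hM hN).isBiTrace hc.isBiTrace
    rcases m with _ | _
    · obtain ⟨hc, he⟩ := Trace.consistent_i.1 hc
      refine Trace.consistent_i.2 ⟨ih hc, ?_⟩
      have := H.eqv_subst he
      rwa [Msg.unrg_subst hM, Msg.unrg_subst hN] at this
    · refine Trace.consistent_o.2 ⟨hb.1, ih hc.tail, fun θ₁ θ₂ hr => ?_⟩
      obtain ⟨z', hz'⟩ := (Trace.fn_finite (Trace.subst θ₁ θ₂ ((Mark.o, M, N) :: h))).exists_notMem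
      obtain ⟨h₁, h₂⟩ := (H.step .o hM hN).subst (θ₁ := θ₁) (θ₂ := θ₂) hc.isBiTrace hr hz'
      have := h₂.theory_consistent (hc.subst h₁).theory
      rwa [Trace.subst_cons, Trace.theory_cons] at this

end Flex

theorem Proc.bs_inst (θ ρ : ℕ → Msg) (M : Msg) (P : Proc) :
    (P.subst (inst M)).bs θ ρ = (P.bs (lift θ) (liftR ρ)).subst (inst (M.bs θ ρ)) := by
  simp only [Proc.subst_eq, Proc.bs_bs]
  refine Proc.bs_congr _ (fun x _ => ?_) fun a _ => ?_
  · rcases x with _ | x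
    · rfl
    · simp [lift, inst, Msg.bs, Msg.rename_eq, Msg.bs_bs, Msg.bs_id]
  · simp [liftR, inst, Msg.bs, Msg.rename_eq, Msg.bs_bs, Msg.bs_id]

theorem instRigid_lt {k : ℕ} (c : Fin k → ℕ) {i : ℕ} (hi : i < k) :
    instRigid c i = .rg (c ⟨i, hi⟩) := dif_pos hi

theorem instRigid_add {k : ℕ} (c : Fin k → ℕ) (i : ℕ) : instRigid c (i + k) = .nm i := by
  simp [instRigid]

theorem bs_instRigid_aux (θ ρ : ℕ → Msg) {k : ℕ} {c c' : Fin k → ℕ}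
    (hc : ∀ i, ρ (c i) = .rg (c' i)) (x : ℕ) :
    (instRigid c x).bs θ ρ = (lift^[k] θ x).bs (instRigid c') Msg.rg := by
  rw [lift_iterate]
  by_cases hx : x < k
  · simp [instRigid_lt, hx, Msg.bs, hc]
  · obtain ⟨y, rfl⟩ := Nat.exists_eq_add_of_le' (not_lt.1 hx)
    simp [instRigid_add, Msg.bs, Msg.rename_eq, Msg.bs_bs, Msg.bs_id]

theorem bs_instRigid_aux' (ρ : ℕ → Msg) {k : ℕ} (c' : Fin k → ℕ) (a : ℕ) :
    ρ a = (liftR^[k] ρ a).bs (instRigid c') Msg.rg := by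
  simp [liftR_iterate, instRigid_add, Msg.rename_eq, Msg.bs_bs, Msg.bs_id, Msg.bs]

theorem Proc.bs_instRigid (θ ρ : ℕ → Msg) {k : ℕ} {c c' : Fin k → ℕ}
    (hc : ∀ i, ρ (c i) = .rg (c' i)) (P : Proc) :
    (P.subst (instRigid c)).bs θ ρ =
      (P.bs (lift^[k] θ) (liftR^[k] ρ)).subst (instRigid c') := by
  rw [subst_eq, bs_bs, subst_eq, bs_bs]
  exact P.bs_congr (fun x _ => bs_instRigid_aux θ ρ hc x) fun a _ => bs_instRigid_aux' ρ c' a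

theorem Msg.bs_instRigid (θ ρ : ℕ → Msg) {k : ℕ} {c c' : Fin k → ℕ}
    (hc : ∀ i, ρ (c i) = .rg (c' i)) (M : Msg) :
    (M.subst (instRigid c)).bs θ ρ =
      (M.bs (lift^[k] θ) (liftR^[k] ρ)).subst (instRigid c') := by
  rw [subst_eq, bs_bs, subst_eq, bs_bs]
  exact M.bs_congr (fun x _ => bs_instRigid_aux θ ρ hc x) fun a _ => bs_instRigid_aux' ρ c' a

theorem Proc.fn_inst {M : Msg} {P : Proc} :
    (P.subst (inst M)).fn ⊆ M.fn ∪ {y | y + 1 ∈ P.fn} := by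
  intro y hy
  rw [subst_eq, mem_fn_bs] at hy
  rcases hy with ⟨x, hx, hy⟩ | ⟨a, -, hy⟩
  · rcases x with _ | x
    · exact .inl hy
    · cases hy; exact .inr hx
  · exact hy.elim

theorem Proc.rn_inst {M : Msg} {P : Proc} : (P.subst (inst M)).rn ⊆ M.rn ∪ P.rn := by
  intro y hy
  rw [subst_eq, mem_rn_bs] at hy
  rcases hy with ⟨x, hx, hy⟩ | ⟨a, h, hy⟩
  · rcases x with _ | x
    · exact .inl hy
    · exact hy.elim
  · cases hy; exact .inr h

theorem mem_fn_instRigid {k : ℕ} {c : Fin k → ℕ} {x y : ℕ} (h : y ∈ (instRigid c x).fn) :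
    x = y + k := by
  by_cases hx : x < k
  · rw [instRigid_lt c hx] at h; exact h.elim
  · obtain ⟨z, rfl⟩ := Nat.exists_eq_add_of_le' (not_lt.1 hx)
    rw [instRigid_add] at h; cases h; rfl

theorem mem_rn_instRigid {k : ℕ} {c : Fin k → ℕ} {x y : ℕ} (h : y ∈ (instRigid c x).rn) :
    y ∈ Set.range c := by
  by_cases hx : x < k
  · rw [instRigid_lt c hx] at h; cases h; exact ⟨_, rfl⟩
  · obtain ⟨z, rfl⟩ := Nat.exists_eq_add_of_le' (not_lt.1 hx)
    rw [instRigid_add] at h; exact h.elim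

theorem Proc.fn_instRigid {k : ℕ} {c : Fin k → ℕ} {P : Proc} :
    (P.subst (instRigid c)).fn ⊆ {y | y + k ∈ P.fn} := by
  intro y hy
  rw [subst_eq, mem_fn_bs] at hy
  rcases hy with ⟨x, hx, hy⟩ | ⟨a, -, hy⟩
  · obtain rfl := mem_fn_instRigid hy; exact hx
  · exact hy.elim

theorem Msg.fn_instRigid {k : ℕ} {c : Fin k → ℕ} {P : Msg} :
    (P.subst (instRigid c)).fn ⊆ {y | y + k ∈ P.fn} := by
  intro y hy
  rw [subst_eq, mem_fn_bs] at hy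
  rcases hy with ⟨x, hx, hy⟩ | ⟨a, -, hy⟩
  · obtain rfl := mem_fn_instRigid hy; exact hx
  · exact hy.elim

theorem Proc.rn_instRigid {k : ℕ} {c : Fin k → ℕ} {P : Proc} :
    (P.subst (instRigid c)).rn ⊆ Set.range c ∪ P.rn := by
  intro y hy
  rw [subst_eq, mem_rn_bs] at hy
  rcases hy with ⟨x, hx, hy⟩ | ⟨a, h, hy⟩
  · exact .inl (mem_rn_instRigid hy)
  · cases hy; exact .inr h

theorem Msg.rn_instRigid {k : ℕ} {c : Fin k → ℕ} {P : Msg} :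
    (P.subst (instRigid c)).rn ⊆ Set.range c ∪ P.rn := by
  intro y hy
  rw [subst_eq, mem_rn_bs] at hy
  rcases hy with ⟨x, hx, hy⟩ | ⟨a, h, hy⟩
  · exact .inl (mem_rn_instRigid hy)
  · cases hy; exact .inr h

/-- `z` represents a pair of rigid names that is fresh at the time of its output. -/
def FlexAt (z : ℕ) (h : Trace) (P Q : Proc) : Prop :=
  ∃ c d h₀, Flex z c d h₀ h ∧ z ∉ P.fn ∧ z ∉ Q.fn ∧
    OpenBisimilarAt h₀ (P.unrg c z) (Q.unrg d z)

theorem FlexAt.consistent {z : ℕ} {h : Trace} {P Q : Proc} (H : FlexAt z h P Q) :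
    h.Consistent := by
  obtain ⟨c, d, h₀, H, -, -, H'⟩ := H
  exact H.consistent (openBisimilarAt_bisim.consistent H')

theorem FlexAt.fn {z : ℕ} {h : Trace} {P Q : Proc} (H : FlexAt z h P Q) :
    P.fn ∪ Q.fn ⊆ h.fn := by
  obtain ⟨c, d, h₀, H, hP, hQ, H'⟩ := H
  intro x hx
  refine (H.mem_fn (x := x) ?_).1 (openBisimilarAt_bisim.fn H' ?_)
  · rintro rfl; exact hx.elim hP hQ
  · exact hx.imp (fun h => Proc.mem_fn_unrg.2 (.inl h)) fun h => Proc.mem_fn_unrg.2 (.inl h)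

theorem FlexAt.inverse {z : ℕ} {h : Trace} {P Q : Proc} (H : FlexAt z h P Q) :
    FlexAt z h.inverse Q P := by
  obtain ⟨c, d, h₀, H, hP, hQ, H'⟩ := H
  exact ⟨d, c, _, H.inverse, hQ, hP, openBisimilarAt_bisim.symm H'⟩

theorem FlexAt.subst {z z' : ℕ} {h : Trace} {P Q : Proc} (H : FlexAt z h P Q)
    {θ₁ θ₂ : ℕ → Msg} (hr : h.Respects θ₁ θ₂) (hz' : z' ∉ (h.subst θ₁ θ₂).fn) :
    FlexAt z' (h.subst θ₁ θ₂) (P.subst θ₁) (Q.subst θ₂) := by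
  have hfn := H.consistent.proc_fn_subst (θ₁ := θ₁) (θ₂ := θ₂) H.fn
  obtain ⟨c, d, h₀, H, hP, hQ, H'⟩ := H
  obtain ⟨h₁, h₂⟩ := H.subst (openBisimilarAt_bisim.consistent H').isBiTrace hr hz'
  refine ⟨c, d, _, h₂, fun h => hz' (hfn (.inl h)), fun h => hz' (hfn (.inr h)), ?_⟩
  rw [← Proc.unrg_unrgSubst θ₁ hP, ← Proc.unrg_unrgSubst θ₂ hQ]
  exact openBisimilarAt_bisim.subst H' h₁

theorem FlexAt.change {z z' : ℕ} {h : Trace} {P Q : Proc} (H : FlexAt z h P Q)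
    (hz' : z' ∉ h.fn) : FlexAt z' h P Q := by
  have := H.subst h.respects_nm (by rwa [Trace.subst_nm])
  rwa [Trace.subst_nm, Proc.subst_nm, Proc.subst_nm] at this

/-- Transitions are stable under replacement in both directions: the step is moved to the process
with `z` for `c`, answered there, and the answer is moved back by substituting `d` for `z`. -/
theorem FlexAt.tau {z : ℕ} {h : Trace} {P Q P' : Proc} (H : FlexAt z h P Q)
    (hs : Step P .tau (.proc P')) : ∃ Q', Step Q .tau (.proc Q') ∧ FlexAt z h P' Q' := by
  obtain ⟨c, d, h₀, H, hP, hQ, H'⟩ := H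
  obtain ⟨Q₀, hs', H''⟩ := openBisimilarAt_bisim.tau H' (hs.bs Msg.nm (nmFor c z))
  have hs₂ := hs'.bs (rgFor z d) Msg.rg
  rw [← Proc.subst_eq, Proc.unrg_subst hQ] at hs₂
  refine ⟨_, hs₂, c, d, h₀, H, fun h => hP (hs.fn.2 h), fun h => hQ (hs₂.fn.2 h), ?_⟩
  rw [← Proc.subst_eq, Proc.subst_unrg fun h' => (Proc.mem_rn_unrg.1 (hs'.rn.2 h')).2 rfl]
  exact H''

theorem FlexAt.inp {z x : ℕ} {h : Trace} {P Q P' : Proc} {M : Msg} (H : FlexAt z h P Q)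
    (hxz : x ≠ z) (hs : Step P (.inp M) (.abs P')) (hM : Syn h.fst M) (hx : x ∉ h.fn) :
    ∃ N Q', Step Q (.inp N) (.abs Q') ∧ FlexAt z ((Mark.i, .nm x, .nm x) :: (Mark.i, M, N) :: h)
      (P'.subst (inst (.nm x))) (Q'.subst (inst (.nm x))) := by
  obtain ⟨c, d, h₀, H, hP, hQ, H'⟩ := H
  obtain ⟨N₀, Q₀, hs', H''⟩ := openBisimilarAt_bisim.inp H' (hs.bs Msg.nm (nmFor c z))
    (H.syn_unrg hM) (fun h' => hx ((H.mem_fn hxz).1 h'))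
  have hs₂ := hs'.bs (rgFor z d) Msg.rg
  rw [← Proc.subst_eq, Proc.unrg_subst hQ] at hs₂
  have hzN : z ∉ (N₀.bs (rgFor z d) Msg.rg).fn := fun h' => hQ (hs₂.fn.1 h')
  have hdN : d ∉ N₀.rn := fun h' => (Proc.mem_rn_unrg.1 (hs'.rn.1 h')).2 rfl
  have hzx : z ∉ (Msg.nm x).fn := hxz.symm
  refine ⟨_, _, hs₂, c, d, _, (H.step .i (fun h' => hP (hs.fn.1 h')) hzN).step .i hzx hzx, ?_, ?_,
    ?_⟩
  · exact fun h' => (Proc.fn_inst h').elim hzx fun h' => hP (hs.fn.2 h')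
  · exact fun h' => (Proc.fn_inst h').elim hzx fun h' => hQ (hs₂.fn.2 h')
  · have e : (Q₀.bs (lift (rgFor z d)) (liftR Msg.rg)).subst (inst (.nm x)) =
        (Q₀.subst (inst (.nm x))).subst (rgFor z d) := by
      conv_rhs => rw [Proc.subst_eq, Proc.bs_inst]
      simp only [Msg.bs, rgFor_of_ne hxz]
    rw [e, Proc.subst_unrg, ← Msg.subst_eq, Msg.subst_unrg hdN, Proc.unrg, Proc.bs_inst]
    · exact H''
    · exact fun h' => (Proc.rn_inst h').elim _root_.id fun h' =>
        (Proc.mem_rn_unrg.1 (hs'.rn.2 h')).2 rfl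

theorem FlexAt.out {z k : ℕ} {h : Trace} {P Q P' : Proc} {M M' : Msg} (H : FlexAt z h P Q)
    (hs : Step P (.out M) (.conc k M' P')) (hM : Syn h.fst M) :
    ∃ N l N' Q', Step Q (.out N) (.conc l N' Q') ∧
      ∀ (c : Fin k → ℕ) (d : Fin l → ℕ), Function.Injective c → Function.Injective d →
        Disjoint (Set.range c) (h.rnL ∪ P.rn) → Disjoint (Set.range d) (h.rnR ∪ Q.rn) →
        FlexAt z ((Mark.o, M'.subst (instRigid c), N'.subst (instRigid d)) :: (Mark.i, M, N) :: h)
          (P'.subst (instRigid c)) (Q'.subst (instRigid d)) := by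
  obtain ⟨c, d, h₀, H, hP, hQ, H'⟩ := H
  obtain ⟨N₀, l, N', Q₀, hs', H''⟩ := openBisimilarAt_bisim.out H' (hs.bs Msg.nm (nmFor c z))
    (H.syn_unrg hM)
  have hs₂ := hs'.bs (rgFor z d) Msg.rg
  rw [← Proc.subst_eq, Proc.unrg_subst hQ] at hs₂
  have hzN : z ∉ (N₀.bs (rgFor z d) Msg.rg).fn := fun h' => hQ (hs₂.fn.1 h')
  have hdN : d ∉ N₀.rn := fun h' => (Proc.mem_rn_unrg.1 (hs'.rn.1 h')).2 rfl
  refine ⟨_, l, _, _, hs₂, fun c' d' hc' hd' hcf hdf => ?_⟩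
  have hc : ∀ i, c' i ≠ c := fun i e =>
    Set.disjoint_left.1 hcf ⟨i, rfl⟩ (.inl (by rw [e]; exact H.mem_rnL))
  have hd : d ∉ Set.range d' := fun h' => Set.disjoint_left.1 hdf h' (.inl H.mem_rnR)
  refine ⟨c, d, _, (H.step .i (fun h' => hP (hs.fn.1 h')) hzN).step .o ?_ ?_, ?_, ?_, ?_⟩
  · exact fun h' => hP (hs.fn.2 (.inl (Msg.fn_instRigid h')))
  · exact fun h' => hQ (hs₂.fn.2 (.inl (Msg.fn_instRigid h')))
  · exact fun h' => hP (hs.fn.2 (.inr (Proc.fn_instRigid h')))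
  · exact fun h' => hQ (hs₂.fn.2 (.inr (Proc.fn_instRigid h')))
  · rw [← Proc.bs_instRigid (rgFor z d) Msg.rg (c := d') fun _ => rfl,
      ← Msg.bs_instRigid (rgFor z d) Msg.rg (c := d') fun _ => rfl, ← Proc.subst_eq,
      ← Msg.subst_eq, Proc.subst_unrg, Msg.subst_unrg, ← Msg.subst_eq, Msg.subst_unrg hdN,
      Proc.unrg, Proc.bs_instRigid (c' := c'), Msg.unrg, Msg.bs_instRigid (c' := c')]
    · refine H'' c' d' hc' hd' (hcf.mono_right ?_) (hdf.mono_right ?_)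
      · exact Set.union_subset_union H.rnL_subset fun x hx => (Proc.mem_rn_unrg.1 hx).1
      · exact Set.union_subset_union H.rnR_subset fun x hx => (Proc.mem_rn_unrg.1 hx).1
    · exact fun i => nmFor_of_ne (hc i)
    · exact fun i => nmFor_of_ne (hc i)
    · exact fun h' => (Msg.rn_instRigid h').elim hd fun h' =>
        (Proc.mem_rn_unrg.1 (hs'.rn.2 (.inl h'))).2 rfl
    · exact fun h' => (Proc.rn_instRigid h').elim hd fun h' =>
        (Proc.mem_rn_unrg.1 (hs'.rn.2 (.inr h'))).2 rfl

/-- The representative is existentially quantified because it has to vary: a substitution or a newly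
input name may clash with it. -/
theorem flexAt_bisim : Bisim fun h P Q => ∃ z, FlexAt z h P Q where
  fn := fun ⟨_, H⟩ => H.fn
  consistent := fun ⟨_, H⟩ => H.consistent
  symm := fun ⟨z, H⟩ => ⟨z, H.inverse⟩
  subst := fun ⟨_, H⟩ hr => by
    obtain ⟨z', hz'⟩ := (Trace.fn_finite _).exists_notMem
    exact ⟨z', H.subst hr hz'⟩
  tau := fun ⟨z, H⟩ hs => by
    obtain ⟨Q', hs', H'⟩ := H.tau hs
    exact ⟨Q', hs', z, H'⟩
  inp := fun {h P Q M P' x} ⟨_, H⟩ hs hM hx => by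
    obtain ⟨z, hz⟩ := (h.fn_finite.insert x).exists_notMem
    obtain ⟨N, Q', hs', H'⟩ := (H.change fun h' => hz (.inr h')).inp (fun e => hz (.inl e.symm))
      hs hM hx
    exact ⟨N, Q', hs', z, H'⟩
  out := fun ⟨z, H⟩ hs hM => by
    obtain ⟨N, l, N', Q', hs', H'⟩ := H.out hs hM
    exact ⟨N, l, N', Q', hs', fun c d hc hd h₁ h₂ => ⟨z, H' c d hc hd h₁ h₂⟩⟩

/-- A name may be replaced by a pair of rigid names that are output before its first use. -/
theorem OpenBisimilarAt.flex {z c d : ℕ} {h₀ h : Trace} {P Q : Proc} (H : Flex z c d h₀ h)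
    (hP : z ∉ P.fn) (hQ : z ∉ Q.fn) (H' : OpenBisimilarAt h₀ (P.unrg c z) (Q.unrg d z)) :
    OpenBisimilarAt h P Q :=
  flexAt_bisim.le ⟨z, c, d, h₀, H, hP, hQ, H'⟩

/-- Fresh rigid names may be added to the knowledge of the observer. -/
theorem OpenBisimilarAt.weaken {c d : ℕ} {h : Trace} {P Q : Proc} (H : OpenBisimilarAt h P Q)
    (hc : c ∉ h.rnL ∪ P.rn) (hd : d ∉ h.rnR ∪ Q.rn) :
    OpenBisimilarAt ((Mark.o, .rg c, .rg d) :: h) P Q := by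
  obtain ⟨z, hz⟩ := h.fn_finite.exists_notMem
  have hfn := openBisimilarAt_bisim.fn H
  refine .flex (.start hz (fun h => hc (.inl h)) fun h => hd (.inl h))
    (fun h => hz (hfn (.inl h))) (fun h => hz (hfn (.inr h))) ?_
  rwa [Proc.unrg_eq_self fun h => hc (.inr h), Proc.unrg_eq_self fun h => hd (.inr h)]

/-! ### Processes of the same form with equivalent messages -/

/-- A theory seen from under `k` binders. -/
def shiftT (k : ℕ) (Γ : Set (Msg × Msg)) : Set (Msg × Msg) :=
  (fun p => (p.1.rename (· + k), p.2.rename (· + k))) '' Γ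

theorem Msg.rename_rename (f g : ℕ → ℕ) (M : Msg) :
    (M.rename f).rename g = M.rename fun x => g (f x) := by
  simp only [rename_eq, bs_bs, bs]

theorem Msg.rename_id (M : Msg) : (M.rename fun x => x) = M := M.subst_nm

theorem Msg.rename_congr {f g : ℕ → ℕ} {M : Msg} (h : ∀ x ∈ M.fn, f x = g x) :
    M.rename f = M.rename g :=
  Msg.subst_congr fun x hx => by rw [h x hx]

theorem shiftT_shiftT (j k : ℕ) (Γ : Set (Msg × Msg)) :
    shiftT j (shiftT k Γ) = shiftT (k + j) Γ := by
  simp [shiftT, Set.image_image, Msg.rename_rename, add_assoc]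

theorem shiftT_zero (Γ : Set (Msg × Msg)) : shiftT 0 Γ = Γ := by
  simp [shiftT, Msg.rename_id]

theorem shiftT_finite {Γ : Set (Msg × Msg)} (h : Γ.Finite) (k : ℕ) : (shiftT k Γ).Finite :=
  h.image _

theorem Eqv.rename {Γ Γ' : Set (Msg × Msg)} {M N : Msg} (h : Eqv Γ M N) {f : ℕ → ℕ}
    (hΓ : ∀ p ∈ Γ, Eqv Γ' (p.1.rename f) (p.2.rename f)) : Eqv Γ' (M.rename f) (N.rename f) := by
  simp only [Msg.rename_eq] at hΓ ⊢
  exact h.bs (fun x => .var _) hΓ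

theorem Eqv.shift {Γ : Set (Msg × Msg)} {M N : Msg} (h : Eqv Γ M N) (k : ℕ) :
    Eqv (shiftT k Γ) (M.rename (· + k)) (N.rename (· + k)) :=
  h.rename fun p hp => .id ⟨p, hp, rfl⟩

theorem fn_shiftT {Γ : Set (Msg × Msg)} {k x : ℕ} (hx : x < k) :
    ∀ p ∈ shiftT k Γ, x ∉ p.1.fn ∧ x ∉ p.2.fn := by
  rintro _ ⟨p, -, rfl⟩
  constructor <;> intro h <;> obtain ⟨y, -, e⟩ := Msg.mem_fn_rename.1 h <;> omega

/-- A shifted theory does not contain the indices below `k`, so these occur on both sides or on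
neither. This synchronizes the decisions about scope extrusion. -/
theorem Eqv.mem_fn_shiftT {Γ : Set (Msg × Msg)} {M N : Msg} {k x : ℕ} (h : Eqv (shiftT k Γ) M N)
    (hx : x < k) : x ∈ M.fn ↔ x ∈ N.fn := by
  constructor <;> intro h'
  · rcases h.fn_left h' with h' | ⟨p, hp, h'⟩
    exacts [h', absurd h' (fn_shiftT hx p hp).1]
  · rcases h.fn_right h' with h' | ⟨p, hp, h'⟩
    exacts [h', absurd h' (fn_shiftT hx p hp).2]

theorem Eqv.of_shift {Γ : Set (Msg × Msg)} {M N : Msg}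
    (h : Eqv (shiftT 1 Γ) (M.rename Nat.succ) N) : ∃ N', N = N'.rename Nat.succ ∧ Eqv Γ M N' := by
  refine ⟨N.rename Nat.pred, ?_, ?_⟩
  · rw [Msg.rename_rename, Msg.rename_congr (g := fun x => x), Msg.rename_id]
    intro x hx
    rcases x with _ | x
    · rw [← h.mem_fn_shiftT one_pos] at hx
      obtain ⟨y, -, e⟩ := Msg.mem_fn_rename.1 hx
      omega
    · rfl
  · have := h.rename (f := Nat.pred) (Γ' := Γ) (by
      rintro _ ⟨p, hp, rfl⟩
      simp only [Msg.rename_rename, Nat.pred_eq_sub_one, Nat.add_sub_cancel, Msg.rename_id]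
      exact .id hp)
    rw [Msg.rename_rename] at this
    simpa only [Nat.pred_succ, Msg.rename_id] using this

/-- The shift is not invertible, as it misses the index `0`. But `Γ` has only finitely many names,
so `0` can be sent beyond them all, and `ConsistentTheory.transport` applies. -/
theorem ConsistentTheory.shift {Γ : Set (Msg × Msg)} (h : ConsistentTheory Γ) (hf : Γ.Finite) :
    ConsistentTheory (shiftT 1 Γ) := by
  have hfin : (⋃ p ∈ Γ, p.1.fn ∪ p.2.fn).Finite :=
    hf.biUnion fun p _ => p.1.fn_finite.union p.2.fn_finite
  obtain ⟨m, hm⟩ := hfin.bddAbove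
  have hm' : ∀ p ∈ Γ, ∀ x ∈ p.1.fn ∪ p.2.fn, x ≤ m := fun p hp x hx =>
    hm (Set.mem_biUnion hp hx)
  -- This undoes the shift on the indices from `1` to `m + 1` and sends `0` to the vacated value `m
  -- + 1`.
  let f : ℕ → ℕ := fun n => if n = 0 then m + 1 else if n ≤ m + 1 then n - 1 else n
  have inj : Function.Injective f := by
    intro x y hxy
    simp only [f] at hxy
    split_ifs at hxy <;> omega
  have key : ∀ x ≤ m, f (x + 1) = x := fun x hx => by simp [f, hx]
  have key' : ∀ x ≤ m, Function.invFun f x = x + 1 := fun x hx => by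
    have := Function.leftInverse_invFun inj (x + 1)
    rwa [key x hx] at this
  refine h.transport (φ₁ := fun x => .nm (f x)) (φ₂ := fun x => .nm (f x)) (r₁ := Msg.rg)
    (r₂ := Msg.rg) (γ₁ := fun x => .nm (Function.invFun f x))
    (γ₂ := fun x => .nm (Function.invFun f x)) (s₁ := Msg.rg) (s₂ := Msg.rg) ?_ (fun x => .var _) ?_
    (fun x => .var _) ?_ (fun _ => rfl) ?_ (fun _ => rfl) (fun _ => trivial) (fun _ _ => trivial)
  · rintro _ ⟨p, hp, rfl⟩
    simp only [← Msg.rename_eq, Msg.rename_rename]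
    rw [Msg.rename_congr (g := fun x => x) fun x hx => key x (hm' p hp x (.inl hx)),
      Msg.rename_congr (g := fun x => x) fun x hx => key x (hm' p hp x (.inr hx)), Msg.rename_id,
      Msg.rename_id]
    exact .id hp
  · intro p hp
    simp only [← Msg.rename_eq]
    rw [Msg.rename_congr (g := (· + 1)) fun x hx => key' x (hm' p hp x (.inl hx)),
      Msg.rename_congr (g := (· + 1)) fun x hx => key' x (hm' p hp x (.inr hx))]
    exact .id ⟨p, hp, rfl⟩
  · exact fun x => by simp only [Msg.bs, Function.leftInverse_invFun inj x]
  · exact fun x => by simp only [Msg.bs, Function.leftInverse_invFun inj x]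

/-- Processes of the same form whose messages are equivalent in the theory `Γ`, up to commuting
parallel components. -/
inductive PRel : Set (Msg × Msg) → Proc → Proc → Prop
  | nil {Γ} : PRel Γ .nil .nil
  | out {Γ M M' N N' P P'} : Eqv Γ M M' → Eqv Γ N N' → PRel Γ P P' →
      PRel Γ (.out M N P) (.out M' N' P')
  | inp {Γ M M' P P'} : Eqv Γ M M' → PRel (shiftT 1 Γ) P P' → PRel Γ (.inp M P) (.inp M' P')
  | par {Γ P P' Q Q'} : PRel Γ P P' → PRel Γ Q Q' → PRel Γ (.par P Q) (.par P' Q')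
  | swap {Γ P P' Q Q'} : PRel Γ P P' → PRel Γ Q Q' → PRel Γ (.par P Q) (.par Q' P')
  | res {Γ P P'} : PRel (shiftT 1 Γ) P P' → PRel Γ (.res P) (.res P')
  | bang {Γ P P'} : PRel Γ P P' → PRel Γ (.bang P) (.bang P')
  | mat {Γ M M' N N' P P'} : Eqv Γ M M' → Eqv Γ N N' → PRel Γ P P' →
      PRel Γ (.mat M N P) (.mat M' N' P')
  | letp {Γ M M' P P'} : Eqv Γ M M' → PRel (shiftT 2 Γ) P P' → PRel Γ (.letp M P) (.letp M' P')
  | dec {Γ M M' N N' P P'} : Eqv Γ M M' → Eqv Γ N N' → PRel (shiftT 1 Γ) P P' →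
      PRel Γ (.dec M N P) (.dec M' N' P')

/-- Pure messages are equivalent to themselves in every theory; messages with rigid names need not
be. -/
theorem PRel.refl {Γ : Set (Msg × Msg)} {P : Proc} (h : P.IsPure) : PRel Γ P P := by
  induction P generalizing Γ <;> simp only [Proc.IsPure, Proc.rn, Set.union_empty_iff] at *
  case nil => exact .nil
  case out ih => exact .out (.of_pure h.1.1) (.of_pure h.1.2) (ih h.2)
  case inp ih => exact .inp (.of_pure h.1) (ih h.2)
  case par ih₁ ih₂ => exact .par (ih₁ h.1) (ih₂ h.2)
  case res ih => exact .res (ih h)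
  case bang ih => exact .bang (ih h)
  case mat ih => exact .mat (.of_pure h.1.1) (.of_pure h.1.2) (ih h.2)
  case letp ih => exact .letp (.of_pure h.1) (ih h.2)
  case dec ih => exact .dec (.of_pure h.1.1) (.of_pure h.1.2) (ih h.2)

theorem sw_shiftT (k : ℕ) (Γ : Set (Msg × Msg)) : sw (shiftT k Γ) = shiftT k (sw Γ) := by
  simp [sw, shiftT, Set.image_image]

theorem PRel.sw {Γ : Set (Msg × Msg)} {P Q : Proc} (h : PRel Γ P Q) : PRel (sw Γ) Q P := by
  induction h with
  | nil => exact .nil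
  | out h₁ h₂ _ ih => exact .out h₁.sw h₂.sw ih
  | inp h₁ _ ih => exact .inp h₁.sw (sw_shiftT _ _ ▸ ih)
  | par _ _ ih₁ ih₂ => exact .par ih₁ ih₂
  | swap _ _ ih₁ ih₂ => exact .swap ih₂ ih₁
  | res _ ih => exact .res (sw_shiftT _ _ ▸ ih)
  | bang _ ih => exact .bang ih
  | mat h₁ h₂ _ ih => exact .mat h₁.sw h₂.sw ih
  | letp h₁ _ ih => exact .letp h₁.sw (sw_shiftT _ _ ▸ ih)
  | dec h₁ h₂ _ ih => exact .dec h₁.sw h₂.sw (sw_shiftT _ _ ▸ ih)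

theorem Msg.rename_add_bs (k : ℕ) (θ ρ : ℕ → Msg) (M : Msg) :
    (M.rename (· + k)).bs (lift^[k] θ) (liftR^[k] ρ) = (M.bs θ ρ).rename (· + k) := by
  simp only [rename_eq, bs_bs]
  refine Msg.bs_congr _ (fun x _ => ?_) fun a _ => ?_
  · simp [Msg.bs, lift_iterate, Msg.rename_eq]
  · simp [Msg.bs, liftR_iterate, Msg.rename_eq]

theorem Eqv.lift_iterate {Γ : Set (Msg × Msg)} {θ₁ θ₂ : ℕ → Msg} (h : ∀ x, Eqv Γ (θ₁ x) (θ₂ x))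
    (k x : ℕ) : Eqv (shiftT k Γ) (lift^[k] θ₁ x) (lift^[k] θ₂ x) := by
  rw [Spi.lift_iterate, Spi.lift_iterate]
  split_ifs
  · exact .var x
  · exact (h _).shift k

theorem PRel.bs {Γ Γ' : Set (Msg × Msg)} {θ₁ ρ₁ θ₂ ρ₂ : ℕ → Msg} {P Q : Proc} (h : PRel Γ P Q)
    (hx : ∀ x, Eqv Γ' (θ₁ x) (θ₂ x)) (hΓ : ∀ p ∈ Γ, Eqv Γ' (p.1.bs θ₁ ρ₁) (p.2.bs θ₂ ρ₂)) :
    PRel Γ' (P.bs θ₁ ρ₁) (Q.bs θ₂ ρ₂) := by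
  have up {Γ Γ' : Set (Msg × Msg)} {θ₁ ρ₁ θ₂ ρ₂ : ℕ → Msg} (k : ℕ)
      (hΓ : ∀ p ∈ Γ, Eqv Γ' (p.1.bs θ₁ ρ₁) (p.2.bs θ₂ ρ₂)) : ∀ p ∈ shiftT k Γ, Eqv (shiftT k Γ')
        (p.1.bs (lift^[k] θ₁) (liftR^[k] ρ₁)) (p.2.bs (lift^[k] θ₂) (liftR^[k] ρ₂)) := by
    rintro _ ⟨p, hp, rfl⟩
    simp only [Msg.rename_add_bs]
    exact (hΓ p hp).shift k
  induction h generalizing Γ' θ₁ ρ₁ θ₂ ρ₂ with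
  | nil => exact .nil
  | out h₁ h₂ _ ih => exact .out (h₁.bs hx hΓ) (h₂.bs hx hΓ) (ih hx hΓ)
  | inp h₁ _ ih => exact .inp (h₁.bs hx hΓ) (ih (Eqv.lift_iterate hx 1) (up 1 hΓ))
  | par _ _ ih₁ ih₂ => exact .par (ih₁ hx hΓ) (ih₂ hx hΓ)
  | swap _ _ ih₁ ih₂ => exact .swap (ih₁ hx hΓ) (ih₂ hx hΓ)
  | res _ ih => exact .res (ih (Eqv.lift_iterate hx 1) (up 1 hΓ))
  | bang _ ih => exact .bang (ih hx hΓ)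
  | mat h₁ h₂ _ ih => exact .mat (h₁.bs hx hΓ) (h₂.bs hx hΓ) (ih hx hΓ)
  | letp h₁ _ ih => exact .letp (h₁.bs hx hΓ) (ih (Eqv.lift_iterate hx 2) (up 2 hΓ))
  | dec h₁ h₂ _ ih =>
    exact .dec (h₁.bs hx hΓ) (h₂.bs hx hΓ) (ih (Eqv.lift_iterate hx 1) (up 1 hΓ))

theorem PRel.cut {Γ Γ' : Set (Msg × Msg)} {P Q : Proc} (h : PRel Γ P Q)
    (hΓ : ∀ p ∈ Γ, Eqv Γ' p.1 p.2) : PRel Γ' P Q := by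
  have := h.bs (Γ' := Γ') (θ₁ := Msg.nm) (θ₂ := Msg.nm) (ρ₁ := Msg.rg) (ρ₂ := Msg.rg)
    (fun x => .var x) (by simpa only [Msg.bs_id] using hΓ)
  rwa [Proc.bs_id, Proc.bs_id] at this

theorem PRel.subst {Γ Γ' : Set (Msg × Msg)} {θ₁ θ₂ : ℕ → Msg} {P Q : Proc} (h : PRel Γ P Q)
    (hx : ∀ x, Eqv Γ' (θ₁ x) (θ₂ x)) (hΓ : ∀ p ∈ Γ, Eqv Γ' (p.1.subst θ₁) (p.2.subst θ₂)) :
    PRel Γ' (P.subst θ₁) (Q.subst θ₂) := by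
  rw [Proc.subst_eq, Proc.subst_eq]
  exact h.bs hx (by simpa only [Msg.subst_eq] using hΓ)

theorem PRel.rename {Γ Γ' : Set (Msg × Msg)} {P Q : Proc} (h : PRel Γ P Q) {f : ℕ → ℕ}
    (hΓ : ∀ p ∈ Γ, Eqv Γ' (p.1.rename f) (p.2.rename f)) : PRel Γ' (P.rename f) (Q.rename f) :=
  h.subst (fun _ => .var _) hΓ

theorem PRel.shift {Γ : Set (Msg × Msg)} {P Q : Proc} (h : PRel Γ P Q) (k : ℕ) :
    PRel (shiftT k Γ) (P.rename (· + k)) (Q.rename (· + k)) :=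
  h.rename fun p hp => .id ⟨p, hp, rfl⟩

theorem PRel.resIter {Γ : Set (Msg × Msg)} {k : ℕ} {P Q : Proc} (h : PRel (shiftT k Γ) P Q) :
    PRel Γ (P.resIter k) (Q.resIter k) := by
  induction k generalizing P Q with
  | zero => rwa [shiftT_zero] at h
  | succ k ih =>
    refine ih (.res ?_)
    rwa [shiftT_shiftT]

theorem PRel.inst {Γ : Set (Msg × Msg)} {P Q : Proc} (h : PRel (shiftT 1 Γ) P Q) {M N : Msg}
    (hM : Eqv Γ M N) : PRel Γ (P.subst (inst M)) (Q.subst (inst N)) := by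
  refine h.subst (fun x => ?_) ?_
  · rcases x with _ | x
    exacts [hM, .var x]
  · rintro _ ⟨p, hp, rfl⟩
    simp only [Msg.rename, Msg.subst_subst, Msg.subst, Spi.inst, Msg.subst_nm]
    exact .id hp

theorem PRel.inst₂ {Γ : Set (Msg × Msg)} {P Q : Proc} (h : PRel (shiftT 2 Γ) P Q) {M N M' N' : Msg}
    (hM : Eqv Γ M M') (hN : Eqv Γ N N') :
    PRel Γ (P.subst (inst₂ M N)) (Q.subst (inst₂ M' N')) := by
  refine h.subst (fun x => ?_) ?_
  · rcases x with _ | _ | x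
    exacts [hM, hN, .var x]
  · rintro _ ⟨p, hp, rfl⟩
    simp only [Msg.rename, Msg.subst_subst, Msg.subst, Spi.inst₂, Msg.subst_nm]
    exact .id hp

theorem PRel.receive {Γ : Set (Msg × Msg)} {k : ℕ} {P Q : Proc} (h : PRel (shiftT 1 Γ) P Q)
    {M N : Msg} (hM : Eqv (shiftT k Γ) M N) :
    PRel (shiftT k Γ) (P.receive k M) (Q.receive k N) := by
  refine h.subst (fun x => ?_) ?_
  · rcases x with _ | x
    exacts [hM, .var _]
  · rintro _ ⟨p, hp, rfl⟩
    simp only [Msg.rename, Msg.subst_subst, Msg.subst]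
    exact .id ⟨p, hp, rfl⟩

inductive ActRel (Γ : Set (Msg × Msg)) : Act → Act → Prop
  | tau : ActRel Γ .tau .tau
  | inp {M N} : Eqv Γ M N → ActRel Γ (.inp M) (.inp N)
  | out {M N} : Eqv Γ M N → ActRel Γ (.out M) (.out N)

inductive AgentRel (Γ : Set (Msg × Msg)) : Agent → Agent → Prop
  | proc {P Q} : PRel Γ P Q → AgentRel Γ (.proc P) (.proc Q)
  | abs {P Q} : PRel (shiftT 1 Γ) P Q → AgentRel Γ (.abs P) (.abs Q)
  | conc {k M N P Q} : Eqv (shiftT k Γ) M N → PRel (shiftT k Γ) P Q →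
      AgentRel Γ (.conc k M P) (.conc k N Q)

theorem ActRel.of_shift {Γ : Set (Msg × Msg)} {α β : Act} (h : ActRel (shiftT 1 Γ) α.shift β) :
    ∃ β', β = β'.shift ∧ ActRel Γ α β' := by
  cases α <;> cases h
  · exact ⟨.tau, rfl, .tau⟩
  · obtain ⟨N, rfl, hN⟩ := Eqv.of_shift ‹_›; exact ⟨.inp N, rfl, .inp hN⟩
  · obtain ⟨N, rfl, hN⟩ := Eqv.of_shift ‹_›; exact ⟨.out N, rfl, .out hN⟩

/-- By `Eqv.mem_fn_shiftT` either both sides extrude the restricted name or neither does; the rest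
is arithmetic on indices. -/
theorem AgentRel.res {Γ : Set (Msg × Msg)} {A B : Agent} (h : AgentRel (shiftT 1 Γ) A B) :
    AgentRel Γ A.res B.res := by
  cases h with
  | proc h => exact .proc (.res h)
  | abs h =>
    refine .abs (.res (h.rename ?_))
    rw [shiftT_shiftT]
    rintro _ ⟨p, hp, rfl⟩
    simp only [Msg.rename_rename]
    exact .id ⟨p, hp, rfl⟩
  | @conc k M N P Q hM h =>
    rw [shiftT_shiftT] at hM h
    have key := hM.mem_fn_shiftT (show k < 1 + k by omega)
    by_cases hk : k ∈ N.fn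
    · simp only [Agent.res, key, hk, if_true]
      rw [add_comm] at hM h
      exact .conc hM h
    · simp only [Agent.res, key, hk, if_false]
      refine .conc (hM.rename ?_) (.res (h.rename ?_))
      · rintro _ ⟨p, hp, rfl⟩
        simp only [Msg.rename_rename]
        have e : (fun x => if k < x + (1 + k) then x + (1 + k) - 1 else x + (1 + k)) = (· + k) := by
          funext x; rw [if_pos (by omega)]; omega
        rw [e]
        exact .id ⟨p, hp, rfl⟩
      · rw [shiftT_shiftT]
        rintro _ ⟨p, hp, rfl⟩
        simp only [Msg.rename_rename]
        have e : (fun x => if x + (1 + k) < k then x + (1 + k) + 1 else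
            if x + (1 + k) = k then 0 else x + (1 + k)) = (· + (k + 1)) := by
          funext x; rw [if_neg (by omega), if_neg (by omega)]; omega
        rw [e]
        exact .id ⟨p, hp, rfl⟩

theorem AgentRel.parL {Γ : Set (Msg × Msg)} {A B : Agent} (h : AgentRel Γ A B) {P Q : Proc}
    (hP : PRel Γ P Q) : AgentRel Γ (A.parL P) (B.parL Q) := by
  cases h with
  | proc h => exact .proc (.par h hP)
  | abs h => exact .abs (.par h (hP.shift 1))
  | conc hM h => exact .conc hM (.par h (hP.shift _))

theorem AgentRel.parR {Γ : Set (Msg × Msg)} {A B : Agent} (h : AgentRel Γ A B) {P Q : Proc}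
    (hP : PRel Γ P Q) : AgentRel Γ (A.parR P) (B.parR Q) := by
  cases h with
  | proc h => exact .proc (.par hP h)
  | abs h => exact .abs (.par (hP.shift 1) h)
  | conc hM h => exact .conc hM (.par (hP.shift _) h)

theorem AgentRel.parLR {Γ : Set (Msg × Msg)} {A B : Agent} (h : AgentRel Γ A B) {P Q : Proc}
    (hP : PRel Γ P Q) : AgentRel Γ (A.parL P) (B.parR Q) := by
  cases h with
  | proc h => exact .proc (.swap h hP)
  | abs h => exact .abs (.swap h (hP.shift 1))
  | conc hM h => exact .conc hM (.swap h (hP.shift _))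

theorem AgentRel.parRL {Γ : Set (Msg × Msg)} {A B : Agent} (h : AgentRel Γ A B) {P Q : Proc}
    (hP : PRel Γ P Q) : AgentRel Γ (A.parR P) (B.parL Q) := by
  cases h with
  | proc h => exact .proc (.swap hP h)
  | abs h => exact .abs (.swap (hP.shift 1) h)
  | conc hM h => exact .conc hM (.swap (hP.shift _) h)

/-- Apart from replication, each reduction rests on its own part of consistency: matching on
uniqueness of partners, splitting on equality of shape, decryption on uniqueness of keys. -/
theorem PRel.red {Γ : Set (Msg × Msg)} (hΓ : ConsistentTheory Γ) {P P' Q : Proc} (h : PRel Γ P Q)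
    (hr : Red P P') : ∃ Q', Red Q Q' ∧ PRel Γ P' Q' := by
  cases hr with
  | bang P => cases h with | bang h => exact ⟨_, .bang _, .par h (.bang h)⟩
  | mat M P =>
    cases h with
    | mat h₁ h₂ h =>
      obtain rfl := hΓ.unique_right _ _ _ h₁ h₂
      exact ⟨_, .mat _ _, h⟩
  | letp M N P =>
    cases h with
    | @letp _ _ M' _ _ h₁ h =>
      have := hΓ.sameType _ _ h₁
      cases M' <;> simp only [Msg.SameType] at this
      exact ⟨_, .letp _ _ _, h.inst₂ h₁.inv_pair.1 h₁.inv_pair.2⟩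
  | dec M K P =>
    cases h with
    | @dec _ _ M' _ _ _ _ h₁ h₂ h =>
      have := hΓ.sameType _ _ h₁
      cases M' <;> simp only [Msg.SameType] at this
      obtain rfl := hΓ.key_unique h₁ h₂
      exact ⟨_, .dec _ _ _, h.inst (h₁.inv_enc h₂)⟩

theorem AgentRel.exists_tau {Γ : Set (Msg × Msg)} {Q P' : Proc}
    (h : ∃ β B, Step Q β B ∧ ActRel Γ .tau β ∧ AgentRel Γ (.proc P') B) :
    ∃ Q', Step Q .tau (.proc Q') ∧ PRel Γ P' Q' := by
  obtain ⟨_, _, s, ha, hb⟩ := h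
  cases ha; cases hb with | proc b => exact ⟨_, s, b⟩

theorem AgentRel.exists_inp {Γ : Set (Msg × Msg)} {Q P' : Proc} {M : Msg}
    (h : ∃ β B, Step Q β B ∧ ActRel Γ (.inp M) β ∧ AgentRel Γ (.abs P') B) :
    ∃ N Q', Step Q (.inp N) (.abs Q') ∧ Eqv Γ M N ∧ PRel (shiftT 1 Γ) P' Q' := by
  obtain ⟨_, _, s, ha, hb⟩ := h
  cases ha with | inp a => cases hb with | abs b => exact ⟨_, _, s, a, b⟩

theorem AgentRel.exists_out {Γ : Set (Msg × Msg)} {Q P' : Proc} {M M' : Msg} {k : ℕ}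
    (h : ∃ β B, Step Q β B ∧ ActRel Γ (.out M) β ∧ AgentRel Γ (.conc k M' P') B) :
    ∃ N N' Q', Step Q (.out N) (.conc k N' Q') ∧ Eqv Γ M N ∧ Eqv (shiftT k Γ) M' N' ∧
      PRel (shiftT k Γ) P' Q' := by
  obtain ⟨_, _, s, ha, hb⟩ := h
  cases ha with | out a => cases hb with | conc c b => exact ⟨_, _, _, s, a, c, b⟩

open AgentRel in
-- Processes of the same form make the same moves. In a communication the two answering channels are
-- partners of one message, hence equal; under a restriction the shifted theory is consistent
-- because `Γ` is finite.
theorem PRel.step {Γ : Set (Msg × Msg)} (hΓ : ConsistentTheory Γ) (hf : Γ.Finite) {P Q : Proc}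
    {α : Act} {A : Agent} (h : PRel Γ P Q) (hs : Step P α A) :
    ∃ β B, Step Q β B ∧ ActRel Γ α β ∧ AgentRel Γ A B := by
  induction hs generalizing Γ Q with
  | inp M P => cases h with | inp hM h => exact ⟨_, _, .inp _ _, .inp hM, .abs h⟩
  | out M N P =>
    cases h with
    | out hM hN h =>
      refine ⟨_, _, .out _ _ _, .out hM, .conc ?_ ?_⟩ <;> rwa [shiftT_zero]
  | comL _ _ ih₁ ih₂ =>
    cases h with
    | par h₁ h₂ =>
      obtain ⟨N, Q₁, s₁, a₁, b₁⟩ := exists_inp (ih₁ hΓ hf h₁)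
      obtain ⟨N', _, Q₂, s₂, a₂, c₂, b₂⟩ := exists_out (ih₂ hΓ hf h₂)
      obtain rfl := hΓ.unique_right _ _ _ a₁ a₂
      exact ⟨_, _, .comL s₁ s₂, .tau, .proc (.resIter (.par (b₁.receive c₂) b₂))⟩
    | swap h₁ h₂ =>
      obtain ⟨N, Q₁, s₁, a₁, b₁⟩ := exists_inp (ih₁ hΓ hf h₁)
      obtain ⟨N', _, Q₂, s₂, a₂, c₂, b₂⟩ := exists_out (ih₂ hΓ hf h₂)
      obtain rfl := hΓ.unique_right _ _ _ a₁ a₂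
      exact ⟨_, _, .comR s₂ s₁, .tau, .proc (.resIter (.swap (b₁.receive c₂) b₂))⟩
  | comR _ _ ih₁ ih₂ =>
    cases h with
    | par h₁ h₂ =>
      obtain ⟨N, Q₁, s₁, a₁, b₁⟩ := exists_inp (ih₂ hΓ hf h₂)
      obtain ⟨N', _, Q₂, s₂, a₂, c₂, b₂⟩ := exists_out (ih₁ hΓ hf h₁)
      obtain rfl := hΓ.unique_right _ _ _ a₁ a₂
      exact ⟨_, _, .comR s₂ s₁, .tau, .proc (.resIter (.par b₂ (b₁.receive c₂)))⟩
    | swap h₁ h₂ =>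
      obtain ⟨N, Q₁, s₁, a₁, b₁⟩ := exists_inp (ih₂ hΓ hf h₂)
      obtain ⟨N', _, Q₂, s₂, a₂, c₂, b₂⟩ := exists_out (ih₁ hΓ hf h₁)
      obtain rfl := hΓ.unique_right _ _ _ a₁ a₂
      exact ⟨_, _, .comL s₁ s₂, .tau, .proc (.resIter (.swap b₂ (b₁.receive c₂)))⟩
  | red hr _ ih =>
    obtain ⟨Q', hr', h'⟩ := h.red hΓ hr
    obtain ⟨β, B, hs, hα, hA⟩ := ih hΓ hf h'
    exact ⟨β, B, .red hr' hs, hα, hA⟩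
  | parL Q _ ih =>
    cases h with
    | par h₁ h₂ =>
      obtain ⟨β, B, hs, hα, hA⟩ := ih hΓ hf h₁
      exact ⟨β, _, .parL _ hs, hα, hA.parL h₂⟩
    | swap h₁ h₂ =>
      obtain ⟨β, B, hs, hα, hA⟩ := ih hΓ hf h₁
      exact ⟨β, _, .parR _ hs, hα, hA.parLR h₂⟩
  | parR P _ ih =>
    cases h with
    | par h₁ h₂ =>
      obtain ⟨β, B, hs, hα, hA⟩ := ih hΓ hf h₂
      exact ⟨β, _, .parR _ hs, hα, hA.parR h₁⟩
    | swap h₁ h₂ =>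
      obtain ⟨β, B, hs, hα, hA⟩ := ih hΓ hf h₂
      exact ⟨β, _, .parL _ hs, hα, hA.parRL h₁⟩
  | res _ ih =>
    cases h with
    | res h =>
      obtain ⟨β, B, hs, hα, hA⟩ := ih (hΓ.shift hf) (shiftT_finite hf 1) h
      obtain ⟨β, rfl, hα'⟩ := hα.of_shift
      exact ⟨β, _, .res hs, hα', hA.res⟩

/-! Inversion of transitions. -/

theorem Step.res_tau {A X : Proc} (h : Step A.res .tau (.proc X)) :
    ∃ Y, Step A .tau (.proc Y) ∧ X = Y.res := by
  generalize hα : Act.tau = α, hB : Agent.proc X = B at h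
  cases h with
  | red hr => cases hr
  | @res _ _ A' h =>
    subst hα
    cases A' with
    | proc Y => cases hB; exact ⟨Y, h, rfl⟩
    | abs Y => cases hB
    | conc k M Y => simp only [Agent.res] at hB; split_ifs at hB

theorem Step.res_inp {A X : Proc} {M : Msg} (h : Step A.res (.inp M) (.abs X)) :
    ∃ Y : Proc, Step A (.inp (M.rename Nat.succ)) (.abs Y) ∧
      X = Proc.res (Y.rename fun i => if i = 0 then 1 else if i = 1 then 0 else i) := by
  generalize hα : Act.inp M = α, hB : Agent.abs X = B at h
  cases h with
  | red hr => cases hr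
  | @res _ _ A' h =>
    subst hα
    cases A' with
    | proc Y => cases hB
    | abs Y => cases hB; exact ⟨Y, h, rfl⟩
    | conc k M Y => simp only [Agent.res] at hB; split_ifs at hB

theorem Step.res_out {A X : Proc} {M M' : Msg} {k : ℕ} (h : Step A.res (.out M) (.conc k M' X)) :
    ∃ j K Y, Step A (.out (M.rename Nat.succ)) (.conc j K Y) ∧
      (Agent.conc j K Y).res = .conc k M' X := by
  generalize hα : Act.out M = α, hB : Agent.conc k M' X = B at h
  cases h with
  | red hr => cases hr
  | @res _ _ A' h =>
    subst hα
    cases A' with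
    | proc Y => cases hB
    | abs Y => cases hB
    | conc j K Y => exact ⟨j, K, Y, h, rfl⟩

theorem Step.par_tau {P Q X : Proc} (h : Step (P.par Q) .tau (.proc X)) :
    (∃ P', Step P .tau (.proc P') ∧ X = P'.par Q) ∨
    (∃ Q', Step Q .tau (.proc Q') ∧ X = P.par Q') ∨
    (∃ M P' k N Q', Step P (.inp M) (.abs P') ∧ Step Q (.out M) (.conc k N Q') ∧
      X = Proc.resIter k ((P'.receive k N).par Q')) ∨
    (∃ M P' k N Q', Step P (.out M) (.conc k N P') ∧ Step Q (.inp M) (.abs Q') ∧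
      X = Proc.resIter k (P'.par (Q'.receive k N))) := by
  generalize hα : Act.tau = α, hB : Agent.proc X = B at h
  cases h with
  | red hr => cases hr
  | comL h₁ h₂ => cases hB; exact .inr (.inr (.inl ⟨_, _, _, _, _, h₁, h₂, rfl⟩))
  | comR h₁ h₂ => cases hB; exact .inr (.inr (.inr ⟨_, _, _, _, _, h₁, h₂, rfl⟩))
  | @parL _ _ A _ h => subst hα; cases A <;> cases hB; exact .inl ⟨_, h, rfl⟩
  | @parR _ _ A _ h => subst hα; cases A <;> cases hB; exact .inr (.inl ⟨_, h, rfl⟩)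

theorem Step.par_inp {P Q X : Proc} {M : Msg} (h : Step (P.par Q) (.inp M) (.abs X)) :
    (∃ P', Step P (.inp M) (.abs P') ∧ X = P'.par (Q.rename Nat.succ)) ∨
    (∃ Q', Step Q (.inp M) (.abs Q') ∧ X = (P.rename Nat.succ).par Q') := by
  generalize hα : Act.inp M = α, hB : Agent.abs X = B at h
  cases h with
  | red hr => cases hr
  | comL h₁ h₂ => cases hB
  | comR h₁ h₂ => cases hB
  | @parL _ _ A _ h => subst hα; cases A <;> cases hB; exact .inl ⟨_, h, rfl⟩
  | @parR _ _ A _ h => subst hα; cases A <;> cases hB; exact .inr ⟨_, h, rfl⟩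

theorem Step.par_out {P Q X : Proc} {M N : Msg} {k : ℕ}
    (h : Step (P.par Q) (.out M) (.conc k N X)) :
    (∃ P', Step P (.out M) (.conc k N P') ∧ X = P'.par (Q.rename (· + k))) ∨
    (∃ Q', Step Q (.out M) (.conc k N Q') ∧ X = (P.rename (· + k)).par Q') := by
  generalize hα : Act.out M = α, hB : Agent.conc k N X = B at h
  cases h with
  | red hr => cases hr
  | comL h₁ h₂ => cases hB
  | comR h₁ h₂ => cases hB
  | @parL _ _ A _ h => subst hα; cases A <;> cases hB; exact .inl ⟨_, h, rfl⟩
  | @parR _ _ A _ h => subst hα; cases A <;> cases hB; exact .inr ⟨_, h, rfl⟩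

/-! Rigid names in place of restricted names. -/

theorem Proc.rename_inst (P : Proc) (M : Msg) : (P.rename Nat.succ).subst (inst M) = P := by
  rw [rename, subst_subst]; exact P.subst_nm

theorem Proc.rename_instRigid {k : ℕ} (P : Proc) (c : Fin k → ℕ) :
    (P.rename (· + k)).subst (instRigid c) = P := by
  rw [rename, subst_subst]
  simp only [Msg.subst, instRigid_add]; exact P.subst_nm

theorem Proc.receive_instRigid {k : ℕ} (P : Proc) (N : Msg) (c : Fin k → ℕ) :
    (P.receive k N).subst (instRigid c) = P.subst (inst (N.subst (instRigid c))) := by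
  rw [receive, subst_subst]
  refine subst_congr fun x _ => ?_
  rcases x with _ | x
  · rfl
  · simp only [Msg.subst, instRigid_add]; rfl

theorem instRigid_zero (c : Fin 0 → ℕ) : instRigid c = Msg.nm := by
  funext i; simp [instRigid]

theorem Proc.lift_instRigid_inst {k : ℕ} (P : Proc) (c : Fin (k + 1) → ℕ) :
    (P.subst (lift (instRigid (Fin.tail c)))).subst (inst (.rg (c 0))) =
      P.subst (instRigid c) := by
  rw [subst_subst]
  refine subst_congr fun x _ => ?_
  rcases x with _ | x
  · rfl
  · rw [lift, Msg.rename, Msg.subst_subst]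
    change (instRigid (Fin.tail c) x).subst Msg.nm = _
    rw [Msg.subst_nm]
    simp only [instRigid, Nat.add_lt_add_iff_right, Nat.add_sub_add_right]
    rfl

/-- An input under a restriction exchanges the two innermost binders; once both are instantiated the
order no longer matters. -/
theorem Proc.swap_inst (P : Proc) (x c : ℕ) :
    ((P.rename fun i => if i = 0 then 1 else if i = 1 then 0 else i).subst
      (lift (inst (.nm x)))).subst (inst (.rg c)) =
      (P.subst (lift (inst (.rg c)))).subst (inst (.nm x)) := by
  simp only [rename, subst_subst]
  refine subst_congr fun i _ => ?_
  rcases i with _ | _ | i <;> rfl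

theorem lift_inst_iterate (M : Msg) (k i : ℕ) : lift^[k] (inst M) i =
    if i < k then .nm i else if i = k then M.rename (· + k) else .nm (i - 1) := by
  rw [lift_iterate]
  split_ifs with h₁ h₂
  · rfl
  · subst h₂; simp [inst]
  · obtain ⟨j, rfl⟩ := Nat.exists_eq_add_of_lt (lt_of_le_of_ne (not_lt.1 h₁) (Ne.symm h₂))
    rw [show k + j + 1 - k = j + 1 by omega]
    simp only [inst, Msg.rename, Msg.subst]
    congr 1; omega

/-- A restriction that joins `k` extruded names becomes the index `k`, so its rigid name is appended
at the end of the list. -/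
theorem snoc_instRigid {k : ℕ} (c : Fin k → ℕ) (a i : ℕ) :
    (lift^[k] (inst (.rg a)) i).subst (instRigid c) =
      instRigid (Fin.snoc c a : Fin (k + 1) → ℕ) i := by
  rw [lift_inst_iterate]
  split_ifs with h₁ h₂
  · rw [instRigid_lt _ (show i < k + 1 by omega), Msg.subst, instRigid_lt _ h₁]
    simp [Fin.snoc, h₁]
  · subst h₂
    rw [instRigid_lt _ (show i < i + 1 by omega)]
    simp [Fin.snoc, Msg.rename, Msg.subst]
  · obtain ⟨j, rfl⟩ := Nat.exists_eq_add_of_lt (lt_of_le_of_ne (not_lt.1 h₁) (Ne.symm h₂))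
    rw [show k + j + 1 - 1 = j + k by omega, Msg.subst, instRigid_add,
      show k + j + 1 = j + (k + 1) by omega, instRigid_add]

theorem Proc.lift_inst_instRigid {k : ℕ} (P : Proc) (c : Fin k → ℕ) (a : ℕ) :
    (P.subst (lift^[k] (inst (.rg a)))).subst (instRigid c) =
      P.subst (instRigid (Fin.snoc c a : Fin (k + 1) → ℕ)) := by
  rw [subst_subst]; exact subst_congr fun i _ => snoc_instRigid c a i

theorem Msg.lift_inst_instRigid {k : ℕ} (P : Msg) (c : Fin k → ℕ) (a : ℕ) :
    (P.subst (lift^[k] (inst (.rg a)))).subst (instRigid c) =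
      P.subst (instRigid (Fin.snoc c a : Fin (k + 1) → ℕ)) := by
  rw [subst_subst]; exact subst_congr fun i _ => snoc_instRigid c a i

theorem Msg.drop_instRigid {k : ℕ} {K : Msg} (h : k ∉ K.fn) (c : Fin k → ℕ) (a : ℕ) :
    (K.rename fun i => if k < i then i - 1 else i).subst (instRigid c) =
      K.subst (instRigid (Fin.snoc c a : Fin (k + 1) → ℕ)) := by
  rw [rename, subst_subst]
  refine subst_congr fun i hi => ?_
  have hik : i ≠ k := ne_of_mem_of_not_mem hi h
  rw [← snoc_instRigid, lift_inst_iterate]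
  split_ifs
  · omega
  · rfl
  · rfl
  · omega

theorem Proc.drop_instRigid {k : ℕ} (P : Proc) (c : Fin k → ℕ) (a : ℕ) :
    ((P.rename fun i => if i < k then i + 1 else if i = k then 0 else i).subst
      (lift (instRigid c))).subst (inst (.rg a)) =
      P.subst (instRigid (Fin.snoc c a : Fin (k + 1) → ℕ)) := by
  simp only [rename, subst_subst]
  refine subst_congr fun i _ => ?_
  rw [← snoc_instRigid, lift_inst_iterate]
  have key : ∀ j, ((lift (instRigid c)) (j + 1)).subst (inst (.rg a)) = instRigid c j := by
    intro j
    rw [lift, Msg.rename, Msg.subst_subst]; exact Msg.subst_nm _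
  split_ifs with h₁ h₂
  · exact key i
  · subst h₂; rfl
  · obtain ⟨j, rfl⟩ := Nat.exists_eq_add_of_lt (lt_of_le_of_ne (not_lt.1 h₁) (Ne.symm h₂))
    exact key (k + j)

/-- The process `P` with the rigid name `a` replaced by a bound name. -/
theorem Step.of_inst {A : Proc} {α : Act} {B : Agent} {a : ℕ}
    (h : Step (A.subst (inst (.rg a))) α B) (hA : a ∉ A.rn) (hα : a ∉ α.rn) :
    ∃ Y, Step A α.shift Y ∧ a ∉ Y.rn ∧ B = Y.bs (inst (.rg a)) Msg.rg := by
  -- These maps invert the instantiation: `a` becomes the bound index `0`, and the other names are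
  -- shifted past it.
  let θ : ℕ → Msg := fun x => .nm (x + 1)
  let ρ : ℕ → Msg := nmFor a 0
  have hs := h.bs θ ρ
  have e₁ : (A.subst (inst (.rg a))).bs θ ρ = A := by
    rw [Proc.subst_eq, Proc.bs_bs]
    conv_rhs => rw [← A.bs_id]
    refine A.bs_congr (fun x _ => ?_) fun b hb => nmFor_of_ne (ne_of_mem_of_not_mem hb hA)
    rcases x with _ | x
    · exact nmFor_self a 0
    · rfl
  have e₂ : α.bs θ ρ = α.shift := by
    have (M : Msg) (hM : a ∉ M.rn) : M.bs θ ρ = M.rename Nat.succ := by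
      rw [Msg.rename_eq]
      exact M.bs_congr (fun _ _ => rfl) fun b hb => nmFor_of_ne (ne_of_mem_of_not_mem hb hM)
    cases α with
    | tau => rfl
    | inp M => simp only [Act.bs, Act.shift, this M hα]
    | out M => simp only [Act.bs, Act.shift, this M hα]
  rw [e₁, e₂] at hs
  refine ⟨_, hs, fun h => hA (hs.rn.2 h), ?_⟩
  have i₁ : ∀ k x, (lift^[k] θ x).bs (lift^[k] (inst (.rg a))) Msg.rg = .nm x := fun k x => by
    rw [Spi.lift_iterate]
    split_ifs with hx
    · simp only [Msg.bs, Spi.lift_iterate, if_pos hx]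
    · simp only [θ, Msg.rename, Msg.subst, Msg.bs, lift_inst_iterate]
      rw [if_neg (by omega), if_neg (by omega)]
      congr 1; omega
  have i₂ : ∀ k b, (liftR^[k] ρ b).bs (lift^[k] (inst (.rg a))) Msg.rg = .rg b := fun k b => by
    rw [liftR_iterate]
    by_cases hb : b = a
    · subst hb
      simp only [ρ, nmFor_self, Msg.rename, Msg.subst, Msg.bs, lift_inst_iterate]
      simp
    · simp only [ρ, nmFor_of_ne hb]; rfl
  have r (k : ℕ) : liftR^[k] Msg.rg = Msg.rg := liftR_rg_iterate _root_.id k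
  have p (k : ℕ) (P : Proc) : (P.bs (lift^[k] θ) (liftR^[k] ρ)).bs (lift^[k] (inst (.rg a)))
      (liftR^[k] Msg.rg) = P := by
    simp only [r, Proc.bs_bs, i₁, i₂]; exact P.bs_id
  cases B with
  | proc P => exact congrArg Agent.proc (p 0 P).symm
  | abs P => exact congrArg Agent.abs (p 1 P).symm
  | conc k M P =>
    simp only [Agent.bs, p]
    simp only [r, Msg.bs_bs, i₁, i₂]
    rw [Msg.bs_id]

theorem Msg.rename_inst (P : Msg) (M : Msg) : (P.rename Nat.succ).subst (inst M) = P := by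
  rw [rename, subst_subst]; exact P.subst_nm

theorem Step.inst {A : Proc} {α : Act} {Y : Agent} (h : Step A α.shift Y) (a : ℕ) :
    Step (A.subst (inst (.rg a))) α (Y.bs (inst (.rg a)) Msg.rg) := by
  have := h.bs (Spi.inst (.rg a)) Msg.rg
  rw [← Proc.subst_eq] at this
  convert this
  cases α with
  | tau => rfl
  | inp M => simp only [Act.shift, Act.bs, ← Msg.subst_eq, Msg.rename_inst]
  | out M => simp only [Act.shift, Act.bs, ← Msg.subst_eq, Msg.rename_inst]

theorem Agent.inst_abs (P : Proc) (a : ℕ) :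
    (Agent.abs P).bs (inst (.rg a)) Msg.rg = .abs (P.subst (lift (inst (.rg a)))) := by
  rw [Proc.subst_eq]; rfl

theorem Agent.inst_conc (k : ℕ) (M : Msg) (P : Proc) (a : ℕ) :
    (Agent.conc k M P).bs (inst (.rg a)) Msg.rg =
      .conc k (M.subst (lift^[k] (inst (.rg a)))) (P.subst (lift^[k] (inst (.rg a)))) := by
  rw [Proc.subst_eq, Msg.subst_eq]
  simp only [bs, show liftR^[k] Msg.rg = Msg.rg from liftR_rg_iterate _root_.id k]

theorem Agent.inst_proc (P : Proc) (a : ℕ) :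
    (Agent.proc P).bs (inst (.rg a)) Msg.rg = .proc (P.subst (inst (.rg a))) := by
  rw [Proc.subst_eq]; rfl

/-- Opening `k` binders on both sides preserves equivalence as soon as the rigid names put for them
are known in pairs. -/
theorem shiftT_eqv_instRigid {Γ Γ' : Set (Msg × Msg)} {k : ℕ} {c d : Fin k → ℕ} (hΓ : Γ ⊆ Γ')
    (hcd : ∀ i, (Msg.rg (c i), Msg.rg (d i)) ∈ Γ') :
    (∀ x, Eqv Γ' (instRigid c x) (instRigid d x)) ∧ ∀ p ∈ shiftT k Γ,
      Eqv Γ' (p.1.subst (instRigid c)) (p.2.subst (instRigid d)) := by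
  refine ⟨fun x => ?_, ?_⟩
  · by_cases hx : x < k
    · rw [instRigid_lt c hx, instRigid_lt d hx]; exact .id (hcd _)
    · obtain ⟨y, rfl⟩ := Nat.exists_eq_add_of_le' (not_lt.1 hx)
      rw [instRigid_add, instRigid_add]; exact .var y
  · rintro _ ⟨p, hp, rfl⟩
    simp only [Msg.rename, Msg.subst_subst, Msg.subst, instRigid_add]
    rw [Msg.subst_nm, Msg.subst_nm]
    exact .id (hΓ hp)

theorem PRel.instRigid {Γ Γ' : Set (Msg × Msg)} {k : ℕ} {c d : Fin k → ℕ} {P Q : Proc}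
    (h : PRel (shiftT k Γ) P Q) (hΓ : Γ ⊆ Γ') (hcd : ∀ i, (Msg.rg (c i), Msg.rg (d i)) ∈ Γ') :
    PRel Γ' (P.subst (instRigid c)) (Q.subst (instRigid d)) :=
  h.subst (shiftT_eqv_instRigid hΓ hcd).1 (shiftT_eqv_instRigid hΓ hcd).2

theorem Eqv.instRigid {Γ Γ' : Set (Msg × Msg)} {k : ℕ} {c d : Fin k → ℕ} {P Q : Msg}
    (h : Eqv (shiftT k Γ) P Q) (hΓ : Γ ⊆ Γ') (hcd : ∀ i, (Msg.rg (c i), Msg.rg (d i)) ∈ Γ') :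
    Eqv Γ' (P.subst (Spi.instRigid c)) (Q.subst (Spi.instRigid d)) := by
  have := shiftT_eqv_instRigid hΓ hcd
  simp only [Msg.subst_eq] at this ⊢
  exact h.bs this.1 this.2

theorem Trace.theory_finite (h : Trace) : h.theory.Finite := by
  induction h using Trace.ind with
  | nil => simp
  | cons m M N h ih => rw [theory_cons]; exact ih.insert _

theorem PRel.subst_of {Γ Γ' : Set (Msg × Msg)} {X : Set ℕ} {θ₁ θ₂ : ℕ → Msg}
    (hx : ∀ x ∈ X, Eqv Γ' (θ₁ x) (θ₂ x)) (hX : ∀ p ∈ Γ, p.1.fn ∪ p.2.fn ⊆ X)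
    (hΓ : ∀ p ∈ Γ, Eqv Γ' (p.1.subst θ₁) (p.2.subst θ₂))
    {P Q : Proc} (hP : P.fn ∪ Q.fn ⊆ X) (h : PRel Γ P Q) :
    PRel Γ' (P.subst θ₁) (Q.subst θ₂) := by
  rw [Set.union_subset_iff] at hP
  rw [Proc.subst_congr (θ' := Trace.cutTo X θ₁) fun x hx => (Trace.cutTo_of_mem (hP.1 hx)).symm,
    Proc.subst_congr (θ' := Trace.cutTo X θ₂) fun x hx => (Trace.cutTo_of_mem (hP.2 hx)).symm]
  refine h.subst (fun x => ?_) fun p hp => ?_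
  · by_cases h : x ∈ X
    · rw [Trace.cutTo_of_mem h, Trace.cutTo_of_mem h]; exact hx x h
    · rw [Trace.cutTo_of_notMem h, Trace.cutTo_of_notMem h]; exact .var x
  · have := hX p hp
    rw [Set.union_subset_iff] at this
    rw [Msg.subst_congr (θ := Trace.cutTo X θ₁) fun x hx => Trace.cutTo_of_mem (this.1 hx),
      Msg.subst_congr (θ := Trace.cutTo X θ₂) fun x hx => Trace.cutTo_of_mem (this.2 hx)]
    exact hΓ p hp

theorem Trace.Respects.proc_rnL {θ₁ θ₂ : ℕ → Msg} {h : Trace} (hr : h.Respects θ₁ θ₂)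
    (hb : h.IsBiTrace) {P : Proc} (hP : P.fn ⊆ h.fn) : (P.subst θ₁).rn ⊆ h.rnL ∪ P.rn := by
  intro a ha
  rw [Proc.subst_eq, Proc.mem_rn_bs] at ha
  rcases ha with ⟨x, hx, ha⟩ | ⟨b, hb, ha⟩
  · obtain ⟨_, ⟨e, he, rfl⟩, h'⟩ := (hr.fn hb (hP hx)).rn_left ha
    exact .inl (hr.rnL hb ⟨e, he, h'⟩)
  · cases ha; exact .inr hb

theorem Trace.Respects.proc_rnR {θ₁ θ₂ : ℕ → Msg} {h : Trace} (hr : h.Respects θ₁ θ₂)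
    (hb : h.IsBiTrace) {P : Proc} (hP : P.fn ⊆ h.fn) : (P.subst θ₂).rn ⊆ h.rnR ∪ P.rn := by
  rw [← rnL_inverse]
  exact hr.inverse.proc_rnL (isBiTrace_inverse hb) (by rwa [fn_inverse])

/-- Fresh rigid names may be added to the knowledge of the observer. -/
theorem OpenBisimilarAt.exists_weaken {h : Trace} {P Q : Proc} (H : OpenBisimilarAt h P Q)
    {k : ℕ} {c d : Fin k → ℕ} (hc : Function.Injective c) (hd : Function.Injective d)
    (hcf : Disjoint (Set.range c) (h.rnL ∪ P.rn)) (hdf : Disjoint (Set.range d) (h.rnR ∪ Q.rn)) :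
    ∃ h', OpenBisimilarAt h' P Q ∧ h.theory ⊆ h'.theory ∧
      (∀ i, (Msg.rg (c i), Msg.rg (d i)) ∈ h'.theory) ∧ ∀ g, Cov g h → Cov g h' := by
  -- The rigid names of the extended trace are recorded as well, so that the next pair to be added
  -- is seen to be fresh.
  have main : ∃ h', OpenBisimilarAt h' P Q ∧ h.theory ⊆ h'.theory ∧
      (∀ i, (Msg.rg (c i), Msg.rg (d i)) ∈ h'.theory) ∧ (∀ g, Cov g h → Cov g h') ∧
      h'.rnL ⊆ Set.range c ∪ h.rnL ∧ h'.rnR ⊆ Set.range d ∪ h.rnR := by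
    induction k with
    | zero => exact ⟨h, H, subset_rfl, fun i => i.elim0, fun _ h => h, Set.subset_union_right,
        Set.subset_union_right⟩
    | succ k ih =>
      have ht (c : Fin (k + 1) → ℕ) : Set.range (Fin.tail c) ⊆ Set.range c := by
        rintro _ ⟨i, rfl⟩; exact ⟨_, rfl⟩
      have h0 {c : Fin (k + 1) → ℕ} (hc : Function.Injective c) : c 0 ∉ Set.range (Fin.tail c) := by
        rintro ⟨i, hi⟩; exact Fin.succ_ne_zero i (hc hi)
      obtain ⟨h', H', h₁, h₂, h₃, h₄, h₅⟩ := ih (c := Fin.tail c) (d := Fin.tail d)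
        (hc.comp (Fin.succ_injective k)) (hd.comp (Fin.succ_injective k))
        (hcf.mono_left (ht c)) (hdf.mono_left (ht d))
      refine ⟨_, H'.weaken (c := c 0) (d := d 0) ?_ ?_, ?_, ?_, ?_, ?_, ?_⟩
      · rintro (h | h)
        · exact (h₄ h).elim (h0 hc) fun h => Set.disjoint_left.1 hcf ⟨0, rfl⟩ (.inl h)
        · exact Set.disjoint_left.1 hcf ⟨0, rfl⟩ (.inr h)
      · rintro (h | h)
        · exact (h₅ h).elim (h0 hd) fun h => Set.disjoint_left.1 hdf ⟨0, rfl⟩ (.inl h)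
        · exact Set.disjoint_left.1 hdf ⟨0, rfl⟩ (.inr h)
      · rw [Trace.theory_cons]; exact h₁.trans (Set.subset_insert _ _)
      · intro i
        rw [Trace.theory_cons]
        refine Fin.cases (.inl rfl) (fun i => .inr (h₂ i)) i
      · exact fun g hg => (h₃ g hg).hide (by simp [Msg.fn])
      · rw [Trace.rnL_cons]
        refine Set.union_subset ?_ (h₄.trans (Set.union_subset_union_left _ (ht c)))
        rintro _ rfl; exact .inl ⟨0, rfl⟩
      · rw [Trace.rnR_cons]
        refine Set.union_subset ?_ (h₅.trans (Set.union_subset_union_left _ (ht d)))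
        rintro _ rfl; exact .inl ⟨0, rfl⟩
  obtain ⟨h', H', h₁, h₂, h₃, -⟩ := main
  exact ⟨h', H', h₁, h₂, h₃⟩

/-! ### Closure under parallel composition and restriction -/

/-- The closure of bisimilarity under smaller knowledge of the observer, parallel composition with
related processes, and restriction. -/
inductive Clo : Trace → Proc → Proc → Prop
  | single {h h' P Q} : OpenBisimilarAt h' P Q → Cov h h' → Clo h P Q
  -- The parallel components may use all of `h'`, including what `h` does not show to the observer,
  -- such as messages exchanged earlier with the bisimilar processes.
  | par {h h' P Q R₁ R₂} : OpenBisimilarAt h' P Q → Cov h h' → PRel h'.theory R₁ R₂ →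
      R₁.fn ∪ R₂.fn ⊆ h.fn → Clo h (P.par R₁) (Q.par R₂)
  -- Restrictions are opened on one side at a time, because the two processes may extrude different
  -- numbers of names.
  | resL {h : Trace} {A B : Proc} {c : ℕ} : Clo h (A.subst (inst (.rg c))) B → c ∉ h.rnL ∪ A.rn → Clo h A.res B
  | resR {h : Trace} {A B : Proc} {d : ℕ} : Clo h A (B.subst (inst (.rg d))) → d ∉ h.rnR ∪ B.rn → Clo h A B.res

theorem Proc.fn_subst_inst_rg (A : Proc) (c : ℕ) : (A.subst (inst (.rg c))).fn = A.res.fn := by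
  ext x
  rw [subst_eq, mem_fn_bs]
  constructor
  · rintro (⟨_ | y, hy, h⟩ | ⟨a, -, h⟩)
    · exact h.elim
    · cases h; exact hy
    · exact h.elim
  · exact fun h => .inl ⟨x + 1, h, rfl⟩

namespace Clo

theorem consistent {h : Trace} {P Q : Proc} (H : Clo h P Q) : h.Consistent := by
  induction H with
  | single H hc => exact hc.consistent (openBisimilarAt_bisim.consistent H)
  | par H hc _ _ => exact hc.consistent (openBisimilarAt_bisim.consistent H)
  | resL _ _ ih => exact ih
  | resR _ _ ih => exact ih

theorem fn {h : Trace} {P Q : Proc} (H : Clo h P Q) : P.fn ∪ Q.fn ⊆ h.fn := by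
  induction H with
  | single H hc => exact (openBisimilarAt_bisim.fn H).trans hc.fn
  | par H hc _ hR =>
    have := (openBisimilarAt_bisim.fn H).trans hc.fn
    rw [Set.union_subset_iff] at *
    exact ⟨Set.union_subset this.1 hR.1, Set.union_subset this.2 hR.2⟩
  | resL _ _ ih => rwa [Proc.fn_subst_inst_rg] at ih
  | resR _ _ ih => rwa [Proc.fn_subst_inst_rg] at ih

theorem symm {h : Trace} {P Q : Proc} (H : Clo h P Q) : Clo h.inverse Q P := by
  induction H with
  | single H hc => exact .single (openBisimilarAt_bisim.symm H) hc.inverse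
  | par H hc h' hR =>
    exact .par (openBisimilarAt_bisim.symm H) hc.inverse (by rw [Trace.theory_inverse]; exact h'.sw)
      (by rwa [Trace.fn_inverse, Set.union_comm])
  | resL _ hc ih => exact .resR ih (by rwa [Trace.rnR_inverse])
  | resR _ hc ih => exact .resL ih (by rwa [Trace.rnL_inverse])

theorem subst {h : Trace} {P Q : Proc} (H : Clo h P Q) {θ₁ θ₂ : ℕ → Msg}
    (hr : h.Respects θ₁ θ₂) : Clo (h.subst θ₁ θ₂) (P.subst θ₁) (Q.subst θ₂) := by
  have inst_subst (A : Proc) (c : ℕ) (θ : ℕ → Msg) : (A.subst (inst (.rg c))).subst θ =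
      (A.subst (lift θ)).subst (inst (.rg c)) := by
    have := A.bs_inst θ Msg.rg (.rg c)
    rwa [← Proc.subst_eq, liftR_rg, ← Proc.subst_eq] at this
  have rn_lift (A : Proc) (θ : ℕ → Msg) : (A.subst (lift θ)).rn = (A.res.subst θ).rn := rfl
  induction H with
  | single H hc =>
    have hc' := openBisimilarAt_bisim.consistent H
    exact .single (openBisimilarAt_bisim.subst H (hc.respects hc'.isBiTrace hr).1) (hc.subst hc' hr)
  | par H hc h' hR =>
    have hc' := openBisimilarAt_bisim.consistent H
    obtain ⟨h₁, h₂⟩ := hc.respects hc'.isBiTrace hr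
    refine .par (openBisimilarAt_bisim.subst H h₁) (hc.subst hc' hr) ?_
      ((hc.consistent hc').proc_fn_subst hR)
    refine h'.subst_of (fun x hx => (hr.fn hc.isBiTrace hx).cut h₂)
      (fun p hp => (Trace.fn_of_mem_theory hp).trans hc.fn) (fun p hp => ?_) hR
    refine .id ?_
    rw [Trace.subst_eq, Msg.subst_eq, Msg.subst_eq]
    exact Trace.mem_theory_bs hp
  | @resL A B c H hc ih =>
    have hfn := H.fn
    rw [Proc.fn_subst_inst_rg] at hfn
    have hb := H.consistent.isBiTrace
    refine .resL (c := c) (by rw [← inst_subst]; exact ih) fun h' => hc (h'.elim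
      (fun h' => .inl (hr.rnL hb h')) fun h' => ?_)
    exact hr.proc_rnL hb (P := A.res) (fun x hx => hfn (.inl hx)) h'
  | @resR A B d H hd ih =>
    have hfn := H.fn
    rw [Proc.fn_subst_inst_rg] at hfn
    have hb := H.consistent.isBiTrace
    refine .resR (d := d) (by rw [← inst_subst]; exact ih) fun h' => hd (h'.elim
      (fun h' => .inl (hr.rnR hb h')) fun h' => ?_)
    exact hr.proc_rnR hb (P := B.res) (fun x hx => hfn (.inr hx)) h'

theorem ren {h : Trace} {P Q : Proc} (f₁ f₂ : Equiv.Perm ℕ) (H : Clo h P Q) :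
    Clo (h.ren f₁ f₂) (P.ren f₁) (Q.ren f₂) := by
  have inst_ren (A : Proc) (c : ℕ) (f : Equiv.Perm ℕ) : (A.subst (inst (.rg c))).ren f =
      (A.ren f).subst (inst (.rg (f c))) := by
    rw [Proc.ren, Proc.bs_inst, lift_nm, liftR_rg_comp]; rfl
  have res_ren (A : Proc) (f : Equiv.Perm ℕ) : A.res.ren f = (A.ren f).res := by
    rw [Proc.ren, Proc.bs, lift_nm, liftR_rg_comp]; rfl
  have mem (f : Equiv.Perm ℕ) {c : ℕ} {S : Set ℕ} : f c ∈ f '' S ↔ c ∈ S :=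
    f.injective.mem_set_image
  induction H with
  | single H hc => exact .single (H.ren f₁ f₂) (hc.ren f₁ f₂)
  | par H hc h' hR =>
    refine .par (H.ren f₁ f₂) (hc.ren f₁ f₂) ?_ ?_
    · exact h'.bs (fun x => .var x) fun p hp => .id (Trace.mem_theory_bs hp)
    · rw [Trace.fn_ren]
      exact (Set.union_subset_union (Proc.fn_ren _ _).subset (Proc.fn_ren _ _).subset).trans hR
  | resL _ hc ih =>
    rw [inst_ren] at ih
    rw [res_ren]
    refine .resL ih ?_
    rwa [Trace.rnL_ren, Proc.rn_ren, ← Set.image_union, mem]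
  | resR _ hc ih =>
    rw [inst_ren] at ih
    rw [res_ren]
    refine .resR ih ?_
    rwa [Trace.rnR_ren, Proc.rn_ren, ← Set.image_union, mem]

/-- Puts back, one at a time, the restrictions around a communication whose extruded names were
represented by rigid ones. -/
theorem resIterL {h : Trace} {A B : Proc} {k : ℕ} {c : Fin k → ℕ}
    (H : Clo h (A.subst (instRigid c)) B) (hc : Function.Injective c)
    (hcf : Disjoint (Set.range c) (h.rnL ∪ A.rn)) : Clo h (A.resIter k) B := by
  induction k generalizing A with
  | zero => rwa [instRigid_zero, Proc.subst_nm] at H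
  | succ k ih =>
    have ht : Set.range (Fin.tail c) ⊆ Set.range c := by rintro _ ⟨i, rfl⟩; exact ⟨_, rfl⟩
    refine ih (c := Fin.tail c) ?_ (hc.comp (Fin.succ_injective k)) (hcf.mono_left ht)
    refine .resL (c := c 0) (by rwa [Proc.lift_instRigid_inst]) ?_
    rintro (h' | h')
    · exact Set.disjoint_left.1 hcf ⟨0, rfl⟩ (.inl h')
    · rcases Proc.rn_instRigid (P := A.res) (c := Fin.tail c) h' with ⟨i, hi⟩ | h'
      · exact Fin.succ_ne_zero i (hc hi)
      · exact Set.disjoint_left.1 hcf ⟨0, rfl⟩ (.inr h')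

theorem resIterR {h : Trace} {A B : Proc} {k : ℕ} {c : Fin k → ℕ}
    (H : Clo h A (B.subst (instRigid c))) (hc : Function.Injective c)
    (hcf : Disjoint (Set.range c) (h.rnR ∪ B.rn)) : Clo h A (B.resIter k) := by
  have := (H.symm.resIterL hc (by rwa [Trace.rnL_inverse])).symm
  rwa [Trace.inverse_inverse] at this

end Clo

theorem Cov.inp_of_syn {h h' : Trace} (H : Cov h h') (hc : h'.Consistent) {M N : Msg}
    (hM : Syn h.fst M) (he : Eqv h'.theory M N) {x : ℕ} :
    Cov ((Mark.i, .nm x, .nm x) :: (Mark.i, M, N) :: h)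
      ((Mark.i, .nm x, .nm x) :: (Mark.i, M, N) :: h') :=
  (H.inp (H.eqv_of_syn hc hM he)).inp (.var x)

theorem Trace.Consistent.eqv_of_inp {h : Trace} {e : Mark × Msg × Msg} {M N : Msg}
    (hc : Trace.Consistent (e :: (Mark.i, M, N) :: h)) : Eqv h.theory M N :=
  (Trace.consistent_i.1 hc.tail).2

/-- A fresh name that has been input may be instantiated. -/
theorem OpenBisimilarAt.inst {h : Trace} {P Q : Proc} {x : ℕ} {M N : Msg}
    (H : OpenBisimilarAt ((Mark.i, .nm x, .nm x) :: h) (P.subst (inst (.nm x)))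
      (Q.subst (inst (.nm x)))) (hx : x ∉ h.fn) (hPQ : ∀ y, y + 1 ∈ P.fn ∪ Q.fn → y ∈ h.fn)
    (he : Eqv h.theory M N) :
    OpenBisimilarAt ((Mark.i, M, N) :: h) (P.subst (Spi.inst M)) (Q.subst (Spi.inst N)) := by
  let θ (M : Msg) : ℕ → Msg := fun y => if y = x then M else .nm y
  have hθ (M : Msg) : θ M x = M := if_pos rfl
  have hθ' (M : Msg) : ∀ y ∈ h.fn, θ M y = .nm y := fun y hy => if_neg (ne_of_mem_of_not_mem hy hx)
  have e : h.subst (θ M) (θ N) = h := by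
    rw [Trace.subst_congr (hθ' M) (hθ' N), Trace.subst_nm]
  have hr : Trace.Respects (θ M) (θ N) ((Mark.i, .nm x, .nm x) :: h) := by
    refine ⟨fun y hy => ?_, h.respects_nm.congr (fun y hy => (hθ' M y hy).symm)
      fun y hy => (hθ' N y hy).symm⟩
    have : y = x := by simpa [Msg.fn] using hy
    rw [this, hθ, hθ, e]
    exact he
  have := openBisimilarAt_bisim.subst H hr
  rw [Trace.subst_cons, e, Proc.subst_subst, Proc.subst_subst] at this
  simp only [Msg.subst, hθ] at this
  have key (M : Msg) {P : Proc} (hP : ∀ y, y + 1 ∈ P.fn → y ∈ h.fn) :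
      (P.subst fun y => (Spi.inst (.nm x) y).subst (θ M)) = P.subst (Spi.inst M) := by
    refine Proc.subst_congr ?_
    rintro (_ | y) hy
    exacts [hθ M, hθ' M y (hP y hy)]
  rwa [key M fun y hy => hPQ y (.inl hy), key N fun y hy => hPQ y (.inr hy)] at this

theorem Proc.rn_subst_of {P : Proc} {θ : ℕ → Msg} (h : ∀ x, (θ x).rn = ∅) :
    (P.subst θ).rn ⊆ P.rn := by
  intro a ha
  rw [subst_eq, mem_rn_bs] at ha
  rcases ha with ⟨x, -, ha⟩ | ⟨b, hb, ha⟩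
  · rw [h] at ha; exact ha.elim
  · cases ha; exact hb

theorem lift_inst_nm_rn (x i : ℕ) : (lift (inst (.nm x)) i).rn = ∅ := by
  rcases i with _ | _ | i <;> rfl

theorem rn_swap_inst (Y : Proc) (x : ℕ) :
    ((Y.rename fun i => if i = 0 then 1 else if i = 1 then 0 else i).subst
      (lift (inst (.nm x)))).rn ⊆ Y.rn :=
  (Proc.rn_subst_of (lift_inst_nm_rn x)).trans (Proc.rn_rename _ _).subset

theorem mem_rn_lift_instRigid {k : ℕ} {c : Fin k → ℕ} {a i : ℕ}
    (h : a ∈ (lift (instRigid c) i).rn) : a ∈ Set.range c := by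
  rcases i with _ | i
  · exact h.elim
  · rw [lift, Msg.rn_rename] at h
    exact mem_rn_instRigid h

theorem rn_drop_instRigid {k : ℕ} (Y : Proc) (c : Fin k → ℕ) (f : ℕ → ℕ) :
    ((Y.rename f).subst (lift (instRigid c))).rn ⊆ Set.range c ∪ Y.rn := by
  intro a ha
  rw [Proc.subst_eq, Proc.mem_rn_bs] at ha
  rcases ha with ⟨x, -, ha⟩ | ⟨b, hb, ha⟩
  · exact .inl (mem_rn_lift_instRigid ha)
  · cases ha; rw [Proc.rn_rename] at hb; exact .inr hb

theorem range_snoc {k : ℕ} (c : Fin k → ℕ) (a : ℕ) :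
    Set.range (Fin.snoc c a : Fin (k + 1) → ℕ) ⊆ insert a (Set.range c) := by
  rintro _ ⟨i, rfl⟩
  refine Fin.lastCases ?_ (fun i => ?_) i
  · simp
  · simp

theorem disjoint_snoc {k : ℕ} {c : Fin k → ℕ} {a : ℕ} {S : Set ℕ} (hc : Disjoint (Set.range c) S)
    (ha : a ∉ S) : Disjoint (Set.range (Fin.snoc c a : Fin (k + 1) → ℕ)) S :=
  Disjoint.mono_left (range_snoc c a) (Set.disjoint_insert_left.2 ⟨ha, hc⟩)

theorem Proc.rn_subst_inst_rg (A : Proc) (c : ℕ) : (A.subst (inst (.rg c))).rn ⊆ insert c A.rn :=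
  Proc.rn_inst

namespace Clo

/-- The substance lies in a communication between the bisimilar processes and their parallel
components: the message must become shared knowledge in the hidden trace without becoming known to
the observer. -/
theorem tau {h : Trace} {P Q P' : Proc} (H : Clo h P Q) (hs : Step P .tau (.proc P')) :
    ∃ Q', Step Q .tau (.proc Q') ∧ Clo h P' Q' := by
  induction H generalizing P' with
  | single H hc =>
    obtain ⟨Q', hs', H'⟩ := openBisimilarAt_bisim.tau H hs
    exact ⟨Q', hs', .single H' hc⟩
  | @par h' P Q R₁ R₂ H hc hR hfn =>
    have hc' := openBisimilarAt_bisim.consistent H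
    have sim {α A} (hs : Step R₁ α A) := hR.step hc'.theory h'.theory_finite hs
    have hfn' := Set.union_subset_iff.1 hfn
    rcases hs.par_tau with ⟨P', s, rfl⟩ | ⟨X, s, rfl⟩ | ⟨M, X, k, N, Y, s₁, s₂, rfl⟩ |
      ⟨M, X, k, N, Y, s₁, s₂, rfl⟩
    · obtain ⟨Q', hs', H'⟩ := openBisimilarAt_bisim.tau H s
      exact ⟨_, .parL _ hs', .par H' hc hR hfn⟩
    · obtain ⟨X', s', hX⟩ := AgentRel.exists_tau (sim s)
      exact ⟨_, .parR _ s', .par H hc hX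
        (Set.union_subset (s.fn.2.trans hfn'.1) (s'.fn.2.trans hfn'.2))⟩
    -- Here the component sends. Its partner extrudes equally many names; they are represented by
    -- fresh rigid pairs added to `h'`, which makes the two messages equivalent.
    · obtain ⟨M₂, N₂, Y₂, s₂', eM, eN, pY⟩ := AgentRel.exists_out (sim s₂)
      obtain ⟨c, hci, hcf⟩ := exists_fresh_rigid
        ((h.rnL_finite.union h'.rnL_finite).union (P.rn_finite.union R₁.rn_finite)) k
      obtain ⟨d, hdi, hdf⟩ := exists_fresh_rigid
        ((h.rnR_finite.union h'.rnR_finite).union (Q.rn_finite.union R₂.rn_finite)) k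
      obtain ⟨h'', H'', i₁, i₂, i₃⟩ := H.exists_weaken hci hdi
        (hcf.mono_right (Set.union_subset_union Set.subset_union_right Set.subset_union_left))
        (hdf.mono_right (Set.union_subset_union Set.subset_union_right Set.subset_union_left))
      -- The receiver inputs a fresh name, which is instantiated by the message afterwards.
      obtain ⟨x, hx⟩ := h''.fn_finite.exists_notMem
      have eM' := eM.mono i₁
      obtain ⟨M₂', X₂, s₁', H₃⟩ := openBisimilarAt_bisim.inp H'' s₁ eM'.syn_left hx
      have hc₃ := openBisimilarAt_bisim.consistent H₃
      -- Both answering channels are partners of the same channel, so they are equal and the answers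
      -- can communicate.
      obtain rfl := hc₃.tail.tail.theory.unique_right _ _ _ eM' hc₃.eqv_of_inp
      have hfnP := Set.union_subset_iff.1 (openBisimilarAt_bisim.fn H'')
      have H₄ := H₃.inst (M := N.subst (instRigid c)) (N := N₂.subst (instRigid d)) (by
          rw [Trace.fn_cons]
          exact fun h => hx (h.elim (fun h => h.elim (fun h => hfnP.1 (s₁.fn.1 h))
            fun h => hfnP.2 (s₁'.fn.1 h)) _root_.id)) (by
          rw [Trace.fn_cons]
          exact fun y hy => .inr (hy.elim (fun h => hfnP.1 (s₁.fn.2 h))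
            fun h => hfnP.2 (s₁'.fn.2 h))) (by
          rw [Trace.theory_cons]
          exact eN.instRigid (i₁.trans (Set.subset_insert _ _)) fun i => .inr (i₂ i))
      refine ⟨_, .comL s₁' s₂', resIterL (c := c) (resIterR (c := d) ?_ hdi ?_) hci ?_⟩
      · simp only [Proc.subst, Proc.receive_instRigid]
        refine .par H₄ (((i₃ h hc).hide ?_).hide ?_) (pY.instRigid ?_ ?_) ?_
        · exact Set.union_subset ((s₂.fn.1).trans hfn'.1) ((s₂'.fn.1).trans hfn'.2)
        · exact Set.union_subset (fun y hy => hfn'.1 (s₂.fn.2 (.inl (Msg.fn_instRigid hy))))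
            fun y hy => hfn'.2 (s₂'.fn.2 (.inl (Msg.fn_instRigid hy)))
        · rw [Trace.theory_cons, Trace.theory_cons]
          exact fun p hp => .inr (.inr (i₁ hp))
        · rw [Trace.theory_cons, Trace.theory_cons]
          exact fun i => .inr (.inr (i₂ i))
        · exact Set.union_subset (fun y hy => hfn'.1 (s₂.fn.2 (.inr (Proc.fn_instRigid hy))))
            fun y hy => hfn'.2 (s₂'.fn.2 (.inr (Proc.fn_instRigid hy)))
      · refine hdf.mono_right (Set.union_subset_union Set.subset_union_left ?_)
        refine Set.union_subset (Proc.rn_receive.trans (Set.union_subset ?_ ?_)) ?_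
        · exact fun a ha => .inr (s₂'.rn.2 (.inl ha))
        · exact fun a ha => .inl (s₁'.rn.2 ha)
        · exact fun a ha => .inr (s₂'.rn.2 (.inr ha))
      · refine hcf.mono_right (Set.union_subset_union Set.subset_union_left ?_)
        refine Set.union_subset (Proc.rn_receive.trans (Set.union_subset ?_ ?_)) ?_
        · exact fun a ha => .inr (s₂.rn.2 (.inl ha))
        · exact fun a ha => .inl (s₁.rn.2 ha)
        · exact fun a ha => .inr (s₂.rn.2 (.inr ha))
    -- Here the component receives. The message becomes an output entry of the hidden trace, which
    -- the components may use from now on; the numbers `k` and `l` of extruded names may differ.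
    · obtain ⟨M₂, Y₂, s₂', eM, pY⟩ := AgentRel.exists_inp (sim s₂)
      obtain ⟨M₂', l, N₂, X₂, s₁', F⟩ := openBisimilarAt_bisim.out H s₁ eM.syn_left
      obtain ⟨c, hci, hcf⟩ := exists_fresh_rigid
        ((h.rnL_finite.union h'.rnL_finite).union (P.rn_finite.union R₁.rn_finite)) k
      obtain ⟨d, hdi, hdf⟩ := exists_fresh_rigid
        ((h.rnR_finite.union h'.rnR_finite).union (Q.rn_finite.union R₂.rn_finite)) l
      have H₃ := F c d hci hdi
        (hcf.mono_right (Set.union_subset_union Set.subset_union_right Set.subset_union_left))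
        (hdf.mono_right (Set.union_subset_union Set.subset_union_right Set.subset_union_left))
      have hc₃ := openBisimilarAt_bisim.consistent H₃
      obtain rfl := hc'.theory.unique_right _ _ _ eM hc₃.eqv_of_inp
      have hfnP := Set.union_subset_iff.1 ((openBisimilarAt_bisim.fn H).trans hc.fn)
      have k₁ : (N.subst (instRigid c)).fn ⊆ h.fn :=
        fun y hy => hfnP.1 (s₁.fn.2 (.inl (Msg.fn_instRigid hy)))
      have k₂ : (N₂.subst (instRigid d)).fn ⊆ h.fn :=
        fun y hy => hfnP.2 (s₁'.fn.2 (.inl (Msg.fn_instRigid hy)))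
      refine ⟨_, .comR s₁' s₂', resIterL (c := c) (resIterR (c := d) ?_ hdi ?_) hci ?_⟩
      · simp only [Proc.subst, Proc.receive_instRigid]
        refine .par H₃ ((hc.hide ?_).hide (Set.union_subset k₁ k₂)) ?_ ?_
        · exact Set.union_subset ((s₂.fn.1).trans hfn'.1) ((s₂'.fn.1).trans hfn'.2)
        · refine PRel.inst (PRel.cut pY ?_) (.id (by rw [Trace.theory_cons]; exact .inl rfl))
          rintro _ ⟨p, hp, rfl⟩
          refine .id ⟨p, ?_, rfl⟩
          rw [Trace.theory_cons, Trace.theory_cons]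
          exact .inr (.inr hp)
        · exact Set.union_subset
            (Proc.fn_inst.trans (Set.union_subset k₁ fun y hy => hfn'.1 (s₂.fn.2 hy)))
            (Proc.fn_inst.trans (Set.union_subset k₂ fun y hy => hfn'.2 (s₂'.fn.2 hy)))
      · refine hdf.mono_right (Set.union_subset_union Set.subset_union_left ?_)
        refine Set.union_subset ?_ (Proc.rn_receive.trans (Set.union_subset ?_ ?_))
        · exact fun a ha => .inl (s₁'.rn.2 (.inr ha))
        · exact fun a ha => .inl (s₁'.rn.2 (.inl ha))
        · exact fun a ha => .inr (s₂'.rn.2 ha)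
      · refine hcf.mono_right (Set.union_subset_union Set.subset_union_left ?_)
        refine Set.union_subset ?_ (Proc.rn_receive.trans (Set.union_subset ?_ ?_))
        · exact fun a ha => .inl (s₁.rn.2 (.inr ha))
        · exact fun a ha => .inl (s₁.rn.2 (.inl ha))
        · exact fun a ha => .inr (s₂.rn.2 ha)
  | @resL A B c H hc ih =>
    obtain ⟨Y, s, rfl⟩ := hs.res_tau
    have s' := Step.inst (α := .tau) s c
    rw [Agent.inst_proc] at s'
    obtain ⟨Q', s₂, H'⟩ := ih s'
    exact ⟨Q', s₂, .resL H' fun h' => hc (h'.imp_right fun h' => s.rn.2 h')⟩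
  | @resR A B d H hd ih =>
    obtain ⟨Q', s₂, H'⟩ := ih hs
    -- The rigid name is fresh for `B`, so the answer of the opened process comes from a transition
    -- under the binder.
    obtain ⟨Y, sY, hY, e⟩ := s₂.of_inst (fun h' => hd (.inr h')) _root_.id
    cases Y with
    | proc Y =>
      rw [Agent.inst_proc] at e
      cases e
      exact ⟨_, .res sY, .resR H' fun h' => h'.elim (fun h' => hd (.inl h')) hY⟩
    | abs Y => cases e
    | conc k M Y => cases e

/-- The answer is computed with the hidden knowledge, but the channel is synthesized by the
observer. By `Cov.eqv_of_syn` the answering channel is its partner for the observer as well, so the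
new input pair is consistent. -/
theorem inp {h : Trace} {P Q P' : Proc} {M : Msg} {x : ℕ} (H : Clo h P Q)
    (hs : Step P (.inp M) (.abs P')) (hM : Syn h.fst M) (hx : x ∉ h.fn) :
    ∃ N Q', Step Q (.inp N) (.abs Q') ∧ Clo ((Mark.i, .nm x, .nm x) :: (Mark.i, M, N) :: h)
      (P'.subst (inst (.nm x))) (Q'.subst (inst (.nm x))) := by
  induction H generalizing P' with
  | single H hc =>
    obtain ⟨N, Q', s', H'⟩ := openBisimilarAt_bisim.inp H hs (hc.syn hM) fun h' => hx (hc.fn h')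
    exact ⟨N, Q', s', .single H' (hc.inp_of_syn (openBisimilarAt_bisim.consistent H) hM
      (openBisimilarAt_bisim.consistent H').eqv_of_inp)⟩
  | @par h' P Q R₁ R₂ H hc hR hfn =>
    have hc' := openBisimilarAt_bisim.consistent H
    have hfn' := Set.union_subset_iff.1 hfn
    rcases hs.par_inp with ⟨P', s, rfl⟩ | ⟨X, s, rfl⟩
    · obtain ⟨N, Q', s', H'⟩ := openBisimilarAt_bisim.inp H s (hc.syn hM) fun h' => hx (hc.fn h')
      refine ⟨N, _, .parL _ s', ?_⟩
      simp only [Proc.subst, Proc.rename_inst]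
      refine .par H' (hc.inp_of_syn hc' hM
        (openBisimilarAt_bisim.consistent H').eqv_of_inp) (hR.cut fun p hp => .id ?_) ?_
      · rw [Trace.theory_cons, Trace.theory_cons]; exact .inr (.inr hp)
      · rw [Trace.fn_cons, Trace.fn_cons]; exact fun y hy => .inr (.inr (hfn hy))
    · obtain ⟨N, X', s', eM, pX⟩ := AgentRel.exists_inp
        (hR.step hc'.theory h'.theory_finite s)
      refine ⟨N, _, .parR _ s', ?_⟩
      simp only [Proc.subst, Proc.rename_inst]
      -- The hidden trace does not change when the component moves: the new entries of the observer
      -- are redundant.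
      refine .par H ((hc.dropI (hc.eqv_of_syn hc' hM eM)).dropI (.var x)) (pX.inst (.var x)) ?_
      rw [Trace.fn_cons, Trace.fn_cons]
      have : ∀ y, y ∈ ({x} : Set ℕ) ∪ h.fn →
        y ∈ (Msg.nm x).fn ∪ (Msg.nm x).fn ∪ (M.fn ∪ N.fn ∪ h.fn) :=
        fun y hy => hy.elim (fun h => .inl (.inl h)) fun h => .inr (.inr h)
      exact Set.union_subset
        (fun y hy => this y ((Proc.fn_inst hy).imp_right fun h => hfn'.1 (s.fn.2 h)))
        (fun y hy => this y ((Proc.fn_inst hy).imp_right fun h => hfn'.2 (s'.fn.2 h)))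
  | @resL A B c H hc ih =>
    obtain ⟨Y, s, rfl⟩ := hs.res_inp
    have s' := Step.inst (α := .inp M) s c
    rw [Agent.inst_abs] at s'
    obtain ⟨N, Q', s₂, H'⟩ := ih s'
    refine ⟨N, Q', s₂, .resL (c := c) (by rwa [Proc.swap_inst]) ?_⟩
    rw [Trace.rnL_cons, Trace.rnL_cons]
    rintro ((h' | h' | h') | h')
    · exact h'
    · exact hc (.inr (s.rn.1 ((Msg.rn_rename _ _).symm.subset h')))
    · exact hc (.inl h')
    · exact hc (.inr (s.rn.2 (rn_swap_inst _ _ h')))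
  | @resR A B d H hd ih =>
    obtain ⟨N, Q', s₂, H'⟩ := ih hs
    -- The answering channel is derivable from the observer's trace, whose right side does not
    -- contain `d`; so it does not depend on the restricted name.
    have hdN : d ∉ N.rn := fun h' => by
      obtain ⟨_, ⟨e, he, rfl⟩, h'⟩ := H'.consistent.eqv_of_inp.rn_right h'
      exact hd (.inl ⟨e, he, h'⟩)
    obtain ⟨Y, sY, hY, e⟩ := s₂.of_inst (fun h' => hd (.inr h')) hdN
    cases Y with
    | proc Y => cases e
    | abs Y =>
      rw [Agent.inst_abs] at e
      cases e
      refine ⟨N, _, .res sY, .resR (d := d) (by rwa [Proc.swap_inst]) ?_⟩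
      rw [Trace.rnR_cons, Trace.rnR_cons]
      rintro ((h' | h' | h') | h')
      · exact h'
      · exact hdN h'
      · exact hd (.inl h')
      · exact hY (rn_swap_inst _ _ h')
    | conc k M Y => cases e

end Clo

theorem fn_out_subset {h : Trace} {P Q P' Q' : Proc} {M N M' N' : Msg} {k l : ℕ}
    (hP : Step P (.out M) (.conc k M' P')) (hQ : Step Q (.out N) (.conc l N' Q'))
    (hfn : P.fn ∪ Q.fn ⊆ h.fn) (c : Fin k → ℕ) (d : Fin l → ℕ) :
    (M'.subst (instRigid c)).fn ∪ (N'.subst (instRigid d)).fn ⊆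
      Trace.fn ((Mark.i, M, N) :: h) := by
  rw [Set.union_subset_iff] at hfn
  rw [Trace.fn_cons]
  exact Set.union_subset (fun y hy => .inr (hfn.1 (hP.fn.2 (.inl (Msg.fn_instRigid hy)))))
    fun y hy => .inr (hfn.2 (hQ.fn.2 (.inl (Msg.fn_instRigid hy))))

namespace Clo

/-- The prescribed rigid names are fresh for the observer's trace but may occur in the hidden one.
One choice fresh for both is used, and closure under permutations supplies the others
(`out_all_of_exists`). -/
theorem out {h : Trace} {P Q P' : Proc} {M M' : Msg} {k : ℕ} (H : Clo h P Q)
    (hs : Step P (.out M) (.conc k M' P')) (hM : Syn h.fst M) :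
    ∃ N l N' Q', Step Q (.out N) (.conc l N' Q') ∧
      ∀ (c : Fin k → ℕ) (d : Fin l → ℕ), Function.Injective c → Function.Injective d →
        Disjoint (Set.range c) (h.rnL ∪ P.rn) → Disjoint (Set.range d) (h.rnR ∪ Q.rn) →
        Clo ((Mark.o, M'.subst (instRigid c), N'.subst (instRigid d)) :: (Mark.i, M, N) :: h)
          (P'.subst (instRigid c)) (Q'.subst (instRigid d)) := by
  induction H generalizing k M' P' with
  | @single h' P Q H hc =>
    have hc' := openBisimilarAt_bisim.consistent H
    obtain ⟨N, l, N', Q', s', F⟩ := openBisimilarAt_bisim.out H hs (hc.syn hM)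
    obtain ⟨c, hci, hcf⟩ := exists_fresh_rigid ((h.rnL_finite.union h'.rnL_finite).union
      P.rn_finite) k
    obtain ⟨d, hdi, hdf⟩ := exists_fresh_rigid ((h.rnR_finite.union h'.rnR_finite).union
      Q.rn_finite) l
    have H' := F c d hci hdi
      (hcf.mono_right (Set.union_subset_union_left _ Set.subset_union_right))
      (hdf.mono_right (Set.union_subset_union_left _ Set.subset_union_right))
    have eM := (openBisimilarAt_bisim.consistent H').eqv_of_inp
    exact ⟨N, l, N', Q', s', out_all_of_exists (ren ·  · ·) hs s' hci hdi
      (hcf.mono_right (Set.union_subset_union_left _ Set.subset_union_left))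
      (hdf.mono_right (Set.union_subset_union_left _ Set.subset_union_left))
      (.single H' ((hc.inp (hc.eqv_of_syn hc' hM eM)).out
        (fn_out_subset hs s' ((openBisimilarAt_bisim.fn H).trans hc.fn) c d)))⟩
  | @par h' P Q R₁ R₂ H hc hR hfn =>
    have hc' := openBisimilarAt_bisim.consistent H
    have hfn' := Set.union_subset_iff.1 hfn
    have monoL {c : Set ℕ} (hc : Disjoint c (h.rnL ∪ h'.rnL ∪ (P.rn ∪ R₁.rn))) :
        Disjoint c (h.rnL ∪ (P.par R₁).rn) ∧ Disjoint c (h'.rnL ∪ P.rn) :=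
      ⟨hc.mono_right (Set.union_subset_union_left _ Set.subset_union_left),
        hc.mono_right (Set.union_subset_union Set.subset_union_right Set.subset_union_left)⟩
    have monoR {d : Set ℕ} (hd : Disjoint d (h.rnR ∪ h'.rnR ∪ (Q.rn ∪ R₂.rn))) :
        Disjoint d (h.rnR ∪ (Q.par R₂).rn) ∧ Disjoint d (h'.rnR ∪ Q.rn) :=
      ⟨hd.mono_right (Set.union_subset_union_left _ Set.subset_union_left),
        hd.mono_right (Set.union_subset_union Set.subset_union_right Set.subset_union_left)⟩
    obtain ⟨c, hci, hcf⟩ := exists_fresh_rigid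
      ((h.rnL_finite.union h'.rnL_finite).union (P.rn_finite.union R₁.rn_finite)) k
    rcases hs.par_out with ⟨P', s, rfl⟩ | ⟨X, s, rfl⟩
    · obtain ⟨N, l, N', Q', s', F⟩ := openBisimilarAt_bisim.out H s (hc.syn hM)
      obtain ⟨d, hdi, hdf⟩ := exists_fresh_rigid
        ((h.rnR_finite.union h'.rnR_finite).union (Q.rn_finite.union R₂.rn_finite)) l
      have H' := F c d hci hdi (monoL hcf).2 (monoR hdf).2
      have eM := (openBisimilarAt_bisim.consistent H').eqv_of_inp
      have s₂ := s'.parL R₂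
      refine ⟨N, l, N', _, s₂, out_all_of_exists (ren · · ·) hs s₂ hci hdi (monoL hcf).1
        (monoR hdf).1 ?_⟩
      simp only [Proc.subst, Proc.rename_instRigid]
      refine .par H' ((hc.inp (hc.eqv_of_syn hc' hM eM)).out (fn_out_subset s s'
        ((openBisimilarAt_bisim.fn H).trans hc.fn) c d)) (hR.cut fun p hp => .id ?_) ?_
      · rw [Trace.theory_cons, Trace.theory_cons]; exact .inr (.inr hp)
      · rw [Trace.fn_cons, Trace.fn_cons]; exact fun y hy => .inr (.inr (hfn hy))
    · obtain ⟨N, N', X', s', eM, eN, pX⟩ := AgentRel.exists_out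
        (hR.step hc'.theory h'.theory_finite s)
      obtain ⟨d, hdi, hdf⟩ := exists_fresh_rigid
        ((h.rnR_finite.union h'.rnR_finite).union (Q.rn_finite.union R₂.rn_finite)) k
      obtain ⟨h'', H'', i₁, i₂, i₃⟩ := H.exists_weaken hci hdi (monoL hcf).2 (monoR hdf).2
      have s₂ := s'.parR Q
      refine ⟨N, k, N', _, s₂, out_all_of_exists (ren · · ·) hs s₂ hci hdi (monoL hcf).1
        (monoR hdf).1 ?_⟩
      simp only [Proc.subst, Proc.rename_instRigid]
      -- The output of the component is derivable from the enlarged hidden trace, so it is redundant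
      -- there although new to the observer.
      refine .par H'' (((i₃ h hc).dropI (hc.eqv_of_syn hc' hM eM)).dropO (eN.instRigid i₁ i₂)
        (fn_out_subset s s' hfn c d)) (pX.instRigid i₁ i₂) ?_
      rw [Trace.fn_cons, Trace.fn_cons]
      exact Set.union_subset
        (fun y hy => .inr (.inr (hfn'.1 (s.fn.2 (.inr (Proc.fn_instRigid hy))))))
        (fun y hy => .inr (.inr (hfn'.2 (s'.fn.2 (.inr (Proc.fn_instRigid hy))))))
  | @resL A B a H ha ih =>
    obtain ⟨j, K, Y, s, e⟩ := hs.res_out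
    have s' := Step.inst (α := .out M) s a
    rw [Agent.inst_conc] at s'
    obtain ⟨N, l, N', Q', s₂, F⟩ := ih s'
    obtain ⟨c, hci, hcf⟩ := exists_fresh_rigid ((h.rnL_finite.union A.rn_finite).insert a) j
    obtain ⟨d, hdi, hdf⟩ := exists_fresh_rigid (h.rnR_finite.union B.rn_finite) l
    have hac : a ∉ Set.range c := fun h' => Set.disjoint_left.1 hcf h' (.inl rfl)
    have hcf' := hcf.mono_right (Set.subset_insert _ _)
    have H' := F c d hci hdi (hcf.mono_right (by
      rintro x (hx | hx)
      exacts [.inr (.inl hx), (Proc.rn_subst_inst_rg _ _ hx).imp_right .inr])) hdf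
    rw [Msg.lift_inst_instRigid, Proc.lift_inst_instRigid] at H'
    refine ⟨N, l, N', Q', s₂, ?_⟩
    -- Either the restricted name is extruded, and `a` joins the list of fresh rigid names, or it
    -- stays private, and the restriction is put back.
    by_cases hj : j ∈ K.fn
    · simp only [Agent.res, if_pos hj, Agent.conc.injEq] at e
      obtain ⟨rfl, rfl, rfl⟩ := e
      exact out_all_of_exists (ren · · ·) hs s₂ (Fin.snoc_injective_of_injective hci hac) hdi
        (disjoint_snoc hcf' ha) hdf H'
    · simp only [Agent.res, if_neg hj, Agent.conc.injEq] at e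
      obtain ⟨rfl, rfl, rfl⟩ := e
      refine out_all_of_exists (ren · · ·) hs s₂ hci hdi hcf' hdf ?_
      rw [Msg.drop_instRigid hj c a]
      refine .resL (c := a) (by rwa [Proc.drop_instRigid]) ?_
      rw [← Msg.drop_instRigid hj c a, Trace.rnL_cons, Trace.rnL_cons]
      rintro ((h' | h' | h') | h')
      · refine (Msg.rn_instRigid h').elim hac fun h' => ha (.inr (s.rn.2 (.inl ?_)))
        rwa [Msg.rn_rename] at h'
      · exact ha (.inr (s.rn.1 ((Msg.rn_rename _ _).symm.subset h')))
      · exact ha (.inl h')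
      · exact (rn_drop_instRigid _ _ _ h').elim hac fun h' => ha (.inr (s.rn.2 (.inr h')))
  | @resR A B a H ha ih =>
    obtain ⟨N, l, N', Q', s₂, F⟩ := ih hs
    obtain ⟨c, hci, hcf⟩ := exists_fresh_rigid (h.rnL_finite.union A.rn_finite) k
    obtain ⟨d, hdi, hdf⟩ := exists_fresh_rigid ((h.rnR_finite.union B.rn_finite).insert a) l
    have had : a ∉ Set.range d := fun h' => Set.disjoint_left.1 hdf h' (.inl rfl)
    have hdf' := hdf.mono_right (Set.subset_insert _ _)
    have H' := F c d hci hdi hcf (hdf.mono_right (by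
      rintro x (hx | hx)
      exacts [.inr (.inl hx), (Proc.rn_subst_inst_rg _ _ hx).imp_right .inr]))
    have haN : a ∉ N.rn := fun h' => by
      obtain ⟨_, ⟨e, he, rfl⟩, h'⟩ := H'.consistent.eqv_of_inp.rn_right h'
      exact ha (.inl ⟨e, he, h'⟩)
    obtain ⟨Y, sY, hY, e⟩ := s₂.of_inst (fun h' => ha (.inr h')) haN
    cases Y with
    | proc Y => cases e
    | abs Y => cases e
    | conc j K Y =>
      rw [Agent.inst_conc] at e
      cases e
      rw [Msg.lift_inst_instRigid, Proc.lift_inst_instRigid] at H'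
      have sY' := sY.res
      by_cases hj : l ∈ K.fn
      · simp only [Agent.res, if_pos hj] at sY'
        exact ⟨N, _, _, _, sY', out_all_of_exists (ren · · ·) hs sY' hci
          (Fin.snoc_injective_of_injective hdi had) hcf (disjoint_snoc hdf' ha) H'⟩
      · simp only [Agent.res, if_neg hj] at sY'
        refine ⟨N, _, _, _, sY', out_all_of_exists (ren · · ·) hs sY' hci hdi hcf hdf' ?_⟩
        rw [Msg.drop_instRigid hj d a]
        refine .resR (d := a) (by rwa [Proc.drop_instRigid]) ?_
        rw [← Msg.drop_instRigid hj d a, Trace.rnR_cons, Trace.rnR_cons]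
        rintro ((h' | h' | h') | h')
        · refine (Msg.rn_instRigid h').elim had fun h' => hY (.inl ?_)
          rwa [Msg.rn_rename] at h'
        · exact haN h'
        · exact ha (.inl h')
        · exact (rn_drop_instRigid _ _ _ h').elim had fun h' => hY (.inr h')

theorem bisim : Bisim Clo where
  fn := fn
  consistent := consistent
  symm := symm
  subst := fun H hr => H.subst hr
  tau := tau
  inp := inp
  out := out

end Clo

theorem OpenBisimilarAt.of_cov {h h' : Trace} {P Q : Proc} (H : OpenBisimilarAt h' P Q)
    (hc : Cov h h') : OpenBisimilarAt h P Q :=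
  Clo.bisim.le (.single H hc)

theorem OpenBisimilarAt.par {h : Trace} {P Q R₁ R₂ : Proc} (H : OpenBisimilarAt h P Q)
    (hR : PRel h.theory R₁ R₂) (hfn : R₁.fn ∪ R₂.fn ⊆ h.fn) :
    OpenBisimilarAt h (P.par R₁) (Q.par R₂) :=
  Clo.bisim.le (.par H (.refl (openBisimilarAt_bisim.consistent H)) hR hfn)

theorem OpenBisimilarAt.res {h : Trace} {A B : Proc} {c d : ℕ}
    (H : OpenBisimilarAt h (A.subst (Spi.inst (.rg c)))
      (B.subst (Spi.inst (.rg d))))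
    (hc : c ∉ h.rnL ∪ A.rn) (hd : d ∉ h.rnR ∪ B.rn) : OpenBisimilarAt h A.res B.res :=
  Clo.bisim.le (.resR (.resL (.single H (.refl (openBisimilarAt_bisim.consistent H))) hc) hd)

/-! The inert process. -/

theorem Step.nil_false {α : Act} {A : Agent} (h : Step .nil α A) : False := by
  generalize hP : Proc.nil = P at h
  cases h with
  | red hr _ => subst hP; cases hr
  | _ => cases hP

theorem openBisimilarAt_nil {h : Trace} (hc : h.Consistent) : OpenBisimilarAt h .nil .nil := by
  refine Bisim.le (R := fun h P Q => h.Consistent ∧ P = .nil ∧ Q = .nil) ?_ ⟨hc, rfl, rfl⟩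
  constructor
  · rintro h _ _ ⟨hc, rfl, rfl⟩; simp [Proc.fn]
  · exact fun H => H.1
  · exact fun ⟨hc, hP, hQ⟩ => ⟨hc.inverse, hQ, hP⟩
  · rintro h _ _ θ₁ θ₂ ⟨hc, rfl, rfl⟩ hr; exact ⟨hc.subst hr, rfl, rfl⟩
  · rintro h _ _ _ ⟨hc, rfl, rfl⟩ hs; exact hs.nil_false.elim
  · rintro h _ _ _ _ _ ⟨hc, rfl, rfl⟩ hs; exact hs.nil_false.elim
  · rintro h _ _ _ _ _ _ ⟨hc, rfl, rfl⟩ hs; exact hs.nil_false.elim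

/-- The inert component has no transitions, so every answer comes from the other one. With this, the
bisimilarity of related processes reduces to `OpenBisimilarAt.par`. -/
theorem openBisimilarAt_of_nil_par {h : Trace} {P Q : Proc}
    (H : OpenBisimilarAt h (Proc.par .nil P) (Proc.par .nil Q)) : OpenBisimilarAt h P Q := by
  refine Bisim.le (R := fun h P Q => OpenBisimilarAt h (Proc.par .nil P) (Proc.par .nil Q)) ?_ H
  constructor
  · intro h P Q H
    simpa [Proc.fn] using openBisimilarAt_bisim.fn H
  · exact fun H => openBisimilarAt_bisim.consistent H
  · exact fun H => openBisimilarAt_bisim.symm H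
  · exact fun H hr => openBisimilarAt_bisim.subst H hr
  · intro h P Q P' H hs
    obtain ⟨Q', s₀, H'⟩ := openBisimilarAt_bisim.tau H (hs.parR .nil)
    rcases s₀.par_tau with ⟨_, s, -⟩ | ⟨_, s, rfl⟩ | ⟨_, _, _, _, _, s, -⟩ | ⟨_, _, _, _, _, s, -⟩
    exacts [s.nil_false.elim, ⟨_, s, H'⟩, s.nil_false.elim, s.nil_false.elim]
  · intro h P Q M P' x H hs hM hx
    obtain ⟨N, Q', s₀, H'⟩ := openBisimilarAt_bisim.inp H (hs.parR .nil) hM hx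
    rcases s₀.par_inp with ⟨_, s, -⟩ | ⟨_, s, rfl⟩
    exacts [s.nil_false.elim, ⟨N, _, s, H'⟩]
  · intro h P Q M k M' P' H hs hM
    obtain ⟨N, l, N', Q', s₀, H'⟩ := openBisimilarAt_bisim.out H (hs.parR .nil) hM
    rcases s₀.par_out with ⟨_, s, -⟩ | ⟨_, s, rfl⟩
    · exact s.nil_false.elim
    · refine ⟨N, l, N', _, s, fun c d hc hd hcf hdf => H' c d hc hd ?_ ?_⟩
      · simpa only [Proc.rn, Set.empty_union] using hcf
      · simpa only [Proc.rn, Set.empty_union] using hdf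

/-- Processes related by the theory of a bi-trace are bisimilar. -/
theorem PRel.openBisimilarAt {h : Trace} {P Q : Proc} (hc : h.Consistent)
    (H : PRel h.theory P Q) (hfn : P.fn ∪ Q.fn ⊆ h.fn) : OpenBisimilarAt h P Q :=
  openBisimilarAt_of_nil_par ((openBisimilarAt_nil hc).par H hfn)

/-! Composition of bi-traces, presented by lists of triples. -/

/-- Lists of marked triples of messages: two bi-traces which agree in the middle. -/
abbrev Trace₃ : Type := List (Mark × Msg × Msg × Msg)

namespace Trace₃

@[elab_as_elim]
theorem ind {motive : Trace₃ → Prop} (nil : motive [])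
    (cons : ∀ m M N R (t : Trace₃), motive t → motive ((m, M, N, R) :: t)) (t : Trace₃) :
    motive t :=
  List.rec nil (fun e t ih => cons e.1 e.2.1 e.2.2.1 e.2.2.2 t ih) t

def t₁₂ (t : Trace₃) : Trace := t.map fun e => (e.1, e.2.1, e.2.2.1)

def t₂₃ (t : Trace₃) : Trace := t.map fun e => (e.1, e.2.2.1, e.2.2.2)

def t₁₃ (t : Trace₃) : Trace := t.map fun e => (e.1, e.2.1, e.2.2.2)

def theory (t : Trace₃) : Set (Msg × Msg × Msg) := {p | ∃ e ∈ t, e.2 = p}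

def subst (θ₁ θ₂ θ₃ : ℕ → Msg) (t : Trace₃) : Trace₃ :=
  t.map fun e => (e.1, e.2.1.subst θ₁, e.2.2.1.subst θ₂, e.2.2.2.subst θ₃)

def inverse (t : Trace₃) : Trace₃ := t.map fun e => (e.1, e.2.2.2, e.2.2.1, e.2.1)

variable (t : Trace₃) (θ₁ θ₂ θ₃ : ℕ → Msg)

theorem t₁₂_subst : (t.subst θ₁ θ₂ θ₃).t₁₂ = t.t₁₂.subst θ₁ θ₂ := by
  simp [t₁₂, subst, Trace.subst]

theorem t₂₃_subst : (t.subst θ₁ θ₂ θ₃).t₂₃ = t.t₂₃.subst θ₂ θ₃ := by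
  simp [t₂₃, subst, Trace.subst]

theorem t₁₃_subst : (t.subst θ₁ θ₂ θ₃).t₁₃ = t.t₁₃.subst θ₁ θ₃ := by
  simp [t₁₃, subst, Trace.subst]

theorem t₁₂_inverse : t.inverse.t₁₂ = t.t₂₃.inverse := by
  simp [t₁₂, t₂₃, inverse, Trace.inverse]

theorem t₂₃_inverse : t.inverse.t₂₃ = t.t₁₂.inverse := by
  simp [t₁₂, t₂₃, inverse, Trace.inverse]

theorem t₁₃_inverse : t.inverse.t₁₃ = t.t₁₃.inverse := by
  simp [t₁₃, inverse, Trace.inverse]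

theorem theory_t₁₂ : t.t₁₂.theory = th₁₂ t.theory := by
  ext; simp only [t₁₂, theory, Trace.theory, th₁₂, Set.mem_image, Set.mem_ofPred_eq, List.mem_map,
    exists_exists_and_eq_and]

theorem theory_t₂₃ : t.t₂₃.theory = th₂₃ t.theory := by
  ext; simp only [t₂₃, theory, Trace.theory, th₂₃, Set.mem_image, Set.mem_ofPred_eq, List.mem_map,
    exists_exists_and_eq_and]

theorem theory_t₁₃ : t.t₁₃.theory = th₁₃ t.theory := by
  ext; simp only [t₁₃, theory, Trace.theory, th₁₃, Set.mem_image, Set.mem_ofPred_eq, List.mem_map,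
    exists_exists_and_eq_and]

theorem snd_t₁₂ : Prod.snd '' t.t₁₂.theory = t.t₂₃.fst := by
  rw [Trace.fst, theory_t₁₂, theory_t₂₃, th₁₂, th₂₃, Set.image_image, Set.image_image]

theorem fst_t₁₃ : t.t₁₃.fst = t.t₁₂.fst := by
  rw [Trace.fst, Trace.fst, theory_t₁₂, theory_t₁₃, th₁₂, th₁₃, Set.image_image, Set.image_image]

theorem rnR_t₁₂ : t.t₁₂.rnR = t.t₂₃.rnL := by
  ext; simp only [t₁₂, t₂₃, Trace.rnR, Trace.rnL, List.mem_map, Set.mem_ofPred_eq, exists_exists_and_eq_and]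

theorem rnL_t₁₂ : t.t₁₂.rnL = t.t₁₃.rnL := by
  ext; simp only [t₁₂, t₁₃, Trace.rnL, List.mem_map, Set.mem_ofPred_eq, exists_exists_and_eq_and]

theorem rnR_t₂₃ : t.t₂₃.rnR = t.t₁₃.rnR := by
  ext; simp only [t₂₃, t₁₃, Trace.rnR, List.mem_map, Set.mem_ofPred_eq, exists_exists_and_eq_and]

theorem fnR_t₁₂ : t.t₁₂.fnR = t.t₂₃.fnL := by
  ext; simp only [t₁₂, t₂₃, Trace.fnR, Trace.fnL, List.mem_map, Set.mem_ofPred_eq, exists_exists_and_eq_and]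

theorem fnL_t₁₂ : t.t₁₂.fnL = t.t₁₃.fnL := by
  ext; simp only [t₁₂, t₁₃, Trace.fnL, List.mem_map, Set.mem_ofPred_eq, exists_exists_and_eq_and]

theorem fnR_t₂₃ : t.t₂₃.fnR = t.t₁₃.fnR := by
  ext; simp only [t₂₃, t₁₃, Trace.fnR, List.mem_map, Set.mem_ofPred_eq, exists_exists_and_eq_and]

variable {t θ₁ θ₂ θ₃}

/-- Each side of a consistent bi-trace contains all of its names, and the two bi-traces share their
middle sides. -/
theorem fn_t₁₂ (h₁ : t.t₁₂.Consistent) (h₂ : t.t₂₃.Consistent) :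
    t.t₁₂.fn = t.t₁₃.fn ∧ t.t₂₃.fn = t.t₁₃.fn := by
  have e₁ := h₁.fn_subset
  have e₂ := h₂.fn_subset
  rw [Trace.fn_eq, Set.union_subset_iff, Set.subset_inter_iff, Set.subset_inter_iff] at e₁ e₂
  rw [Trace.fn_eq, Trace.fn_eq, Trace.fn_eq, ← fnL_t₁₂, ← fnR_t₂₃,
    Set.union_eq_self_of_subset_right e₁.2.1, Set.union_eq_self_of_subset_left e₂.1.2]
  have : t.t₁₂.fnL = t.t₂₃.fnR := by
    refine (e₁.1.2.trans ?_).antisymm (e₂.2.1.trans ?_)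
    · rw [fnR_t₁₂]; exact e₂.1.2
    · rw [← fnR_t₁₂]; exact e₁.2.1
  rw [this, Set.union_self]
  exact ⟨rfl, rfl⟩

theorem exists_eqv_middle (h₁ : t.t₁₂.Consistent) {M R : Msg} (h : Eqv t.t₁₃.theory M R) :
    ∃ N, Eqv t.t₁₂.theory M N ∧ Eqv t.t₂₃.theory N R := by
  have := h₁.theory
  rw [theory_t₁₂] at this ⊢
  rw [theory_t₁₃] at h
  rw [theory_t₂₃]
  exact h.exists_middle this

theorem eqv_comp (h₁ : t.t₁₂.Consistent) (h₂ : t.t₂₃.Consistent) {M N R : Msg}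
    (h : Eqv t.t₁₂.theory M N) (h' : Eqv t.t₂₃.theory N R) : Eqv t.t₁₃.theory M R := by
  have h₁ := h₁.theory
  have h₂ := h₂.theory
  rw [theory_t₁₂] at h₁ h
  rw [theory_t₂₃] at h₂ h'
  rw [theory_t₁₃]
  exact h.comp h₁ h₂ h'

/-- The value of the middle substitution at a name is found at the input pair where the name is new:
there `θ₁ x` and `θ₃ x` are equivalent in the composite instance, and such an equivalence passes
through a middle message. -/
theorem exists_respects (h₁ : t.t₁₂.Consistent) (h₂ : t.t₂₃.Consistent)
    (hr : t.t₁₃.Respects θ₁ θ₃) : ∃ θ₂, t.t₁₂.Respects θ₁ θ₂ ∧ t.t₂₃.Respects θ₂ θ₃ := by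
  induction t using Trace₃.ind with
  | nil => exact ⟨Msg.nm, trivial, trivial⟩
  | cons m M N R t ih =>
    have h₁' : t.t₁₂.Consistent := h₁.tail
    have h₂' : t.t₂₃.Consistent := h₂.tail
    rcases m with _ | _
    · obtain ⟨hx, hr⟩ := hr
      obtain ⟨θ₂, r₁, r₂⟩ := ih h₁' h₂' hr
      have hc := h₁'.subst r₁
      change ∀ x ∈ M.fn ∪ R.fn, Eqv (t.t₁₃.subst θ₁ θ₃).theory _ _ at hx
      rw [← t₁₂_subst _ _ _ θ₃] at hc
      rw [← t₁₃_subst _ _ θ₂ _] at hx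
      -- Names already present keep their value, since earlier entries must not change; `nm 0` is a
      -- dummy value where nothing is required.
      have key : ∀ x, ∃ K, (x ∈ t.t₁₃.fn → K = θ₂ x) ∧ (x ∈ M.fn ∪ R.fn →
          Eqv (t.t₁₂.subst θ₁ θ₂).theory (θ₁ x) K ∧ Eqv (t.t₂₃.subst θ₂ θ₃).theory K (θ₃ x)) := by
        intro x
        by_cases h : x ∈ t.t₁₃.fn
        · exact ⟨_, fun _ => rfl, fun _ => ⟨r₁.fn h₁'.isBiTrace ((fn_t₁₂ h₁' h₂').1 ▸ h),
            r₂.fn h₂'.isBiTrace ((fn_t₁₂ h₁' h₂').2 ▸ h)⟩⟩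
        · by_cases h' : x ∈ M.fn ∪ R.fn
          · obtain ⟨K, hK⟩ := exists_eqv_middle hc (hx x h')
            rw [t₁₂_subst, t₂₃_subst] at hK
            exact ⟨K, fun h' => (h h').elim, fun _ => hK⟩
          · exact ⟨.nm 0, fun h' => (h h').elim, fun h => (h' h).elim⟩
      choose φ hφ hφ' using key
      have e₁ : ∀ x ∈ t.t₁₂.fn, θ₂ x = φ x := fun x hx => (hφ x ((fn_t₁₂ h₁' h₂').1 ▸ hx)).symm
      have e₂ : ∀ x ∈ t.t₂₃.fn, θ₂ x = φ x := fun x hx => (hφ x ((fn_t₁₂ h₁' h₂').2 ▸ hx)).symm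
      have hX : ∀ x ∈ (M.fn ∪ N.fn) ∪ (N.fn ∪ R.fn),
          Eqv (t.t₁₂.subst θ₁ φ).theory (θ₁ x) (φ x) ∧
          Eqv (t.t₂₃.subst φ θ₃).theory (φ x) (θ₃ x) := by
        intro x hx
        rw [← Trace.subst_congr (fun _ _ => rfl) e₁, ← Trace.subst_congr e₂ fun _ _ => rfl]
        have : x ∈ (M.fn ∪ R.fn) ∪ t.t₁₃.fn := by
          have := fn_t₁₂ h₁ h₂
          change (Trace.fn ((_, M, N) :: t.t₁₂)) = Trace.fn ((_, M, R) :: t.t₁₃) ∧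
            (Trace.fn ((_, N, R) :: t.t₂₃)) = Trace.fn ((_, M, R) :: t.t₁₃) at this
          simp only [Trace.fn_cons] at this
          rcases hx with hx | hx
          · rw [← this.1]; exact .inl hx
          · rw [← this.2]; exact .inl hx
        rcases this with hx | hx
        · exact hφ' x hx
        · rw [hφ x hx]
          exact ⟨r₁.fn h₁'.isBiTrace ((fn_t₁₂ h₁' h₂').1 ▸ hx),
            r₂.fn h₂'.isBiTrace ((fn_t₁₂ h₁' h₂').2 ▸ hx)⟩
      exact ⟨φ, ⟨fun x hx => (hX x (.inl hx)).1, r₁.congr (fun _ _ => rfl) e₁⟩,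
        fun x hx => (hX x (.inr hx)).2, r₂.congr e₂ fun _ _ => rfl⟩
    · exact ih h₁' h₂' hr

/-- At an output pair `exists_respects` supplies the missing middle substitution, and the two
instances compose by `ConsistentTheory.comp`. -/
theorem consistent (h₁ : t.t₁₂.Consistent) (h₂ : t.t₂₃.Consistent) : t.t₁₃.Consistent := by
  induction t using Trace₃.ind with
  | nil => exact h₁
  | cons m M N R t ih =>
    have h₁' : t.t₁₂.Consistent := h₁.tail
    have h₂' : t.t₂₃.Consistent := h₂.tail
    have ih := ih h₁' h₂'
    rcases m with _ | _
    · exact Trace.consistent_i.2 ⟨ih, eqv_comp h₁' h₂' (Trace.consistent_i.1 h₁).2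
        (Trace.consistent_i.1 h₂).2⟩
    · obtain ⟨f₁, -, H₁⟩ := Trace.consistent_o.1 h₁
      obtain ⟨f₂, -, H₂⟩ := Trace.consistent_o.1 h₂
      have f := fn_t₁₂ h₁' h₂'
      refine Trace.consistent_o.2 ⟨Set.union_subset ?_ ?_, ih, fun θ₁ θ₃ hr => ?_⟩
      · exact (Set.subset_union_left.trans f₁).trans f.1.subset
      · exact (Set.subset_union_right.trans f₂).trans f.2.subset
      obtain ⟨θ₂, r₁, r₂⟩ := exists_respects h₁' h₂' hr
      have k₁ := H₁ _ _ r₁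
      have k₂ := H₂ _ _ r₂
      change ConsistentTheory (insert (M.subst θ₁, N.subst θ₂) (t.t₁₂.subst θ₁ θ₂).theory) at k₁
      change ConsistentTheory (insert (N.subst θ₂, R.subst θ₃) (t.t₂₃.subst θ₂ θ₃).theory) at k₂
      change ConsistentTheory (insert (M.subst θ₁, R.subst θ₃) (t.t₁₃.subst θ₁ θ₃).theory)
      rw [← t₁₂_subst _ _ _ θ₃, theory_t₁₂] at k₁
      rw [← t₂₃_subst _ θ₁ _ _, theory_t₂₃] at k₂
      rw [← t₁₃_subst _ _ θ₂ _, theory_t₁₃]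
      have := ConsistentTheory.comp
        (T := insert (M.subst θ₁, N.subst θ₂, R.subst θ₃) (t.subst θ₁ θ₂ θ₃).theory)
        (by rwa [th₁₂, Set.image_insert_eq]) (by rwa [th₂₃, Set.image_insert_eq])
      rwa [th₁₃, Set.image_insert_eq] at this

end Trace₃

/-- Composition of bisimilarities along composable bi-traces. -/
def CompAt (h : Trace) (P S : Proc) : Prop :=
  ∃ (t : Trace₃) (Q : Proc), t.t₁₃ = h ∧ OpenBisimilarAt t.t₁₂ P Q ∧ OpenBisimilarAt t.t₂₃ Q S

/-- The channel of the middle process is a partner in the first bi-trace, hence synthesizable from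
the left side of the second; so the middle answer can be answered in turn. -/
theorem compAt_bisim : Bisim CompAt where
  fn := by
    rintro _ P S ⟨t, Q, rfl, H₁, H₂⟩
    have := Trace₃.fn_t₁₂ (openBisimilarAt_bisim.consistent H₁) (openBisimilarAt_bisim.consistent H₂)
    refine Set.union_subset ?_ ?_
    · rw [← this.1]; exact Set.subset_union_left.trans (openBisimilarAt_bisim.fn H₁)
    · rw [← this.2]; exact Set.subset_union_right.trans (openBisimilarAt_bisim.fn H₂)
  consistent := by
    rintro _ P S ⟨t, Q, rfl, H₁, H₂⟩
    exact Trace₃.consistent (openBisimilarAt_bisim.consistent H₁)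
      (openBisimilarAt_bisim.consistent H₂)
  symm := by
    rintro _ P S ⟨t, Q, rfl, H₁, H₂⟩
    refine ⟨t.inverse, Q, t.t₁₃_inverse, ?_, ?_⟩
    · rw [Trace₃.t₁₂_inverse]; exact openBisimilarAt_bisim.symm H₂
    · rw [Trace₃.t₂₃_inverse]; exact openBisimilarAt_bisim.symm H₁
  subst := by
    rintro _ P S θ₁ θ₃ ⟨t, Q, rfl, H₁, H₂⟩ hr
    obtain ⟨θ₂, r₁, r₂⟩ := Trace₃.exists_respects (openBisimilarAt_bisim.consistent H₁)
      (openBisimilarAt_bisim.consistent H₂) hr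
    refine ⟨t.subst θ₁ θ₂ θ₃, Q.subst θ₂, t.t₁₃_subst _ _ _, ?_, ?_⟩
    · rw [Trace₃.t₁₂_subst]; exact openBisimilarAt_bisim.subst H₁ r₁
    · rw [Trace₃.t₂₃_subst]; exact openBisimilarAt_bisim.subst H₂ r₂
  tau := by
    rintro _ P S P' ⟨t, Q, rfl, H₁, H₂⟩ hs
    obtain ⟨Q', s, H₁⟩ := openBisimilarAt_bisim.tau H₁ hs
    obtain ⟨S', s', H₂⟩ := openBisimilarAt_bisim.tau H₂ s
    exact ⟨S', s', t, Q', rfl, H₁, H₂⟩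
  inp := by
    rintro _ P S M P' x ⟨t, Q, rfl, H₁, H₂⟩ hs hM hx
    have f := Trace₃.fn_t₁₂ (openBisimilarAt_bisim.consistent H₁)
      (openBisimilarAt_bisim.consistent H₂)
    obtain ⟨N, Q', s, H₁⟩ := openBisimilarAt_bisim.inp H₁ hs (t.fst_t₁₃ ▸ hM) (f.1 ▸ hx)
    have e := (Trace.consistent_i.1 (openBisimilarAt_bisim.consistent H₁).tail).2
    obtain ⟨K, S', s', H₂⟩ := openBisimilarAt_bisim.inp H₂ s (t.snd_t₁₂ ▸ e.syn_right) (f.2 ▸ hx)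
    exact ⟨K, S', s', (.i, .nm x, .nm x, .nm x) :: (.i, M, N, K) :: t, _, rfl, H₁, H₂⟩
  out := by
    rintro _ P S M k M' P' ⟨t, Q, rfl, H₁, H₂⟩ hs hM
    obtain ⟨N, l, N', Q', s, F₁⟩ := openBisimilarAt_bisim.out H₁ hs (t.fst_t₁₃ ▸ hM)
    obtain ⟨c, hc, hcf⟩ := exists_fresh_rigid (t.t₁₂.rnL_finite.union P.rn_finite) k
    -- The middle rigid names are invisible from outside and are chosen once; those of the outer
    -- sides are prescribed.
    obtain ⟨d, hd, hdf⟩ := exists_fresh_rigid (t.t₁₂.rnR_finite.union Q.rn_finite) l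
    have e := (openBisimilarAt_bisim.consistent (F₁ c d hc hd hcf hdf)).eqv_of_inp
    obtain ⟨K, m, K', S', s', F₂⟩ := openBisimilarAt_bisim.out H₂ s (t.snd_t₁₂ ▸ e.syn_right)
    refine ⟨K, m, K', S', s', fun c e hc he hcf hef => ?_⟩
    exact ⟨(.o, M'.subst (instRigid c), N'.subst (instRigid d), K'.subst (instRigid e)) ::
      (.i, M, N, K) :: t, _, rfl, F₁ c d hc hd (t.rnL_t₁₂ ▸ hcf) hdf,
      F₂ d e hd he (t.rnR_t₁₂ ▸ hdf) (t.rnR_t₂₃ ▸ hef)⟩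

/-! Universal bi-traces. -/

namespace Trace.IsUniversal

variable {h h' : Trace}

theorem of_cons {e : Mark × Msg × Msg} (hu : IsUniversal (e :: h)) :
    (∃ x, e = (Mark.i, .nm x, .nm x)) ∧ h.IsUniversal :=
  ⟨hu e (by simp), fun e he => hu e (by simp [he])⟩

theorem inverse (hu : h.IsUniversal) : h.inverse = h := by
  refine (List.map_congr_left fun e he => ?_).trans (List.map_id h)
  obtain ⟨x, rfl⟩ := hu e he
  rfl

theorem cov_nil (hu : h.IsUniversal) : Cov h [] := by
  induction h with
  | nil => exact .nil
  | cons e h ih =>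
    obtain ⟨⟨x, rfl⟩, hu₂⟩ := hu.of_cons
    exact (ih hu₂).dropI (.var x)

theorem consistent (hu : h.IsUniversal) : h.Consistent := hu.cov_nil.consistent consistent_nil

end Trace.IsUniversal

/-- Knowledge of names does not matter. -/
theorem Cov.of_universal {h h' : Trace} (H : Cov h []) (hu : h'.IsUniversal)
    (hfn : h'.fn ⊆ h.fn) : Cov h h' := by
  induction h' with
  | nil => exact H
  | cons e h' ih =>
    obtain ⟨⟨x, rfl⟩, hu₂⟩ := hu.of_cons
    rw [Trace.fn_cons, Set.union_subset_iff] at hfn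
    exact (ih hu₂ hfn.2).hide hfn.1

theorem exists_universal {X : Set ℕ} (hX : X.Finite) :
    ∃ h : Trace, h.IsUniversal ∧ h.fn = X := by
  refine ⟨hX.toFinset.toList.map fun x => (Mark.i, .nm x, .nm x), ?_, ?_⟩
  · intro e he
    obtain ⟨x, -, rfl⟩ := List.mem_map.1 he
    exact ⟨x, rfl⟩
  · ext x
    simp [Trace.fn, Msg.fn, eq_comm]

/-- A universal bi-trace conveys no knowledge beyond names, so it may be reordered and extended by
further names. -/
theorem OpenBisimilarAt.of_universal {h h' : Trace} {P Q : Proc} (H : OpenBisimilarAt h P Q)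
    (hu : h.IsUniversal) (hu' : h'.IsUniversal) (hfn : h.fn ⊆ h'.fn) : OpenBisimilarAt h' P Q :=
  H.of_cov (hu'.cov_nil.of_universal hu hfn)

theorem OpenBisimilar.exists_trace {P Q : Proc} (H : OpenBisimilar P Q) {X : Set ℕ} (hX : X.Finite) :
    ∃ h : Trace, h.IsUniversal ∧ X ⊆ h.fn ∧ OpenBisimilarAt h P Q := by
  obtain ⟨-, -, h, hu, H⟩ := H
  obtain ⟨h', hu', hX⟩ := exists_universal (hX.union h.fn_finite)
  exact ⟨h', hu', hX ▸ Set.subset_union_left, H.of_universal hu hu' (hX ▸ Set.subset_union_right)⟩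

theorem OpenBisimilar.symm {P Q : Proc} (H : OpenBisimilar P Q) : OpenBisimilar Q P := by
  obtain ⟨hP, hQ, h, hu, H⟩ := H
  exact ⟨hQ, hP, h, hu, hu.inverse ▸ openBisimilarAt_bisim.symm H⟩

theorem OpenBisimilar.trans {P Q S : Proc} (H : OpenBisimilar P Q) (H' : OpenBisimilar Q S) :
    OpenBisimilar P S := by
  obtain ⟨hP, -, h, hu, H⟩ := H
  obtain ⟨h', hu', hfn, H'⟩ := H'.exists_trace h.fn_finite
  have key (f : Mark × Msg × Msg → Mark × Msg × Msg)
      (hf : ∀ x, f (.i, .nm x, .nm x) = (.i, .nm x, .nm x)) : h'.map f = h' := by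
    refine (List.map_congr_left fun e he => ?_).trans (List.map_id h')
    obtain ⟨x, rfl⟩ := hu' e he
    exact hf x
  -- A universal bi-trace composes with itself, each name being its own middle.
  obtain ⟨t, e₁, e₂, e₃⟩ : ∃ t : Trace₃, t.t₁₂ = h' ∧ t.t₂₃ = h' ∧ t.t₁₃ = h' := by
    refine ⟨h'.map fun e => (e.1, e.2.1, e.2.1, e.2.1), ?_⟩
    simp only [Trace₃.t₁₂, Trace₃.t₂₃, Trace₃.t₁₃, List.map_map]
    exact ⟨key _ fun _ => rfl, key _ fun _ => rfl, key _ fun _ => rfl⟩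
  have H := H.of_universal hu hu' hfn
  exact ⟨hP, ‹OpenBisimilar Q S›.2.1, h', hu', compAt_bisim.le ⟨t, Q, e₃, by rwa [e₁], by rwa [e₂]⟩⟩

/-! Prefixes. -/

theorem Proc.mem_fn_subst {θ : ℕ → Msg} {P : Proc} {x : ℕ} :
    x ∈ (P.subst θ).fn ↔ ∃ y ∈ P.fn, x ∈ (θ y).fn := by
  simp [subst_eq, mem_fn_bs, Msg.fn]

theorem Msg.IsPure.subst {θ : ℕ → Msg} {M : Msg} (h : M.IsPure) (hθ : ∀ x, (θ x).IsPure) :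
    (M.subst θ).IsPure := by
  simp only [IsPure, Set.eq_empty_iff_forall_notMem] at *
  intro a
  rw [subst_eq, mem_rn_bs]
  rintro (⟨y, -, h'⟩ | ⟨b, h', -⟩)
  exacts [hθ _ _ h', h _ h']

theorem Msg.IsPure.nm (x : ℕ) : (nm x).IsPure := by rw [IsPure, rn]

theorem Msg.IsPure.fn_nonempty {M : Msg} (h : M.IsPure) : M.fn.Nonempty := by
  induction M with
  | nm x => exact ⟨x, rfl⟩
  | rg a => simp [IsPure, rn] at h
  | pair M N ih _ =>
    rw [IsPure, rn, Set.union_empty_iff] at h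
    exact (ih h.1).mono Set.subset_union_left
  | enc M N ih _ =>
    rw [IsPure, rn, Set.union_empty_iff] at h
    exact (ih h.1).mono Set.subset_union_left

theorem isPure_lift {θ : ℕ → Msg} (hθ : ∀ x, (θ x).IsPure) : ∀ x, (lift θ x).IsPure
  | 0 => .nm 0
  | n + 1 => (hθ n).subst fun _ => .nm _

theorem isPure_inst {M : Msg} (hM : M.IsPure) : ∀ x, (inst M x).IsPure
  | 0 => hM
  | n + 1 => .nm n

theorem isPure_inst₂ {M N : Msg} (hM : M.IsPure) (hN : N.IsPure) : ∀ x, (inst₂ M N x).IsPure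
  | 0 => hM
  | 1 => hN
  | n + 2 => .nm n

namespace Trace

/-- Non-empty bi-traces consisting of pairs of a pure message with itself. -/
structure IsDiagonal (h : Trace) : Prop where
  ne_nil : h ≠ []
  isBiTrace : h.IsBiTrace
  diag : ∀ e ∈ h, e.2.1 = e.2.2 ∧ e.2.1.IsPure

namespace IsDiagonal

variable {h : Trace}

theorem cov_nil (hd : h.IsDiagonal) : Cov h [] := by
  obtain ⟨-, hb, hd⟩ := hd
  induction h using Trace.ind with
  | nil => exact .nil
  | cons m M N h ih =>
    obtain ⟨e, hM⟩ := hd _ List.mem_cons_self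
    have hd' := fun e he => hd e (List.mem_cons_of_mem _ he)
    dsimp only at e hM
    subst e
    rcases m with _ | _
    · exact (ih hb hd').dropI (.of_pure hM)
    · exact (ih hb.2 hd').dropO (.of_pure hM) hb.1

theorem consistent (hd : h.IsDiagonal) : h.Consistent := hd.cov_nil.consistent consistent_nil

theorem inverse (hd : h.IsDiagonal) : h.inverse = h := by
  refine (List.map_congr_left fun e he => ?_).trans (List.map_id h)
  obtain ⟨m, M, N⟩ := e
  obtain ⟨e, -⟩ := hd.diag _ he
  dsimp only at e
  subst e
  rfl

theorem fn_nonempty (hd : h.IsDiagonal) : h.fn.Nonempty := by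
  obtain ⟨e, he⟩ := List.exists_mem_of_ne_nil _ hd.ne_nil
  obtain ⟨x, hx⟩ := (hd.diag e he).2.fn_nonempty
  exact ⟨x, e, he, .inl hx⟩

/-- A diagonal trace derives no more than the empty theory, in which only identical pure messages
are equivalent. -/
theorem eq_of_respects (hd : h.IsDiagonal) {θ₁ θ₂ : ℕ → Msg} (hr : h.Respects θ₁ θ₂) {x : ℕ}
    (hx : x ∈ h.fn) : θ₁ x = θ₂ x ∧ (θ₁ x).IsPure := by
  have hb := hd.isBiTrace
  obtain ⟨h₁, -⟩ := hd.cov_nil.respects trivial hr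
  have := (hr.fn hb hx).cut (hd.cov_nil.subst consistent_nil hr).mem
  rw [subst_nil, theory_nil] at this
  exact this.of_empty

theorem inp (hd : h.IsDiagonal) {M : Msg} (hM : M.IsPure) : IsDiagonal ((.i, M, M) :: h) where
  ne_nil := by simp
  isBiTrace := hd.isBiTrace
  diag := by
    rintro e (_ | ⟨_, he⟩)
    exacts [⟨rfl, hM⟩, hd.diag e he]

theorem out (hd : h.IsDiagonal) {M : Msg} (hM : M.IsPure) (hfn : M.fn ⊆ h.fn) :
    IsDiagonal ((.o, M, M) :: h) where
  ne_nil := by simp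
  isBiTrace := ⟨by rwa [Set.union_self], hd.isBiTrace⟩
  diag := by
    rintro e (_ | ⟨_, he⟩)
    exacts [⟨rfl, hM⟩, hd.diag e he]

/-- On the names of the trace the two substitutions agree and are pure; elsewhere the identity
serves. -/
theorem exists_subst (hd : h.IsDiagonal) {θ₁ θ₂ : ℕ → Msg} (hr : h.Respects θ₁ θ₂) :
    ∃ θ : ℕ → Msg, (∀ x, (θ x).IsPure) ∧ (∀ x ∈ h.fn, θ₁ x = θ x ∧ θ₂ x = θ x) ∧
      (h.subst θ₁ θ₂).IsDiagonal := by
  have key : ∀ x, (cutTo h.fn θ₁ x).IsPure := by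
    intro x
    by_cases hx : x ∈ h.fn
    · rw [cutTo_of_mem hx]; exact (hd.eq_of_respects hr hx).2
    · rw [cutTo_of_notMem hx]; exact .nm x
  have key' : ∀ x ∈ h.fn, θ₁ x = cutTo h.fn θ₁ x ∧ θ₂ x = cutTo h.fn θ₁ x := by
    intro x hx
    rw [cutTo_of_mem hx]
    exact ⟨rfl, (hd.eq_of_respects hr hx).1.symm⟩
  refine ⟨_, key, key', ?_, hd.consistent.isBiTrace_subst _ _, ?_⟩
  · simpa [Trace.subst] using hd.ne_nil
  · rw [Trace.subst_congr (fun x hx => (key' x hx).1) fun x hx => (key' x hx).2]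
    intro e he
    obtain ⟨⟨m, M, N⟩, he', rfl⟩ := List.mem_map.1 he
    obtain ⟨e, hM⟩ := hd.diag _ he'
    dsimp only at e hM
    subst e
    exact ⟨rfl, hM.subst key⟩

end IsDiagonal

theorem IsUniversal.isDiagonal {h : Trace} (hu : h.IsUniversal) (hfn : h.fn.Nonempty) :
    h.IsDiagonal where
  ne_nil := by
    rintro rfl
    simp at hfn
  isBiTrace := hu.consistent.isBiTrace
  diag := by
    intro e he
    obtain ⟨x, rfl⟩ := hu e he
    exact ⟨rfl, .nm x⟩

theorem IsUniversal.of_subst_fn {u g : Trace} {θ : ℕ → Msg} (hu : u.IsUniversal)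
    (hg : Cov g []) (hfn : ∀ x ∈ u.fn, (θ x).fn ⊆ g.fn) : Cov g (u.subst θ θ) := by
  induction u with
  | nil => exact hg
  | cons e u ih =>
    obtain ⟨⟨x, rfl⟩, hu₂⟩ := hu.of_cons
    simp only [Trace.fn_cons, Msg.fn, Set.union_self] at hfn
    have := hfn x (.inl rfl)
    exact (ih hu₂ fun y hy => hfn y (.inr hy)).hide (Set.union_subset this this)

theorem IsUniversal.respects {u : Trace} {θ : ℕ → Msg} (hu : u.IsUniversal)
    (hθ : ∀ x ∈ u.fn, (θ x).IsPure) : u.Respects θ θ := by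
  induction u with
  | nil => trivial
  | cons e u ih =>
    obtain ⟨⟨x, rfl⟩, hu₂⟩ := hu.of_cons
    simp only [Trace.fn_cons, Msg.fn, Set.union_self] at hθ
    refine ⟨?_, ih hu₂ fun y hy => hθ y (.inr hy)⟩
    simp only [Msg.fn, Set.union_self]
    rintro _ rfl
    exact .of_pure (hθ _ (.inl rfl))

end Trace

/-- Bisimilarity of all pure instances. -/
def PureEquiv (P Q : Proc) : Prop :=
  ∀ (g : Trace) (θ : ℕ → Msg), g.IsDiagonal → (∀ x, (θ x).IsPure) →
    (P.subst θ).fn ∪ (Q.subst θ).fn ⊆ g.fn → OpenBisimilarAt g (P.subst θ) (Q.subst θ)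

theorem PureEquiv.symm {P Q : Proc} (H : PureEquiv P Q) : PureEquiv Q P := by
  intro g θ hg hθ hfn
  rw [← hg.inverse]
  exact openBisimilarAt_bisim.symm (H g θ hg hθ (by rwa [Set.union_comm]))

theorem PureEquiv.subst {P Q : Proc} (H : PureEquiv P Q) {θ : ℕ → Msg}
    (hθ : ∀ x, (θ x).IsPure) : PureEquiv (P.subst θ) (Q.subst θ) := by
  intro g θ' hg hθ' hfn
  rw [Proc.subst_subst, Proc.subst_subst] at *
  exact H g _ hg (fun x => (hθ x).subst hθ') hfn

theorem PureEquiv.at {P Q : Proc} (H : PureEquiv P Q) {g : Trace} (hg : g.IsDiagonal)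
    (hfn : P.fn ∪ Q.fn ⊆ g.fn) : OpenBisimilarAt g P Q := by
  have := H g Msg.nm hg .nm
  rw [Proc.subst_nm, Proc.subst_nm] at this
  exact this hfn

/-- A pure instance of a universal bi-trace is respectful and conveys no knowledge, so it is covered
by any diagonal trace with enough names. -/
theorem OpenBisimilar.pureEquiv {P Q : Proc} (H : OpenBisimilar P Q) : PureEquiv P Q := by
  obtain ⟨-, -, u, hu, H⟩ := H
  intro g θ hg hθ hfn
  classical
  obtain ⟨z, hz⟩ := hg.fn_nonempty
  -- The bi-trace `u` may contain names absent from both processes. Their values must not leave the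
  -- names of `g`, so they are all sent to one name `z` of `g`.
  let φ : ℕ → Msg := fun x => if x ∈ P.fn ∪ Q.fn then θ x else .nm z
  have hφ : ∀ x ∈ P.fn ∪ Q.fn, θ x = φ x := fun x hx => (if_pos hx).symm
  have hφ' : ∀ x, (φ x).IsPure := fun x => by
    simp only [φ]
    split_ifs
    exacts [hθ x, .nm z]
  rw [Proc.subst_congr fun x hx => hφ x (.inl hx), Proc.subst_congr fun x hx => hφ x (.inr hx)]
  refine (openBisimilarAt_bisim.subst H (hu.respects fun x _ => hφ' x)).of_cov
    (hu.of_subst_fn hg.cov_nil fun x _ y hy => ?_)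
  by_cases hx : x ∈ P.fn ∪ Q.fn
  · rw [← hφ x hx] at hy
    exact hfn (hx.imp (fun hx => Proc.mem_fn_subst.2 ⟨x, hx, hy⟩)
      fun hx => Proc.mem_fn_subst.2 ⟨x, hx, hy⟩)
  · simp only [φ, if_neg hx, Msg.fn] at hy
    rw [hy]
    exact hz

/-- Processes with the same prefix and equivalent continuations. -/
inductive PrefixRel : Proc → Proc → Prop
  | out {M N : Msg} {P Q : Proc} : M.IsPure → N.IsPure → PureEquiv P Q →
      PrefixRel (.out M N P) (.out M N Q)
  | inp {M : Msg} {P Q : Proc} : M.IsPure → PureEquiv P Q → PrefixRel (.inp M P) (.inp M Q)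
  | mat {M N : Msg} {P Q : Proc} : M.IsPure → N.IsPure → PureEquiv P Q →
      PrefixRel (.mat M N P) (.mat M N Q)
  | letp {M : Msg} {P Q : Proc} : M.IsPure → PureEquiv P Q → PrefixRel (.letp M P) (.letp M Q)
  | dec {L K : Msg} {P Q : Proc} : L.IsPure → K.IsPure → PureEquiv P Q →
      PrefixRel (.dec L K P) (.dec L K Q)

namespace PrefixRel

variable {P Q : Proc}

theorem symm (H : PrefixRel P Q) : PrefixRel Q P := by
  cases H with
  | out h h' H => exact .out h h' H.symm
  | inp h H => exact .inp h H.symm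
  | mat h h' H => exact .mat h h' H.symm
  | letp h H => exact .letp h H.symm
  | dec h h' H => exact .dec h h' H.symm

theorem subst (H : PrefixRel P Q) {θ : ℕ → Msg} (hθ : ∀ x, (θ x).IsPure) :
    PrefixRel (P.subst θ) (Q.subst θ) := by
  cases H with
  | out h h' H => exact .out (h.subst hθ) (h'.subst hθ) (H.subst hθ)
  | inp h H => exact .inp (h.subst hθ) (H.subst (isPure_lift hθ))
  | mat h h' H => exact .mat (h.subst hθ) (h'.subst hθ) (H.subst hθ)
  | letp h H => exact .letp (h.subst hθ) (H.subst (isPure_lift (isPure_lift hθ)))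
  | dec h h' H => exact .dec (h.subst hθ) (h'.subst hθ) (H.subst (isPure_lift hθ))

theorem red (H : PrefixRel P Q) {P' : Proc} (hr : Red P P') :
    ∃ Q', Red Q Q' ∧ PureEquiv P' Q' := by
  cases H with
  | out => cases hr
  | inp => cases hr
  | mat _ _ H => cases hr; exact ⟨_, .mat _ _, H⟩
  | letp h H =>
    cases hr
    rw [Msg.IsPure, Msg.rn, Set.union_empty_iff] at h
    exact ⟨_, .letp _ _ _, H.subst (isPure_inst₂ h.1 h.2)⟩
  | dec h _ H =>
    cases hr
    rw [Msg.IsPure, Msg.rn, Set.union_empty_iff] at h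
    exact ⟨_, .dec _ _ _, H.subst (isPure_inst h.1)⟩

theorem red_at (H : PrefixRel P Q) {h : Trace} (hd : h.IsDiagonal) (hfn : P.fn ∪ Q.fn ⊆ h.fn)
    {P' : Proc} (hr : Red P P') : ∃ Q', Red Q Q' ∧ OpenBisimilarAt h P' Q' := by
  obtain ⟨Q', hr', H⟩ := H.red hr
  exact ⟨Q', hr', H.at hd ((Set.union_subset_union hr.fn hr'.fn).trans hfn)⟩

end PrefixRel

/-- A prefix is consumed by the first transition, after which bisimilarity takes over. Before that,
the bi-trace is diagonal, so both sides undergo one and the same pure substitution, under which the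
continuations stay related by `PureEquiv`. -/
theorem PrefixRel.bisim : Bisim fun h P Q => OpenBisimilarAt h P Q ∨
    h.IsDiagonal ∧ P.fn ∪ Q.fn ⊆ h.fn ∧ PrefixRel P Q where
  fn := by
    rintro h P Q (H | ⟨-, hfn, -⟩)
    exacts [openBisimilarAt_bisim.fn H, hfn]
  consistent := by
    rintro h P Q (H | ⟨hd, -⟩)
    exacts [openBisimilarAt_bisim.consistent H, hd.consistent]
  symm := by
    rintro h P Q (H | ⟨hd, hfn, H⟩)
    · exact .inl (openBisimilarAt_bisim.symm H)
    · rw [hd.inverse]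
      exact .inr ⟨hd, by rwa [Set.union_comm], H.symm⟩
  subst := by
    rintro h P Q θ₁ θ₂ (H | ⟨hd, hfn, H⟩) hr
    · exact .inl (openBisimilarAt_bisim.subst H hr)
    · obtain ⟨θ, hθ, e, hd'⟩ := hd.exists_subst hr
      refine .inr ⟨hd', hd.consistent.proc_fn_subst hfn, ?_⟩
      rw [Proc.subst_congr fun x hx => (e x (hfn (.inl hx))).1,
        Proc.subst_congr fun x hx => (e x (hfn (.inr hx))).2]
      exact H.subst hθ
  tau := by
    rintro h P Q P' (H | ⟨hd, hfn, H⟩) hs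
    · obtain ⟨Q', s, H⟩ := openBisimilarAt_bisim.tau H hs
      exact ⟨Q', s, .inl H⟩
    · generalize hA : Agent.proc P' = A at hs
      generalize hα : Act.tau = α at hs
      cases hs with
      | red hr hs =>
        subst hA hα
        obtain ⟨Q₁, hr', H⟩ := H.red_at hd hfn hr
        obtain ⟨Q', s, H⟩ := openBisimilarAt_bisim.tau H hs
        exact ⟨Q', .red hr' s, .inl H⟩
      | inp => cases hα
      | out => cases hα
      | _ => cases H
  inp := by
    rintro h P Q M P' x (H | ⟨hd, hfn, H⟩) hs hM hx
    · obtain ⟨N, Q', s, H⟩ := openBisimilarAt_bisim.inp H hs hM hx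
      exact ⟨N, Q', s, .inl H⟩
    · generalize hA : Agent.abs P' = A at hs
      generalize hα : Act.inp M = α at hs
      cases hs with
      | red hr hs =>
        subst hA hα
        obtain ⟨Q₁, hr', H⟩ := H.red_at hd hfn hr
        obtain ⟨N, Q', s, H⟩ := openBisimilarAt_bisim.inp H hs hM hx
        exact ⟨N, Q', .red hr' s, .inl H⟩
      | inp M P =>
        cases hα
        cases hA
        cases H with
        | @inp _ _ Q hM H =>
        -- Putting the input name for the bound index is a pure instance, and the trace extended by
        -- two pairs of identical pure messages is again diagonal.
        refine ⟨M, Q, .inp _ _, .inl (H _ _ ((hd.inp hM).inp (.nm x)) (isPure_inst (.nm x)) ?_)⟩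
        rw [Trace.fn_cons, Trace.fn_cons]
        rintro y hy
        simp only [Set.mem_union, Proc.mem_fn_subst] at hy
        rcases hy with ⟨_ | z, hz, hy⟩ | ⟨_ | z, hz, hy⟩
        · exact .inl (.inl hy)
        · cases hy; exact .inr (.inr (hfn (.inl (.inr hz))))
        · exact .inl (.inl hy)
        · cases hy; exact .inr (.inr (hfn (.inr (.inr hz))))
      | out => cases hα
      | _ => cases H
  out := by
    rintro h P Q M k M' P' (H | ⟨hd, hfn, H⟩) hs hM
    · obtain ⟨N, l, N', Q', s, H⟩ := openBisimilarAt_bisim.out H hs hM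
      exact ⟨N, l, N', Q', s, fun c d hc hd hcf hdf => .inl (H c d hc hd hcf hdf)⟩
    · generalize hA : Agent.conc k M' P' = A at hs
      generalize hα : Act.out M = α at hs
      cases hs with
      | red hr hs =>
        subst hA hα
        obtain ⟨Q₁, hr', H⟩ := H.red_at hd hfn hr
        obtain ⟨N, l, N', Q', s, H⟩ := openBisimilarAt_bisim.out H hs hM
        exact ⟨N, l, N', Q', .red hr' s, fun c d hc hd hcf hdf => .inl <|
          H c d hc hd (hcf.mono_right (Set.union_subset_union_right _ hr.rn))
            (hdf.mono_right (Set.union_subset_union_right _ hr'.rn))⟩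
      | out M₀ N P =>
        cases hα
        cases hA
        cases H with
        | @out _ _ _ Q hM hN H =>
        have e (c : Fin 0 → ℕ) : instRigid c = Msg.nm := by
          funext i
          simp [instRigid]
        -- An output prefix extrudes no name, so the lists of rigid names are empty.
        refine ⟨_, 0, _, Q, .out _ _ _, fun c d _ _ _ _ => .inl ?_⟩
        rw [e, e, Msg.subst_nm, Proc.subst_nm, Proc.subst_nm]
        refine H.at ((hd.inp hM).out hN ?_) ?_
        · rw [Trace.fn_cons]
          exact fun y hy => .inr (hfn (.inl (.inl (.inr hy))))
        · rw [Trace.fn_cons, Trace.fn_cons]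
          exact fun y hy => .inr (.inr (hfn (hy.imp .inr .inr)))
      | inp => cases hα
      | _ => cases H

theorem PrefixRel.openBisimilar {P Q : Proc} (H : PrefixRel P Q) (hP : P.IsPure) (hQ : Q.IsPure) :
    OpenBisimilar P Q := by
  -- The name `0` is added so that the bi-trace is non-empty even for processes without free names.
  obtain ⟨h, hu, e⟩ := exists_universal (P.fn_finite.union (Q.fn_finite.insert 0))
  refine ⟨hP, hQ, h, hu, PrefixRel.bisim.le (.inr ⟨hu.isDiagonal ?_, ?_, H⟩)⟩
  · exact e ▸ ⟨0, .inr (.inl rfl)⟩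
  · exact e ▸ Set.union_subset_union_right _ (Set.subset_insert _ _)

/-! Congruence. -/

namespace OpenBisimilar

theorem refl {P : Proc} (hP : P.IsPure) : OpenBisimilar P P := by
  obtain ⟨h, hu, e⟩ := exists_universal P.fn_finite
  exact ⟨hP, hP, h, hu, PRel.openBisimilarAt hu.consistent (.refl hP) (by rw [e, Set.union_self])⟩

theorem isPure_par {P Q : Proc} (hP : P.IsPure) (hQ : Q.IsPure) : (P.par Q).IsPure := by
  rw [Proc.IsPure, Proc.rn, Set.union_empty_iff]
  exact ⟨hP, hQ⟩

theorem par_comm {P Q : Proc} (hP : P.IsPure) (hQ : Q.IsPure) :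
    OpenBisimilar (P.par Q) (Q.par P) := by
  obtain ⟨h, hu, e⟩ := exists_universal (P.fn_finite.union Q.fn_finite)
  exact ⟨isPure_par hP hQ, isPure_par hQ hP, h, hu,
    PRel.openBisimilarAt hu.consistent (.swap (.refl hP) (.refl hQ))
      (by rw [e, Proc.fn, Proc.fn, Set.union_comm Q.fn, Set.union_self])⟩

variable {P Q : Proc}

theorem par_right (H : OpenBisimilar P Q) {R : Proc} (hR : R.IsPure) :
    OpenBisimilar (P.par R) (Q.par R) := by
  obtain ⟨h, hu, hfn, H'⟩ := H.exists_trace R.fn_finite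
  exact ⟨isPure_par H.1 hR, isPure_par H.2.1 hR, h, hu,
    H'.par (.refl hR) (by rwa [Set.union_self])⟩

theorem par_left (H : OpenBisimilar P Q) {R : Proc} (hR : R.IsPure) :
    OpenBisimilar (R.par P) (R.par Q) :=
  ((par_comm hR H.1).trans (H.par_right hR)).trans (par_comm H.2.1 hR)

/-- The name `x` is replaced by a fresh pair of rigid names (`OpenBisimilarAt.flex`), the observer
forgets this pair (`OpenBisimilarAt.of_cov`), and the restriction binds it (`OpenBisimilarAt.res`).
-/
theorem resN (H : OpenBisimilar P Q) (x : ℕ) : OpenBisimilar (P.resN x) (Q.resN x) := by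
  obtain ⟨hP, hQ, u, hu, H⟩ := H
  have pure {P : Proc} (hP : P.IsPure) : (P.close x).rn = ∅ := by
    rw [Proc.close, Proc.rn_rename]; exact hP
  refine ⟨pure hP, pure hQ, ?_⟩
  -- The input of `x` is moved to the end of the bi-trace, so that `x` does not occur before the
  -- rigid pair is output.
  obtain ⟨v, hv, e⟩ := exists_universal (X := u.fn \ {x}) (u.fn_finite.subset Set.sdiff_subset)
  have hx : x ∉ v.fn := by simp [e]
  have hv' : Trace.IsUniversal ((.i, .nm x, .nm x) :: v) := by
    rintro e (_ | ⟨_, he⟩)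
    exacts [⟨x, rfl⟩, hv e he]
  have H := H.of_universal hu hv' (by
    rw [Trace.fn_cons, e]
    intro y hy
    by_cases h : y = x
    exacts [.inl (.inl h), .inr ⟨hy, h⟩])
  have vL : v.rnL = ∅ := by
    refine Set.eq_empty_iff_forall_notMem.2 ?_
    rintro a ⟨e, he, ha⟩
    obtain ⟨y, rfl⟩ := hv e he
    exact ha
  have vR : v.rnR = ∅ := by
    rw [← Trace.rnL_inverse, hv.inverse, vL]
  -- The rigid name `0` is fresh because `v` contains no rigid names. After its output the input
  -- `(x, x)` turns into an input of the rigid pair.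
  have F := (Flex.start (z := x) (c := 0) (d := 0) hx (by simp [vL]) (by simp [vR])).step .i
    (M := .rg 0) (N := .rg 0) (by simp [Msg.fn]) (by simp [Msg.fn])
  have hsub {P : Proc} (hP : P.IsPure) :
      (P.subst (rgFor x 0)).unrg 0 x = P ∧ x ∉ (P.subst (rgFor x 0)).fn ∧
        (P.close x).subst (inst (.rg 0)) = P.subst (rgFor x 0) := by
    refine ⟨Proc.subst_unrg (by rw [hP]; simp), ?_, ?_⟩
    · rw [Proc.mem_fn_subst]
      rintro ⟨y, -, hy⟩
      by_cases h : y = x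
      · rw [h, rgFor_self] at hy; exact hy
      · rw [rgFor_of_ne h] at hy; exact h hy.symm
    · rw [Proc.close, Proc.rename, Proc.subst_subst]
      congr 1
      funext y
      by_cases h : y = x
      · simp [h, Msg.subst, inst, rgFor_self]
      · simp [h, Msg.subst, inst, rgFor_of_ne h]
  have H₁ := OpenBisimilarAt.flex F (hsub hP).2.1 (hsub hQ).2.1 (by
    rw [(hsub hP).1, (hsub hQ).1]
    simpa only [Msg.unrg, Msg.bs, nmFor_self] using H)
  have hrg : (Msg.rg 0).fn ∪ (Msg.rg 0).fn ⊆ v.fn := by simp [Msg.fn]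
  have H₂ := H₁.of_cov (((Cov.refl hv.consistent).hide hrg).hide hrg)
  rw [← (hsub hP).2.2, ← (hsub hQ).2.2] at H₂
  exact ⟨v, hv, H₂.res (by rw [vL, pure hP]; simp) (by rw [vR, pure hQ]; simp)⟩

theorem _root_.Spi.Proc.IsPure.rename {P : Proc} (hP : P.IsPure) (f : ℕ → ℕ) :
    (P.rename f).IsPure := by
  rw [Proc.IsPure, Proc.rn_rename]; exact hP

/-- Binding a name renames the continuation, and a renaming is a pure instance, so `PureEquiv`
passes to the body of the binder. -/
theorem inpN (H : OpenBisimilar P Q) {M : Msg} (hM : M.IsPure) (x : ℕ) :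
    OpenBisimilar (P.inpN M x) (Q.inpN M x) :=
  have pure {P : Proc} (hP : P.IsPure) : (P.inpN M x).IsPure :=
    Set.union_empty_iff.2 ⟨hM, hP.rename _⟩
  PrefixRel.openBisimilar (.inp hM (H.pureEquiv.subst fun _ => .nm _)) (pure H.1) (pure H.2.1)

theorem out (H : OpenBisimilar P Q) {M N : Msg} (hM : M.IsPure) (hN : N.IsPure) :
    OpenBisimilar (.out M N P) (.out M N Q) :=
  have pure {P : Proc} (hP : P.IsPure) : (Proc.out M N P).IsPure :=
    Set.union_empty_iff.2 ⟨Set.union_empty_iff.2 ⟨hM, hN⟩, hP⟩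
  PrefixRel.openBisimilar (.out hM hN H.pureEquiv) (pure H.1) (pure H.2.1)

theorem mat (H : OpenBisimilar P Q) {M N : Msg} (hM : M.IsPure) (hN : N.IsPure) :
    OpenBisimilar (.mat M N P) (.mat M N Q) :=
  have pure {P : Proc} (hP : P.IsPure) : (Proc.mat M N P).IsPure :=
    Set.union_empty_iff.2 ⟨Set.union_empty_iff.2 ⟨hM, hN⟩, hP⟩
  PrefixRel.openBisimilar (.mat hM hN H.pureEquiv) (pure H.1) (pure H.2.1)

theorem letN (H : OpenBisimilar P Q) {M : Msg} (hM : M.IsPure) (x y : ℕ) :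
    OpenBisimilar (P.letN x y M) (Q.letN x y M) :=
  have pure {P : Proc} (hP : P.IsPure) : (P.letN x y M).IsPure :=
    Set.union_empty_iff.2 ⟨hM, hP.rename _⟩
  PrefixRel.openBisimilar (.letp hM (H.pureEquiv.subst fun _ => .nm _)) (pure H.1) (pure H.2.1)

theorem decN (H : OpenBisimilar P Q) {L K : Msg} (hL : L.IsPure) (hK : K.IsPure) (x : ℕ) :
    OpenBisimilar (P.decN L x K) (Q.decN L x K) :=
  have pure {P : Proc} (hP : P.IsPure) : (P.decN L x K).IsPure :=
    Set.union_empty_iff.2 ⟨Set.union_empty_iff.2 ⟨hL, hK⟩, hP.rename _⟩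
  PrefixRel.openBisimilar (.dec hL hK (H.pureEquiv.subst fun _ => .nm _)) (pure H.1) (pure H.2.1)

end OpenBisimilar

end Spi

theorem mainTheorem2 :
    Equivalence (fun P Q : Spi.FinPureProc => Spi.OpenBisimilar P.1 Q.1) ∧
    ∀ P Q : Spi.FinPureProc, Spi.OpenBisimilar P.1 Q.1 →
      (∀ (M : Spi.Msg) (x : ℕ), M.IsPure →
        Spi.OpenBisimilar (Spi.Proc.inpN M x P.1) (Spi.Proc.inpN M x Q.1)) ∧
      (∀ M N : Spi.Msg, M.IsPure → N.IsPure →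
        Spi.OpenBisimilar (Spi.Proc.out M N P.1) (Spi.Proc.out M N Q.1)) ∧
      (∀ R : Spi.FinPureProc,
        Spi.OpenBisimilar (Spi.Proc.par P.1 R.1) (Spi.Proc.par Q.1 R.1) ∧
        Spi.OpenBisimilar (Spi.Proc.par R.1 P.1) (Spi.Proc.par R.1 Q.1)) ∧
      (∀ x : ℕ, Spi.OpenBisimilar (Spi.Proc.resN x P.1) (Spi.Proc.resN x Q.1)) ∧
      (∀ M N : Spi.Msg, M.IsPure → N.IsPure →
        Spi.OpenBisimilar (Spi.Proc.mat M N P.1) (Spi.Proc.mat M N Q.1)) ∧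
      (∀ (x y : ℕ) (M : Spi.Msg), M.IsPure →
        Spi.OpenBisimilar (Spi.Proc.letN x y M P.1) (Spi.Proc.letN x y M Q.1)) ∧
      (∀ (L : Spi.Msg) (x : ℕ) (K : Spi.Msg), L.IsPure → K.IsPure →
        Spi.OpenBisimilar (Spi.Proc.decN L x K P.1) (Spi.Proc.decN L x K Q.1)) := by
  refine ⟨⟨fun P => .refl P.2.2, .symm, .trans⟩, fun P Q H => ⟨fun M x hM => H.inpN hM x,
    fun M N hM hN => H.out hM hN, fun R => ⟨H.par_right R.2.2, H.par_left R.2.2⟩, H.resN,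
    fun M N hM hN => H.mat hM hN, fun x y M hM => H.letN hM x y,
    fun L x K hL hK => H.decN hL hK x⟩⟩
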